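/- Let $S$ be a closed connected oriented surface, $Z\subset S$ a finite non-empty set of marked points, and let $q$ be a half-translation structure on $(S,Z)$: on $S\setminus Z$ there are charts to $\mathbb{C}$ whose transition maps are locally of the form $z\mapsto \pm z+c$, and each point of $Z$ is a cone point of angle $k\pi$ for some integer $k\ge 1$ (equivalently, $q$ is a meromorphic quadratic differential with at most simple poles, all of whose zeros and poles lie in $Z$). A saddle connection is a straight segment with end points in $Z$ and with interior embedded in $S\setminus Z$. A veering triangulation of $(S,q)$ is a triangulation $\tau$ of $S$ with vertex set $Z$ whose edges are saddle connections, none of them horizontal or vertical, such that, when edges of positive slope are coloured red and edges of negative slope blue, there is no monochromatic triangle and no vertex all of whose edges have the same colour. Let $\mathcal{V}_q$ be the set of these triangulations and let $E(\tau)$ be the set of edges of $\tau$. For a vertical separatrix $\beta$, that is, a germ of a vertical ray emanating from a point of $Z$, let $T(\beta,\tau)$ be the triangle of $\tau$ that contains the germ of $\beta$. Lay out $\beta$ and $T(\beta,\tau)$ in the plane, with $\beta$ starting at the origin and running along the positive imaginary axis; the wedge $w(\beta,\tau)$ is the cone based at the origin spanned by the two edges of $T(\beta,\tau)$ at the starting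 point of $\beta$. Write $\tau\le_q\tau'$ if $w(\beta,\tau')\subseteq w(\beta,\tau)$ for every vertical separatrix $\beta$. Let $e$ be an edge of $\tau$, let $Q$ be the quadrilateral formed by the two triangles of $\tau$ adjacent to $e$, and orient $e$. Let $a,b,c,d$ be the sides of $Q$ in anti-clockwise order, with $a,b$ on the left of $e$, so that the sides of the triangle on the left are $a,b,e$ in anti-clockwise order. If $a,c$ are blue and $b,d$ are red, then replacing $e$ by the other diagonal $e'$ of $Q$ is called a forward flip; if $a,c$ are red and $b,d$ are blue, a backward flip. A labelling of $\tau$ is a bijection $\pi\colon\mathcal{A}\to E(\tau)$; a flip of $e$ to $e'$ induces the labelling of the new triangulation that gives $e'$ the label of $e$ and keeps all other labels. Then $\le_q$ is a partial order on $\mathcal{V}_q$, and $(\mathcal{V}_q,\le_q)$ is a distributive lattice. Moreover, for every $\tau_0\in\mathcal{V}_q$ and every labelling $\pi_0\colon\mathcal{A}\to E(\tau_0)$ there are a unique family of labellings $\pi_\tau\colon\mathcal{A}\to E(\tau)$, $\tau\in\mathcal{V}_q$, and a unique map $\Phi\colon\mathcal{V}_q\to\mathbb{Z}^{\mathcal{A}}$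 such that * $\pi_{\tau_0}=\pi_0$ and $\Phi(\tau_0)=0$; * whenever $\tau,\tau'\in\mathcal{V}_q$ and $\tau'$ is obtained from $\tau$ by a forward or a backward flip of the edge $\pi_\tau(a)$, the labelling $\pi_{\tau'}$ is the one induced from $\pi_\tau$, and $\Phi(\tau')=\Phi(\tau)+a^*$ if the flip is forward, $\Phi(\tau')=\Phi(\tau)-a^*$ if it is backward, where $a^*$ is the unit vector of the label $a$. This map $\Phi$ is injective and preserves joins and meets, where joins and meets in $\mathbb{Z}^{\mathcal{A}}$ are the coordinatewise maxima and minima; so $\mathcal{V}_q$ is isomorphic to a sublattice of $\mathbb{Z}^{\mathcal{A}}$. -/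

import Mathlib

open scoped Topology

namespace VeeringLattice

/-- A half-translation of the plane: `w ↦ w + c` or `w ↦ -w + c`. -/
def IsHalfTranslation (g : ℂ → ℂ) : Prop :=
  ∃ c : ℂ, (∀ w, g w = w + c) ∨ (∀ w, g w = -w + c)

/-- A half-translation structure on `S` with finite nonempty set `Z` of marked points (which
contains all singularities).  Off `Z` there is an atlas of charts to `ℂ` whose transition maps are,
locally, half-translations.  Around a marked point `z` there is a coordinate `ψ` centred at `z` such
that the flat charts are, up to an additive constant, the branches of `ψ ^ (k / 2)` for some `k ≥ 1`:
the cone angle at `z` is `k * π` and the quadratic differential has order `k - 2 ≥ -1` at `z`. -/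
structure HalfTranslationSurface (S : Type*) [TopologicalSpace S] where
  /-- the marked points -/
  Z : Set S
  Z_finite : Z.Finite
  Z_nonempty : Z.Nonempty
  /-- the flat charts -/
  charts : Set (OpenPartialHomeomorph S ℂ)
  charts_source : ∀ φ ∈ charts, φ.source ⊆ Zᶜ
  charts_cover : ∀ x ∉ Z, ∃ φ ∈ charts, x ∈ φ.source
  transition : ∀ φ ∈ charts, ∀ ψ ∈ charts, ∀ x, x ∈ φ.source → x ∈ ψ.source →
    ∃ g, IsHalfTranslation g ∧ ∀ᶠ y in 𝓝 x, ψ y = g (φ y)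
  cone : ∀ z ∈ Z, ∃ k : ℕ, 1 ≤ k ∧ ∃ ψ : OpenPartialHomeomorph S ℂ,
    ψ.source ∩ Z = {z} ∧ ψ z = 0 ∧
    ∀ x ∈ ψ.source, x ≠ z → ∀ φ ∈ charts, x ∈ φ.source →
      ∃ c : ℂ, ∀ᶠ y in 𝓝 x, (φ y - c) ^ 2 = (ψ y) ^ k

section

variable {S : Type*} [TopologicalSpace S] (q : HalfTranslationSurface S)

/-- `f` maps the subset `U` of the plane into the surface minus the marked points, and in the flat
charts it is, locally on `U`, a half-translation. -/
def IsFlatOn (f : ℂ → S) (U : Set ℂ) : Prop :=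
  ∀ p ∈ U, ∃ φ ∈ q.charts, ∃ g, IsHalfTranslation g ∧
    f p ∈ φ.source ∧ ∀ᶠ w in 𝓝[U] p, f w ∈ φ.source ∧ φ (f w) = g w

/-- `f`, on the straight segment from `a` to `b`, parametrises a saddle connection: the end points
go to marked points, and the open segment is embedded flatly in the complement of these. -/
def IsSaddleParam (f : ℂ → S) (a b : ℂ) : Prop :=
  a ≠ b ∧ ContinuousOn f (segment ℝ a b) ∧ f a ∈ q.Z ∧ f b ∈ q.Z ∧
    IsFlatOn q f (openSegment ℝ a b) ∧ Set.InjOn f (openSegment ℝ a b)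

/-- The subset `e` of the surface is a (closed) saddle connection with holonomy `v`; here `v` is
determined by `e` only up to sign. -/
def HasHolonomy (e : Set S) (v : ℂ) : Prop :=
  ∃ f a b, IsSaddleParam q f a b ∧ e = f '' segment ℝ a b ∧ v = b - a

/-- A saddle connection of positive slope.  (A vertical or horizontal one is neither red nor
blue: its quotient `im / re` is zero in Lean.) -/
def IsRed (e : Set S) : Prop := ∃ v, HasHolonomy q e v ∧ 0 < v.im / v.re

/-- A saddle connection of negative slope. -/
def IsBlue (e : Set S) : Prop := ∃ v, HasHolonomy q e v ∧ v.im / v.re < 0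

/-- The closed triangle in the plane. -/
def closedTriangle (a b c : ℂ) : Set ℂ := convexHull ℝ {a, b, c}

/-- The open triangle in the plane. -/
def openTriangle (a b c : ℂ) : Set ℂ := interior (closedTriangle a b c)

/-- `f`, on the nondegenerate triangle with vertices `a`, `b`, `c` in anti-clockwise order,
parametrises a flat triangle on the surface with vertices in `Z`.  Its interior is embedded;
different sides may be glued to each other, and so may the vertices. -/
def IsFlatTriangle (f : ℂ → S) (a b c : ℂ) : Prop :=
  0 < ((starRingEnd ℂ) (b - a) * (c - a)).im ∧
  ContinuousOn f (closedTriangle a b c) ∧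
  f a ∈ q.Z ∧ f b ∈ q.Z ∧ f c ∈ q.Z ∧
  IsFlatOn q f (closedTriangle a b c \ {a, b, c}) ∧
  Set.InjOn f (openTriangle a b c)

/-- A straight triangulation of the surface with vertex set `Z`: finitely many closed edges, which
are saddle connections, and finitely many open faces, which are flat triangles whose sides are
edges.  The marked points, the open edges, and the faces partition the surface. -/
@[ext] structure StraightTriangulation where
  /-- the closed edges -/
  edges : Set (Set S)
  /-- the open faces -/
  faces : Set (Set S)
  edges_finite : edges.Finite
  faces_finite : faces.Finite
  edge_saddle : ∀ e ∈ edges, ∃ v, HasHolonomy q e v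
  face_triangle : ∀ T ∈ faces, ∃ f a b c, IsFlatTriangle q f a b c ∧
    T = f '' openTriangle a b c ∧ f '' segment ℝ a b ∈ edges ∧
    f '' segment ℝ b c ∈ edges ∧ f '' segment ℝ c a ∈ edges
  edge_edge : ∀ e ∈ edges, ∀ e' ∈ edges, e ≠ e' → e ∩ e' ⊆ q.Z
  edge_face : ∀ e ∈ edges, ∀ T ∈ faces, Disjoint e T
  face_face : ∀ T ∈ faces, ∀ T' ∈ faces, T ≠ T' → Disjoint T T'
  cover : ∀ x, x ∈ q.Z ∨ (∃ e ∈ edges, x ∈ e) ∨ (∃ T ∈ faces, x ∈ T)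

variable {q}

/-- `f` on the triangle `a b c` (anti-clockwise) lays out a face of `τ`, with its three edges, in
the plane. -/
def StraightTriangulation.LaysOut (τ : StraightTriangulation q) (f : ℂ → S) (a b c : ℂ) : Prop :=
  IsFlatTriangle q f a b c ∧ f '' openTriangle a b c ∈ τ.faces ∧
  f '' segment ℝ a b ∈ τ.edges ∧ f '' segment ℝ b c ∈ τ.edges ∧ f '' segment ℝ c a ∈ τ.edges

variable (q)

/-- A veering triangulation of the surface: a straight triangulation, all of whose edges have
positive slope (red) or negative slope (blue), without monochromatic triangles and without
monochromatic vertices. -/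
@[ext] structure VeeringTriangulation extends StraightTriangulation q where
  coloured : ∀ e ∈ edges, IsRed q e ∨ IsBlue q e
  triangle_colours : ∀ f a b c, toStraightTriangulation.LaysOut f a b c →
    ¬ (IsRed q (f '' segment ℝ a b) ∧ IsRed q (f '' segment ℝ b c) ∧
        IsRed q (f '' segment ℝ c a)) ∧
    ¬ (IsBlue q (f '' segment ℝ a b) ∧ IsBlue q (f '' segment ℝ b c) ∧
        IsBlue q (f '' segment ℝ c a))
  vertex_colours : ∀ z ∈ q.Z,
    (∃ e ∈ edges, z ∈ e ∧ IsRed q e) ∧ (∃ e ∈ edges, z ∈ e ∧ IsBlue q e)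

/-- A vertical separatrix, given by an initial segment of it: a flat map that starts at a marked
point, laid out along the positive imaginary axis.  (As the charts are defined up to
half-translation, rays going up and rays going down in a chart are both of this form.)  Only the
germ at the starting point is used below. -/
structure VerticalSeparatrix where
  /-- the parametrisation; only its values on the segment from `0` to `len * I` matter -/
  map : ℂ → S
  /-- the length of the initial segment -/
  len : ℝ
  len_pos : 0 < len
  start_mem : map 0 ∈ q.Z
  continuousOn : ContinuousOn map (segment ℝ 0 ((len : ℂ) * Complex.I))
  flat : IsFlatOn q map (openSegment ℝ 0 ((len : ℂ) * Complex.I))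

variable {q}

/-- `f` on the triangle `0 b c` (anti-clockwise) lays out the triangle `T(β, τ)` of `τ` that contains
the germ of `β`, in such a way that `β` starts at `0` and runs along the positive imaginary axis. -/
def LaysOutAt (τ : StraightTriangulation q) (β : VerticalSeparatrix q)
    (f : ℂ → S) (b c : ℂ) : Prop :=
  τ.LaysOut f 0 b c ∧ ∃ δ > (0 : ℝ), ∀ t : ℝ, 0 < t → t < δ →
    (t : ℂ) * Complex.I ∈ openTriangle 0 b c ∧ f ((t : ℂ) * Complex.I) = β.map ((t : ℂ) * Complex.I)

/-- The wedge `w(β, τ)`: the cone in the plane, based at the origin, that is spanned by the two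
edges at the initial point of `β` of the triangle `T(β, τ)`, laid out in the plane along with `β`. -/
def wedge (β : VerticalSeparatrix q) (τ : StraightTriangulation q) : Set ℂ :=
  {w | ∃ f b c, LaysOutAt τ β f b c ∧ ∃ s t : ℝ, 0 ≤ s ∧ 0 ≤ t ∧ w = (s : ℂ) * b + (t : ℂ) * c}

/-- `τ` precedes `τ'`: about every vertical separatrix the wedge of `τ'` is contained in that
of `τ`. -/
def Precedes (τ τ' : VeeringTriangulation q) : Prop :=
  ∀ β : VerticalSeparatrix q,
    wedge β τ'.toStraightTriangulation ⊆ wedge β τ.toStraightTriangulation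

/-- `τ'` is obtained from `τ` by flipping the edge `e` to `e'`.  The map `f` lays out in the plane
the quadrilateral made of the two faces adjacent to `e`; its vertices are `p`, `u`, `r`, `s` in
anti-clockwise order, `e` is the diagonal from `p` to `r`, and `e'` is that from `u` to `s`. -/
def IsFlipAt (τ τ' : StraightTriangulation q) (e e' : Set S)
    (f : ℂ → S) (p u r s : ℂ) : Prop :=
  τ.LaysOut f p r s ∧ τ.LaysOut f p u r ∧
  f '' openTriangle p r s ≠ f '' openTriangle p u r ∧
  τ'.LaysOut f p u s ∧ τ'.LaysOut f u r s ∧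
  e = f '' segment ℝ p r ∧ e' = f '' segment ℝ u s ∧ e' ∉ τ.edges ∧
  τ'.edges = insert e' (τ.edges \ {e}) ∧
  τ'.faces = {f '' openTriangle p u s, f '' openTriangle u r s} ∪
    (τ.faces \ {f '' openTriangle p r s, f '' openTriangle p u r})

/-- `τ'` is obtained from `τ` by a forward flip of `e` to `e'`.  With `e` oriented from `p` to `r`,
the sides of the quadrilateral, in anti-clockwise order and starting with the two on the left of
`e`, are `[r, s]`, `[s, p]`, `[p, u]`, `[u, r]`; these are blue, red, blue, red. -/
def IsForwardFlip (τ τ' : VeeringTriangulation q) (e e' : Set S) : Prop :=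
  ∃ f p u r s,
    IsFlipAt τ.toStraightTriangulation τ'.toStraightTriangulation e e' f p u r s ∧
    IsBlue q (f '' segment ℝ r s) ∧ IsRed q (f '' segment ℝ s p) ∧
    IsBlue q (f '' segment ℝ p u) ∧ IsRed q (f '' segment ℝ u r)

/-- `τ'` is obtained from `τ` by a backward flip of `e` to `e'`: as for forward flips, with the two
colours exchanged. -/
def IsBackwardFlip (τ τ' : VeeringTriangulation q) (e e' : Set S) : Prop :=
  ∃ f p u r s,
    IsFlipAt τ.toStraightTriangulation τ'.toStraightTriangulation e e' f p u r s ∧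
    IsRed q (f '' segment ℝ r s) ∧ IsBlue q (f '' segment ℝ s p) ∧
    IsRed q (f '' segment ℝ p u) ∧ IsBlue q (f '' segment ℝ u r)

/-- `π'` is the labelling induced from `π` by a flip of `e` to `e'`: the new edge gets the label of
the removed one, and all other edges keep their labels. -/
def IsInducedLabelling {A : Type*} {τ τ' : VeeringTriangulation q}
    (π : A ≃ τ.edges) (π' : A ≃ τ'.edges) (e e' : Set S) : Prop :=
  ∀ a : A, ((π a : Set S) = e → (π' a : Set S) = e') ∧
    ((π a : Set S) ≠ e → (π' a : Set S) = (π a : Set S))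

/-- The labellings `π` of all veering triangulations, and the map `Φ` to `ℤ^A`, are those obtained
from the labelling `π₀` of the base point `τ₀` by carrying labels along flips, and by adding
(subtracting) the unit vector of the flipped label for every forward (backward) flip. -/
structure IsFlipCoordinates {A : Type*} [DecidableEq A] (τ₀ : VeeringTriangulation q)
    (π₀ : A ≃ τ₀.edges) (π : ∀ τ : VeeringTriangulation q, A ≃ τ.edges)
    (Φ : VeeringTriangulation q → A → ℤ) : Prop where
  base_label : π τ₀ = π₀
  base_coord : Φ τ₀ = 0
  forward_label : ∀ τ τ' e e', IsForwardFlip τ τ' e e' → IsInducedLabelling (π τ) (π τ') e e'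
  forward_coord : ∀ τ τ' e e', IsForwardFlip τ τ' e e' →
    ∀ a : A, (π τ a : Set S) = e → Φ τ' = Φ τ + Pi.single a 1
  backward_label : ∀ τ τ' e e', IsBackwardFlip τ τ' e e' → IsInducedLabelling (π τ) (π τ') e e'
  backward_coord : ∀ τ τ' e e', IsBackwardFlip τ τ' e e' →
    ∀ a : A, (π τ a : Set S) = e → Φ τ' = Φ τ - Pi.single a 1

end

end VeeringLattice

/-! ### Half-translations and flat maps: comparison in charts, identity principle, gluing -/

namespace VeeringLattice

open Set Filter

/-- The cross product of two plane vectors. -/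
def cr (a b : ℂ) : ℝ := a.re * b.im - a.im * b.re

theorem conj_mul_im (a b : ℂ) : ((starRingEnd ℂ) a * b).im = cr a b := by
  simp [cr, Complex.mul_im]; ring

theorem continuous_cr_right (a : ℂ) : Continuous fun w => cr a w := by
  unfold cr; fun_prop

theorem cr_smul_right (a b : ℂ) (t : ℝ) : cr a ((t : ℂ) * b) = t * cr a b := by
  simp [cr]; ring

theorem cr_neg_neg (a b : ℂ) : cr (-a) (-b) = cr a b := by
  simp [cr]

namespace IsHalfTranslation

variable {g g' : ℂ → ℂ}

theorem id : IsHalfTranslation (fun w => w) := ⟨0, Or.inl fun w => by simp⟩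

theorem add (c : ℂ) : IsHalfTranslation (fun w => w + c) := ⟨c, Or.inl fun _ => rfl⟩

theorem neg_add (c : ℂ) : IsHalfTranslation (fun w => -w + c) := ⟨c, Or.inr fun _ => rfl⟩

theorem comp (hg : IsHalfTranslation g) (hg' : IsHalfTranslation g') :
    IsHalfTranslation (fun w => g (g' w)) := by
  obtain ⟨c, h | h⟩ := hg <;> obtain ⟨c', h' | h'⟩ := hg'
  · exact ⟨c' + c, Or.inl fun w => by simp only [h, h']; ring⟩
  · exact ⟨c' + c, Or.inr fun w => by simp only [h, h']; ring⟩
  · exact ⟨-c' + c, Or.inr fun w => by simp only [h, h']; ring⟩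
  · exact ⟨-c' + c, Or.inl fun w => by simp only [h, h']; ring⟩

theorem exists_inv (hg : IsHalfTranslation g) :
    ∃ g', IsHalfTranslation g' ∧ (∀ w, g' (g w) = w) ∧ ∀ w, g (g' w) = w := by
  obtain ⟨c, h | h⟩ := hg
  · exact ⟨fun w => w + -c, add _, fun w => by simp [h], fun w => by simp [h]⟩
  · exact ⟨fun w => -w + c, neg_add _, fun w => by simp [h], fun w => by simp [h]⟩

theorem continuous (hg : IsHalfTranslation g) : Continuous g := by
  obtain ⟨c, h | h⟩ := hg
  · rw [show g = fun w => w + c from funext h]; fun_prop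
  · rw [show g = fun w => -w + c from funext h]; fun_prop

theorem injective (hg : IsHalfTranslation g) : Function.Injective g := by
  obtain ⟨g', -, h, -⟩ := hg.exists_inv
  exact Function.LeftInverse.injective h

/-- A map `w ↦ w + c` and a map `w ↦ -w + c'` agree at exactly one point, so agreement at two points
forces equal signs and then equal constants. -/
theorem eq_of_eq_of_eq (hg : IsHalfTranslation g) (hg' : IsHalfTranslation g') {x y : ℂ}
    (hxy : x ≠ y) (hx : g x = g' x) (hy : g y = g' y) : g = g' := by
  obtain ⟨c, h | h⟩ := hg <;> obtain ⟨c', h' | h'⟩ := hg' <;> rw [h, h'] at hx hy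
  · ext w; rw [h, h']; linear_combination hx
  · exact absurd (by linear_combination (hx - hy) / 2) hxy
  · exact absurd (by linear_combination (hy - hx) / 2) hxy
  · ext w; rw [h, h']; linear_combination hx

theorem sub_eq (hg : IsHalfTranslation g) :
    (∀ x y, g x - g y = x - y) ∨ ∀ x y, g x - g y = -(x - y) := by
  obtain ⟨c, h | h⟩ := hg
  · exact Or.inl fun x y => by rw [h, h]; ring
  · exact Or.inr fun x y => by rw [h, h]; ring

theorem cr_sub (hg : IsHalfTranslation g) (x y z w : ℂ) :
    cr (g x - g y) (g z - g w) = cr (x - y) (z - w) := by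
  obtain h | h := hg.sub_eq <;> rw [h, h]
  exact cr_neg_neg _ _

theorem exists_affine (hg : IsHalfTranslation g) : ∃ A : ℂ →ᵃ[ℝ] ℂ, ⇑A = g := by
  obtain ⟨c, h | h⟩ := hg
  · exact ⟨AffineMap.id ℝ ℂ + AffineMap.const ℝ ℂ c, by ext w; simp [h]⟩
  · exact ⟨-AffineMap.id ℝ ℂ + AffineMap.const ℝ ℂ c, by ext w; simp [h]⟩

theorem image_segment (hg : IsHalfTranslation g) (a b : ℂ) :
    g '' segment ℝ a b = segment ℝ (g a) (g b) := by
  obtain ⟨A, rfl⟩ := hg.exists_affine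
  exact _root_.image_segment ℝ A a b

theorem image_openSegment (hg : IsHalfTranslation g) (a b : ℂ) :
    g '' openSegment ℝ a b = openSegment ℝ (g a) (g b) := by
  obtain ⟨A, rfl⟩ := hg.exists_affine
  exact _root_.image_openSegment ℝ A a b

theorem mem_segment (hg : IsHalfTranslation g) {a b w : ℂ} :
    g w ∈ segment ℝ (g a) (g b) ↔ w ∈ segment ℝ a b := by
  rw [← hg.image_segment, hg.injective.mem_set_image]

theorem mem_openSegment (hg : IsHalfTranslation g) {a b w : ℂ} :
    g w ∈ openSegment ℝ (g a) (g b) ↔ w ∈ openSegment ℝ a b := by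
  rw [← hg.image_openSegment, hg.injective.mem_set_image]

end IsHalfTranslation

section Flat

variable {S : Type*} [TopologicalSpace S] {q : HalfTranslationSurface S}

namespace IsFlatOn

variable {f f' : ℂ → S} {U U' V : Set ℂ} {p : ℂ}

/-- Continuity is not part of `IsFlatOn`; it holds because the map is `φ.symm ∘ g` near `p`. -/
theorem continuousWithinAt (hf : IsFlatOn q f U) (hp : p ∈ U) : ContinuousWithinAt f U p := by
  obtain ⟨φ, hφ, g, hg, hps, hev⟩ := hf p hp
  have h1 : φ (f p) = g p := (hev.self_of_nhdsWithin hp).2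
  have h2 : Tendsto (fun w => φ.symm (g w)) (𝓝[U] p) (𝓝 (φ.symm (g p))) := by
    have : ContinuousAt φ.symm (g p) := φ.symm.continuousAt (by
      simpa using h1 ▸ φ.map_source hps)
    exact (this.tendsto.comp hg.continuous.continuousAt.tendsto).mono_left nhdsWithin_le_nhds
  rw [← h1, φ.left_inv hps] at h2
  refine h2.congr' ?_
  filter_upwards [hev] with w hw
  rw [← hw.2, φ.left_inv hw.1]

theorem continuousOn (hf : IsFlatOn q f U) : ContinuousOn f U :=
  fun _ hp => hf.continuousWithinAt hp

theorem notMem (hf : IsFlatOn q f U) (hp : p ∈ U) : f p ∉ q.Z := by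
  obtain ⟨φ, hφ, g, hg, hps, hev⟩ := hf p hp
  exact q.charts_source φ hφ hps

theorem mono (hf : IsFlatOn q f U) (h : V ⊆ U) : IsFlatOn q f V := fun p hp => by
  obtain ⟨φ, hφ, g, hg, hps, hev⟩ := hf p (h hp)
  exact ⟨φ, hφ, g, hg, hps, hev.filter_mono (nhdsWithin_mono _ h)⟩

theorem congr (hf : IsFlatOn q f U) (h : EqOn f' f U) : IsFlatOn q f' U := fun p hp => by
  obtain ⟨φ, hφ, g, hg, hps, hev⟩ := hf p hp
  refine ⟨φ, hφ, g, hg, by rwa [h hp], ?_⟩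
  filter_upwards [hev, self_mem_nhdsWithin] with w hw hwU
  rwa [h hwU]

theorem comp (hf : IsFlatOn q f U) {h : ℂ → ℂ} (hh : IsHalfTranslation h) :
    IsFlatOn q (fun w => f (h w)) (h ⁻¹' U) := fun p hp => by
  obtain ⟨φ, hφ, g, hg, hps, hev⟩ := hf (h p) hp
  refine ⟨φ, hφ, _, hg.comp hh, hps, ?_⟩
  exact (hh.continuous.continuousWithinAt.tendsto_nhdsWithin fun w hw => hw).eventually hev

/-- The chart provided by `IsFlatOn` can be exchanged for any other one around `f p`, because
transition maps are half-translations. This brings two flat maps into one chart. -/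
theorem chart (hf : IsFlatOn q f U) (hp : p ∈ U) {φ : OpenPartialHomeomorph S ℂ}
    (hφ : φ ∈ q.charts) (hps : f p ∈ φ.source) :
    ∃ g, IsHalfTranslation g ∧ ∀ᶠ w in 𝓝[U] p, f w ∈ φ.source ∧ φ (f w) = g w := by
  obtain ⟨φ₀, hφ₀, g₀, hg₀, hps₀, hev₀⟩ := hf p hp
  obtain ⟨g₁, hg₁, hev₁⟩ := q.transition φ₀ hφ₀ φ hφ (f p) hps₀ hps
  refine ⟨_, hg₁.comp hg₀, ?_⟩
  have hc := hf.continuousWithinAt hp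
  filter_upwards [hev₀, hc.tendsto.eventually hev₁,
    hc.tendsto.eventually (φ.open_source.mem_nhds hps)] with w h1 h2 h3
  exact ⟨h3, by rw [h2, h1.2]⟩

/-- A flat map extends, near each point, to an injective flat map on a disc. -/
theorem exists_extension (hf : IsFlatOn q f U) (hp : p ∈ U) :
    ∃ F : ℂ → S, ∃ r > 0, IsFlatOn q F (Metric.ball p r) ∧ InjOn F (Metric.ball p r) ∧
      F p = f p ∧ ∀ w ∈ U, w ∈ Metric.ball p r → F w = f w := by
  obtain ⟨φ, hφ, g, hg, hps, hev⟩ := hf p hp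
  have h1 : φ (f p) = g p := (hev.self_of_nhdsWithin hp).2
  have hopen : IsOpen (g ⁻¹' φ.target) := φ.open_target.preimage hg.continuous
  have hmem : p ∈ g ⁻¹' φ.target := by
    rw [mem_preimage, ← h1]; exact φ.map_source hps
  obtain ⟨r₁, hr₁, hb₁⟩ := Metric.isOpen_iff.1 hopen p hmem
  obtain ⟨r₂, hr₂, hb₂⟩ := Metric.mem_nhdsWithin_iff.1 hev
  have hloc : ∀ w ∈ Metric.ball p (min r₁ r₂), w ∈ U → φ.symm (g w) = f w := fun w hw hwU => by
    have := hb₂ ⟨Metric.ball_subset_ball (min_le_right _ _) hw, hwU⟩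
    rw [← this.2, φ.left_inv this.1]
  have hball : ∀ w ∈ Metric.ball p (min r₁ r₂), g w ∈ φ.target := fun w hw =>
    hb₁ (Metric.ball_subset_ball (min_le_left _ _) hw)
  -- The extension is `φ.symm ∘ g` on a disc that `g` sends into the target of `φ`; on the smaller
  -- radius it also agrees with `f`.
  refine ⟨fun w => φ.symm (g w), min r₁ r₂, lt_min hr₁ hr₂, ?_, ?_, ?_, ?_⟩
  · intro w hw
    refine ⟨φ, hφ, g, hg, φ.map_target (hball w hw), ?_⟩
    filter_upwards [self_mem_nhdsWithin] with y hy
    exact ⟨φ.map_target (hball y hy), φ.right_inv (hball y hy)⟩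
  · intro x hx y hy hxy
    exact hg.injective (φ.symm.injOn (hball x hx) (hball y hy) hxy)
  · simp only [← h1, φ.left_inv hps]
  · exact fun w hw hwb => hloc w hwb hw

/-- Two flat maps differ, near points with the same image, by a half-translation. -/
theorem compare (hf : IsFlatOn q f U) (hf' : IsFlatOn q f' U') {p' : ℂ} (hp : p ∈ U)
    (hp' : p' ∈ U') (h : f p = f' p') :
    ∃ g, IsHalfTranslation g ∧ g p = p' ∧ ∀ᶠ w in 𝓝[U] p, g w ∈ U' → f w = f' (g w) := by
  obtain ⟨φ, hφ, g, hg, hps, hev⟩ := hf p hp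
  obtain ⟨g', hg', hev'⟩ := hf'.chart hp' hφ (h ▸ hps)
  obtain ⟨g'', hg'', h1, h2⟩ := hg'.exists_inv
  have e1 := (hev.self_of_nhdsWithin hp).2
  have e2 := (hev'.self_of_nhdsWithin hp').2
  have e3 : g'' (g p) = p' := by rw [← e1, h, e2, h1]
  refine ⟨_, hg''.comp hg, e3, ?_⟩
  have hc : Tendsto (fun w => g'' (g w)) (𝓝[U] p) (𝓝 p') := by
    rw [← e3]
    exact ((hg''.comp hg).continuous.tendsto p).mono_left nhdsWithin_le_nhds
  filter_upwards [hev, hc.eventually (eventually_nhdsWithin_iff.1 hev')] with w hw1 hw2 hw3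
  obtain ⟨hs, hw4⟩ := hw2 hw3
  refine φ.injOn hw1.1 hs ?_
  rw [hw1.2, hw4, h2]

variable [T2Space S]

/-- Continuity and the Hausdorff property give `f p = f' p`, hence a common chart. There both maps
are half-translations that agree at `p` and at one more point, so they are equal. -/
theorem eventually_eq (hf : IsFlatOn q f U) (hf' : IsFlatOn q f' U') (hp : p ∈ U) (hp' : p ∈ U')
    (h : ∃ᶠ w in 𝓝[≠] p, w ∈ U ∧ w ∈ U' ∧ f w = f' w) :
    ∀ᶠ w in 𝓝 p, w ∈ U → w ∈ U' → f w = f' w := by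
  have hpp : f p = f' p := by
    have h0 : ∃ᶠ w in 𝓝 p, w ∈ U ∧ w ∈ U' ∧ f w = f' w := h.filter_mono nhdsWithin_le_nhds
    have hne : NeBot (𝓝[{w | w ∈ U ∧ w ∈ U' ∧ f w = f' w}] p) :=
      mem_closure_iff_nhdsWithin_neBot.1 (mem_closure_iff_frequently.2 h0)
    have t1 := (hf.continuousWithinAt hp).tendsto.mono_left (nhdsWithin_mono p
      (show {w | w ∈ U ∧ w ∈ U' ∧ f w = f' w} ⊆ U from fun w hw => hw.1))
    have t2 := (hf'.continuousWithinAt hp').tendsto.mono_left (nhdsWithin_mono p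
      (show {w | w ∈ U ∧ w ∈ U' ∧ f w = f' w} ⊆ U' from fun w hw => hw.2.1))
    refine tendsto_nhds_unique_of_eventuallyEq t1 t2 ?_
    filter_upwards [self_mem_nhdsWithin] with w hw using hw.2.2
  obtain ⟨φ, hφ, g, hg, hps, hev⟩ := hf p hp
  obtain ⟨g', hg', hev'⟩ := hf'.chart hp' hφ (hpp ▸ hps)
  have e1 := (hev.self_of_nhdsWithin hp).2
  have e2 := (hev'.self_of_nhdsWithin hp').2
  rw [eventually_nhdsWithin_iff] at hev hev'
  obtain ⟨w, hw, hwn, hw1, hw2⟩ := (h.and_eventually (((eventually_nhdsWithin_of_forall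
    fun w (hw : w ∈ ({p} : Set ℂ)ᶜ) => hw).and
      ((hev.and hev').filter_mono nhdsWithin_le_nhds)))).exists
  have hgg : g = g' := hg.eq_of_eq_of_eq hg' (x := w) (y := p) hwn
    (by rw [← (hw1 hw.1).2, ← (hw2 hw.2.1).2, hw.2.2]) (by rw [← e1, ← e2, hpp])
  subst hgg
  filter_upwards [hev, hev'] with y h1 h2 hU hU'
  exact φ.injOn (h1 hU).1 (h2 hU').1 (by rw [(h1 hU).2, (h2 hU').2])

/-- The identity principle for flat maps. -/
theorem eqOn_of_frequently (hf : IsFlatOn q f U) (hf' : IsFlatOn q f' U) (hU : IsPreconnected U)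
    (hp : p ∈ U) (h : ∃ᶠ w in 𝓝[≠] p, w ∈ U ∧ f w = f' w) : EqOn f f' U := by
  have key : ∀ x ∈ U, (∃ᶠ w in 𝓝[≠] x, w ∈ U ∧ f w = f' w) →
      ∀ᶠ w in 𝓝 x, w ∈ U → f w = f' w := fun x hx hfr => by
    refine (hf.eventually_eq hf' hx hx (hfr.mono fun w hw => ⟨hw.1, hw.1, hw.2⟩)).mono ?_
    exact fun w hw h => hw h h
  have : PreconnectedSpace U := Subtype.preconnectedSpace hU
  -- The set of points near which the two maps agree is open by construction, and closed by
  -- `eventually_eq`; connectedness does the rest.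
  let A : Set U := {x | ∀ᶠ w in 𝓝 (x : ℂ), w ∈ U → f w = f' w}
  have hA : IsClopen A := by
    constructor
    · refine isClosed_of_closure_subset fun x hx => ?_
      by_contra hxA
      refine hxA (key x x.2 ?_)
      rw [frequently_nhdsWithin_iff, frequently_iff]
      intro V hV
      obtain ⟨y, hyV, hyA⟩ := mem_closure_iff_nhds.1 hx _ (continuous_subtype_val.continuousAt hV)
      refine ⟨y, hyV, ⟨y.2, hyA.self_of_nhds y.2⟩, fun hyx => hxA ?_⟩
      rwa [← Subtype.ext hyx]
    · rw [isOpen_iff_mem_nhds]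
      intro x hx
      exact continuous_subtype_val.continuousAt.eventually (eventually_eventually_nhds.2 hx)
  have hAu : A = univ := hA.eq_univ ⟨⟨p, hp⟩, key p hp h⟩
  intro x hx
  have : (⟨x, hx⟩ : U) ∈ A := hAu ▸ mem_univ _
  exact Eventually.self_of_nhds this hx

end IsFlatOn

theorem frequently_of_accPt {C P : Set ℂ} {p : ℂ} (h : AccPt p (𝓟 C)) (hC : C ⊆ P) :
    ∃ᶠ w in 𝓝[≠] p, w ∈ P :=
  (accPt_iff_frequently_nhdsNE.1 h).mono fun _ hw => hC hw

theorem accPt_of_convex {C : Set ℂ} (hC : Convex ℝ C) (hn : C.Nontrivial) {p : ℂ} (hp : p ∈ C) :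
    AccPt p (𝓟 C) :=
  hC.isPreconnected.preperfect_of_nontrivial hn p hp

theorem accPt_diff_finite {C V : Set ℂ} (hV : V.Finite) {p : ℂ} (h : AccPt p (𝓟 C)) :
    AccPt p (𝓟 (C \ V)) := by
  rw [accPt_iff_frequently_nhdsNE] at h ⊢
  have h2 : ∀ᶠ w in 𝓝[≠] p, w ∉ V := by
    have h3 : (V \ {p})ᶜ ∈ 𝓝 p :=
      (hV.subset sdiff_subset).isClosed.isOpen_compl.mem_nhds fun h => h.2 rfl
    filter_upwards [nhdsWithin_le_nhds h3, self_mem_nhdsWithin] with w hw hwp hwV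
    exact hw ⟨hwV, hwp⟩
  exact (h.and_eventually h2).mono fun w hw => ⟨hw.1, hw.2⟩

/-- Flat maps on two closed sets that agree on the intersection, which is a nontrivial convex set,
can be glued. -/
theorem exists_glue {f f' : ℂ → S} {U U' V : Set ℂ} (hU : IsClosed U) (hU' : IsClosed U')
    (hV : V.Finite) (hc : ContinuousOn f U) (hc' : ContinuousOn f' U')
    (hf : IsFlatOn q f (U \ V)) (hf' : IsFlatOn q f' (U' \ V)) (he : EqOn f f' (U ∩ U'))
    (hconv : Convex ℝ (U ∩ U')) (hn : (U ∩ U').Nontrivial) :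
    ∃ F : ℂ → S, EqOn F f U ∧ EqOn F f' U' ∧ ContinuousOn F (U ∪ U') ∧
      IsFlatOn q F ((U ∪ U') \ V) := by
  classical
  set F : ℂ → S := fun w => if w ∈ U then f w else f' w with hF
  have e1 : EqOn F f U := fun w hw => by simp [hF, hw]
  have e2 : EqOn F f' U' := fun w hw => by
    by_cases h : w ∈ U
    · rw [e1 h, he ⟨h, hw⟩]
    · simp [hF, h]
  -- Off the closed set `B`, a neighbourhood within the union is the same as one within `A` alone.
  have hcl : ∀ {A B : Set ℂ} {x : ℂ}, IsClosed B → x ∉ B →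
      𝓝[(A ∪ B) \ V] x ≤ 𝓝[A \ V] x := fun {A B x} hB hx => by
    rw [nhdsWithin, nhdsWithin, le_inf_iff]
    refine ⟨inf_le_left, ?_⟩
    rw [le_principal_iff]
    filter_upwards [nhdsWithin_le_nhds (hB.isOpen_compl.mem_nhds hx), self_mem_nhdsWithin]
      with w hw hw2
    exact ⟨hw2.1.resolve_right hw, hw2.2⟩
  have hFU := hf.congr (e1.mono sdiff_subset)
  have hFU' := hf'.congr (e2.mono sdiff_subset)
  refine ⟨F, e1, e2, (hc.congr e1).union_of_isClosed (hc'.congr e2) hU hU', ?_⟩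
  rintro p ⟨hp, hpV⟩
  by_cases hpU : p ∈ U
  · obtain ⟨φ, hφ, g, hg, hps, hev⟩ := hFU p ⟨hpU, hpV⟩
    refine ⟨φ, hφ, g, hg, hps, ?_⟩
    -- On the overlap there are two chart expressions. They coincide at `p` and, as the overlap is
    -- convex and nontrivial, also at some other unmarked point nearby.
    by_cases hpU' : p ∈ U'
    · obtain ⟨g', hg', hev'⟩ := hFU'.chart ⟨hpU', hpV⟩ hφ hps
      have e1 := (hev.self_of_nhdsWithin ⟨hpU, hpV⟩).2
      have e2 := (hev'.self_of_nhdsWithin ⟨hpU', hpV⟩).2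
      rw [eventually_nhdsWithin_iff] at hev hev'
      have hacc := accPt_iff_frequently_nhdsNE.1
        (accPt_diff_finite hV (accPt_of_convex hconv hn ⟨hpU, hpU'⟩))
      obtain ⟨w, hw, hwn, hw1, hw2⟩ := (hacc.and_eventually (((eventually_nhdsWithin_of_forall
        fun w (hw : w ∈ ({p} : Set ℂ)ᶜ) => hw).and
          ((hev.and hev').filter_mono nhdsWithin_le_nhds)))).exists
      have hgg : g = g' := hg.eq_of_eq_of_eq hg' (x := w) (y := p) hwn
        (by rw [← (hw1 ⟨hw.1.1, hw.2⟩).2, ← (hw2 ⟨hw.1.2, hw.2⟩).2]) (by rw [← e1, ← e2])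
      subst hgg
      rw [eventually_nhdsWithin_iff]
      filter_upwards [hev, hev'] with y h1 h2 hy
      obtain ⟨hy | hy, hyV⟩ := hy
      exacts [h1 ⟨hy, hyV⟩, h2 ⟨hy, hyV⟩]
    · exact hev.filter_mono (hcl hU' hpU')
  · have hpU' := hp.resolve_left hpU
    obtain ⟨φ, hφ, g, hg, hps, hev⟩ := hFU' p ⟨hpU', hpV⟩
    exact ⟨φ, hφ, g, hg, hps, hev.filter_mono (by rw [union_comm]; exact hcl hU hpU)⟩

variable [T2Space S]

/-- Two continuous maps on a convex set with interior, flat off a set of boundary points, agree if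
they agree on a set that accumulates at some point. -/
theorem eqOn_of_convex {f f' : ℂ → S} {D V : Set ℂ} (hD : Convex ℝ D)
    (hi : (interior D).Nonempty) (hc : ContinuousOn f D) (hc' : ContinuousOn f' D)
    (hf : IsFlatOn q f (D \ V)) (hf' : IsFlatOn q f' (D \ V)) (hV : Disjoint V (interior D))
    {m : ℂ} (hm : m ∈ D) (hmV : m ∉ V)
    (h : ∃ᶠ w in 𝓝[≠] m, w ∈ D ∧ w ∉ V ∧ f w = f' w) : EqOn f f' D := by
  have hcl : D ⊆ closure (interior D) := by
    rw [hD.closure_interior_eq_closure_of_nonempty_interior hi]; exact subset_closure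
  have hsub : interior D ⊆ D \ V := fun x hx =>
    ⟨interior_subset hx, fun hxV => hV.le_bot ⟨hxV, hx⟩⟩
  -- `D \ V` lies between the convex set `interior D` and its closure.
  have hpre : IsPreconnected (D \ V) :=
    hD.interior.isPreconnected.subset_closure hsub (sdiff_subset.trans hcl)
  have h1 := hf.eqOn_of_frequently hf' hpre ⟨hm, hmV⟩ (h.mono fun w hw => ⟨⟨hw.1, hw.2.1⟩, hw.2.2⟩)
  exact (h1.mono hsub).of_subset_closure hc hc' interior_subset hcl

end Flat

end VeeringLattice

/-! ### Segments and triangles in the plane, described by cross products -/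

namespace VeeringLattice

open Set Filter

/-- The dot product of two plane vectors. -/
def dt (a b : ℂ) : ℝ := a.re * b.re + a.im * b.im

theorem continuous_dt_right (a : ℂ) : Continuous fun w => dt a w := by
  unfold dt; fun_prop

theorem dt_self_pos {a : ℂ} (h : a ≠ 0) : 0 < dt a a := by
  have : a.re ≠ 0 ∨ a.im ≠ 0 := by
    by_contra! hh; exact h (Complex.ext hh.1 hh.2)
  unfold dt
  rcases this with h | h
  · have := mul_self_pos.2 h; nlinarith [mul_self_nonneg a.im]
  · have := mul_self_pos.2 h; nlinarith [mul_self_nonneg a.re]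

theorem mem_segment_iff' {a b w : ℂ} :
    w ∈ segment ℝ a b ↔ ∃ t : ℝ, 0 ≤ t ∧ t ≤ 1 ∧ w = a + (t : ℂ) * (b - a) := by
  rw [segment_eq_image_lineMap]
  constructor
  · rintro ⟨t, ⟨h0, h1⟩, rfl⟩
    exact ⟨t, h0, h1, by simp [AffineMap.lineMap_apply]; ring⟩
  · rintro ⟨t, h0, h1, rfl⟩
    exact ⟨t, ⟨h0, h1⟩, by simp [AffineMap.lineMap_apply]; ring⟩

theorem mem_openSegment_iff' {a b w : ℂ} :
    w ∈ openSegment ℝ a b ↔ ∃ t : ℝ, 0 < t ∧ t < 1 ∧ w = a + (t : ℂ) * (b - a) := by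
  rw [openSegment_eq_image_lineMap]
  constructor
  · rintro ⟨t, ⟨h0, h1⟩, rfl⟩
    exact ⟨t, h0, h1, by simp [AffineMap.lineMap_apply]; ring⟩
  · rintro ⟨t, h0, h1, rfl⟩
    exact ⟨t, ⟨h0, h1⟩, by simp [AffineMap.lineMap_apply]; ring⟩

theorem eq_of_cr_eq_zero {v w : ℂ} (hv : v ≠ 0) (h : cr v w = 0) :
    w = ((dt v w / dt v v : ℝ) : ℂ) * v := by
  have h0 := dt_self_pos hv
  have h1 : (dt v v : ℂ) ≠ 0 := by exact_mod_cast h0.ne'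
  push_cast
  rw [div_mul_eq_mul_div, eq_div_iff h1]
  unfold cr at h
  apply Complex.ext
  · simp [dt]; linear_combination (-v.im) * h
  · simp [dt]; linear_combination (v.re) * h

/-- Membership is split into the equation of the line and two strict inequalities. The latter
persist under small changes, as the lifting along saddle connections needs. -/
theorem mem_openSegment_iff_cr {a b w : ℂ} (hab : a ≠ b) :
    w ∈ openSegment ℝ a b ↔
      cr (b - a) (w - a) = 0 ∧ 0 < dt (b - a) (w - a) ∧ dt (b - a) (w - a) < dt (b - a) (b - a) := by
  have hv : b - a ≠ 0 := sub_ne_zero.2 hab.symm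
  have h0 := dt_self_pos hv
  rw [mem_openSegment_iff']
  constructor
  · rintro ⟨t, h1, h2, rfl⟩
    have e : dt (b - a) (a + t * (b - a) - a) = t * dt (b - a) (b - a) := by
      simp [dt]; ring
    refine ⟨by simp [cr]; ring, ?_, ?_⟩ <;> rw [e]
    · positivity
    · nlinarith
  · rintro ⟨h1, h2, h3⟩
    refine ⟨dt (b - a) (w - a) / dt (b - a) (b - a), by positivity, (div_lt_one h0).2 h3, ?_⟩
    rw [← eq_of_cr_eq_zero hv h1]; ring

theorem segment_eq_union (a b : ℂ) : segment ℝ a b = openSegment ℝ a b ∪ {a, b} := by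
  rw [← insert_endpoints_openSegment ℝ a b]
  ext x; simp

theorem midpoint_mem_openSegment (a b : ℂ) : (a + b) / 2 ∈ openSegment ℝ a b :=
  mem_openSegment_iff'.2 ⟨1 / 2, by norm_num, by norm_num, by push_cast; ring⟩

theorem openSegment_nontrivial {a b : ℂ} (hab : a ≠ b) : (openSegment ℝ a b).Nontrivial := by
  refine ⟨_, midpoint_mem_openSegment a b, a + ((1 / 4 : ℝ) : ℂ) * (b - a),
    mem_openSegment_iff'.2 ⟨1 / 4, by norm_num, by norm_num, rfl⟩, fun h => hab ?_⟩
  push_cast at h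
  linear_combination (-4) * h

theorem notMem_openSegment_left {a b : ℂ} (hab : a ≠ b) : a ∉ openSegment ℝ a b := fun h =>
  hab (by simpa using (left_mem_openSegment_iff (𝕜 := ℝ)).1 h)

theorem notMem_openSegment_right {a b : ℂ} (hab : a ≠ b) : b ∉ openSegment ℝ a b := fun h =>
  hab (by simpa using (right_mem_openSegment_iff (𝕜 := ℝ)).1 h)

section Triangle

variable {a b c w : ℂ}

/-- The cross products of `w` with the three sides are its barycentric coordinates, up to the factor
`cr (b - a) (c - a)`. -/
theorem barycentric (a b c w : ℂ) : (cr (b - a) (c - a) : ℂ) * w =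
    (cr (c - b) (w - b) : ℂ) * a + (cr (a - c) (w - c) : ℂ) * b + (cr (b - a) (w - a) : ℂ) * c := by
  apply Complex.ext <;> simp [cr] <;> ring

theorem cr_add_cr_add_cr (a b c w : ℂ) :
    cr (c - b) (w - b) + cr (a - c) (w - c) + cr (b - a) (w - a) = cr (b - a) (c - a) := by
  simp [cr]; ring

theorem cr_cyc (a b c : ℂ) : cr (c - b) (a - b) = cr (b - a) (c - a) := by
  simp [cr]; ring

theorem closedTriangle_cyc (a b c : ℂ) : closedTriangle b c a = closedTriangle a b c := by
  unfold closedTriangle; congr 1; ext x; simp; tauto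

theorem openTriangle_cyc (a b c : ℂ) : openTriangle b c a = openTriangle a b c := by
  unfold openTriangle; rw [closedTriangle_cyc]

theorem openTriangle_subset (a b c : ℂ) : openTriangle a b c ⊆ closedTriangle a b c :=
  interior_subset

theorem isOpen_openTriangle (a b c : ℂ) : IsOpen (openTriangle a b c) := isOpen_interior

theorem convex_closedTriangle (a b c : ℂ) : Convex ℝ (closedTriangle a b c) := convex_convexHull _ _

theorem isClosed_closedTriangle (a b c : ℂ) : IsClosed (closedTriangle a b c) :=
  ((Set.toFinite {a, b, c}).isCompact_convexHull (𝕜 := ℝ)).isClosed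

theorem mem_closedTriangle (h : 0 < cr (b - a) (c - a)) : w ∈ closedTriangle a b c ↔
    0 ≤ cr (b - a) (w - a) ∧ 0 ≤ cr (c - b) (w - b) ∧ 0 ≤ cr (a - c) (w - c) := by
  constructor
  · intro hw
    have key : ∀ x y v : ℂ, 0 ≤ cr (y - x) (a - x) → 0 ≤ cr (y - x) (b - x) →
        0 ≤ cr (y - x) (c - x) → v ∈ closedTriangle a b c → 0 ≤ cr (y - x) (v - x) := by
      intro x y v ha hb hc hv
      have hconv : Convex ℝ {v : ℂ | 0 ≤ cr (y - x) (v - x)} := by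
        intro u hu v hv s t hs ht hst
        simp only [mem_ofPred_eq] at *
        have : cr (y - x) (s • u + t • v - x) = s * cr (y - x) (u - x) + t * cr (y - x) (v - x) := by
          have : s = 1 - t := by linarith
          subst this
          simp [cr]; ring
        rw [this]; positivity
      refine convexHull_min ?_ hconv hv
      rintro z (rfl | rfl | rfl) <;> assumption
    have z : ∀ x y : ℂ, cr (y - x) (x - x) = 0 := fun x y => by simp [cr]
    have z' : ∀ x y : ℂ, cr (y - x) (y - x) = 0 := fun x y => by simp [cr]; ring
    have h1 : cr (c - b) (a - b) = cr (b - a) (c - a) := by simp [cr]; ring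
    have h2 : cr (a - c) (b - c) = cr (b - a) (c - a) := by simp [cr]; ring
    exact ⟨key a b w (z _ _).ge (z' _ _).ge h.le hw,
      key b c w (by rw [h1]; exact h.le) (z _ _).ge (z' _ _).ge hw,
      key c a w (z' _ _).ge (by rw [h2]; exact h.le) (z _ _).ge hw⟩
  · rintro ⟨h1, h2, h3⟩
    set Δ := cr (b - a) (c - a) with hΔ
    have hb := barycentric a b c w
    have hs := cr_add_cr_add_cr a b c w
    rw [← hΔ] at hb hs
    have hw : w = (cr (c - b) (w - b) / Δ) • a + ((cr (a - c) (w - c) / Δ) • b +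
        (cr (b - a) (w - a) / Δ) • c) := by
      have hΔ' : (Δ : ℂ) ≠ 0 := by exact_mod_cast h.ne'
      apply mul_left_cancel₀ hΔ'
      rw [hb]
      simp only [Complex.real_smul]
      push_cast
      field_simp
      ring
    have hconv := convex_closedTriangle a b c
    have ha : a ∈ closedTriangle a b c := subset_convexHull _ _ (by simp)
    have hb' : b ∈ closedTriangle a b c := subset_convexHull _ _ (by simp)
    have hc : c ∈ closedTriangle a b c := subset_convexHull _ _ (by simp)
    rw [hw]
    have := hconv.sum_mem (t := Finset.univ) (w := ![cr (c - b) (w - b) / Δ,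
      cr (a - c) (w - c) / Δ, cr (b - a) (w - a) / Δ]) (z := ![a, b, c])
      (by intro i _; fin_cases i <;> simp <;> positivity)
      (by simp [Fin.sum_univ_three]; field_simp; linarith)
      (by intro i _; fin_cases i <;> simp [ha, hb', hc])
    simpa [Fin.sum_univ_three, add_assoc] using this

theorem mem_openTriangle (h : 0 < cr (b - a) (c - a)) : w ∈ openTriangle a b c ↔
    0 < cr (b - a) (w - a) ∧ 0 < cr (c - b) (w - b) ∧ 0 < cr (a - c) (w - c) := by
  constructor
  · intro hw
    have key : ∀ x y v : ℂ, x ≠ y → (∀ v ∈ closedTriangle a b c, 0 ≤ cr (y - x) (v - x)) →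
        v ∈ openTriangle a b c → 0 < cr (y - x) (v - x) := by
      intro x y v hxy hall hv
      by_contra hneg
      have h0 : cr (y - x) (v - x) = 0 :=
        le_antisymm (not_lt.1 hneg) (hall v (openTriangle_subset _ _ _ hv))
      -- A point of the interior on the line of a side could be moved a little to the right of this
      -- side (`t < 0`) without leaving the triangle, where the cross product is negative.
      have hcont : Tendsto (fun t : ℝ => v + (t : ℂ) * (Complex.I * (y - x))) (𝓝[<] 0) (𝓝 v) := by
        have : Continuous (fun t : ℝ => v + (t : ℂ) * (Complex.I * (y - x))) := by fun_prop
        simpa using (this.tendsto 0).mono_left nhdsWithin_le_nhds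
      obtain ⟨t, ht, htneg⟩ := ((hcont.eventually ((isOpen_openTriangle a b c).mem_nhds hv)).and
        self_mem_nhdsWithin).exists
      have h1 := hall _ (openTriangle_subset _ _ _ ht)
      have h2 : cr (y - x) (v + (t : ℂ) * (Complex.I * (y - x)) - x) =
          cr (y - x) (v - x) + t * dt (y - x) (y - x) := by simp [cr, dt]; ring
      rw [h2, h0] at h1
      have := dt_self_pos (sub_ne_zero.2 hxy.symm)
      have htneg : t < 0 := htneg
      nlinarith
    have hab : a ≠ b := by rintro rfl; simp [cr] at h
    have hac : a ≠ c := by rintro rfl; simp [cr] at h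
    have hbc : b ≠ c := by
      rintro rfl
      have : cr (b - a) (b - a) = 0 := by simp [cr]; ring
      linarith
    exact ⟨key _ _ _ hab (fun v hv => ((mem_closedTriangle h).1 hv).1) hw,
      key _ _ _ hbc (fun v hv => ((mem_closedTriangle h).1 hv).2.1) hw,
      key _ _ _ hac.symm (fun v hv => ((mem_closedTriangle h).1 hv).2.2) hw⟩
  · rintro ⟨h1, h2, h3⟩
    have ho : ∀ x y : ℂ, IsOpen {w : ℂ | 0 < cr (y - x) (w - x)} := fun x y =>
      isOpen_lt continuous_const ((continuous_cr_right _).comp (continuous_id.sub continuous_const))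
    refine interior_maximal (s := closedTriangle a b c) (t := {w | 0 < cr (b - a) (w - a)} ∩
      ({w | 0 < cr (c - b) (w - b)} ∩ {w | 0 < cr (a - c) (w - c)})) ?_
      ((ho _ _).inter ((ho _ _).inter (ho _ _))) ⟨h1, h2, h3⟩
    rintro v ⟨h1, h2, h3⟩
    exact (mem_closedTriangle h).2 ⟨le_of_lt h1, le_of_lt h2, le_of_lt h3⟩

theorem left_mem_closedTriangle (a b c : ℂ) : a ∈ closedTriangle a b c :=
  subset_convexHull _ _ (by simp)

theorem segment_subset_closedTriangle (a b c : ℂ) : segment ℝ a b ⊆ closedTriangle a b c :=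
  (convex_closedTriangle a b c).segment_subset (subset_convexHull _ _ (by simp))
    (subset_convexHull _ _ (by simp))

theorem mem_segment_of_cr (h : 0 < cr (b - a) (c - a)) (hw : w ∈ closedTriangle a b c)
    (h0 : cr (b - a) (w - a) = 0) : w ∈ segment ℝ a b := by
  obtain ⟨-, h2, h3⟩ := (mem_closedTriangle h).1 hw
  have hb := barycentric a b c w
  have hs := cr_add_cr_add_cr a b c w
  set Δ := cr (b - a) (c - a)
  rw [h0] at hb hs
  have hΔ' : (Δ : ℂ) ≠ 0 := by exact_mod_cast h.ne'
  rw [mem_segment_iff']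
  refine ⟨cr (a - c) (w - c) / Δ, by positivity, (div_le_one h).2 (by linarith), ?_⟩
  have : (cr (c - b) (w - b) : ℂ) = Δ - cr (a - c) (w - c) := by
    rw [← hs]; push_cast; ring
  apply mul_left_cancel₀ hΔ'
  rw [hb, this]
  push_cast
  field_simp
  ring

theorem notMem_openTriangle_of_segment (h : 0 < cr (b - a) (c - a)) (hw : w ∈ segment ℝ a b) :
    w ∉ openTriangle a b c := by
  rw [mem_openTriangle h]
  obtain ⟨t, -, -, rfl⟩ := mem_segment_iff'.1 hw
  rintro ⟨h1, -⟩
  have : cr (b - a) (a + t * (b - a) - a) = 0 := by simp [cr]; ring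
  linarith

/-- The boundary of a triangle consists of its sides. -/
theorem mem_sides (h : 0 < cr (b - a) (c - a)) (hw : w ∈ closedTriangle a b c)
    (hn : w ∉ openTriangle a b c) :
    w ∈ segment ℝ a b ∨ w ∈ segment ℝ b c ∨ w ∈ segment ℝ c a := by
  have h1 : 0 < cr (c - b) (a - b) := by rw [cr_cyc]; exact h
  have h2 : 0 < cr (a - c) (b - c) := by rw [cr_cyc]; exact h1
  obtain ⟨k1, k2, k3⟩ := (mem_closedTriangle h).1 hw
  rw [mem_openTriangle h] at hn
  rcases k1.eq_or_lt with k1 | k1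
  · exact Or.inl (mem_segment_of_cr h hw k1.symm)
  rcases k2.eq_or_lt with k2 | k2
  · exact Or.inr (Or.inl (mem_segment_of_cr h1 (by rwa [closedTriangle_cyc]) k2.symm))
  rcases k3.eq_or_lt with k3 | k3
  · exact Or.inr (Or.inr (mem_segment_of_cr h2
      (by rwa [closedTriangle_cyc, closedTriangle_cyc]) k3.symm))
  exact absurd ⟨k1, k2, k3⟩ hn

theorem disjoint_vertices (h : 0 < cr (b - a) (c - a)) :
    Disjoint ({a, b, c} : Set ℂ) (openTriangle a b c) := by
  have h1 : 0 < cr (c - b) (a - b) := by rw [cr_cyc]; exact h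
  have h2 : 0 < cr (a - c) (b - c) := by rw [cr_cyc]; exact h1
  rw [Set.disjoint_left]
  rintro x (rfl | rfl | rfl)
  · exact notMem_openTriangle_of_segment h (left_mem_segment _ _ _)
  · exact notMem_openTriangle_of_segment h (right_mem_segment _ _ _)
  · rw [← openTriangle_cyc]
    exact notMem_openTriangle_of_segment h1 (right_mem_segment _ _ _)

theorem openTriangle_nonempty (h : 0 < cr (b - a) (c - a)) : (openTriangle a b c).Nonempty := by
  refine ⟨(a + b + c) / 3, (mem_openTriangle h).2 ⟨?_, ?_, ?_⟩⟩
  all_goals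
    have h3 : ∀ z : ℂ, (z / 3).re = z.re / 3 ∧ (z / 3).im = z.im / 3 := fun z => by
      constructor <;> simp
    simp only [cr, Complex.sub_re, Complex.sub_im, h3, Complex.add_re, Complex.add_im] at h ⊢
    nlinarith

theorem openTriangle_nontrivial (h : 0 < cr (b - a) (c - a)) : (openTriangle a b c).Nontrivial := by
  obtain ⟨x, hx⟩ := openTriangle_nonempty h
  have := (isOpen_openTriangle a b c).mem_nhds hx
  by_contra hn
  rw [not_nontrivial_iff] at hn
  have : (openTriangle a b c) = {x} := hn.eq_singleton_of_mem hx
  exact not_isOpen_singleton x (this ▸ isOpen_openTriangle a b c)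

theorem IsHalfTranslation.mem_closedTriangle {g : ℂ → ℂ} (hg : IsHalfTranslation g)
    (a b c w : ℂ) : g w ∈ closedTriangle (g a) (g b) (g c) ↔ w ∈ closedTriangle a b c := by
  have : closedTriangle (g a) (g b) (g c) = g '' closedTriangle a b c := by
    obtain ⟨A, rfl⟩ := hg.exists_affine
    unfold closedTriangle
    rw [AffineMap.image_convexHull]
    simp [image_insert_eq]
  rw [this, hg.injective.mem_set_image]

theorem IsHalfTranslation.mem_openTriangle {g : ℂ → ℂ} (hg : IsHalfTranslation g)
    (h : 0 < cr (b - a) (c - a)) (w : ℂ) :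
    g w ∈ openTriangle (g a) (g b) (g c) ↔ w ∈ openTriangle a b c := by
  rw [VeeringLattice.mem_openTriangle h, VeeringLattice.mem_openTriangle (by rwa [hg.cr_sub]),
    hg.cr_sub, hg.cr_sub, hg.cr_sub]

end Triangle

end VeeringLattice

/-! ### Lifting flat maps, and uniqueness of parametrisations of saddle connections -/

namespace VeeringLattice

open Set Filter

variable {S : Type*} [TopologicalSpace S] {q : HalfTranslationSurface S}

/-- Lifting a flat map through another one along a half-translation. -/
theorem IsFlatOn.lift [T2Space S] {f g : ℂ → S} {U U' C' : Set ℂ} {h : ℂ → ℂ} {p : ℂ}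
    (hf : IsFlatOn q f U) (hU : IsPreconnected U) (hg : IsFlatOn q g U') (hUC : U' ⊆ C')
    (hC : IsClosed C') (hgc : ContinuousOn g C') (hbd : ∀ x ∈ C', x ∉ U' → ∀ w ∈ U, f w ≠ g x)
    (hh : IsHalfTranslation h) (hrel : ∀ x ∈ U, h x ∈ U' → ∀ᶠ w in 𝓝[U] x, h w ∈ U')
    (hp : p ∈ U) (hpU' : h p ∈ U')
    (hfr : ∃ᶠ w in 𝓝[≠] p, w ∈ U ∧ h w ∈ U' ∧ f w = g (h w)) :
    ∀ w ∈ U, h w ∈ U' ∧ g (h w) = f w := by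
  have hgh := hg.comp hh
  have key : ∀ x ∈ U, h x ∈ U' → (∃ᶠ w in 𝓝[≠] x, w ∈ U ∧ h w ∈ U' ∧ f w = g (h w)) →
      ∀ᶠ w in 𝓝 x, w ∈ U → h w ∈ U' ∧ f w = g (h w) := fun x hx hx' hfr => by
    filter_upwards [hf.eventually_eq hgh hx hx' hfr, eventually_nhdsWithin_iff.1 (hrel x hx hx')]
      with w h1 h2 hw
    exact ⟨h2 hw, h1 hw (h2 hw)⟩
  have : PreconnectedSpace U := Subtype.preconnectedSpace hU
  let A : Set U := {x | ∀ᶠ w in 𝓝 (x : ℂ), w ∈ U → h w ∈ U' ∧ f w = g (h w)}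
  have hA : IsClopen A := by
    constructor
    · refine isClosed_of_closure_subset fun x hx => ?_
      by_contra hxA
      have hfr : ∃ᶠ w in 𝓝[≠] (x : ℂ), w ∈ U ∧ h w ∈ U' ∧ f w = g (h w) := by
        rw [frequently_nhdsWithin_iff, frequently_iff]
        intro V hV
        obtain ⟨y, hyV, hyA⟩ := mem_closure_iff_nhds.1 hx _
          (continuous_subtype_val.continuousAt hV)
        refine ⟨y, hyV, ⟨y.2, (hyA.self_of_nhds y.2)⟩, fun hyx => hxA ?_⟩
        rwa [← Subtype.ext hyx]
      refine hxA (key x x.2 ?_ hfr)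
      have hne : NeBot (𝓝[{w | w ∈ U ∧ h w ∈ U' ∧ f w = g (h w)}] (x : ℂ)) :=
        mem_closure_iff_nhdsWithin_neBot.1 (mem_closure_iff_frequently.2
          (hfr.filter_mono nhdsWithin_le_nhds))
      have hle : 𝓝[{w | w ∈ U ∧ h w ∈ U' ∧ f w = g (h w)}] (x : ℂ) ≤ 𝓝[U] (x : ℂ) :=
        nhdsWithin_mono _ fun w hw => hw.1
      have hxC : h x ∈ C' := by
        refine hC.mem_of_tendsto ((hh.continuous.tendsto (x : ℂ)).mono_left
          (nhdsWithin_le_nhds (s := {w | w ∈ U ∧ h w ∈ U' ∧ f w = g (h w)}))) ?_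
        filter_upwards [self_mem_nhdsWithin] with w hw using hUC hw.2.1
      -- A limit of lifted points stays in `C'`. If it left `U'`, continuity would give `f x = g (h
      -- x)` at a boundary point, against `hbd`.
      by_contra hn
      refine hbd _ hxC hn x x.2 ?_
      have t1 := (hf.continuousWithinAt x.2).tendsto.mono_left hle
      have t2 : Tendsto (fun w => g (h w)) (𝓝[{w | w ∈ U ∧ h w ∈ U' ∧ f w = g (h w)}] (x : ℂ))
          (𝓝 (g (h x))) := by
        refine (hgc (h x) hxC).tendsto.comp (tendsto_nhdsWithin_iff.2
          ⟨(hh.continuous.tendsto (x : ℂ)).mono_left nhdsWithin_le_nhds, ?_⟩)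
        filter_upwards [self_mem_nhdsWithin] with w hw using hUC hw.2.1
      refine tendsto_nhds_unique_of_eventuallyEq t1 t2 ?_
      filter_upwards [self_mem_nhdsWithin] with w hw using hw.2.2
    · rw [isOpen_iff_mem_nhds]
      intro x hx
      exact continuous_subtype_val.continuousAt.eventually (eventually_eventually_nhds.2 hx)
  have hAu : A = univ := hA.eq_univ ⟨⟨p, hp⟩, key p hp hpU' hfr⟩
  intro x hx
  have : (⟨x, hx⟩ : U) ∈ A := hAu ▸ mem_univ _
  obtain ⟨h1, h2⟩ := Eventually.self_of_nhds this hx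
  exact ⟨h1, h2.symm⟩

namespace IsSaddleParam

variable {f f' : ℂ → S} {a b a' b' : ℂ}

theorem flat (h : IsSaddleParam q f a b) : IsFlatOn q f (openSegment ℝ a b) := h.2.2.2.2.1

theorem mem_openSegment (h : IsSaddleParam q f a b) {w : ℂ} (hw : w ∈ segment ℝ a b)
    (hZ : f w ∉ q.Z) : w ∈ openSegment ℝ a b := by
  rw [segment_eq_union] at hw
  rcases hw with hw | rfl | rfl
  · exact hw
  · exact absurd h.2.2.1 hZ
  · exact absurd h.2.2.2.1 hZ

theorem comp (h : IsSaddleParam q f a b) {g : ℂ → ℂ} (hg : IsHalfTranslation g)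
    (ha : g a' = a) (hb : g b' = b) : IsSaddleParam q (fun w => f (g w)) a' b' := by
  subst ha hb
  obtain ⟨h1, h2, h3, h4, h5, h6⟩ := h
  refine ⟨fun h => h1 (by rw [h]), h2.comp hg.continuous.continuousOn fun w hw => hg.mem_segment.2 hw,
    h3, h4, (h5.comp hg).mono fun w hw => hg.mem_openSegment.2 hw, fun x hx y hy hxy => ?_⟩
  exact hg.injective (h6 (hg.mem_openSegment.2 hx) (hg.mem_openSegment.2 hy) hxy)

theorem symm (h : IsSaddleParam q f a b) : IsSaddleParam q f b a := by
  obtain ⟨h1, h2, h3, h4, h5, h6⟩ := h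
  rw [segment_symm] at h2
  rw [openSegment_symm] at h5 h6
  exact ⟨h1.symm, h2, h4, h3, h5, h6⟩

variable [T2Space S]

/-- Near an interior point, the preimage of a saddle connection under a flat disc is a segment. -/
theorem exists_ball (h : IsSaddleParam q f a b) {m : ℂ} (hm : m ∈ openSegment ℝ a b) {F : ℂ → S}
    {r : ℝ} (hr : 0 < r) (hF : IsFlatOn q F (Metric.ball m r)) (hFi : InjOn F (Metric.ball m r))
    (hFf : ∀ w ∈ openSegment ℝ a b, w ∈ Metric.ball m r → F w = f w) :
    ∃ r' > 0, r' ≤ r ∧ ∀ w ∈ Metric.ball m r', F w ∈ f '' segment ℝ a b →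
      w ∈ openSegment ℝ a b := by
  have hFm : F m = f m := hFf m hm (Metric.mem_ball_self hr)
  -- The part of the saddle connection outside the disc is compact and misses `F m`, so a smaller
  -- disc avoids its image altogether.
  have hK : IsCompact (segment ℝ a b \ Metric.ball m r) := by
    refine IsCompact.diff ?_ Metric.isOpen_ball
    rw [segment_eq_image_lineMap]
    exact isCompact_Icc.image (AffineMap.lineMap_continuous)
  have hK' := (hK.image_of_continuousOn (h.2.1.mono sdiff_subset)).isClosed
  have hnot : F m ∉ f '' (segment ℝ a b \ Metric.ball m r) := by
    rintro ⟨x, ⟨hx, hxb⟩, hxm⟩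
    rw [hFm] at hxm
    have hxo : x ∈ openSegment ℝ a b := h.mem_openSegment hx (by
      rw [hxm]; exact h.flat.notMem hm)
    rw [h.2.2.2.2.2 hxo hm hxm] at hxb
    exact hxb (Metric.mem_ball_self hr)
  have hFc : ContinuousAt F m :=
    hF.continuousOn.continuousAt (Metric.ball_mem_nhds m hr)
  have hev := hFc.eventually (hK'.isOpen_compl.mem_nhds hnot)
  obtain ⟨r', hr', hb⟩ := Metric.mem_nhds_iff.1 hev
  refine ⟨min r' r, lt_min hr' hr, min_le_right _ _, fun w hw hwf => ?_⟩
  have hwr : w ∈ Metric.ball m r := Metric.ball_subset_ball (min_le_right _ _) hw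
  have hwn : F w ∉ f '' (segment ℝ a b \ Metric.ball m r) :=
    hb (Metric.ball_subset_ball (min_le_left _ _) hw)
  obtain ⟨x, hx, hxw⟩ := hwf
  have hxb : x ∈ Metric.ball m r := by
    by_contra hxb
    exact hwn ⟨x, ⟨hx, hxb⟩, hxw⟩
  have hxo : x ∈ openSegment ℝ a b := h.mem_openSegment hx (by rw [hxw]; exact hF.notMem hwr)
  have : x = w := hFi hxb hwr (by rw [hFf x hxo hxb, hxw])
  exact this ▸ hxo

/-- A flat path with end points in `Z` whose image is that of a saddle connection is a
reparametrisation of it by a half-translation. -/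
theorem unique (h : IsSaddleParam q f' a' b') (hab : a ≠ b) (hc : ContinuousOn f (segment ℝ a b))
    (ha : f a ∈ q.Z) (hb : f b ∈ q.Z) (hf : IsFlatOn q f (openSegment ℝ a b))
    (him : f '' segment ℝ a b = f' '' segment ℝ a' b') :
    ∃ g, IsHalfTranslation g ∧ ((g a = a' ∧ g b = b') ∨ (g a = b' ∧ g b = a')) ∧
      ∀ w ∈ segment ℝ a b, f' (g w) = f w := by
  set m := (a + b) / 2 with hmdef
  have hm : m ∈ openSegment ℝ a b := midpoint_mem_openSegment a b
  obtain ⟨m', hm's, hm'⟩ : f m ∈ f' '' segment ℝ a' b' := by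
    rw [← him]; exact mem_image_of_mem _ (openSegment_subset_segment _ _ _ hm)
  have hm'o : m' ∈ openSegment ℝ a' b' := h.mem_openSegment hm's (by
    rw [hm']; exact hf.notMem hm)
  obtain ⟨F, r, hr, hF, hFi, hFm, hFf⟩ := h.flat.exists_extension hm'o
  obtain ⟨r', hr', hrr, hball⟩ := h.exists_ball hm'o hr hF hFi hFf
  obtain ⟨g, hg, hgm, hev⟩ := hf.compare hF hm (Metric.mem_ball_self hr)
    (show f m = F m' by rw [hFm, hm'])
  -- Only the images are known to agree, as sets. By `exists_ball` this puts `g w` on the target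
  -- segment for `w` close to `m`.
  have hev2 : ∀ᶠ w in 𝓝[openSegment ℝ a b] m, g w ∈ openSegment ℝ a' b' ∧ f w = f' (g w) := by
    have hgb : ∀ᶠ w in 𝓝[openSegment ℝ a b] m, g w ∈ Metric.ball m' r' := by
      rw [← hgm]
      exact hg.continuous.continuousAt.continuousWithinAt.eventually
        (Metric.ball_mem_nhds _ hr')
    filter_upwards [hev, hgb, self_mem_nhdsWithin] with w h1 h2 h3
    have h4 := h1 (Metric.ball_subset_ball hrr h2)
    have h5 := hball _ h2 (by
      rw [← h4, ← him]; exact mem_image_of_mem _ (openSegment_subset_segment _ _ _ h3))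
    exact ⟨h5, by rw [h4, hFf _ h5 (Metric.ball_subset_ball hrr h2)]⟩
  have hacc := accPt_iff_frequently_nhdsNE.1
    (accPt_of_convex (convex_openSegment a b) (openSegment_nontrivial hab) hm)
  have hfr : ∃ᶠ w in 𝓝[≠] m, w ∈ openSegment ℝ a b ∧ g w ∈ openSegment ℝ a' b' ∧
      f w = f' (g w) :=
    (hacc.and_eventually ((eventually_nhdsWithin_iff.1 hev2).filter_mono nhdsWithin_le_nhds)).mono
      fun w hw => ⟨hw.1, hw.2 hw.1⟩
  -- the line through `a b` goes to the line through `a' b'`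
  have hline : ∀ w ∈ openSegment ℝ a b, cr (b' - a') (g w - a') = 0 := by
    obtain ⟨w, ⟨hw, hgw, -⟩, hwm⟩ := (hfr.and_eventually self_mem_nhdsWithin).exists
    have hwm : w ≠ m := hwm
    have e1 := ((mem_openSegment_iff_cr h.1).1 hgw).1
    have e2 := ((mem_openSegment_iff_cr h.1).1 hm'o).1
    rw [← hgm] at e2
    obtain ⟨t, -, -, hwt⟩ := mem_openSegment_iff'.1 hw
    obtain ⟨tm, -, -, hmt⟩ := mem_openSegment_iff'.1 hm
    have hne : t - tm ≠ 0 := fun h0 => hwm (by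
      rw [hwt, hmt, sub_eq_zero.1 h0])
    intro x hx
    obtain ⟨tx, -, -, hxt⟩ := mem_openSegment_iff'.1 hx
    have e3 : (t - tm) * cr (b' - a') (g x - a') =
        (tx - tm) * cr (b' - a') (g w - a') + (t - tx) * cr (b' - a') (g m - a') := by
      obtain ⟨c, hc | hc⟩ := id hg
      all_goals
        rw [hc, hc, hc, hwt, hmt, hxt]; simp [cr]; ring
    rw [e1, e2] at e3
    simpa [hne] using e3
  -- Being on the target segment is an open condition along the source: `hline` provides the
  -- equation of the line, and the two inequalities are strict.
  have hlift := hf.lift (C' := segment ℝ a' b') (convex_openSegment a b).isPreconnected h.flat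
    (openSegment_subset_segment _ _ _)
    (by
      rw [segment_eq_image_lineMap]
      exact (isCompact_Icc.image (AffineMap.lineMap_continuous)).isClosed) h.2.1
    (by
      intro x hx hxn w hw hfw
      exact hxn (h.mem_openSegment hx (hfw ▸ hf.notMem hw))) hg
    (by
      intro x hx hgx
      obtain ⟨-, h1, h2⟩ := (mem_openSegment_iff_cr h.1).1 hgx
      have hcont : Continuous fun w => dt (b' - a') (g w - a') :=
        (continuous_dt_right _).comp (hg.continuous.sub continuous_const)
      filter_upwards [self_mem_nhdsWithin,
        nhdsWithin_le_nhds (hcont.continuousAt.eventually (lt_mem_nhds h1)),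
        nhdsWithin_le_nhds (hcont.continuousAt.eventually (gt_mem_nhds h2))] with w k1 k2 k3
      exact (mem_openSegment_iff_cr h.1).2 ⟨hline w k1, k2, k3⟩) hm (by rwa [hgm]) hfr
  have hclos : ∀ w ∈ segment ℝ a b, g w ∈ segment ℝ a' b' ∧ f' (g w) = f w := by
    have hcl : segment ℝ a b ⊆ closure (openSegment ℝ a b) := segment_subset_closure_openSegment
    have h1 : MapsTo g (segment ℝ a b) (segment ℝ a' b') := by
      have : MapsTo g (openSegment ℝ a b) (openSegment ℝ a' b') := fun w hw => (hlift w hw).1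
      have h2 := this.closure hg.continuous
      rw [closure_openSegment, closure_openSegment] at h2
      exact h2
    have h3 : EqOn (fun w => f' (g w)) f (segment ℝ a b) :=
      Set.EqOn.of_subset_closure (fun w hw => (hlift w hw).2)
        (h.2.1.comp hg.continuous.continuousOn h1) hc (openSegment_subset_segment _ _ _) hcl
    exact fun w hw => ⟨h1 hw, h3 hw⟩
  -- End points go to end points, since interior points of a saddle connection are not marked.
  have hend : ∀ x ∈ segment ℝ a b, f x ∈ q.Z → g x = a' ∨ g x = b' := by
    intro x hx hxZ
    obtain ⟨h1, h2⟩ := hclos x hx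
    rw [segment_eq_union] at h1
    rcases h1 with h1 | h1
    · exact absurd (h2 ▸ hxZ) (h.flat.notMem h1)
    · exact h1
  refine ⟨g, hg, ?_, fun w hw => (hclos w hw).2⟩
  have hne : g a ≠ g b := fun h => hab (hg.injective h)
  rcases hend a (left_mem_segment _ _ _) ha with h1 | h1 <;>
    rcases hend b (right_mem_segment _ _ _) hb with h2 | h2
  · exact absurd (h1.trans h2.symm) hne
  · exact Or.inl ⟨h1, h2⟩
  · exact Or.inr ⟨h1, h2⟩
  · exact absurd (h1.trans h2.symm) hne

/-- Injectivity of `f` is not assumed; it is transported from `f'` by the half-translation of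
`unique`. -/
theorem of_image_eq (h : IsSaddleParam q f' a' b') (hab : a ≠ b)
    (hc : ContinuousOn f (segment ℝ a b))
    (ha : f a ∈ q.Z) (hb : f b ∈ q.Z) (hf : IsFlatOn q f (openSegment ℝ a b))
    (him : f '' segment ℝ a b = f' '' segment ℝ a' b') : IsSaddleParam q f a b := by
  obtain ⟨g, hg, hgab, hgf⟩ := h.unique hab hc ha hb hf him
  refine ⟨hab, hc, ha, hb, hf, fun x hx y hy hxy => hg.injective (h.2.2.2.2.2 ?_ ?_ ?_)⟩
  · rcases hgab with ⟨h1, h2⟩ | ⟨h1, h2⟩ <;> subst h1 h2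
    · exact hg.mem_openSegment.2 hx
    · rw [openSegment_symm]; exact hg.mem_openSegment.2 hx
  · rcases hgab with ⟨h1, h2⟩ | ⟨h1, h2⟩ <;> subst h1 h2
    · exact hg.mem_openSegment.2 hy
    · rw [openSegment_symm]; exact hg.mem_openSegment.2 hy
  · rw [hgf x (openSegment_subset_segment _ _ _ hx), hgf y (openSegment_subset_segment _ _ _ hy),
      hxy]

theorem unique' (h : IsSaddleParam q f' a' b') (hf : IsSaddleParam q f a b)
    (him : f '' segment ℝ a b = f' '' segment ℝ a' b') :
    ∃ g, IsHalfTranslation g ∧ ((g a = a' ∧ g b = b') ∨ (g a = b' ∧ g b = a')) ∧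
      ∀ w ∈ segment ℝ a b, f' (g w) = f w :=
  h.unique hf.1 hf.2.1 hf.2.2.1 hf.2.2.2.1 hf.flat him

end IsSaddleParam

theorem IsSaddleParam.hasHolonomy {f : ℂ → S} {a b : ℂ} (h : IsSaddleParam q f a b) :
    HasHolonomy q (f '' segment ℝ a b) (b - a) := ⟨f, a, b, h, rfl, rfl⟩

theorem HasHolonomy.neg {e : Set S} {v : ℂ} (h : HasHolonomy q e v) : HasHolonomy q e (-v) := by
  obtain ⟨f, a, b, h, rfl, rfl⟩ := h
  exact ⟨f, b, a, h.symm, by rw [segment_symm], by ring⟩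

/-- Two parametrisations differ by a half-translation that keeps or exchanges the ends; each of the
four combinations changes the holonomy by a sign at most. So colour, width and height belong to the
edge as a set. -/
theorem HasHolonomy.unique [T2Space S] {e : Set S} {v v' : ℂ} (h : HasHolonomy q e v)
    (h' : HasHolonomy q e v') : v' = v ∨ v' = -v := by
  obtain ⟨f, a, b, h, rfl, rfl⟩ := h
  obtain ⟨f', a', b', h', he, rfl⟩ := h'
  obtain ⟨g, hg, hgab, -⟩ := h'.unique' h he
  rcases hgab with ⟨rfl, rfl⟩ | ⟨rfl, rfl⟩ <;> rcases hg.sub_eq with h | h <;> rw [h]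
  · simp
  · simp
  · right; ring
  · left; ring

theorem HasHolonomy.isClosed [T2Space S] {e : Set S} {v : ℂ} (h : HasHolonomy q e v) :
    IsClosed e := by
  obtain ⟨f, a, b, h, rfl, rfl⟩ := h
  have : IsCompact (segment ℝ a b) := by
    rw [segment_eq_image_lineMap]
    exact isCompact_Icc.image (AffineMap.lineMap_continuous)
  exact (this.image_of_continuousOn h.2.1).isClosed

end VeeringLattice

/-! ### Flat triangles, layouts of faces, and the faces next to an edge -/

namespace VeeringLattice

open Set Filter

theorem IsHalfTranslation.image_openTriangle {X : Type*} {f : ℂ → X} {a b c a' b' c' : ℂ} {g : ℂ → ℂ} (hg : IsHalfTranslation g) (h : 0 < cr (b' - a') (c' - a'))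
    (ha : g a' = a) (hb : g b' = b) (hc : g c' = c) :
    (fun w => f (g w)) '' openTriangle a' b' c' = f '' openTriangle a b c := by
  subst ha hb hc
  obtain ⟨g', hg', h1, h2⟩ := hg.exists_inv
  ext x; constructor
  · rintro ⟨w, hw, rfl⟩
    exact ⟨_, (hg.mem_openTriangle h _).2 hw, rfl⟩
  · rintro ⟨w, hw, rfl⟩
    refine ⟨g' w, ?_, by simp only [h2]⟩
    rw [← hg.mem_openTriangle h, h2]; exact hw

variable {S : Type*} [TopologicalSpace S] {q : HalfTranslationSurface S}

namespace IsFlatTriangle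

variable {f g : ℂ → S} {a b c a' b' c' : ℂ}

theorem pos (h : IsFlatTriangle q f a b c) : 0 < cr (b - a) (c - a) := by
  rw [← conj_mul_im]; exact h.1

theorem cyc (h : IsFlatTriangle q f a b c) : IsFlatTriangle q f b c a := by
  have h0 := h.pos
  obtain ⟨h1, h2, h3, h4, h5, h6, h7⟩ := h
  refine ⟨by rw [conj_mul_im, cr_cyc]; exact h0, by rwa [closedTriangle_cyc], h4, h5, h3, ?_,
    by rwa [openTriangle_cyc]⟩
  rw [closedTriangle_cyc]
  refine h6.mono fun w hw => ⟨hw.1, fun hn => hw.2 ?_⟩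
  simp only [mem_insert_iff, mem_singleton_iff] at hn ⊢
  tauto

theorem comp (h : IsFlatTriangle q f a b c) {g : ℂ → ℂ} (hg : IsHalfTranslation g)
    (ha : g a' = a) (hb : g b' = b) (hc : g c' = c) :
    IsFlatTriangle q (fun w => f (g w)) a' b' c' := by
  subst ha hb hc
  have h0 := h.pos
  rw [hg.cr_sub] at h0
  obtain ⟨h1, h2, h3, h4, h5, h6, h7⟩ := h
  refine ⟨by rw [conj_mul_im]; exact h0, h2.comp hg.continuous.continuousOn
    fun _ hw => (hg.mem_closedTriangle _ _ _ _).2 hw, h3, h4, h5, ?_, ?_⟩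
  · refine (h6.comp hg).mono fun w hw => ⟨(hg.mem_closedTriangle _ _ _ _).2 hw.1, fun hn => hw.2 ?_⟩
    simpa [hg.injective.eq_iff] using hn
  · intro _ hx _ hy hxy
    exact hg.injective (h7 ((hg.mem_openTriangle h0 _).2 hx) ((hg.mem_openTriangle h0 _).2 hy) hxy)

theorem flat (h : IsFlatTriangle q f a b c) :
    IsFlatOn q f (closedTriangle a b c \ {a, b, c}) := h.2.2.2.2.2.1

theorem open_subset (h : IsFlatTriangle q f a b c) :
    openTriangle a b c ⊆ closedTriangle a b c \ {a, b, c} := fun _ hx =>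
  ⟨openTriangle_subset _ _ _ hx, fun hn => (disjoint_vertices h.pos).le_bot ⟨hn, hx⟩⟩

theorem mem_vertices (h : IsFlatTriangle q f a b c) {w : ℂ} (hw : w ∈ closedTriangle a b c)
    (hZ : f w ∈ q.Z) : w = a ∨ w = b ∨ w = c := by
  by_contra hn
  exact h.flat.notMem ⟨hw, hn⟩ hZ

theorem ne (h : IsFlatTriangle q f a b c) : a ≠ b := by
  have := h.pos
  rintro rfl
  simp [cr] at this

theorem openSegment_subset (h : IsFlatTriangle q f a b c) :
    openSegment ℝ a b ⊆ closedTriangle a b c \ {a, b, c} := by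
  intro w hw
  refine ⟨segment_subset_closedTriangle _ _ _ (openSegment_subset_segment _ _ _ hw), ?_⟩
  rintro (rfl | rfl | rfl)
  · exact notMem_openSegment_left h.ne hw
  · exact notMem_openSegment_right h.ne hw
  · have := h.pos
    obtain ⟨t, -, -, ht⟩ := mem_openSegment_iff'.1 hw
    have e : cr (b - a) (w - a) = 0 := by rw [ht]; simp [cr]; ring
    rw [e] at this
    exact lt_irrefl _ this

variable [T2Space S]

/-- A connected flat piece that enters the open triangle and avoids the image of its boundary cannot
leave, so `IsFlatOn.lift` applies to all of it. -/
theorem exists_lift (hg : IsFlatTriangle q g a b c) {U : Set ℂ} (hf : IsFlatOn q f U)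
    (hU : IsPreconnected U) (hn : U.Nontrivial)
    (hbd : ∀ x ∈ closedTriangle a b c, x ∉ openTriangle a b c → ∀ w ∈ U, f w ≠ g x)
    {p : ℂ} (hp : p ∈ U) (hpT : f p ∈ g '' openTriangle a b c) :
    ∃ h, IsHalfTranslation h ∧ ∀ w ∈ U, h w ∈ openTriangle a b c ∧ g (h w) = f w := by
  obtain ⟨p', hp', hpp⟩ := hpT
  have hgo := hg.flat.mono hg.open_subset
  obtain ⟨h, hh, hhp, hev⟩ := hf.compare hgo hp hp' hpp.symm
  have ho : ∀ x ∈ U, h x ∈ openTriangle a b c → ∀ᶠ w in 𝓝[U] x, h w ∈ openTriangle a b c :=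
    fun x _ hx => hh.continuous.continuousAt.continuousWithinAt.eventually
      ((isOpen_openTriangle a b c).mem_nhds hx)
  have hacc := accPt_iff_frequently_nhdsNE.1 (hU.preperfect_of_nontrivial hn p hp)
  refine ⟨h, hh, hf.lift hU hgo (openTriangle_subset _ _ _) (isClosed_closedTriangle _ _ _) hg.2.1
    hbd hh ho hp (by rwa [hhp]) ?_⟩
  have h2 := (eventually_nhdsWithin_iff.1 (hev.and (ho p hp (by rwa [hhp])))).filter_mono
    (nhdsWithin_le_nhds (s := {p}ᶜ))
  exact (hacc.and_eventually h2).mono fun w hw => ⟨hw.1, (hw.2 hw.1).2, (hw.2 hw.1).1 (hw.2 hw.1).2⟩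

/-- Two flat triangles with the same interior agree up to a half-translation and a cyclic
permutation of the vertices. -/
theorem unique (hg : IsFlatTriangle q g a b c) (hf : IsFlatTriangle q f a' b' c')
    (him : f '' openTriangle a' b' c' = g '' openTriangle a b c)
    (hbd : ∀ x ∈ closedTriangle a b c, x ∉ openTriangle a b c → g x ∉ g '' openTriangle a b c) :
    ∃ h, IsHalfTranslation h ∧ (∀ w ∈ closedTriangle a' b' c', g (h w) = f w) ∧
      (∀ w ∈ openTriangle a' b' c', h w ∈ openTriangle a b c) ∧
      ((h a' = a ∧ h b' = b ∧ h c' = c) ∨ (h a' = b ∧ h b' = c ∧ h c' = a) ∨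
        (h a' = c ∧ h b' = a ∧ h c' = b)) := by
  obtain ⟨p, hp⟩ := openTriangle_nonempty hf.pos
  obtain ⟨h, hh, hlift⟩ := hg.exists_lift (hf.flat.mono hf.open_subset)
    ((convex_closedTriangle a' b' c').interior.isPreconnected) (openTriangle_nontrivial hf.pos)
    (fun x hx hxn w hw hfw => hbd x hx hxn (by rw [← hfw, ← him]; exact mem_image_of_mem _ hw)) hp
    (by rw [← him]; exact mem_image_of_mem _ hp)
  have hcl : closedTriangle a' b' c' ⊆ closure (openTriangle a' b' c') := by
    rw [openTriangle, (convex_closedTriangle a' b' c').closure_interior_eq_closure_of_nonempty_interior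
      ⟨p, hp⟩]
    exact subset_closure
  have hmap : MapsTo h (closedTriangle a' b' c') (closedTriangle a b c) := by
    have h1 : MapsTo h (openTriangle a' b' c') (closedTriangle a b c) := fun w hw =>
      openTriangle_subset _ _ _ (hlift w hw).1
    have h2 := h1.closure hh.continuous
    rw [(isClosed_closedTriangle a b c).closure_eq] at h2
    exact h2.mono_left hcl
  have heq : EqOn (fun w => g (h w)) f (closedTriangle a' b' c') :=
    Set.EqOn.of_subset_closure (fun w hw => (hlift w hw).2)
      (hg.2.1.comp hh.continuous.continuousOn hmap) hf.2.1 (openTriangle_subset _ _ _) hcl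
  refine ⟨h, hh, heq, fun w hw => (hlift w hw).1, ?_⟩
  have hv : ∀ x ∈ closedTriangle a' b' c', f x ∈ q.Z → h x = a ∨ h x = b ∨ h x = c :=
    fun x hx hxZ => hg.mem_vertices (hmap hx) (by have := heq hx; simp only at this; rwa [this])
  have ha := hv a' (left_mem_closedTriangle _ _ _) hf.2.2.1
  have hb := hv b' (subset_convexHull _ _ (by simp)) hf.2.2.2.1
  have hc := hv c' (subset_convexHull _ _ (by simp)) hf.2.2.2.2.1
  have hab : h a' ≠ h b' := fun e => hf.ne (hh.injective e)
  have hbc : h b' ≠ h c' := fun e => hf.cyc.ne (hh.injective e)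
  have hca : h c' ≠ h a' := fun e => hf.cyc.cyc.ne (hh.injective e)
  -- Half-translations preserve orientation, so only the cyclic ones among the bijections of the
  -- vertices remain.
  have hor := hf.pos
  rw [← hh.cr_sub] at hor
  have hpos := hg.pos
  have anti : ∀ x y z : ℂ, cr (z - x) (y - x) = - cr (y - x) (z - x) := fun x y z => by
    simp [cr]; ring
  rcases ha with ha | ha | ha <;> rcases hb with hb | hb | hb <;> rcases hc with hc | hc | hc <;>
    first
      | exact absurd (ha.trans hb.symm) hab
      | exact absurd (hb.trans hc.symm) hbc
      | exact absurd (hc.trans ha.symm) hca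
      | exact Or.inl ⟨ha, hb, hc⟩
      | exact Or.inr (Or.inl ⟨ha, hb, hc⟩)
      | exact Or.inr (Or.inr ⟨ha, hb, hc⟩)
      | (exfalso; rw [ha, hb, hc] at hor; simp [cr] at hor hpos; linarith)

end IsFlatTriangle

namespace StraightTriangulation

variable {τ : StraightTriangulation q} {f g : ℂ → S} {a b c a' b' c' : ℂ}

namespace LaysOut

theorem cyc (h : τ.LaysOut f a b c) : τ.LaysOut f b c a := by
  obtain ⟨h1, h2, h3, h4, h5⟩ := h
  exact ⟨h1.cyc, by rwa [openTriangle_cyc], h4, h5, h3⟩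

theorem comp (h : τ.LaysOut f a b c) {g : ℂ → ℂ} (hg : IsHalfTranslation g)
    (ha : g a' = a) (hb : g b' = b) (hc : g c' = c) : τ.LaysOut (fun w => f (g w)) a' b' c' := by
  obtain ⟨h1, h2, h3, h4, h5⟩ := h
  have him : ∀ x y x' y' : ℂ, g x' = x → g y' = y →
      (fun w => f (g w)) '' segment ℝ x' y' = f '' segment ℝ x y := fun x y x' y' hx hy => by
    rw [← hx, ← hy, ← hg.image_segment, image_image]
  refine ⟨h1.comp hg ha hb hc, ?_, ?_, ?_, ?_⟩
  · rwa [IsHalfTranslation.image_openTriangle hg (h1.comp hg ha hb hc).pos ha hb hc]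
  · rwa [him _ _ _ _ ha hb]
  · rwa [him _ _ _ _ hb hc]
  · rwa [him _ _ _ _ hc ha]

theorem tri (h : τ.LaysOut f a b c) : IsFlatTriangle q f a b c := h.1

theorem pos (h : τ.LaysOut f a b c) : 0 < cr (b - a) (c - a) := h.1.pos

/-- The boundary of a face is disjoint from all faces. -/
theorem boundary (h : τ.LaysOut f a b c) {x : ℂ} (hx : x ∈ closedTriangle a b c)
    (hn : x ∉ openTriangle a b c) : ∃ e ∈ τ.edges, f x ∈ e := by
  rcases mem_sides h.pos hx hn with hs | hs | hs
  · exact ⟨_, h.2.2.1, mem_image_of_mem _ hs⟩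
  · exact ⟨_, h.2.2.2.1, mem_image_of_mem _ hs⟩
  · exact ⟨_, h.2.2.2.2, mem_image_of_mem _ hs⟩

theorem boundary_notMem (h : τ.LaysOut f a b c) {x : ℂ} (hx : x ∈ closedTriangle a b c)
    (hn : x ∉ openTriangle a b c) {T : Set S} (hT : T ∈ τ.faces) : f x ∉ T := fun hxT => by
  obtain ⟨e, he, hxe⟩ := h.boundary hx hn
  exact (τ.edge_face e he T hT).le_bot ⟨hxe, hxT⟩

variable [T2Space S]

/-- `IsFlatTriangle` asks for injectivity in the interior only. That a side is injective comes from
the edge being a saddle connection. -/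
theorem saddle (h : τ.LaysOut f a b c) : IsSaddleParam q f a b := by
  obtain ⟨v, f', a', b', h', he, -⟩ := τ.edge_saddle _ h.2.2.1
  exact h'.of_image_eq h.1.ne (h.1.2.1.mono (segment_subset_closedTriangle _ _ _)) h.1.2.2.1
    h.1.2.2.2.1 (h.1.flat.mono h.1.openSegment_subset) he

theorem unique (hg : τ.LaysOut g a b c) (hf : IsFlatTriangle q f a' b' c')
    (him : f '' openTriangle a' b' c' = g '' openTriangle a b c) :
    ∃ h, IsHalfTranslation h ∧ (∀ w ∈ closedTriangle a' b' c', g (h w) = f w) ∧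
      (∀ w ∈ openTriangle a' b' c', h w ∈ openTriangle a b c) ∧
      ((h a' = a ∧ h b' = b ∧ h c' = c) ∨ (h a' = b ∧ h b' = c ∧ h c' = a) ∨
        (h a' = c ∧ h b' = a ∧ h c' = b)) :=
  hg.1.unique hf him fun _ hx hxn => hg.boundary_notMem hx hxn hg.2.1

/-- A flat triangle whose interior is a face lays out that face. -/
theorem of_face {τ : StraightTriangulation q} {f : ℂ → S} {a b c : ℂ}
    (hf : IsFlatTriangle q f a b c) (hT : f '' openTriangle a b c ∈ τ.faces) :
    τ.LaysOut f a b c := by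
  obtain ⟨g, a', b', c', h1, h2, h3, h4, h5⟩ := τ.face_triangle _ hT
  have hg : τ.LaysOut g a' b' c' := ⟨h1, h2 ▸ hT, h3, h4, h5⟩
  obtain ⟨h, hh, heq, -, hcase⟩ := hg.unique hf h2
  have key : ∀ {x y : ℂ}, segment ℝ x y ⊆ closedTriangle a b c →
      f '' segment ℝ x y = g '' segment ℝ (h x) (h y) := fun {x y} hs => by
    rw [← hh.image_segment, image_image]
    exact image_congr fun w hw => (heq w (hs hw)).symm
  have s1 := segment_subset_closedTriangle a b c
  have s2 := segment_subset_closedTriangle b c a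
  have s3 := segment_subset_closedTriangle c a b
  rw [closedTriangle_cyc] at s2
  rw [closedTriangle_cyc, closedTriangle_cyc] at s3
  refine ⟨hf, hT, ?_, ?_, ?_⟩
  · rw [key s1]
    rcases hcase with ⟨r1, r2, r3⟩ | ⟨r1, r2, r3⟩ | ⟨r1, r2, r3⟩ <;> rw [r1, r2] <;> assumption
  · rw [key s2]
    rcases hcase with ⟨r1, r2, r3⟩ | ⟨r1, r2, r3⟩ | ⟨r1, r2, r3⟩ <;> rw [r2, r3] <;> assumption
  · rw [key s3]
    rcases hcase with ⟨r1, r2, r3⟩ | ⟨r1, r2, r3⟩ | ⟨r1, r2, r3⟩ <;> rw [r3, r1] <;> assumption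

end LaysOut

theorem exists_laysOut (τ : StraightTriangulation q) {T : Set S} (hT : T ∈ τ.faces) :
    ∃ f a b c, τ.LaysOut f a b c ∧ T = f '' openTriangle a b c := by
  obtain ⟨g, a', b', c', h1, h2, h3, h4, h5⟩ := τ.face_triangle _ hT
  exact ⟨g, a', b', c', ⟨h1, h2 ▸ hT, h3, h4, h5⟩, h2⟩

variable [T2Space S]

/-- Two edges of a triangulation that cross at a point have the same direction there. -/
theorem parallel_of_cross (τ : StraightTriangulation q) (hf : IsSaddleParam q f a b)
    (hf' : IsSaddleParam q g a' b') (he : f '' segment ℝ a b ∈ τ.edges)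
    (he' : g '' segment ℝ a' b' ∈ τ.edges) {w : ℂ} (hw : w ∈ openSegment ℝ a b)
    (hw' : w ∈ openSegment ℝ a' b') (hfw : f w = g w) : b' - a' = b - a ∨ b' - a' = -(b - a) := by
  -- Distinct edges meet in marked points only, and the crossing point is not marked.
  have hee : f '' segment ℝ a b = g '' segment ℝ a' b' := by
    by_contra hne
    exact hf.flat.notMem hw (τ.edge_edge _ he _ he' hne
      ⟨mem_image_of_mem _ (openSegment_subset_segment _ _ _ hw),
        by rw [hfw]; exact mem_image_of_mem _ (openSegment_subset_segment _ _ _ hw')⟩)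
  exact (hf.hasHolonomy).unique (hee ▸ hf'.hasHolonomy)

/-- Each side of each edge belongs to a face, which can be laid out along with the edge. -/
theorem exists_adjacent (τ : StraightTriangulation q) {l u : ℂ} (hf : IsSaddleParam q f l u)
    (he : f '' segment ℝ l u ∈ τ.edges) :
    ∃ g s, τ.LaysOut g l u s ∧ EqOn g f (segment ℝ l u) := by
  set m := (l + u) / 2 with hm
  have hmo : m ∈ openSegment ℝ l u := midpoint_mem_openSegment l u
  have hfm : f m ∉ q.Z := hf.flat.notMem hmo
  have hul : u - l ≠ 0 := sub_ne_zero.2 hf.1.symm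
  obtain ⟨F, r, hr, hF, hFi, hFm, hFf⟩ := hf.flat.exists_extension hmo
  obtain ⟨r₁, hr₁, hrr₁, hball⟩ := hf.exists_ball hmo hr hF hFi hFf
  have hFc : ContinuousAt F m := hF.continuousOn.continuousAt (Metric.ball_mem_nhds m hr)
  -- a disc that meets no other edge
  have hcl : IsClosed (⋃ e ∈ τ.edges \ {f '' segment ℝ l u}, e) :=
    (τ.edges_finite.subset sdiff_subset).isClosed_biUnion fun e he => by
      obtain ⟨v, hv⟩ := τ.edge_saddle e he.1
      exact hv.isClosed
  have hnot : F m ∉ ⋃ e ∈ τ.edges \ {f '' segment ℝ l u}, e := by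
    simp only [mem_iUnion, not_exists]
    rintro e ⟨he1, he2⟩ hme
    rw [hFm] at hme
    exact hfm (τ.edge_edge _ he _ he1 (fun h => he2 h.symm)
      ⟨mem_image_of_mem _ (openSegment_subset_segment _ _ _ hmo), hme⟩)
  obtain ⟨r₂, hr₂, hball₂⟩ := Metric.mem_nhds_iff.1 (hFc.eventually (hcl.isOpen_compl.mem_nhds hnot))
  set ρ := min r₁ r₂ with hρ
  have hρ0 : 0 < ρ := lt_min hr₁ hr₂
  have hb1 : ∀ w ∈ Metric.ball m ρ, w ∈ Metric.ball m r₁ := fun w hw =>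
    Metric.ball_subset_ball (min_le_left _ _) hw
  have hbr : ∀ w ∈ Metric.ball m ρ, w ∈ Metric.ball m r := fun w hw =>
    Metric.ball_subset_ball hrr₁ (hb1 w hw)
  have hb2 : ∀ w ∈ Metric.ball m ρ, w ∈ Metric.ball m r₂ := fun w hw =>
    Metric.ball_subset_ball (min_le_right _ _) hw
  -- The half-disc on the left of the edge. It meets neither this edge nor any other one, so it is
  -- contained in a single face.
  let H : Set ℂ := Metric.ball m ρ ∩ {w | 0 < cr (u - l) (w - m)}
  have hcrm : ∀ w ∈ openSegment ℝ l u, cr (u - l) (w - m) = 0 := by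
    intro w hw
    have e1 := ((mem_openSegment_iff_cr hf.1).1 hw).1
    have e2 := ((mem_openSegment_iff_cr hf.1).1 hmo).1
    simp only [cr, Complex.sub_re, Complex.sub_im] at *; linarith
  have hHedge : ∀ w ∈ H, ∀ e ∈ τ.edges, F w ∉ e := by
    rintro w ⟨hwb, hwc⟩ e he' hwe
    by_cases hee : e = f '' segment ℝ l u
    · subst hee
      have := hcrm w (hball w (hb1 w hwb) hwe)
      have hwc : 0 < cr (u - l) (w - m) := hwc
      linarith
    · exact hball₂ (hb2 w hwb) (mem_biUnion (show e ∈ τ.edges \ _ from ⟨he', hee⟩) hwe)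
  have hHconv : Convex ℝ H := by
    refine (convex_ball _ _).inter ?_
    intro x hx y hy s t hs ht hst
    simp only [mem_ofPred_eq] at *
    have : cr (u - l) (s • x + t • y - m) = s * cr (u - l) (x - m) + t * cr (u - l) (y - m) := by
      have : s = 1 - t := by linarith
      subst this
      simp [cr]; ring
    rw [this]
    rcases hs.eq_or_lt with rfl | hs
    · have : t = 1 := by linarith
      subst this; simpa using hy
    · positivity
  have hray : ∀ z : ℂ, 0 < cr (u - l) z → ∃ t₀ > 0, ∀ t : ℝ, 0 < t → t < t₀ →
      m + (t : ℂ) * z ∈ H := by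
    intro z hz
    have hc : Tendsto (fun t : ℝ => m + (t : ℂ) * z) (𝓝 0) (𝓝 m) := by
      have : Continuous (fun t : ℝ => m + (t : ℂ) * z) := by fun_prop
      simpa using this.tendsto 0
    obtain ⟨t₀, ht₀, hb⟩ := Metric.mem_nhds_iff.1 (hc.eventually (Metric.ball_mem_nhds m hρ0))
    refine ⟨t₀, ht₀, fun t ht htt => ⟨hb (by simpa [abs_of_pos ht] using htt), ?_⟩⟩
    show 0 < cr (u - l) (m + (t : ℂ) * z - m)
    rw [add_sub_cancel_left, cr_smul_right]; positivity
  have hI : 0 < cr (u - l) (Complex.I * (u - l)) := by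
    have := dt_self_pos hul
    have e : cr (u - l) (Complex.I * (u - l)) = dt (u - l) (u - l) := by simp [cr, dt]; ring
    rwa [e]
  obtain ⟨t₀, ht₀, hrayI⟩ := hray _ hI
  have hx1 := hrayI (t₀ / 2) (by positivity) (by linarith)
  have hx2 := hrayI (t₀ / 3) (by positivity) (by linarith)
  have hHn : H.Nontrivial := by
    refine ⟨_, hx1, _, hx2, fun h => ?_⟩
    have h0 : Complex.I * (u - l) ≠ 0 := mul_ne_zero Complex.I_ne_zero hul
    have h2 := mul_right_cancel₀ h0 (add_left_cancel h)
    have : t₀ / 2 = t₀ / 3 := by exact_mod_cast h2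
    linarith
  have hFH : IsFlatOn q F H := hF.mono fun w hw => hbr w hw.1
  -- the face that contains the half-disc
  obtain ⟨T, hT, hxT⟩ : ∃ T ∈ τ.faces, F (m + ((t₀ / 2 : ℝ) : ℂ) * (Complex.I * (u - l))) ∈ T := by
    rcases τ.cover (F (m + ((t₀ / 2 : ℝ) : ℂ) * (Complex.I * (u - l)))) with h | ⟨e, he', h⟩ | h
    · exact absurd h (hFH.notMem hx1)
    · exact absurd h (hHedge _ hx1 e he')
    · exact h
  obtain ⟨g₀, a₀, b₀, c₀, hg₀, rfl⟩ := τ.exists_laysOut hT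
  obtain ⟨h, hh, hlift⟩ := hg₀.1.exists_lift hFH hHconv.isPreconnected hHn
    (fun x hx hxn w hw hfw => by
      obtain ⟨e, he', hxe⟩ := hg₀.boundary hx hxn
      exact hHedge w hw e he' (hfw ▸ hxe)) hx1 hxT
  obtain ⟨h', hh', hl, hr'⟩ := hh.exists_inv
  have hg := hg₀.comp hh (hr' a₀) (hr' b₀) (hr' c₀)
  have hgF : ∀ w ∈ H, w ∈ openTriangle (h' a₀) (h' b₀) (h' c₀) ∧ g₀ (h w) = F w := fun w hw => by
    obtain ⟨h1, h2⟩ := hlift w hw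
    refine ⟨?_, h2⟩
    rw [← hh.mem_openTriangle hg.pos, hr', hr', hr']; exact h1
  generalize h' a₀ = a at *
  generalize h' b₀ = b at *
  generalize h' c₀ = c at *
  set g : ℂ → S := fun w => g₀ (h w) with hgdef
  have hclH : ∀ w ∈ openSegment ℝ l u, w ∈ Metric.ball m ρ → w ∈ closure H := by
    intro w hw hwb
    have hc : Tendsto (fun t : ℝ => w + (t : ℂ) * (Complex.I * (u - l))) (𝓝[>] 0) (𝓝 w) := by
      have : Continuous (fun t : ℝ => w + (t : ℂ) * (Complex.I * (u - l))) := by fun_prop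
      simpa using (this.tendsto 0).mono_left nhdsWithin_le_nhds
    refine mem_closure_of_tendsto hc ?_
    filter_upwards [hc.eventually (Metric.isOpen_ball.mem_nhds hwb), self_mem_nhdsWithin]
      with t ht htpos
    refine ⟨ht, ?_⟩
    show 0 < cr (u - l) _
    have e : cr (u - l) (w + (t : ℂ) * (Complex.I * (u - l)) - m) =
        cr (u - l) (w - m) + t * cr (u - l) (Complex.I * (u - l)) := by
      rw [show w + (t : ℂ) * (Complex.I * (u - l)) - m =
        (w - m) + (t : ℂ) * (Complex.I * (u - l)) by ring, ← cr_smul_right]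
      simp [cr]; ring
    rw [e, hcrm w hw]
    have htpos : 0 < t := htpos
    rw [zero_add]; exact mul_pos htpos hI
  have hseg : ∀ w ∈ openSegment ℝ l u, w ∈ Metric.ball m ρ →
      w ∈ closedTriangle a b c ∧ g w = f w := by
    intro w hw hwb
    have hsub : closure H ⊆ closedTriangle a b c :=
      closure_minimal (fun x hx => openTriangle_subset _ _ _ (hgF x hx).1)
        (isClosed_closedTriangle a b c)
    have hwT := hsub (hclH w hw hwb)
    refine ⟨hwT, ?_⟩
    rw [← hFf w hw (hbr w hwb)]
    have hne : NeBot (𝓝[H] w) := mem_closure_iff_nhdsWithin_neBot.1 (hclH w hw hwb)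
    have t1 : Tendsto g (𝓝[H] w) (𝓝 (g w)) := (hg.1.2.1 w hwT).tendsto.mono_left
      (nhdsWithin_mono _ fun x hx => openTriangle_subset _ _ _ (hgF x hx).1)
    have t2 : Tendsto F (𝓝[H] w) (𝓝 (F w)) :=
      (hF.continuousOn.continuousAt (Metric.isOpen_ball.mem_nhds (hbr w hwb))).tendsto.mono_left
        nhdsWithin_le_nhds
    refine tendsto_nhds_unique_of_eventuallyEq t1 t2 ?_
    filter_upwards [self_mem_nhdsWithin] with x hx using (hgF x hx).2
  obtain ⟨hmT, hgm⟩ := hseg m hmo (Metric.mem_ball_self hρ0)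
  -- The midpoint is in the closed layout of the face but on an edge, so it lies on one of the three
  -- sides.
  have hmn : m ∉ openTriangle a b c := fun hmn =>
    (τ.edge_face _ he _ hg.2.1).le_bot ⟨by
      show g m ∈ f '' segment ℝ l u
      rw [hgm]; exact mem_image_of_mem _ (openSegment_subset_segment _ _ _ hmo),
      mem_image_of_mem _ hmn⟩
  -- it suffices to treat the case where the edge is the first side
  have main : ∀ a b c : ℂ, τ.LaysOut g a b c → (∀ w ∈ H, w ∈ openTriangle a b c) →
      m ∈ segment ℝ a b → ∃ s, τ.LaysOut g l u s ∧ EqOn g f (segment ℝ l u) := by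
    intro a b c hg hHo hmab
    have hmo' : m ∈ openSegment ℝ a b := hg.saddle.mem_openSegment hmab (by rw [hgm]; exact hfm)
    have hee : g '' segment ℝ a b = f '' segment ℝ l u := by
      by_contra hne
      exact hfm (τ.edge_edge _ hg.2.2.1 _ he hne ⟨by rw [← hgm]; exact mem_image_of_mem _ hmab,
        mem_image_of_mem _ (openSegment_subset_segment _ _ _ hmo)⟩)
    obtain ⟨k, hk, hkab, hkf⟩ := hf.unique' hg.saddle hee
    have hcra : cr (b - a) (m - a) = 0 := ((mem_openSegment_iff_cr hg.1.ne).1 hmo').1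
    have hpos : ∀ z : ℂ, 0 < cr (u - l) z → 0 < cr (b - a) z := by
      intro z hz
      obtain ⟨t₁, ht₁, hr⟩ := hray z hz
      have h1 := ((mem_openTriangle hg.pos).1 (hHo _ (hr (t₁ / 2) (by positivity)
        (by linarith)))).1
      have e : cr (b - a) (m + ((t₁ / 2 : ℝ) : ℂ) * z - a) = cr (b - a) (m - a) +
          (t₁ / 2) * cr (b - a) z := by
        rw [show m + ((t₁ / 2 : ℝ) : ℂ) * z - a = (m - a) + ((t₁ / 2 : ℝ) : ℂ) * z by ring,
          ← cr_smul_right]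
        simp [cr]; ring
      rw [e, hcra, zero_add] at h1
      exact pos_of_mul_pos_right h1 (by positivity)
    have hk1 : ∀ w ∈ openSegment ℝ l u, w ∈ Metric.ball m ρ → w ∈ openSegment ℝ a b → k w = w := by
      intro w hw hwb hwab
      have h1 := hkf w (openSegment_subset_segment _ _ _ hwab)
      rw [(hseg w hw hwb).2] at h1
      refine hf.2.2.2.2.2 ?_ hw h1
      rcases hkab with ⟨r1, r2⟩ | ⟨r1, r2⟩ <;> subst r1 r2
      · exact hk.mem_openSegment.2 hwab
      · rw [openSegment_symm]; exact hk.mem_openSegment.2 hwab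
    have hkm := hk1 m hmo (Metric.mem_ball_self hρ0) hmo'
    -- the directions agree
    have hkab' : b - a = u - l ∨ b - a = -(u - l) :=
      hf.hasHolonomy.unique (hee ▸ hg.saddle.hasHolonomy)
    -- The half-disc is on the left both of the side and of the edge, so their directions are not
    -- opposite.
    have hba : b - a = u - l := by
      refine hkab'.resolve_right fun h => ?_
      have := hpos _ hI
      rw [h] at this
      have e : cr (-(u - l)) (Complex.I * (u - l)) = - cr (u - l) (Complex.I * (u - l)) := by
        simp [cr]; ring
      rw [e] at this
      linarith
    have hk2 : k = fun w => w := by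
      rcases hk.sub_eq with h | h
      · ext w
        have := h w m
        rw [hkm] at this
        linear_combination this
      · -- the half-turn would fold the edge
        exfalso
        obtain ⟨t, ht0, ht1, hmt⟩ := mem_openSegment_iff'.1 hmo'
        have hc : Tendsto (fun t : ℝ => m + (t : ℂ) * (u - l)) (𝓝[>] 0) (𝓝 m) := by
          have : Continuous (fun t : ℝ => m + (t : ℂ) * (u - l)) := by fun_prop
          simpa using (this.tendsto 0).mono_left nhdsWithin_le_nhds
        have ev1 := hc.eventually (Metric.ball_mem_nhds m hρ0)
        have ev2 : ∀ᶠ s : ℝ in 𝓝[>] 0, s < min (1 / 2) (1 - t) :=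
          nhdsWithin_le_nhds (gt_mem_nhds (lt_min (by norm_num) (by linarith)))
        obtain ⟨s, hs1, hs2, hs3⟩ := (ev1.and (ev2.and self_mem_nhdsWithin)).exists
        have hs3 : 0 < s := hs3
        have hs4 := lt_of_lt_of_le hs2 (min_le_left _ _)
        have hs5 := lt_of_lt_of_le hs2 (min_le_right _ _)
        have e1 := hk1 (m + (s : ℂ) * (u - l)) (mem_openSegment_iff'.2
          ⟨1 / 2 + s, by linarith, by linarith, by rw [hm]; push_cast; ring⟩) hs1
          (mem_openSegment_iff'.2 ⟨t + s, by linarith, by linarith, by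
            rw [hmt, hba]; push_cast; ring⟩)
        have e2 := h (m + (s : ℂ) * (u - l)) m
        rw [e1, hkm] at e2
        have e3 : (s : ℂ) * (u - l) = 0 := by linear_combination e2 / 2
        rcases mul_eq_zero.1 e3 with h0 | h0
        · exact hs3.ne' (by exact_mod_cast h0)
        · exact hul h0
    subst hk2
    have hal : a = l ∧ b = u := by
      rcases hkab with h | ⟨h1, h2⟩
      · exact h
      · exfalso
        simp only at h1 h2
        rw [h1, h2] at hba
        exact hul (by linear_combination (-1 / 2) * hba)
    obtain ⟨rfl, rfl⟩ := hal
    exact ⟨c, hg, fun w hw => (hkf w hw).symm⟩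
  refine ⟨g, ?_⟩
  rcases mem_sides hg.pos hmT hmn with hs | hs | hs
  · exact main a b c hg (fun w hw => (hgF w hw).1) hs
  · exact main b c a hg.cyc (fun w hw => by rw [openTriangle_cyc]; exact (hgF w hw).1) hs
  · exact main c a b hg.cyc.cyc
      (fun w hw => by rw [openTriangle_cyc, openTriangle_cyc]; exact (hgF w hw).1) hs

end StraightTriangulation

end VeeringLattice

/-! ### Rays from cone points, and the face that contains the germ of a separatrix -/

namespace VeeringLattice

open Set Filter

variable {S : Type*} [TopologicalSpace S] {q : HalfTranslationSurface S}

/-- In the coordinate at a cone point, a flat ray from that point satisfies `ψ ^ k = w ^ 2`. -/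
theorem cone_coordinate_ray {f : ℂ → S} {v z : ℂ} (hv : v ≠ 0)
    (hc : ContinuousOn f (segment ℝ z (z + v))) (hf : IsFlatOn q f (openSegment ℝ z (z + v)))
    {k : ℕ} (hk : 1 ≤ k) {ψ : OpenPartialHomeomorph S ℂ} (hψZ : ψ.source ∩ q.Z = {f z})
    (hψ0 : ψ (f z) = 0)
    (hψ : ∀ x ∈ ψ.source, x ≠ f z → ∀ φ ∈ q.charts, x ∈ φ.source →
      ∃ c : ℂ, ∀ᶠ y in 𝓝 x, (φ y - c) ^ 2 = (ψ y) ^ k) :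
    ∀ᶠ t : ℝ in 𝓝[>] 0, (ψ (f (z + t * v))) ^ k = (t * v) ^ 2 := by
  have hz : f z ∈ ψ.source ∩ q.Z := by rw [hψZ]; rfl
  have hmem : ∀ t : ℝ, 0 < t → t < 1 → z + t * v ∈ openSegment ℝ z (z + v) := fun t h0 h1 =>
    mem_openSegment_iff'.2 ⟨t, h0, h1, by ring⟩
  have hlim : Tendsto (fun t : ℝ => z + t * v) (𝓝[>] 0) (𝓝 z) := by
    have : Continuous (fun t : ℝ => z + t * v) := by fun_prop
    simpa using (this.tendsto 0).mono_left nhdsWithin_le_nhds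
  have hlt1 : ∀ᶠ t : ℝ in 𝓝[>] 0, t < 1 := nhdsWithin_le_nhds (gt_mem_nhds one_pos)
  have hlimf : Tendsto (fun t : ℝ => f (z + t * v)) (𝓝[>] 0) (𝓝 (f z)) := by
    refine (hc z (left_mem_segment _ _ _)).tendsto.comp (tendsto_nhdsWithin_iff.2 ⟨hlim, ?_⟩)
    filter_upwards [hlt1, self_mem_nhdsWithin] with t h1 h0
    exact openSegment_subset_segment _ _ _ (hmem t h0 h1)
  have hsrc := hlimf.eventually (ψ.open_source.mem_nhds hz.1)
  obtain ⟨ε, hε, hεs⟩ : ∃ ε > 0, ∀ t : ℝ, 0 < t → t < ε → t < 1 ∧ f (z + t * v) ∈ ψ.source := by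
    obtain ⟨ε, hε, h⟩ := mem_nhdsGT_iff_exists_Ioo_subset.1 (hlt1.and hsrc)
    exact ⟨ε, hε, fun t h0 h1 => h ⟨h0, h1⟩⟩
  -- Near each parameter the cone coordinate and a flat chart give the relation with `t * v - c` for
  -- some constant `c`, which may depend on the place.
  have hloc : ∀ t₀ : Ioo (0 : ℝ) ε, ∃ c : ℂ, ∀ᶠ t : ℝ in 𝓝 (t₀ : ℝ),
      (ψ (f (z + t * v))) ^ k = (t * v - c) ^ 2 := by
    rintro ⟨t₀, ht0, ht1⟩
    obtain ⟨h1, hs⟩ := hεs t₀ ht0 ht1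
    have hmo := hmem t₀ ht0 h1
    have hnz : f (z + t₀ * v) ≠ f z := fun h => hf.notMem hmo (h ▸ hz.2)
    obtain ⟨φ, hφ, g, hg, hps, hev⟩ := hf _ hmo
    obtain ⟨c, hc'⟩ := hψ _ hs hnz φ hφ hps
    have hcont : Tendsto (fun t : ℝ => z + t * v) (𝓝 t₀)
        (𝓝[openSegment ℝ z (z + v)] (z + t₀ * v)) := by
      refine tendsto_nhdsWithin_iff.2 ⟨?_, ?_⟩
      · have : Continuous (fun t : ℝ => z + t * v) := by fun_prop
        exact this.tendsto t₀
      · filter_upwards [lt_mem_nhds ht0, gt_mem_nhds h1] with t k0 k1 using hmem t k0 k1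
    have hc2 := hcont.eventually hev
    have hc3 := hcont.eventually ((hf.continuousWithinAt hmo).eventually hc')
    obtain ⟨d, hd | hd⟩ := hg
    · refine ⟨c - d - z, ?_⟩
      filter_upwards [hc2, hc3] with t k2 k3
      rw [← k3, k2.2, hd]; ring
    · refine ⟨d - c - z, ?_⟩
      filter_upwards [hc2, hc3] with t k2 k3
      rw [← k3, k2.2, hd]; ring
  choose c hcc using hloc
  -- Two different constants valid near the same parameter would force `2 * (s * v)` to be constant
  -- for `s` in an interval.
  have hconst : IsLocallyConstant c := by
    rw [IsLocallyConstant.iff_eventually_eq]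
    intro t₀
    have h1 : ∀ᶠ t : Ioo (0 : ℝ) ε in 𝓝 t₀, ∀ᶠ s : ℝ in 𝓝 (t : ℝ),
        (ψ (f (z + s * v))) ^ k = (s * v - c t₀) ^ 2 :=
      continuous_subtype_val.continuousAt.eventually (eventually_eventually_nhds.2 (hcc t₀))
    filter_upwards [h1] with t ht
    by_contra hne
    have h2 : ∀ᶠ s : ℝ in 𝓝 (t : ℝ), 2 * (s * v) = c t₀ + c t := by
      filter_upwards [ht, hcc t] with s k1 k2
      have : (c t - c t₀) * (2 * (s * v) - (c t₀ + c t)) = 0 := by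
        linear_combination k2 - k1
      rcases mul_eq_zero.1 this with h | h
      · exact absurd (sub_eq_zero.1 h) hne
      · exact sub_eq_zero.1 h
    have h3 : ∃ᶠ s : ℝ in 𝓝 (t : ℝ), s ≠ t := by
      have : (𝓝[≠] (t : ℝ)).NeBot := inferInstance
      exact (eventually_nhdsWithin_of_forall (s := {(t : ℝ)}ᶜ) fun s hs => hs).frequently.filter_mono
        nhdsWithin_le_nhds
    obtain ⟨s, hs, hs2⟩ := (h3.and_eventually h2).exists
    have h4 := h2.self_of_nhds
    rw [← h4] at hs2
    have h5 := mul_right_cancel₀ hv (mul_left_cancel₀ two_ne_zero hs2)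
    exact hs (by exact_mod_cast h5)
  have : PreconnectedSpace (Ioo (0 : ℝ) ε) := Subtype.preconnectedSpace isPreconnected_Ioo
  set t₁ : Ioo (0 : ℝ) ε := ⟨ε / 2, by constructor <;> linarith⟩
  have hall : ∀ᶠ t : ℝ in 𝓝[>] 0, (ψ (f (z + t * v))) ^ k = (t * v - c t₁) ^ 2 := by
    filter_upwards [nhdsWithin_le_nhds (gt_mem_nhds hε), self_mem_nhdsWithin] with t h1 h0
    rw [hconst.apply_eq_of_preconnectedSpace t₁ ⟨t, h0, h1⟩]
    exact (hcc ⟨t, h0, h1⟩).self_of_nhds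
  -- Towards the cone point the left side tends to `0`, as `k ≥ 1`, and the right side to the square
  -- of the constant.
  have hc0 : c t₁ = 0 := by
    have l1 : Tendsto (fun t : ℝ => (ψ (f (z + t * v))) ^ k) (𝓝[>] 0) (𝓝 0) := by
      have := ((ψ.continuousAt hz.1).tendsto.comp hlimf).pow k
      rw [hψ0, zero_pow (by omega)] at this
      exact this
    have l2 : Tendsto (fun t : ℝ => (t * v - c t₁) ^ 2) (𝓝[>] 0) (𝓝 ((c t₁) ^ 2)) := by
      have : Continuous (fun t : ℝ => (t * v - c t₁) ^ 2) := by fun_prop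
      simpa using (this.tendsto 0).mono_left nhdsWithin_le_nhds
    have := tendsto_nhds_unique_of_eventuallyEq l1 l2 hall
    exact pow_eq_zero_iff (two_ne_zero) |>.1 this.symm
  rw [hc0] at hall
  simpa using hall

/-- A flat ray that meets a saddle connection arbitrarily close to its starting point is parallel to
it. -/
theorem eventually_notMem_edge [T2Space S] {f : ℂ → S} {v z : ℂ} (hv : v ≠ 0)
    (hc : ContinuousOn f (segment ℝ z (z + v))) (hf : IsFlatOn q f (openSegment ℝ z (z + v)))
    (hz : f z ∈ q.Z) {e : Set S} {u : ℂ} (he : HasHolonomy q e u) (huv : cr u v ≠ 0) :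
    ∀ᶠ t : ℝ in 𝓝[>] 0, f (z + t * v) ∉ e := by
  by_contra hne
  obtain ⟨k, hk, ψ, hψZ, hψ0, hψ⟩ := q.cone (f z) hz
  have hray := cone_coordinate_ray hv hc hf hk hψZ hψ0 hψ
  have hfr : ∃ᶠ t : ℝ in 𝓝[>] 0, f (z + t * v) ∈ e ∧ (t < 1 ∧ 0 < t ∧
      (ψ (f (z + t * v))) ^ k = (t * v) ^ 2) := by
    refine (not_eventually.1 hne).mp ?_
    filter_upwards [nhdsWithin_le_nhds (gt_mem_nhds one_pos), self_mem_nhdsWithin, hray]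
      with t h1 h2 h3 h4 using ⟨by simpa using h4, h1, h2, h3⟩
  obtain ⟨f', a, b, h', rfl, rfl⟩ := he
  -- Meeting points with parameters tending to `0` have, by compactness of the edge, a subsequence
  -- that converges along it; the limit is a marked point, hence an end of the edge.
  obtain ⟨t, htlim, ht⟩ := exists_seq_forall_of_frequently hfr
  choose p hp hpt using fun n => (ht n).1
  have hcomp : IsCompact (segment ℝ a b) := by
    rw [segment_eq_image_lineMap]
    exact isCompact_Icc.image (AffineMap.lineMap_continuous)
  obtain ⟨p₀, hp₀, σ, hσ, hlim⟩ := hcomp.tendsto_subseq hp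
  have htl : Tendsto (fun n => t (σ n)) atTop (𝓝[>] 0) := htlim.comp hσ.tendsto_atTop
  have hzt : Tendsto (fun n => f (z + t (σ n) * v)) atTop (𝓝 (f z)) := by
    refine (hc z (left_mem_segment _ _ _)).tendsto.comp (tendsto_nhdsWithin_iff.2 ⟨?_, ?_⟩)
    · have : Continuous (fun t : ℝ => z + t * v) := by fun_prop
      have h2 := (this.tendsto 0).comp (htl.mono_right nhdsWithin_le_nhds)
      simpa [Function.comp_def] using h2
    · exact Eventually.of_forall fun n => mem_segment_iff'.2
        ⟨t (σ n), (ht (σ n)).2.2.1.le, (ht (σ n)).2.1.le, by ring⟩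
  have hpz : f' p₀ = f z := by
    have l1 : Tendsto (fun n => f' (p (σ n))) atTop (𝓝 (f' p₀)) :=
      (h'.2.1 p₀ hp₀).tendsto.comp (tendsto_nhdsWithin_iff.2
        ⟨hlim, Eventually.of_forall fun n => hp (σ n)⟩)
    refine tendsto_nhds_unique_of_eventuallyEq l1 hzt ?_
    exact Eventually.of_forall fun n => hpt (σ n)
  have main : ∀ a b : ℂ, IsSaddleParam q f' a b → cr (b - a) v ≠ 0 →
      (∀ n, p n ∈ segment ℝ a b) → p₀ = a → False := by
    intro a b h' huv hp hpa
    subst hpa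
    have hba : b - p₀ ≠ 0 := sub_ne_zero.2 h'.1.symm
    have hb : p₀ + (b - p₀) = b := by ring
    have hray' := cone_coordinate_ray (f := f') hba (by rw [hb]; exact h'.2.1)
      (by rw [hb]; exact h'.flat) hk (by rw [hpz]; exact hψZ) (by rw [hpz]; exact hψ0)
      (by rw [hpz]; exact hψ)
    choose s hs0 hs1 hsp using fun n => mem_segment_iff'.1 (hp n)
    have hdt := dt_self_pos hba
    have hs_eq : ∀ n, s n = dt (b - p₀) (p n - p₀) / dt (b - p₀) (b - p₀) := fun n => by
      rw [eq_div_iff hdt.ne', hsp n]; simp [dt]; ring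
    have hspos : ∀ n, 0 < s n := fun n => by
      refine lt_of_le_of_ne (hs0 n) fun h0 => ?_
      have h1 := hsp n
      rw [← h0] at h1
      have h2 : p n = p₀ := by rw [h1]; simp
      have h3 := hpt n
      rw [h2, hpz] at h3
      refine hf.notMem (mem_openSegment_iff'.2 ⟨t n, (ht n).2.2.1, (ht n).2.1, ?_⟩) (h3 ▸ hz)
      ring
    have hsl : Tendsto (fun n => s (σ n)) atTop (𝓝[>] 0) := by
      refine tendsto_nhdsWithin_iff.2 ⟨?_, Eventually.of_forall fun n => hspos _⟩
      have hcont : Continuous fun w => dt (b - p₀) (w - p₀) / dt (b - p₀) (b - p₀) :=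
        ((continuous_dt_right _).comp (continuous_id.sub continuous_const)).div_const _
      have := (hcont.tendsto p₀).comp hlim
      simp only [hs_eq]
      simpa [dt, Function.comp_def] using this
    obtain ⟨n, hn⟩ := (hsl.eventually hray').exists
    have e1 := (ht (σ n)).2.2.2
    rw [← hsp (σ n), hpt (σ n), e1] at hn
    -- Both rays satisfy the relation of `cone_coordinate_ray` in the same cone coordinate, so at a
    -- common point `t * v` and `s * (b - p₀)` have the same square and are parallel.
    have e2 : ((t (σ n) : ℂ) * v - s (σ n) * (b - p₀)) * (t (σ n) * v + s (σ n) * (b - p₀)) = 0 := by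
      linear_combination hn
    have ht0 := (ht (σ n)).2.2.1
    have e3 : t (σ n) * cr (b - p₀) v = 0 := by
      rw [← cr_smul_right]
      rcases mul_eq_zero.1 e2 with h | h
      · rw [sub_eq_zero.1 h, cr_smul_right]; simp [cr]; right; ring
      · rw [eq_neg_of_add_eq_zero_left h]
        have : -((s (σ n) : ℂ) * (b - p₀)) = ((-s (σ n) : ℝ) : ℂ) * (b - p₀) := by push_cast; ring
        rw [this, cr_smul_right]; simp [cr]; right; ring
    exact huv ((mul_eq_zero.1 e3).resolve_left ht0.ne')
  have hpZ : f' p₀ ∈ q.Z := hpz ▸ hz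
  rw [segment_eq_union] at hp₀
  rcases hp₀ with h | h | h
  · exact h'.flat.notMem h hpZ
  · exact main a b h' huv hp h
  · refine main b a h'.symm ?_ (fun n => by rw [segment_symm]; exact hp n) h
    have : cr (a - b) v = - cr (b - a) v := by simp [cr]; ring
    rw [this]; exact neg_ne_zero.2 huv

namespace LaysOutAt

variable {τ : StraightTriangulation q} {β : VerticalSeparatrix q} {f f' : ℂ → S} {b c b' c' : ℂ}

theorem laysOut (h : LaysOutAt τ β f b c) : τ.LaysOut f 0 b c := h.1

theorem pos (h : LaysOutAt τ β f b c) : 0 < cr b c := by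
  have := h.1.pos; simpa using this

theorem eventually (h : LaysOutAt τ β f b c) : ∀ᶠ t : ℝ in 𝓝[>] 0,
    (t : ℂ) * Complex.I ∈ openTriangle 0 b c ∧ f ((t : ℂ) * Complex.I) = β.map (t * Complex.I) := by
  obtain ⟨-, δ, hδ, h⟩ := h
  filter_upwards [nhdsWithin_le_nhds (gt_mem_nhds hδ), self_mem_nhdsWithin] with t h1 h0
  exact h t h0 h1

theorem of_eventually (h : τ.LaysOut f 0 b c) (hev : ∀ᶠ t : ℝ in 𝓝[>] 0,
    (t : ℂ) * Complex.I ∈ openTriangle 0 b c ∧ f ((t : ℂ) * Complex.I) = β.map (t * Complex.I)) :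
    LaysOutAt τ β f b c := by
  obtain ⟨δ, hδ, hs⟩ := mem_nhdsGT_iff_exists_Ioo_subset.1 hev
  exact ⟨h, δ, hδ, fun t h0 h1 => hs ⟨h0, h1⟩⟩

theorem re_pos (h : LaysOutAt τ β f b c) : 0 < b.re ∧ c.re < 0 := by
  obtain ⟨t, ⟨ht, -⟩, ht0⟩ := (h.eventually.and self_mem_nhdsWithin).exists
  have ht0 : 0 < t := ht0
  obtain ⟨h1, -, h3⟩ := (mem_openTriangle h.1.pos).1 ht
  simp [cr] at h1 h3
  constructor
  · exact pos_of_mul_pos_left h1 ht0.le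
  · nlinarith

variable [T2Space S]

/-- Both layouts extend `β`, so the half-translation between them fixes two points of the vertical
ray and is the identity. Thus the existential in `wedge` ranges over a single triangle. -/
theorem unique (h : LaysOutAt τ β f b c) (h' : LaysOutAt τ β f' b' c') :
    b' = b ∧ c' = c ∧ EqOn f' f (closedTriangle 0 b c) := by
  obtain ⟨δ, hδ, hs⟩ := mem_nhdsGT_iff_exists_Ioo_subset.1 (h.eventually.and h'.eventually)
  have h1 := hs ⟨show 0 < δ / 2 by have : 0 < δ := hδ; positivity, show δ / 2 < δ by
    have : 0 < δ := hδ; linarith⟩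
  have h2 := hs ⟨show 0 < δ / 3 by have : 0 < δ := hδ; positivity, show δ / 3 < δ by
    have : 0 < δ := hδ; linarith⟩
  have hδ : 0 < δ := hδ
  have hT : f' '' openTriangle 0 b' c' = f '' openTriangle 0 b c := by
    by_contra hne
    exact (τ.face_face _ h'.1.2.1 _ h.1.2.1 hne).le_bot
      ⟨mem_image_of_mem _ h1.2.1, by rw [h1.2.2, ← h1.1.2]; exact mem_image_of_mem _ h1.1.1⟩
  obtain ⟨k, hk, heq, hmap, hcase⟩ := h.1.unique h'.1.1 hT
  have hfix : ∀ t : ℝ, ((t : ℂ) * Complex.I ∈ openTriangle 0 b c ∧ f (t * Complex.I) =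
      β.map (t * Complex.I)) ∧ ((t : ℂ) * Complex.I ∈ openTriangle 0 b' c' ∧
      f' (t * Complex.I) = β.map (t * Complex.I)) → k (t * Complex.I) = t * Complex.I := by
    rintro t ⟨⟨k1, k2⟩, k3, k4⟩
    refine h.1.1.2.2.2.2.2.2 (hmap _ k3) k1 ?_
    rw [heq _ (openTriangle_subset _ _ _ k3), k4, k2]
  have e1 := hfix _ h1
  have e2 := hfix _ h2
  have hk0 : k = fun w => w := hk.eq_of_eq_of_eq IsHalfTranslation.id (fun h => by
    have h3 := mul_right_cancel₀ Complex.I_ne_zero h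
    have : δ / 2 = δ / 3 := by exact_mod_cast h3
    linarith) e1 e2
  subst hk0
  rcases hcase with ⟨-, rfl, rfl⟩ | ⟨r, -⟩ | ⟨r, -⟩
  · exact ⟨rfl, rfl, fun w hw => (heq w hw).symm⟩
  · exact absurd r h.1.1.ne
  · exact absurd r h.1.1.cyc.cyc.ne.symm

theorem mem_wedge (h : LaysOutAt τ β f b c) {w : ℂ} :
    w ∈ wedge β τ ↔ 0 ≤ cr b w ∧ 0 ≤ cr w c := by
  have hpos := h.pos
  constructor
  · rintro ⟨f', b', c', h', s, t, hs, ht, rfl⟩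
    obtain ⟨rfl, rfl, -⟩ := h.unique h'
    have e1 : cr b' (s * b' + t * c') = t * cr b' c' := by simp [cr]; ring
    have e2 : cr (s * b' + t * c') c' = s * cr b' c' := by simp [cr]; ring
    rw [e1, e2]
    constructor <;> positivity
  · rintro ⟨h1, h2⟩
    refine ⟨f, b, c, h, cr w c / cr b c, cr b w / cr b c, by positivity, by positivity, ?_⟩
    have hne : (cr b c : ℂ) ≠ 0 := by exact_mod_cast hpos.ne'
    push_cast
    field_simp
    apply Complex.ext <;> simp [cr] <;> ring

end LaysOutAt

variable [T2Space S]

/-- Every vertical separatrix starts in some face, if no edge is vertical. -/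
theorem exists_laysOutAt (τ : StraightTriangulation q) (β : VerticalSeparatrix q)
    (hτ : ∀ e ∈ τ.edges, ∀ v, HasHolonomy q e v → v.re ≠ 0) :
    ∃ f b c, LaysOutAt τ β f b c := by
  set v : ℂ := (β.len : ℂ) * Complex.I with hvdef
  have hlen := β.len_pos
  have hv : v ≠ 0 := mul_ne_zero (by exact_mod_cast hlen.ne') Complex.I_ne_zero
  have hc : ContinuousOn β.map (segment ℝ 0 (0 + v)) := by rw [zero_add]; exact β.continuousOn
  have hf : IsFlatOn q β.map (openSegment ℝ 0 (0 + v)) := by rw [zero_add]; exact β.flat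
  -- As no edge is vertical, the ray avoids each of the finitely many edges near its start.
  have hev : ∀ᶠ t : ℝ in 𝓝[>] 0, ∀ e ∈ τ.edges, β.map (0 + t * v) ∉ e := by
    rw [eventually_all_finite τ.edges_finite]
    intro e he
    obtain ⟨u, hu⟩ := τ.edge_saddle e he
    refine eventually_notMem_edge hv hc hf β.start_mem hu ?_
    have : cr u v = u.re * β.len := by simp [cr, hvdef]
    rw [this]
    exact mul_ne_zero (hτ e he u hu) hlen.ne'
  obtain ⟨δ, hδ, hs⟩ := mem_nhdsGT_iff_exists_Ioo_subset.1
    (hev.and (nhdsWithin_le_nhds (gt_mem_nhds one_pos)))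
  have hδ : 0 < δ := hδ
  set U : Set ℂ := openSegment ℝ 0 ((δ : ℂ) * v) with hU
  have hδv : (0 : ℂ) ≠ δ * v := (mul_ne_zero (by exact_mod_cast hδ.ne') hv).symm
  have hUt : ∀ w ∈ U, ∃ t : ℝ, 0 < t ∧ t < δ ∧ w = t * v := by
    intro w hw
    obtain ⟨s, h0, h1, rfl⟩ := mem_openSegment_iff'.1 hw
    exact ⟨s * δ, by positivity, by nlinarith, by push_cast; ring⟩
  have hUsub : U ⊆ openSegment ℝ 0 (0 + v) := by
    intro w hw
    obtain ⟨t, h0, h1, rfl⟩ := hUt w hw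
    exact mem_openSegment_iff'.2 ⟨t, h0, (hs ⟨h0, h1⟩).2, by ring⟩
  have hUe : ∀ w ∈ U, ∀ e ∈ τ.edges, β.map w ∉ e := by
    intro w hw e he
    obtain ⟨t, h0, h1, rfl⟩ := hUt w hw
    have := (hs ⟨h0, h1⟩).1 e he
    rwa [zero_add] at this
  have hfU := hf.mono hUsub
  obtain ⟨p, hp⟩ := (openSegment_nontrivial hδv).nonempty
  obtain ⟨T, hT, hpT⟩ : ∃ T ∈ τ.faces, β.map p ∈ T := by
    rcases τ.cover (β.map p) with h | ⟨e, he', h⟩ | h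
    · exact absurd h (hfU.notMem hp)
    · exact absurd h (hUe _ hp e he')
    · exact h
  obtain ⟨g, a, b, c, hg, rfl⟩ := τ.exists_laysOut hT
  obtain ⟨h, hh, hlift⟩ := hg.1.exists_lift hfU (convex_openSegment _ _).isPreconnected
    (openSegment_nontrivial hδv) (fun x hx hxn w hw hfw => by
      obtain ⟨e, he', hxe⟩ := hg.boundary hx hxn
      exact hUe w hw e he' (hfw ▸ hxe)) hp hpT
  have h0cl : (0 : ℂ) ∈ closure U := by rw [closure_openSegment]; exact left_mem_segment _ _ _
  have h0T : h 0 ∈ closedTriangle a b c := by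
    have h1 : MapsTo h U (closedTriangle a b c) := fun w hw =>
      openTriangle_subset _ _ _ (hlift w hw).1
    have h2 := h1.closure hh.continuous
    rw [(isClosed_closedTriangle a b c).closure_eq] at h2
    exact h2 h0cl
  have hg0 : g (h 0) = β.map 0 := by
    have hne : NeBot (𝓝[U] (0 : ℂ)) := mem_closure_iff_nhdsWithin_neBot.1 h0cl
    have t1 : Tendsto (fun w => g (h w)) (𝓝[U] 0) (𝓝 (g (h 0))) := by
      refine (hg.1.2.1 _ h0T).tendsto.comp (tendsto_nhdsWithin_iff.2
        ⟨(hh.continuous.tendsto 0).mono_left nhdsWithin_le_nhds, ?_⟩)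
      filter_upwards [self_mem_nhdsWithin] with w hw using openTriangle_subset _ _ _ (hlift w hw).1
    have t2 : Tendsto β.map (𝓝[U] 0) (𝓝 (β.map 0)) := by
      refine (hc 0 (left_mem_segment _ _ _)).tendsto.mono_left (nhdsWithin_mono _ fun w hw => ?_)
      exact openSegment_subset_segment _ _ _ (hUsub hw)
    refine tendsto_nhds_unique_of_eventuallyEq t1 t2 ?_
    filter_upwards [self_mem_nhdsWithin] with w hw using (hlift w hw).2
  -- The ray starts at a marked point, so its lift starts at a vertex of the face; a cyclic
  -- relabelling makes this the first one.
  have hvert := hg.1.mem_vertices h0T (by rw [hg0]; exact β.start_mem)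
  have main : ∀ a b c : ℂ, τ.LaysOut g a b c → (∀ w ∈ U, h w ∈ openTriangle a b c) → h 0 = a →
      ∃ f b c, LaysOutAt τ β f b c := by
    intro a b c hg ho h0
    obtain ⟨h', hh', hl, hr⟩ := hh.exists_inv
    have hlay := hg.comp hh (a' := 0) (b' := h' b) (c' := h' c) h0 (hr b) (hr c)
    refine ⟨_, _, _, LaysOutAt.of_eventually hlay ?_⟩
    filter_upwards [nhdsWithin_le_nhds (gt_mem_nhds (mul_pos hδ hlen)), self_mem_nhdsWithin]
      with t h1 h0'
    have h0' : 0 < t := h0'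
    have hw : (t : ℂ) * Complex.I ∈ U := mem_openSegment_iff'.2 ⟨t / (δ * β.len), by positivity,
      (div_lt_one (by positivity)).2 h1, by
        have h1 : (β.len : ℂ) ≠ 0 := by exact_mod_cast hlen.ne'
        have h2 : (δ : ℂ) ≠ 0 := by exact_mod_cast hδ.ne'
        rw [hvdef]; push_cast; field_simp; ring⟩
    refine ⟨?_, (hlift _ hw).2⟩
    rw [← hh.mem_openTriangle hlay.pos, h0, hr, hr]
    exact ho _ hw
  rcases hvert with h0 | h0 | h0
  · exact main a b c hg (fun w hw => (hlift w hw).1) h0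
  · exact main b c a hg.cyc (fun w hw => by rw [openTriangle_cyc]; exact (hlift w hw).1) h0
  · exact main c a b hg.cyc.cyc
      (fun w hw => by rw [openTriangle_cyc, openTriangle_cyc]; exact (hlift w hw).1) h0

end VeeringLattice

/-! ### Colours in terms of holonomy, and the surface turned by a quarter turn -/

namespace VeeringLattice

open Set Filter

variable {S : Type*} [TopologicalSpace S] {q : HalfTranslationSurface S}

section Colours

variable [T2Space S] {e : Set S} {v : ℂ}

/-- The product of the coordinates has the sign of the slope, does not see the sign ambiguity of the
holonomy, and is `0` for vertical and horizontal vectors. -/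
theorem HasHolonomy.isRed_iff (h : HasHolonomy q e v) : IsRed q e ↔ 0 < v.re * v.im := by
  have hd : ∀ x y : ℝ, 0 < x / y ↔ 0 < y * x := fun x y => by rw [div_pos_iff, mul_pos_iff]; tauto
  constructor
  · rintro ⟨v', hv', hpos⟩
    rw [hd] at hpos
    rcases h.unique hv' with rfl | rfl
    · exact hpos
    · simpa using hpos
  · exact fun hp => ⟨v, h, (hd _ _).2 hp⟩

theorem HasHolonomy.isBlue_iff (h : HasHolonomy q e v) : IsBlue q e ↔ v.re * v.im < 0 := by
  have hd : ∀ x y : ℝ, x / y < 0 ↔ y * x < 0 := fun x y => by rw [div_neg_iff, mul_neg_iff]; tauto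
  constructor
  · rintro ⟨v', hv', hpos⟩
    rw [hd] at hpos
    rcases h.unique hv' with rfl | rfl
    · exact hpos
    · simpa using hpos
  · exact fun hp => ⟨v, h, (hd _ _).2 hp⟩

theorem VeeringTriangulation.re_im_ne (τ : VeeringTriangulation q) (he : e ∈ τ.edges)
    (hv : HasHolonomy q e v) : v.re ≠ 0 ∧ v.im ≠ 0 := by
  rcases τ.coloured e he with h | h
  · have := hv.isRed_iff.1 h
    constructor <;> (intro h0; rw [h0] at this; simp at this)
  · have := hv.isBlue_iff.1 h
    constructor <;> (intro h0; rw [h0] at this; simp at this)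

end Colours

section Rotation

/-- The surface rotated by a quarter turn. -/
noncomputable def HalfTranslationSurface.rot (q : HalfTranslationSurface S) :
    HalfTranslationSurface S where
  Z := q.Z
  Z_finite := q.Z_finite
  Z_nonempty := q.Z_nonempty
  charts := (fun φ => φ.transHomeomorph (Homeomorph.mulLeft₀ Complex.I Complex.I_ne_zero)) '' q.charts
  charts_source := by
    rintro _ ⟨φ, hφ, rfl⟩
    exact q.charts_source φ hφ
  charts_cover := fun x hx => by
    obtain ⟨φ, hφ, h⟩ := q.charts_cover x hx
    exact ⟨_, ⟨φ, hφ, rfl⟩, h⟩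
  transition := by
    rintro _ ⟨φ, hφ, rfl⟩ _ ⟨ψ, hψ, rfl⟩ x hx hx'
    obtain ⟨g, ⟨c, hc⟩, hev⟩ := q.transition φ hφ ψ hψ x hx hx'
    rcases hc with hc | hc
    · refine ⟨_, IsHalfTranslation.add (Complex.I * c), hev.mono fun y hy => ?_⟩
      simp [hy, hc]; ring
    · refine ⟨_, IsHalfTranslation.neg_add (Complex.I * c), hev.mono fun y hy => ?_⟩
      simp [hy, hc]; ring
  cone := fun z hz => by
    obtain ⟨k, hk, ψ, h1, h2, h3⟩ := q.cone z hz
    -- The charts are multiplied by `I`, so their squares change sign; the cone coordinate has to be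
    -- multiplied by a `k`-th root of `-1`.
    obtain ⟨ζ, hζ⟩ := IsAlgClosed.exists_pow_nat_eq (-1 : ℂ) (n := k) (by omega)
    have hζ0 : ζ ≠ 0 := by
      rintro rfl
      rw [zero_pow (by omega)] at hζ
      norm_num at hζ
    refine ⟨k, hk, ψ.transHomeomorph (Homeomorph.mulLeft₀ ζ hζ0), h1, by simp [h2], ?_⟩
    rintro x hx hxz _ ⟨φ, hφ, rfl⟩ hxφ
    obtain ⟨c, hc⟩ := h3 x hx hxz φ hφ hxφ
    refine ⟨Complex.I * c, hc.mono fun y hy => ?_⟩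
    simp only [OpenPartialHomeomorph.transHomeomorph_apply, Function.comp_apply,
      Homeomorph.coe_mulLeft₀]
    rw [mul_pow, hζ, ← hy, ← mul_sub, mul_pow, Complex.I_sq]

theorem I_mul_neg_I_mul (w : ℂ) : Complex.I * (-Complex.I * w) = w := by
  rw [← mul_assoc]; simp

theorem neg_I_mul_I_mul (w : ℂ) : -Complex.I * (Complex.I * w) = w := by
  rw [← mul_assoc]; simp

theorem I_mul_image_segment (a b : ℂ) :
    (fun w => Complex.I * w) '' segment ℝ a b = segment ℝ (Complex.I * a) (Complex.I * b) :=
  image_segment ℝ (LinearMap.mulLeft ℝ Complex.I).toAffineMap a b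

theorem I_mul_image_openSegment (a b : ℂ) : (fun w => Complex.I * w) '' openSegment ℝ a b =
    openSegment ℝ (Complex.I * a) (Complex.I * b) :=
  image_openSegment ℝ (LinearMap.mulLeft ℝ Complex.I).toAffineMap a b

theorem I_mul_image_closedTriangle (a b c : ℂ) : (fun w => Complex.I * w) '' closedTriangle a b c =
    closedTriangle (Complex.I * a) (Complex.I * b) (Complex.I * c) := by
  have := AffineMap.image_convexHull (LinearMap.mulLeft ℝ Complex.I).toAffineMap ({a, b, c} : Set ℂ)
  simp only [LinearMap.coe_toAffineMap, image_insert_eq, image_singleton] at this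
  exact this

theorem I_mul_image_openTriangle (a b c : ℂ) : (fun w => Complex.I * w) '' openTriangle a b c =
    openTriangle (Complex.I * a) (Complex.I * b) (Complex.I * c) := by
  unfold openTriangle
  rw [← I_mul_image_closedTriangle]
  exact (Homeomorph.mulLeft₀ Complex.I Complex.I_ne_zero).image_interior _

theorem I_mul_injective : Function.Injective fun w : ℂ => Complex.I * w :=
  mul_right_injective₀ Complex.I_ne_zero

theorem isFlatOn_rot {f : ℂ → S} {U : Set ℂ} :
    IsFlatOn q.rot f ((fun w => Complex.I * w) '' U) ↔ IsFlatOn q (fun w => f (Complex.I * w)) U := by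
  constructor
  · intro h p hp
    obtain ⟨_, ⟨φ, hφ, rfl⟩, g, ⟨c, hc⟩, hps, hev⟩ := h _ (mem_image_of_mem _ hp)
    have hlim : Tendsto (fun w => Complex.I * w) (𝓝[U] p)
        (𝓝[(fun w => Complex.I * w) '' U] (Complex.I * p)) := by
      refine ContinuousWithinAt.tendsto_nhdsWithin_image ?_
      exact (continuous_const.mul continuous_id).continuousWithinAt
    have hev2 := hlim.eventually hev
    rcases hc with hc | hc
    · refine ⟨φ, hφ, _, IsHalfTranslation.add (-Complex.I * c), hps, ?_⟩
      filter_upwards [hev2] with w hw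
      refine ⟨hw.1, ?_⟩
      have := hw.2
      rw [hc] at this
      simp at this
      linear_combination (-Complex.I) * this + (φ (f (Complex.I * w)) - w) * Complex.I_sq
    · refine ⟨φ, hφ, _, IsHalfTranslation.neg_add (-Complex.I * c), hps, ?_⟩
      filter_upwards [hev2] with w hw
      refine ⟨hw.1, ?_⟩
      have := hw.2
      rw [hc] at this
      simp at this
      linear_combination (-Complex.I) * this + (φ (f (Complex.I * w)) + w) * Complex.I_sq
  · rintro h _ ⟨p, hp, rfl⟩
    obtain ⟨φ, hφ, g, ⟨c, hc⟩, hps, hev⟩ := h _ hp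
    have hlim : Tendsto (fun w => -Complex.I * w) (𝓝[(fun w => Complex.I * w) '' U] (Complex.I * p))
        (𝓝[U] p) := by
      refine tendsto_nhdsWithin_iff.2 ⟨?_, ?_⟩
      · have : Continuous fun w : ℂ => -Complex.I * w := by fun_prop
        have h2 := (this.tendsto (Complex.I * p)).mono_left
          (nhdsWithin_le_nhds (s := (fun w => Complex.I * w) '' U))
        rwa [neg_I_mul_I_mul] at h2
      · filter_upwards [self_mem_nhdsWithin] with w hw
        obtain ⟨x, hx, rfl⟩ := hw
        simp only [neg_I_mul_I_mul]; exact hx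
    have hev2 := hlim.eventually hev
    refine ⟨_, ⟨φ, hφ, rfl⟩, ?_⟩
    rcases hc with hc | hc
    · refine ⟨_, IsHalfTranslation.add (Complex.I * c), hps, ?_⟩
      filter_upwards [hev2] with w hw
      rw [I_mul_neg_I_mul] at hw
      refine ⟨hw.1, ?_⟩
      simp only [OpenPartialHomeomorph.transHomeomorph_apply, Function.comp_apply,
        Homeomorph.coe_mulLeft₀]
      rw [hw.2, hc]
      linear_combination (-w) * Complex.I_sq
    · refine ⟨_, IsHalfTranslation.neg_add (Complex.I * c), hps, ?_⟩
      filter_upwards [hev2] with w hw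
      rw [I_mul_neg_I_mul] at hw
      refine ⟨hw.1, ?_⟩
      simp only [OpenPartialHomeomorph.transHomeomorph_apply, Function.comp_apply,
        Homeomorph.coe_mulLeft₀]
      rw [hw.2, hc]
      linear_combination (w) * Complex.I_sq

theorem continuousOn_I_mul {f : ℂ → S} {U : Set ℂ} :
    ContinuousOn f ((fun w => Complex.I * w) '' U) ↔ ContinuousOn (fun w => f (Complex.I * w)) U :=
  ((Homeomorph.mulLeft₀ Complex.I Complex.I_ne_zero).isOpenEmbedding.continuousOn_image_iff).trans Iff.rfl

theorem injOn_I_mul {X : Type*} {f : ℂ → X} {U : Set ℂ} :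
    InjOn f ((fun w => Complex.I * w) '' U) ↔ InjOn (fun w => f (Complex.I * w)) U :=
  ⟨fun h => h.comp I_mul_injective.injOn (mapsTo_image _ _), fun h => h.image_of_comp⟩

theorem image_I_mul {X : Type*} {f : ℂ → X} {U : Set ℂ} :
    f '' ((fun w => Complex.I * w) '' U) = (fun w => f (Complex.I * w)) '' U := image_image _ _ _

theorem isSaddleParam_rot {f : ℂ → S} {a b : ℂ} :
    IsSaddleParam q.rot f (Complex.I * a) (Complex.I * b) ↔
      IsSaddleParam q (fun w => f (Complex.I * w)) a b := by
  unfold IsSaddleParam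
  rw [← I_mul_image_segment, ← I_mul_image_openSegment, isFlatOn_rot, continuousOn_I_mul,
    injOn_I_mul, I_mul_injective.ne_iff]
  rfl

theorem hasHolonomy_rot {e : Set S} {v : ℂ} :
    HasHolonomy q.rot e (Complex.I * v) ↔ HasHolonomy q e v := by
  constructor
  · rintro ⟨f, a, b, h, rfl, hv⟩
    rw [← I_mul_neg_I_mul a, ← I_mul_neg_I_mul b] at h
    refine ⟨_, _, _, isSaddleParam_rot.1 h, ?_, ?_⟩
    · rw [← image_I_mul, I_mul_image_segment, I_mul_neg_I_mul, I_mul_neg_I_mul]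
    · rw [← neg_I_mul_I_mul v, hv]; ring
  · rintro ⟨f, a, b, h, rfl, rfl⟩
    refine ⟨fun w => f (-Complex.I * w), Complex.I * a, Complex.I * b, isSaddleParam_rot.2 ?_, ?_,
      by ring⟩
    · simpa only [neg_I_mul_I_mul] using h
    · rw [← I_mul_image_segment, image_image]; simp only [neg_I_mul_I_mul]

/-- Multiplication by `I` sends the slope `m` to `-1 / m`. -/
theorem isRed_rot {e : Set S} : IsRed q.rot e ↔ IsBlue q e := by
  have hd : ∀ x y : ℝ, 0 < x / (-y) ↔ y / x < 0 := fun x y => by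
    rw [div_neg, neg_pos, div_neg_iff, div_neg_iff]; tauto
  constructor
  · rintro ⟨v, hv, h⟩
    rw [← I_mul_neg_I_mul v] at hv
    exact ⟨_, hasHolonomy_rot.1 hv, by simp; rw [← hd]; simpa using h⟩
  · rintro ⟨v, hv, h⟩
    exact ⟨_, hasHolonomy_rot.2 hv, by simpa using (hd v.re v.im).2 h⟩

theorem isBlue_rot {e : Set S} : IsBlue q.rot e ↔ IsRed q e := by
  have hd : ∀ x y : ℝ, x / (-y) < 0 ↔ 0 < y / x := fun x y => by
    rw [div_neg, neg_lt_zero, div_pos_iff, div_pos_iff]; tauto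
  constructor
  · rintro ⟨v, hv, h⟩
    rw [← I_mul_neg_I_mul v] at hv
    exact ⟨_, hasHolonomy_rot.1 hv, by simp; rw [← hd]; simpa using h⟩
  · rintro ⟨v, hv, h⟩
    exact ⟨_, hasHolonomy_rot.2 hv, by simpa using (hd v.re v.im).2 h⟩

theorem isFlatTriangle_rot {f : ℂ → S} {a b c : ℂ} :
    IsFlatTriangle q.rot f (Complex.I * a) (Complex.I * b) (Complex.I * c) ↔
      IsFlatTriangle q (fun w => f (Complex.I * w)) a b c := by
  unfold IsFlatTriangle
  have h1 : ({Complex.I * a, Complex.I * b, Complex.I * c} : Set ℂ) =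
      (fun w => Complex.I * w) '' {a, b, c} := by simp [image_insert_eq]
  rw [← I_mul_image_closedTriangle, ← I_mul_image_openTriangle, h1,
    ← image_sdiff I_mul_injective, isFlatOn_rot, continuousOn_I_mul, injOn_I_mul,
    conj_mul_im, conj_mul_im]
  have h2 : cr (Complex.I * b - Complex.I * a) (Complex.I * c - Complex.I * a) =
      cr (b - a) (c - a) := by simp [cr]; ring
  rw [h2]
  rfl

theorem laysOut_rot {τ : StraightTriangulation q} {σ : StraightTriangulation q.rot}
    (he : σ.edges = τ.edges) (hf : σ.faces = τ.faces) {f : ℂ → S} {a b c : ℂ} :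
    σ.LaysOut f (Complex.I * a) (Complex.I * b) (Complex.I * c) ↔
      τ.LaysOut (fun w => f (Complex.I * w)) a b c := by
  unfold StraightTriangulation.LaysOut
  rw [isFlatTriangle_rot, he, hf]
  simp only [← I_mul_image_openTriangle, ← I_mul_image_segment, image_I_mul]

/-- A triangulation, as a triangulation of the rotated surface. -/
noncomputable def StraightTriangulation.rot (τ : StraightTriangulation q) :
    StraightTriangulation q.rot where
  edges := τ.edges
  faces := τ.faces
  edges_finite := τ.edges_finite
  faces_finite := τ.faces_finite
  edge_saddle := fun e he => by
    obtain ⟨v, hv⟩ := τ.edge_saddle e he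
    exact ⟨_, hasHolonomy_rot.2 hv⟩
  face_triangle := fun T hT => by
    obtain ⟨f, a, b, c, h1, rfl, h3⟩ := τ.face_triangle T hT
    refine ⟨fun w => f (-Complex.I * w), Complex.I * a, Complex.I * b, Complex.I * c,
      isFlatTriangle_rot.2 ?_, ?_⟩
    · simpa only [neg_I_mul_I_mul] using h1
    · simp only [← I_mul_image_openTriangle, ← I_mul_image_segment, image_I_mul, neg_I_mul_I_mul]
      exact ⟨trivial, h3⟩
  edge_edge := τ.edge_edge
  edge_face := τ.edge_face
  face_face := τ.face_face
  cover := τ.cover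

/-- A triangulation of the rotated surface, as one of the original surface. -/
noncomputable def StraightTriangulation.unrot (τ : StraightTriangulation q.rot) :
    StraightTriangulation q where
  edges := τ.edges
  faces := τ.faces
  edges_finite := τ.edges_finite
  faces_finite := τ.faces_finite
  edge_saddle := fun e he => by
    obtain ⟨v, hv⟩ := τ.edge_saddle e he
    rw [← I_mul_neg_I_mul v] at hv
    exact ⟨_, hasHolonomy_rot.1 hv⟩
  face_triangle := fun T hT => by
    obtain ⟨f, a, b, c, h1, rfl, h3⟩ := τ.face_triangle T hT
    rw [← I_mul_neg_I_mul a, ← I_mul_neg_I_mul b, ← I_mul_neg_I_mul c] at h1 h3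
    refine ⟨fun w => f (Complex.I * w), -Complex.I * a, -Complex.I * b, -Complex.I * c,
      isFlatTriangle_rot.1 h1, ?_⟩
    simp only [← I_mul_image_segment, image_I_mul] at h3
    refine ⟨?_, h3⟩
    rw [← image_I_mul, I_mul_image_openTriangle]
    simp only [I_mul_neg_I_mul]
  edge_edge := τ.edge_edge
  edge_face := τ.edge_face
  face_face := τ.face_face
  cover := τ.cover

/-- A veering triangulation, as a veering triangulation of the rotated surface. -/
noncomputable def VeeringTriangulation.rot (τ : VeeringTriangulation q) :
    VeeringTriangulation q.rot where
  toStraightTriangulation := τ.toStraightTriangulation.rot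
  coloured := fun e he => by
    rw [isRed_rot, isBlue_rot]; exact (τ.coloured e he).symm
  triangle_colours := fun f a b c h => by
    rw [← I_mul_neg_I_mul a, ← I_mul_neg_I_mul b, ← I_mul_neg_I_mul c] at h ⊢
    have h2 := (laysOut_rot (τ := τ.toStraightTriangulation) rfl rfl).1 h
    have := τ.triangle_colours _ _ _ _ h2
    simp only [← I_mul_image_segment, image_I_mul, isRed_rot, isBlue_rot]
    exact this.symm
  vertex_colours := fun z hz => by
    have := τ.vertex_colours z hz
    simp only [isRed_rot, isBlue_rot]
    exact this.symm

/-- A veering triangulation of the rotated surface, as one of the original surface. -/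
noncomputable def VeeringTriangulation.unrot (τ : VeeringTriangulation q.rot) :
    VeeringTriangulation q where
  toStraightTriangulation := τ.toStraightTriangulation.unrot
  coloured := fun e he => by
    rw [← isRed_rot, ← isBlue_rot]; exact (τ.coloured e he).symm
  triangle_colours := fun f a b c h => by
    have h2 := (laysOut_rot (τ := τ.toStraightTriangulation.unrot) (σ := τ.toStraightTriangulation)
      (f := fun w => f (-Complex.I * w)) (a := a) (b := b) (c := c) rfl rfl).2
      (by simpa only [neg_I_mul_I_mul] using h)
    have := τ.triangle_colours _ _ _ _ h2
    simp only [← I_mul_image_segment, image_I_mul, neg_I_mul_I_mul, isRed_rot, isBlue_rot] at this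
    exact this.symm
  vertex_colours := fun z hz => by
    have := τ.vertex_colours z hz
    simp only [isRed_rot, isBlue_rot] at this
    exact this.symm

theorem isFlipAt_rot {τ τ' : StraightTriangulation q} {e e' : Set S} {f : ℂ → S} {p u r s : ℂ} :
    IsFlipAt τ.rot τ'.rot e e' f (Complex.I * p) (Complex.I * u) (Complex.I * r) (Complex.I * s) ↔
      IsFlipAt τ τ' e e' (fun w => f (Complex.I * w)) p u r s := by
  unfold IsFlipAt
  rw [laysOut_rot (τ := τ) rfl rfl, laysOut_rot (τ := τ) rfl rfl, laysOut_rot (τ := τ') rfl rfl,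
    laysOut_rot (τ := τ') rfl rfl]
  simp only [← I_mul_image_openTriangle, ← I_mul_image_segment, image_I_mul]
  rfl

/-- A quarter turn keeps the cyclic order of the sides and exchanges the two colours. It will deduce
statements about meets from those about joins. -/
theorem isForwardFlip_rot {τ τ' : VeeringTriangulation q} {e e' : Set S} :
    IsForwardFlip τ.rot τ'.rot e e' ↔ IsBackwardFlip τ τ' e e' := by
  constructor
  · rintro ⟨f, p, u, r, s, h1, h2⟩
    rw [← I_mul_neg_I_mul p, ← I_mul_neg_I_mul u, ← I_mul_neg_I_mul r, ← I_mul_neg_I_mul s] at h1 h2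
    refine ⟨_, _, _, _, _, isFlipAt_rot.1 h1, ?_⟩
    simpa only [← I_mul_image_segment, image_I_mul, isRed_rot, isBlue_rot] using h2
  · rintro ⟨f, p, u, r, s, h1, h2⟩
    refine ⟨fun w => f (-Complex.I * w), Complex.I * p, Complex.I * u, Complex.I * r,
      Complex.I * s, isFlipAt_rot.2 (by simpa only [neg_I_mul_I_mul] using h1), ?_⟩
    simpa only [← I_mul_image_segment, image_I_mul, isRed_rot, isBlue_rot, neg_I_mul_I_mul] using h2

end Rotation

end VeeringLattice

/-! ### Developing a right-angled corner over a red edge -/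

namespace VeeringLattice

open Set Filter

variable {S : Type*} [TopologicalSpace S] {q : HalfTranslationSurface S}

theorem convex_cr_nonneg (v a : ℂ) : Convex ℝ {w : ℂ | 0 ≤ cr v (w - a)} := by
  intro x hx y hy s t hs ht hst
  simp only [mem_ofPred_eq] at *
  have : cr v (s • x + t • y - a) = s * cr v (x - a) + t * cr v (y - a) := by
    have : s = 1 - t := by linarith
    subst this
    simp [cr]; ring
  rw [this]; positivity

theorem isClosed_cr_nonneg (v a : ℂ) : IsClosed {w : ℂ | 0 ≤ cr v (w - a)} :=
  isClosed_le continuous_const ((continuous_cr_right v).comp (continuous_id.sub continuous_const))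

theorem mem_segment_of_re {l u w : ℂ} (h : l.re < u.re) (h1 : l.re ≤ w.re) (h2 : w.re ≤ u.re)
    (h0 : cr (u - l) (w - l) = 0) : w ∈ segment ℝ l u := by
  have hp : 0 < u.re - l.re := by linarith
  obtain ⟨t, ht⟩ : ∃ t, t = (w.re - l.re) / (u.re - l.re) := ⟨_, rfl⟩
  have ht' : t * (u.re - l.re) = w.re - l.re := by rw [ht, div_mul_cancel₀ _ hp.ne']
  refine mem_segment_iff'.2 ⟨t, ht ▸ div_nonneg (by linarith) hp.le,
    ht ▸ (div_le_one hp).2 (by linarith), ?_⟩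
  simp only [cr, Complex.sub_re, Complex.sub_im] at h0
  apply Complex.ext
  · simp only [Complex.add_re, Complex.mul_re, Complex.ofReal_re, Complex.ofReal_im, Complex.sub_re]
    linarith
  · simp only [Complex.add_im, Complex.mul_im, Complex.ofReal_re, Complex.ofReal_im, Complex.sub_im]
    refine mul_left_cancel₀ hp.ne' ?_
    linear_combination h0 - (u.im - l.im) * ht'

/-- The corner region to the left of the line from `l` to `u`. -/
def cornerRegion (l u k : ℂ) : Set ℂ :=
  {w | k.re ≤ w.re} ∩ {w | w.im ≤ k.im} ∩ {w | 0 ≤ cr (u - l) (w - l)}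

theorem mem_cornerRegion {l u k w : ℂ} : w ∈ cornerRegion l u k ↔ k.re ≤ w.re ∧ w.im ≤ k.im ∧
    0 ≤ (u.re - l.re) * (w.im - l.im) - (u.im - l.im) * (w.re - l.re) := by
  simp [cornerRegion, cr, and_assoc]

theorem convex_cornerRegion (l u k : ℂ) : Convex ℝ (cornerRegion l u k) :=
  ((convex_halfSpace_re_ge _).inter (convex_halfSpace_im_le _)).inter (convex_cr_nonneg _ _)

theorem isClosed_cornerRegion (l u k : ℂ) : IsClosed (cornerRegion l u k) :=
  ((isClosed_le continuous_const Complex.continuous_re).inter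
    (isClosed_le Complex.continuous_im continuous_const)).inter (isClosed_cr_nonneg _ _)

theorem cornerRegion_bounds {l u k w : ℂ} (h1 : l.re < u.re) (h2 : l.im < u.im) (hk1 : l.re ≤ k.re)
    (hk2 : k.im ≤ u.im) (hw : w ∈ cornerRegion l u k) :
    l.re ≤ w.re ∧ w.re ≤ u.re ∧ l.im ≤ w.im ∧ w.im ≤ u.im := by
  obtain ⟨w1, w2, w3⟩ := mem_cornerRegion.1 hw
  refine ⟨by linarith, ?_, ?_, by linarith⟩
  · by_contra! h
    nlinarith [mul_pos (sub_pos.2 h2) (sub_pos.2 h),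
      mul_nonneg (sub_pos.2 h1).le (show 0 ≤ u.im - w.im by linarith)]
  · by_contra! h
    nlinarith [mul_pos (sub_pos.2 h1) (sub_pos.2 h),
      mul_nonneg (sub_pos.2 h2).le (show 0 ≤ w.re - l.re by linarith)]

/-- The witnesses are the two points of the line through `l` and `u` straight below `k` and to the
right of `k`, that is, the ends of the hypotenuse of the corner region. -/
theorem cornerRegion_inter_nontrivial {l u k : ℂ} (h1 : l.re < u.re) (h2 : l.im < u.im)
    (hk : 0 < cr (u - l) (k - l)) :
    ∃ x y : ℂ, x ≠ y ∧ (∀ z ∈ ({x, y} : Set ℂ), k.re ≤ z.re ∧ z.im ≤ k.im ∧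
      cr (u - l) (z - l) = 0) := by
  have p1 : 0 < u.re - l.re := by linarith
  have p2 : 0 < u.im - l.im := by linarith
  simp only [cr, Complex.sub_re, Complex.sub_im] at hk
  refine ⟨⟨k.re, l.im + (u.im - l.im) * (k.re - l.re) / (u.re - l.re)⟩,
    ⟨l.re + (u.re - l.re) * (k.im - l.im) / (u.im - l.im), k.im⟩, ?_, ?_⟩
  · intro h
    have h3 := congrArg Complex.im h
    simp only at h3
    have h4 : (u.im - l.im) * (k.re - l.re) / (u.re - l.re) = k.im - l.im := by linarith
    rw [div_eq_iff p1.ne'] at h4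
    linarith
  · rintro z (rfl | rfl)
    · refine ⟨le_rfl, ?_, ?_⟩
      · simp only
        rw [← le_sub_iff_add_le', div_le_iff₀ p1]; linarith
      · simp only [cr, Complex.sub_re, Complex.sub_im]; field_simp; ring
    · refine ⟨?_, le_rfl, ?_⟩
      · simp only
        rw [← sub_le_iff_le_add', le_div_iff₀ p2]; linarith
      · simp only [cr, Complex.sub_re, Complex.sub_im]; field_simp; ring

variable [T2Space S]

-- The region is a right-angled triangle with corner `k` and hypotenuse on the red edge from `l` up
-- to `u`. Let `s` be the apex of the face on the left of that edge. As the face is not all red, `s`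
-- is higher than `u` or to the left of `l`, so it is outside the region. What the face leaves
-- uncovered is a corner region with the same `k` over another red side of the face, developed by
-- induction and glued along that side. Edges have width at least `w₀` and height at least `h₀`, so
-- the weight in the last hypothesis drops by at least `1`.
set_option maxHeartbeats 1000000 in
theorem exists_corner_development (τ : VeeringTriangulation q) {h₀ w₀ : ℝ} (hh : 0 < h₀)
    (hw : 0 < w₀) (hb : ∀ e ∈ τ.edges, ∀ v, HasHolonomy q e v → w₀ ≤ |v.re| ∧ h₀ ≤ |v.im|) :
    ∀ (n : ℕ) (f : ℂ → S) (l u k : ℂ), IsSaddleParam q f l u → f '' segment ℝ l u ∈ τ.edges →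
      l.re < u.re → l.im < u.im → l.re ≤ k.re → k.im ≤ u.im → 0 ≤ cr (u - l) (k - l) →
      (k.im - l.im) / h₀ + (u.re - k.re) / w₀ < n →
      ∃ F : ℂ → S, EqOn F f (segment ℝ l u ∩ cornerRegion l u k) ∧
        ContinuousOn F (cornerRegion l u k) ∧ IsFlatOn q F (cornerRegion l u k \ {l, u}) := by
  intro n
  induction n with
  | zero =>
    intro f l u k hf he h1 h2 hk1 hk2 hk3 hn
    exfalso
    have hkW : k ∈ cornerRegion l u k := mem_cornerRegion.2
      ⟨le_rfl, le_rfl, by simpa [cr] using hk3⟩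
    obtain ⟨b1, b2, b3, b4⟩ := cornerRegion_bounds h1 h2 hk1 hk2 hkW
    have := div_nonneg (sub_nonneg.2 b3) hh.le
    have := div_nonneg (sub_nonneg.2 b2) hw.le
    push_cast at hn
    linarith
  | succ n ih =>
    intro f l u k hf he h1 h2 hk1 hk2 hk3 hn
    have hkW : k ∈ cornerRegion l u k := mem_cornerRegion.2
      ⟨le_rfl, le_rfl, by simpa [cr] using hk3⟩
    obtain ⟨b1, b2, b3, b4⟩ := cornerRegion_bounds h1 h2 hk1 hk2 hkW
    obtain ⟨g, s, hg, hgf⟩ := τ.exists_adjacent hf he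
    have hpos := hg.pos
    have sd1 := hg.saddle
    have sd2 := hg.cyc.saddle
    have sd3 := hg.cyc.cyc.saddle
    obtain ⟨n2r, n2i⟩ := τ.re_im_ne hg.2.2.2.1 sd2.hasHolonomy
    obtain ⟨n3r, n3i⟩ := τ.re_im_ne hg.2.2.2.2 sd3.hasHolonomy
    have hcol := (τ.triangle_colours g l u s hg).1
    rw [sd1.hasHolonomy.isRed_iff, sd2.hasHolonomy.isRed_iff, sd3.hasHolonomy.isRed_iff] at hcol
    have m2 := hb _ hg.2.2.2.1 _ sd2.hasHolonomy
    have m3 := hb _ hg.2.2.2.2 _ sd3.hasHolonomy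
    simp only [Complex.sub_re, Complex.sub_im] at hcol n2r n2i n3r n3i m2 m3
    have hposr : 0 < (u.re - l.re) * (s.im - l.im) - (u.im - l.im) * (s.re - l.re) := by
      simpa [cr] using hpos
    -- the whole region lies in the triangle
    have cover : (∀ w ∈ cornerRegion l u k, w ∈ closedTriangle l u s ∧ w ≠ s) →
        ∃ F : ℂ → S, EqOn F f (segment ℝ l u ∩ cornerRegion l u k) ∧
        ContinuousOn F (cornerRegion l u k) ∧ IsFlatOn q F (cornerRegion l u k \ {l, u}) := by
      intro hc
      refine ⟨g, fun w hw => hgf hw.1, hg.1.2.1.mono fun w hw => (hc w hw).1,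
        hg.1.flat.mono fun w hw => ⟨(hc w hw.1).1, ?_⟩⟩
      rintro (rfl | rfl | rfl)
      · exact hw.2 (by simp)
      · exact hw.2 (by simp)
      · exact (hc w hw.1).2 rfl
    -- the part of the region off the triangle is developed across another side
    have step : ∀ (l' u' a b : ℂ), l'.re < u'.re → l'.im < u'.im → ((u' - l' = -(b - a) ∧
        (a = l' ∨ a = u')) ∧ (l' = s ∨ u' = s)) → 
        IsSaddleParam q g l' u' → g '' segment ℝ l' u' ∈ τ.edges → l'.re ≤ k.re → k.im ≤ u'.im →
        0 < cr (u' - l') (k - l') → (k.im - l'.im) / h₀ + (u'.re - k.re) / w₀ < n →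
        (∀ w ∈ cornerRegion l u k, 0 ≤ cr (b - a) (w - a) → w ∈ closedTriangle l u s) →
        (∀ w ∈ segment ℝ l u, 0 ≤ cr (b - a) (w - a)) →
        cornerRegion l' u' k ⊆ cornerRegion l u k → s ∉ cornerRegion l u k →
        ({l', u'} ⊆ ({l, u, s} : Set ℂ)) →
        ∃ F : ℂ → S, EqOn F f (segment ℝ l u ∩ cornerRegion l u k) ∧
        ContinuousOn F (cornerRegion l u k) ∧ IsFlatOn q F (cornerRegion l u k \ {l, u}) := by
      intro l' u' a b k1 k2 hab hsd hse k3 k4 k5 k6 hT hseg hsub hs hV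
      obtain ⟨F', e1, e2, e3⟩ := ih g l' u' k hsd hse k1 k2 k3 k4 k5.le k6
      have hcr : ∀ w, cr (u' - l') (w - l') = - cr (b - a) (w - a) := by
        intro w
        rw [hab.1.1]
        rcases hab.1.2 with rfl | rfl
        · simp [cr]; ring
        · have h1 : b - a = -(a - l') := by rw [hab.1.1]; ring
          rw [h1]; simp [cr]; ring
      have hline : ∀ w ∈ (cornerRegion l u k ∩ {w | 0 ≤ cr (b - a) (w - a)}) ∩ cornerRegion l' u' k,
          w ∈ segment ℝ l' u' := by
        rintro w ⟨⟨hw1, hw2⟩, hw3⟩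
        obtain ⟨c1, c2, c3, c4⟩ := cornerRegion_bounds k1 k2 k3 k4 hw3
        refine mem_segment_of_re k1 c1 c2 (le_antisymm ?_ hw3.2)
        rw [hcr]; simpa using hw2
      obtain ⟨F, f1, f2, f3, f4⟩ := exists_glue (q := q) (f := g) (f' := F')
        (U := cornerRegion l u k ∩ {w | 0 ≤ cr (b - a) (w - a)}) (U' := cornerRegion l' u' k)
        (V := {l, u}) ((isClosed_cornerRegion _ _ _).inter (isClosed_cr_nonneg _ _))
        (isClosed_cornerRegion _ _ _) (toFinite _)
        (hg.1.2.1.mono fun w hw => hT w hw.1 hw.2) e2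
        (hg.1.flat.mono fun w hw => ⟨hT w hw.1.1 hw.1.2, by
          rintro (rfl | rfl | rfl)
          · exact hw.2 (by simp)
          · exact hw.2 (by simp)
          · exact hs hw.1.1⟩)
        (e3.mono fun w hw => ⟨hw.1, fun hwv => by
          rcases hV hwv with rfl | rfl | rfl
          · exact hw.2 (by simp)
          · exact hw.2 (by simp)
          · exact hs (hsub hw.1)⟩)
        (fun w hw => (e1 ⟨hline w hw, hw.2⟩).symm)
        (((convex_cornerRegion _ _ _).inter (convex_cr_nonneg _ _)).inter
          (convex_cornerRegion _ _ _)) (by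
          obtain ⟨x, y, hxy, hz⟩ := cornerRegion_inter_nontrivial k1 k2 k5
          have hm : ∀ z ∈ ({x, y} : Set ℂ), z ∈ (cornerRegion l u k ∩
              {w | 0 ≤ cr (b - a) (w - a)}) ∩ cornerRegion l' u' k := fun z hz' => by
            obtain ⟨z1, z2, z3⟩ := hz z hz'
            have hz4 : z ∈ cornerRegion l' u' k := ⟨⟨z1, z2⟩, z3.ge⟩
            refine ⟨⟨hsub hz4, ?_⟩, hz4⟩
            have := hcr z
            simp only [mem_ofPred_eq]; linarith
          exact ⟨x, hm x (by simp), y, hm y (by simp), hxy⟩)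
      have hun : cornerRegion l u k ⊆ (cornerRegion l u k ∩ {w | 0 ≤ cr (b - a) (w - a)}) ∪
          cornerRegion l' u' k := fun w hw => by
        by_cases hwc : 0 ≤ cr (b - a) (w - a)
        · exact Or.inl ⟨hw, hwc⟩
        · refine Or.inr ⟨hw.1, ?_⟩
          simp only [mem_ofPred_eq]
          rw [hcr]; linarith
      refine ⟨F, fun w hw => ?_, f3.mono hun, f4.mono fun w hw => ⟨hun hw.1, hw.2⟩⟩
      rw [f1 ⟨hw.2, hseg w hw.1⟩, hgf hw.1]
    have hsegT : ∀ w ∈ segment ℝ l u, w ∈ closedTriangle l u s :=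
      fun w hw => segment_subset_closedTriangle _ _ _ hw
    simp only [cr, Complex.sub_re, Complex.sub_im] at hk3
    by_cases hls : 0 < (l.re - s.re) * (l.im - s.im)
    · -- `ls` is red, so `us` is blue
      have hus : (s.re - u.re) * (s.im - u.im) < 0 := by
        refine lt_of_le_of_ne ?_ (mul_ne_zero n2r n2i)
        by_contra! hp
        exact hcol ⟨mul_pos (by linarith) (by linarith), hp, hls⟩
      have hs1 : s.re < u.re ∧ u.im < s.im := by
        rcases mul_neg_iff.1 hus with ⟨p1, p2⟩ | ⟨p1, p2⟩
        · exfalso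
          nlinarith [mul_pos (sub_pos.2 h1) (show 0 < u.im - s.im by linarith),
            mul_pos (sub_pos.2 h2) p1]
        · constructor <;> linarith
      obtain ⟨hs1, hs2⟩ := hs1
      have hs3 : l.re < s.re := by
        rcases mul_pos_iff.1 hls with ⟨p1, p2⟩ | ⟨p1, p2⟩ <;> linarith
      have hsn : s ∉ cornerRegion l u k := fun h => by
        have := (mem_cornerRegion.1 h).2.1; linarith
      -- On the region the cross product with the red side is smallest at the corner `k`, so `k`
      -- decides whether this side cuts the region.
      by_cases hc : 0 ≤ cr (l - s) (k - s)
      · refine cover fun w hw => ⟨(mem_closedTriangle hpos).2 ⟨hw.2, ?_, ?_⟩, fun h => hsn (h ▸ hw)⟩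
        · obtain ⟨c1, c2, c3, c4⟩ := cornerRegion_bounds h1 h2 hk1 hk2 hw
          simp only [cr, Complex.sub_re, Complex.sub_im]
          linarith [mul_nonneg (sub_pos.2 hs1).le (sub_nonneg.2 c4),
            mul_nonneg (sub_pos.2 hs2).le (sub_nonneg.2 c2)]
        · obtain ⟨d1, d2, d3⟩ := mem_cornerRegion.1 hw
          simp only [cr, Complex.sub_re, Complex.sub_im] at hc ⊢
          linarith [mul_nonneg (show 0 ≤ s.im - l.im by linarith) (sub_nonneg.2 d1),
            mul_nonneg (sub_pos.2 hs3).le (sub_nonneg.2 d2)]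
      · have hsl : s - l = -(l - s) := by ring
        refine step l s s l hs3 (by linarith) ⟨⟨hsl, Or.inr rfl⟩, Or.inr rfl⟩ sd3.symm
          (by rw [segment_symm]; exact hg.2.2.2.2) hk1 (by linarith) ?_ ?_ ?_ ?_ ?_ hsn ?_
        · have : cr (s - l) (k - l) = - cr (l - s) (k - s) := by simp [cr]; ring
          rw [this]; linarith
        -- `u` is replaced by `s`, which is at least `w₀` further to the left.
        · have hm := m2.1
          rw [abs_of_neg (by linarith)] at hm
          have : (s.re - k.re) / w₀ ≤ (u.re - k.re) / w₀ - 1 := by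
            rw [div_sub_one hw.ne']; exact (div_le_div_iff_of_pos_right hw).2 (by linarith)
          push_cast at hn; linarith
        · intro w hw hwc
          refine (mem_closedTriangle hpos).2 ⟨hw.2, ?_, hwc⟩
          obtain ⟨c1, c2, c3, c4⟩ := cornerRegion_bounds h1 h2 hk1 hk2 hw
          simp only [cr, Complex.sub_re, Complex.sub_im]
          linarith [mul_nonneg (sub_pos.2 hs1).le (sub_nonneg.2 c4),
            mul_nonneg (sub_pos.2 hs2).le (sub_nonneg.2 c2)]
        · exact fun w hw => ((mem_closedTriangle hpos).1 (hsegT w hw)).2.2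
        · intro w hw
          obtain ⟨c1, c2, c3, c4⟩ := cornerRegion_bounds hs3 (by linarith) hk1 (by linarith) hw
          obtain ⟨d1, d2, d3⟩ := mem_cornerRegion.1 hw
          refine mem_cornerRegion.2 ⟨d1, d2, ?_⟩
          linarith [mul_nonneg (sub_pos.2 hs1).le (sub_nonneg.2 c3),
            mul_nonneg (sub_pos.2 hs2).le (sub_nonneg.2 c1)]
        · rintro x (rfl | rfl) <;> simp
    · -- `ls` is blue
      have hls' : (l.re - s.re) * (l.im - s.im) < 0 :=
        lt_of_le_of_ne (not_lt.1 hls) (mul_ne_zero n3r n3i)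
      obtain ⟨hs1, hs2⟩ : s.re < l.re ∧ l.im < s.im := by
        rcases mul_neg_iff.1 hls' with ⟨p1, p2⟩ | ⟨p1, p2⟩
        · constructor <;> linarith
        · exfalso
          nlinarith [mul_pos (sub_pos.2 h1) p2, mul_pos (sub_pos.2 h2)
            (show 0 < s.re - l.re by linarith)]
      have hsn : s ∉ cornerRegion l u k := fun h => by
        have := (mem_cornerRegion.1 h).1; linarith
      have hthird : ∀ w ∈ cornerRegion l u k, 0 ≤ cr (l - s) (w - s) := by
        intro w hw
        obtain ⟨c1, c2, c3, c4⟩ := cornerRegion_bounds h1 h2 hk1 hk2 hw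
        simp only [cr, Complex.sub_re, Complex.sub_im]
        linarith [mul_nonneg (sub_pos.2 hs1).le (sub_nonneg.2 c3),
          mul_nonneg (sub_pos.2 hs2).le (sub_nonneg.2 c1)]
      -- If `s` is higher than `u`, the side from `u` to `s` is blue and does not cut the region.
      -- Otherwise it is red, and again `k` decides.
      by_cases hc : u.im < s.im ∨ 0 ≤ cr (s - u) (k - u)
      · refine cover fun w hw => ⟨(mem_closedTriangle hpos).2 ⟨hw.2, ?_, hthird w hw⟩,
          fun h => hsn (h ▸ hw)⟩
        obtain ⟨c1, c2, c3, c4⟩ := cornerRegion_bounds h1 h2 hk1 hk2 hw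
        obtain ⟨d1, d2, d3⟩ := mem_cornerRegion.1 hw
        simp only [cr, Complex.sub_re, Complex.sub_im] at hc ⊢
        by_cases hus : u.im < s.im
        · linarith [mul_nonneg (show 0 ≤ u.re - s.re by linarith) (sub_nonneg.2 c4),
            mul_nonneg (sub_pos.2 hus).le (sub_nonneg.2 c2)]
        · have hc := hc.resolve_left hus
          linarith [mul_nonneg (show 0 ≤ u.re - s.re by linarith) (sub_nonneg.2 d2),
            mul_nonneg (sub_nonneg.2 (not_lt.1 hus)) (sub_nonneg.2 d1)]
      · push Not at hc
        obtain ⟨hus, hc⟩ := hc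
        have hus : s.im < u.im := lt_of_le_of_ne hus fun h => n2i (by linarith)
        have hsu : u - s = -(s - u) := by ring
        have hkpos : 0 < cr (u - s) (k - s) := by
          have : cr (u - s) (k - s) = - cr (s - u) (k - u) := by simp [cr]; ring
          rw [this]; linarith
        refine step s u u s (by linarith) hus ⟨⟨hsu, Or.inr rfl⟩, Or.inl rfl⟩ sd2.symm
          (by rw [segment_symm]; exact hg.2.2.2.1) (by linarith) hk2 hkpos ?_ ?_ ?_ ?_ hsn ?_
        -- `l` is replaced by `s`, which is at least `h₀` higher.
        · have hm := m3.2
          rw [abs_of_neg (by linarith)] at hm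
          have : (k.im - s.im) / h₀ ≤ (k.im - l.im) / h₀ - 1 := by
            rw [div_sub_one hh.ne']; exact (div_le_div_iff_of_pos_right hh).2 (by linarith)
          push_cast at hn; linarith
        · exact fun w hw hwc => (mem_closedTriangle hpos).2 ⟨hw.2, hwc, hthird w hw⟩
        · exact fun w hw => ((mem_closedTriangle hpos).1 (hsegT w hw)).2.1
        · intro w hw
          obtain ⟨c1, c2, c3, c4⟩ := cornerRegion_bounds (by linarith) hus (by linarith) hk2 hw
          obtain ⟨d1, d2, d3⟩ := mem_cornerRegion.1 hw
          refine mem_cornerRegion.2 ⟨d1, d2, ?_⟩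
          linarith [mul_nonneg (sub_pos.2 hs1).le (sub_nonneg.2 c4),
            mul_nonneg (sub_pos.2 hs2).le (sub_nonneg.2 c2)]
        · rintro x (rfl | rfl) <;> simp

end VeeringLattice

/-! ### Developments of planar regions, and the half rectangles over edges -/

namespace VeeringLattice

open Set Filter

variable {S : Type*} [TopologicalSpace S] {q : HalfTranslationSurface S}

/-- `F` develops the planar region `D` on the surface, with marked points exactly at `V`. -/
structure IsDevelopment (q : HalfTranslationSurface S) (F : ℂ → S) (D V : Set ℂ) : Prop where
  continuousOn : ContinuousOn F D
  flat : IsFlatOn q F (D \ V)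
  marked : ∀ v ∈ V, F v ∈ q.Z

namespace IsDevelopment

variable {F F' : ℂ → S} {D D' V V' : Set ℂ}

/-- Off `V` the development is flat, and flat maps avoid marked points. This is the means of
comparing the vertices of two triangulations. -/
theorem mem_of_marked (h : IsDevelopment q F D V) {v : ℂ} (hv : v ∈ D) (hZ : F v ∈ q.Z) : v ∈ V := by
  by_contra hn
  exact h.flat.notMem ⟨hv, hn⟩ hZ

theorem mono (h : IsDevelopment q F D V) (hD : D' ⊆ D) : IsDevelopment q F D' V :=
  ⟨h.continuousOn.mono hD, h.flat.mono fun _ hx => ⟨hD hx.1, hx.2⟩, h.marked⟩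

theorem comp (h : IsDevelopment q F D V) {g : ℂ → ℂ} (hg : IsHalfTranslation g) :
    IsDevelopment q (fun w => F (g w)) (g ⁻¹' D) (g ⁻¹' V) :=
  ⟨h.continuousOn.comp hg.continuous.continuousOn fun _ hx => hx,
    by rw [← preimage_sdiff]; exact h.flat.comp hg, fun _ hv => h.marked _ hv⟩

theorem glue (h : IsDevelopment q F D V) (h' : IsDevelopment q F' D' V') (hD : IsClosed D)
    (hD' : IsClosed D') (hV : V.Finite) (hV' : V'.Finite) (hVD : V ⊆ D) (hVD' : V' ⊆ D')
    (he : EqOn F F' (D ∩ D')) (hconv : Convex ℝ (D ∩ D')) (hn : (D ∩ D').Nontrivial) :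
    ∃ G, EqOn G F D ∧ EqOn G F' D' ∧ IsDevelopment q G (D ∪ D') (V ∪ V') := by
  obtain ⟨G, g1, g2, g3, g4⟩ := exists_glue hD hD' (hV.union hV') h.continuousOn h'.continuousOn
    (h.flat.mono fun w hw => ⟨hw.1, fun hv => hw.2 (Or.inl hv)⟩)
    (h'.flat.mono fun w hw => ⟨hw.1, fun hv => hw.2 (Or.inr hv)⟩) he hconv hn
  refine ⟨G, g1, g2, g3, g4, ?_⟩
  rintro v (hv | hv)
  · rw [g1 (hVD hv)]; exact h.marked v hv
  · rw [g2 (hVD' hv)]; exact h'.marked v hv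

/-- Two developments that agree on a nondegenerate convex set agree where both are defined. -/
theorem eqOn [T2Space S] (h : IsDevelopment q F D V) (h' : IsDevelopment q F' D' V')
    (hD : Convex ℝ D) (hD' : Convex ℝ D') (hi : (interior (D ∩ D')).Nonempty)
    (hV : V.Finite) (hV' : V'.Finite)
    (hVD : Disjoint V (interior D)) (hVD' : Disjoint V' (interior D'))
    {C : Set ℂ} (hC : Convex ℝ C) (hn : C.Nontrivial) (hCD : C ⊆ D ∩ D') (he : EqOn F F' C) :
    EqOn F F' (D ∩ D') := by
  have hfin := hV.union hV'
  obtain ⟨m₀, hm₀⟩ := hn.nonempty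
  obtain ⟨m, hm⟩ : ∃ m, m ∈ C \ (V ∪ V') := by
    have := frequently_of_accPt (accPt_diff_finite hfin (accPt_of_convex hC hn hm₀)) subset_rfl
    exact this.exists
  have hacc := frequently_of_accPt (accPt_diff_finite hfin (accPt_of_convex hC hn hm.1)) subset_rfl
  refine eqOn_of_convex (q := q) (V := V ∪ V') (hD.inter hD') hi
    (h.continuousOn.mono inter_subset_left) (h'.continuousOn.mono inter_subset_right)
    (h.flat.mono fun w hw => ⟨hw.1.1, fun hv => hw.2 (Or.inl hv)⟩)
    (h'.flat.mono fun w hw => ⟨hw.1.2, fun hv => hw.2 (Or.inr hv)⟩) ?_ (hCD hm.1) hm.2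
    (hacc.mono fun w hw => ⟨hCD hw.1, hw.2, he hw.1⟩)
  rw [disjoint_union_left]
  exact ⟨hVD.mono_right (interior_mono inter_subset_left),
    hVD'.mono_right (interior_mono inter_subset_right)⟩

end IsDevelopment

theorem IsFlatTriangle.isDevelopment {f : ℂ → S} {a b c : ℂ} (h : IsFlatTriangle q f a b c) :
    IsDevelopment q f (closedTriangle a b c) {a, b, c} :=
  ⟨h.2.1, h.flat, by rintro v (rfl | rfl | rfl); exacts [h.2.2.1, h.2.2.2.1, h.2.2.2.2.1]⟩

/-- The closed rectangle with sides parallel to the axes. -/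
def rect (x₁ x₂ y₁ y₂ : ℝ) : Set ℂ := Icc x₁ x₂ ×ℂ Icc y₁ y₂

theorem mem_rect {x₁ x₂ y₁ y₂ : ℝ} {w : ℂ} :
    w ∈ rect x₁ x₂ y₁ y₂ ↔ (x₁ ≤ w.re ∧ w.re ≤ x₂) ∧ y₁ ≤ w.im ∧ w.im ≤ y₂ := by
  simp [rect, Complex.mem_reProdIm]

theorem isClosed_rect (x₁ x₂ y₁ y₂ : ℝ) : IsClosed (rect x₁ x₂ y₁ y₂) :=
  isClosed_Icc.reProdIm isClosed_Icc

theorem convex_rect (x₁ x₂ y₁ y₂ : ℝ) : Convex ℝ (rect x₁ x₂ y₁ y₂) :=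
  ((convex_Icc x₁ x₂).linear_preimage Complex.reLm).inter
    ((convex_Icc y₁ y₂).linear_preimage Complex.imLm)

theorem interior_rect (x₁ x₂ y₁ y₂ : ℝ) :
    interior (rect x₁ x₂ y₁ y₂) = Ioo x₁ x₂ ×ℂ Ioo y₁ y₂ := by
  rw [rect, Complex.interior_reProdIm, interior_Icc, interior_Icc]

theorem mem_interior_rect {x₁ x₂ y₁ y₂ : ℝ} {w : ℂ} :
    w ∈ interior (rect x₁ x₂ y₁ y₂) ↔ (x₁ < w.re ∧ w.re < x₂) ∧ y₁ < w.im ∧ w.im < y₂ := by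
  simp [interior_rect, Complex.mem_reProdIm]

theorem rect_inter (x₁ x₂ y₁ y₂ x₁' x₂' y₁' y₂' : ℝ) :
    rect x₁ x₂ y₁ y₂ ∩ rect x₁' x₂' y₁' y₂' =
      rect (max x₁ x₁') (min x₂ x₂') (max y₁ y₁') (min y₂ y₂') := by
  ext w
  simp only [mem_inter_iff, mem_rect, max_le_iff, le_min_iff]
  tauto

theorem interior_rect_nonempty {x₁ x₂ y₁ y₂ : ℝ} (hx : x₁ < x₂) (hy : y₁ < y₂) :
    (interior (rect x₁ x₂ y₁ y₂)).Nonempty :=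
  ⟨⟨(x₁ + x₂) / 2, (y₁ + y₂) / 2⟩, mem_interior_rect.2
    ⟨⟨by simp only; linarith, by simp only; linarith⟩, by simp only; linarith, by simp only; linarith⟩⟩

/-- The half to the left of the segment from `l` to `u` of the rectangle with this diagonal. -/
def halfRect (l u : ℂ) : Set ℂ :=
  rect (min l.re u.re) (max l.re u.re) (min l.im u.im) (max l.im u.im) ∩
    {w | 0 ≤ cr (u - l) (w - l)}

theorem mem_halfRect {l u w : ℂ} : w ∈ halfRect l u ↔
    ((min l.re u.re ≤ w.re ∧ w.re ≤ max l.re u.re) ∧ min l.im u.im ≤ w.im ∧ w.im ≤ max l.im u.im) ∧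
      0 ≤ cr (u - l) (w - l) := by
  simp [halfRect, mem_rect]

theorem isClosed_halfRect (l u : ℂ) : IsClosed (halfRect l u) :=
  (isClosed_rect _ _ _ _).inter (isClosed_cr_nonneg _ _)

theorem mem_rect_of_mem_segment {l u w : ℂ} (h : w ∈ segment ℝ l u) :
    w ∈ rect (min l.re u.re) (max l.re u.re) (min l.im u.im) (max l.im u.im) := by
  refine (convex_rect _ _ _ _).segment_subset ?_ ?_ h <;> rw [mem_rect] <;> simp

theorem cr_of_mem_segment {l u w : ℂ} (h : w ∈ segment ℝ l u) : cr (u - l) (w - l) = 0 := by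
  obtain ⟨t, -, -, rfl⟩ := mem_segment_iff'.1 h
  rw [add_sub_cancel_left, cr_smul_right]
  simp only [cr]; ring

theorem segment_subset_halfRect (l u : ℂ) : segment ℝ l u ⊆ halfRect l u := fun _ hw =>
  ⟨mem_rect_of_mem_segment hw, (cr_of_mem_segment hw).ge⟩

variable [T2Space S]

theorem VeeringTriangulation.exists_lower_bounds (τ : VeeringTriangulation q) :
    ∃ w₀ > 0, ∃ h₀ > 0, ∀ e ∈ τ.edges, ∀ v, HasHolonomy q e v → w₀ ≤ |v.re| ∧ h₀ ≤ |v.im| := by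
  have key : ∀ E : Set (Set S), E.Finite → E ⊆ τ.edges → ∃ d > 0, ∀ e ∈ E, ∀ v,
      HasHolonomy q e v → d ≤ |v.re| ∧ d ≤ |v.im| := by
    intro E hE
    induction E, hE using Set.Finite.induction_on with
    | empty => intro _; exact ⟨1, one_pos, by simp⟩
    | @insert e E _ _ ih =>
      intro hs
      obtain ⟨d, hd, h⟩ := ih fun x hx => hs (mem_insert_of_mem _ hx)
      obtain ⟨v, hv⟩ := τ.edge_saddle e (hs (mem_insert _ _))
      obtain ⟨n1, n2⟩ := τ.re_im_ne (hs (mem_insert _ _)) hv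
      refine ⟨min d (min |v.re| |v.im|), by positivity, ?_⟩
      rintro x (rfl | hx) v' hv'
      · have : |v'.re| = |v.re| ∧ |v'.im| = |v.im| := by
          rcases hv.unique hv' with rfl | rfl <;> simp
        rw [this.1, this.2]
        simp
      · have := h x hx v' hv'
        exact ⟨(min_le_left _ _).trans this.1, (min_le_left _ _).trans this.2⟩
  obtain ⟨d, hd, h⟩ := key _ τ.edges_finite subset_rfl
  exact ⟨d, hd, d, hd, h⟩

/-- The corner development with `k` the upper left corner of the rectangle whose diagonal is the
edge; the corner region then contains the half rectangle. -/
theorem exists_halfRect_of_lt (τ : VeeringTriangulation q) {f : ℂ → S} {l u : ℂ}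
    (hf : IsSaddleParam q f l u) (he : f '' segment ℝ l u ∈ τ.edges) (h1 : l.re < u.re)
    (h2 : l.im < u.im) :
    ∃ F, EqOn F f (segment ℝ l u) ∧ IsDevelopment q F (halfRect l u) {l, u} := by
  obtain ⟨w₀, hw, h₀, hh, hb⟩ := τ.exists_lower_bounds
  obtain ⟨n, hn⟩ := exists_nat_gt ((u.im - l.im) / h₀ + (u.re - l.re) / w₀)
  obtain ⟨F, f1, f2, f3⟩ := exists_corner_development τ hh hw hb n f l u ⟨l.re, u.im⟩ hf he h1 h2
    le_rfl le_rfl (by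
      simp only [cr, Complex.sub_re, Complex.sub_im, sub_self, mul_zero, sub_zero]
      nlinarith) hn
  have hsub : halfRect l u ⊆ cornerRegion l u ⟨l.re, u.im⟩ := by
    rintro w ⟨hw, hc⟩
    rw [mem_rect, min_eq_left h1.le, max_eq_right h2.le] at hw
    exact ⟨⟨hw.1.1, hw.2.2⟩, hc⟩
  have hsd : EqOn F f (segment ℝ l u) := fun w hw => f1 ⟨hw, hsub (segment_subset_halfRect _ _ hw)⟩
  refine ⟨F, hsd, f2.mono hsub, f3.mono fun w hw => ⟨hsub hw.1, hw.2⟩, ?_⟩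
  rintro v (rfl | rfl)
  · rw [hsd (left_mem_segment _ _ _)]; exact hf.2.2.1
  · rw [hsd (right_mem_segment _ _ _)]; exact hf.2.2.2.1

/-- The half rectangle on the other side of a red edge, i.e. for the edge read from right to left,
results by a half-turn of the plane. -/
theorem exists_halfRect_of_mul_pos (τ : VeeringTriangulation q) {f : ℂ → S} {l u : ℂ}
    (hf : IsSaddleParam q f l u) (he : f '' segment ℝ l u ∈ τ.edges)
    (h : 0 < (u.re - l.re) * (u.im - l.im)) :
    ∃ F, EqOn F f (segment ℝ l u) ∧ IsDevelopment q F (halfRect l u) {l, u} := by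
  rcases mul_pos_iff.1 h with ⟨h1, h2⟩ | ⟨h1, h2⟩
  · exact exists_halfRect_of_lt τ hf he (by linarith) (by linarith)
  · have hg := IsHalfTranslation.neg_add 0
    have himg : (fun w => -w + 0) '' segment ℝ (-l) (-u) = segment ℝ l u := by
      rw [hg.image_segment]; simp
    obtain ⟨F, f1, f2⟩ := exists_halfRect_of_lt τ (l := -l) (u := -u)
      (hf.comp hg (by simp) (by simp)) (by rwa [← himg, image_image] at he) (by simp; linarith)
      (by simp; linarith)
    refine ⟨fun w => F (-w + 0), fun w hw => ?_, ?_⟩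
    · have : -w + 0 ∈ segment ℝ (-l) (-u) := by
        rw [← himg] at hw
        obtain ⟨x, hx, rfl⟩ := hw
        simpa using hx
      simpa using f1 this
    · have := f2.comp hg
      convert this using 1
      · ext w
        simp only [mem_halfRect, mem_preimage, Complex.neg_re, Complex.neg_im, add_zero,
          min_neg_neg, max_neg_neg, neg_le_neg_iff]
        have : cr (-u - -l) (-w - -l) = cr (u - l) (w - l) := by
          rw [← cr_neg_neg]; congr 1 <;> ring
        rw [this]; tauto
      · ext w
        simp

/-- A blue edge is a red edge of the rotated surface. -/
theorem exists_halfRect (τ : VeeringTriangulation q) {f : ℂ → S} {l u : ℂ}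
    (hf : IsSaddleParam q f l u) (he : f '' segment ℝ l u ∈ τ.edges) :
    ∃ F, EqOn F f (segment ℝ l u) ∧ IsDevelopment q F (halfRect l u) {l, u} := by
  obtain ⟨n1, n2⟩ := τ.re_im_ne he hf.hasHolonomy
  simp only [Complex.sub_re, Complex.sub_im] at n1 n2
  rcases (mul_ne_zero n1 n2).lt_or_gt with h | h
  · have e1 : (fun w => (fun w => f (-Complex.I * w)) (Complex.I * w)) = f := by
      funext w; simp only [neg_I_mul_I_mul]
    have hf' : IsSaddleParam q.rot (fun w => f (-Complex.I * w)) (Complex.I * l) (Complex.I * u) := by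
      rw [isSaddleParam_rot, e1]; exact hf
    obtain ⟨F, f1, f2⟩ := exists_halfRect_of_mul_pos τ.rot hf' (by
      rw [← I_mul_image_segment, image_I_mul, e1]; exact he) (by simp; linarith)
    have himg : halfRect (Complex.I * l) (Complex.I * u) = (fun w => Complex.I * w) '' halfRect l u := by
      ext w
      constructor
      · intro hw
        refine ⟨-Complex.I * w, ?_, I_mul_neg_I_mul w⟩
        obtain ⟨⟨h1, h2⟩, h3⟩ := mem_halfRect.1 hw
        simp [cr, min_neg_neg, max_neg_neg, -inf_le_iff, -le_sup_iff, -le_inf_iff, -sup_le_iff] at h1 h2 h3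
        rw [mem_halfRect]
        simp only [cr, Complex.mul_re, Complex.mul_im, Complex.sub_re, Complex.sub_im,
          Complex.neg_re, Complex.neg_im, Complex.I_re, Complex.I_im]
        refine ⟨⟨⟨?_, ?_⟩, ?_, ?_⟩, ?_⟩ <;> linarith
      · rintro ⟨w, hw, rfl⟩
        obtain ⟨⟨h1, h2⟩, h3⟩ := mem_halfRect.1 hw
        rw [mem_halfRect]
        simp [cr, min_neg_neg, max_neg_neg, -inf_le_iff, -le_sup_iff, -le_inf_iff, -sup_le_iff] at h3 ⊢
        refine ⟨⟨⟨?_, ?_⟩, ?_, ?_⟩, ?_⟩ <;> linarith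
    refine ⟨fun w => F (Complex.I * w), fun w hw => ?_, ?_, ?_, ?_⟩
    · have : Complex.I * w ∈ segment ℝ (Complex.I * l) (Complex.I * u) := by
        rw [← I_mul_image_segment]; exact mem_image_of_mem _ hw
      simpa only [neg_I_mul_I_mul] using f1 this
    · rw [← continuousOn_I_mul, ← himg]; exact f2.continuousOn
    · rw [← isFlatOn_rot, image_sdiff I_mul_injective, ← himg, image_pair]; exact f2.flat
    · rintro v (rfl | rfl)
      · exact f2.marked _ (by simp)
      · exact f2.marked _ (by simp)
  · exact exists_halfRect_of_mul_pos τ hf he h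

end VeeringLattice

/-! ### Upright layouts, and the bounding box of a face -/

namespace VeeringLattice

open Set Filter

theorem sub_identity (a b c w : ℂ) : (cr (b - a) (c - a) : ℂ) * (w - b) =
    (-cr (c - b) (w - b) : ℝ) * (b - a) + (-cr (b - a) (w - a) : ℝ) * (b - c) := by
  apply Complex.ext <;> simp [cr] <;> ring

/-- By `sub_identity`, `w - b` is a non-negative combination of `b - a` and `b - c`, whose real
parts both have the sign of `ε`. The bound on the real part of `w - b` makes both coefficients
vanish. So the half rectangles over two sides meet only in the common vertex. -/
theorem eq_of_opposite_wedge {a b c w : ℂ} (h : 0 < cr (b - a) (c - a))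
    (h1 : cr (b - a) (w - a) ≤ 0) (h2 : cr (c - b) (w - b) ≤ 0) {ε : ℝ} (ha : 0 < ε * (b - a).re)
    (hc : 0 < ε * (b - c).re) (hw : ε * (w - b).re ≤ 0) : w = b := by
  have hid := sub_identity a b c w
  have hre := congrArg Complex.re hid
  simp only [Complex.add_re, Complex.re_ofReal_mul] at hre
  have hA : 0 ≤ -cr (c - b) (w - b) * (ε * (b - a).re) := mul_nonneg (by linarith) ha.le
  have hB : 0 ≤ -cr (b - a) (w - a) * (ε * (b - c).re) := mul_nonneg (by linarith) hc.le
  have hC : cr (b - a) (c - a) * (ε * (w - b).re) ≤ 0 := mul_nonpos_of_nonneg_of_nonpos h.le hw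
  have hsum : cr (b - a) (c - a) * (ε * (w - b).re) =
      -cr (c - b) (w - b) * (ε * (b - a).re) + -cr (b - a) (w - a) * (ε * (b - c).re) := by
    linear_combination ε * hre
  have hA0 : -cr (c - b) (w - b) = 0 := by
    rcases mul_eq_zero.1 (le_antisymm (by linarith) hA) with h | h
    · exact h
    · exact absurd h ha.ne'
  have hB0 : -cr (b - a) (w - a) = 0 := by
    rcases mul_eq_zero.1 (le_antisymm (by linarith) hB) with h | h
    · exact h
    · exact absurd h hc.ne'
  rw [hA0, hB0] at hid
  simp only [Complex.ofReal_zero, zero_mul, add_zero, mul_eq_zero, Complex.ofReal_eq_zero] at hid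
  exact sub_eq_zero.1 (hid.resolve_left h.ne')

theorem vertices_subset (a b c : ℂ) : {a, b, c} ⊆ closedTriangle a b c := subset_convexHull ℝ _

theorem pair_subset_halfRect (l u : ℂ) : {l, u} ⊆ halfRect l u := by
  rintro w (rfl | rfl)
  · exact segment_subset_halfRect _ _ (left_mem_segment _ _ _)
  · exact segment_subset_halfRect _ _ (right_mem_segment _ _ _)

variable {S : Type*} [TopologicalSpace S] {q : HalfTranslationSurface S}

/-- A layout of a face in which the vertex `0` is between the others in the horizontal direction. -/
structure VeeringTriangulation.IsUpright (τ : VeeringTriangulation q) (f : ℂ → S) (b c : ℂ) :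
    Prop where
  laysOut : τ.LaysOut f 0 b c
  re_neg : c.re < 0
  re_pos : 0 < b.re

/-- The bounding box of the triangle `0`, `b`, `c` in upright position. -/
def box (b c : ℂ) : Set ℂ := rect c.re b.re 0 (max b.im c.im)

theorem mem_box {b c w : ℂ} :
    w ∈ box b c ↔ (c.re ≤ w.re ∧ w.re ≤ b.re) ∧ 0 ≤ w.im ∧ w.im ≤ max b.im c.im := mem_rect

theorem disjoint_interior_box (b c : ℂ) : Disjoint ({0, b, c} : Set ℂ) (interior (box b c)) := by
  rw [disjoint_left]
  rintro w (rfl | rfl | rfl) h <;> obtain ⟨⟨h1, h2⟩, h3, h4⟩ := mem_interior_rect.1 h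
  · exact lt_irrefl _ h3
  · exact lt_irrefl _ h2
  · exact lt_irrefl _ h1

theorem triangle_subset_box {b c : ℂ} (h1 : c.re ≤ 0) (h2 : 0 ≤ b.re) (h3 : 0 ≤ b.im)
    (h4 : 0 ≤ c.im) : closedTriangle 0 b c ⊆ box b c := by
  refine convexHull_min ?_ (convex_rect _ _ _ _)
  rintro w (rfl | rfl | rfl) <;> rw [mem_box] <;> simp [*] <;> linarith

theorem VeeringTriangulation.IsUpright.pos {τ : VeeringTriangulation q} {f : ℂ → S} {b c : ℂ}
    (h : τ.IsUpright f b c) : 0 < cr b c := by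
  simpa using h.laysOut.pos

variable [T2Space S]

/-- No edge is vertical, so the vertices have distinct real parts. The middle one is moved to `0`,
with a half-turn if otherwise the orientation would put the next vertex on the left. -/
theorem VeeringTriangulation.exists_isUpright (τ : VeeringTriangulation q) {T : Set S}
    (hT : T ∈ τ.faces) : ∃ f b c, τ.IsUpright f b c ∧ T = f '' openTriangle 0 b c := by
  obtain ⟨f, a, b, c, hf, rfl⟩ := τ.exists_laysOut hT
  have key : ∀ a b c, τ.LaysOut f a b c → 0 < (b.re - a.re) * (a.re - c.re) →
      ∃ f' b' c', τ.IsUpright f' b' c' ∧ f '' openTriangle a b c = f' '' openTriangle 0 b' c' := by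
    intro a b c hf h
    rcases mul_pos_iff.1 h with ⟨h1, h2⟩ | ⟨h1, h2⟩
    · have hg := IsHalfTranslation.add a
      have hl := hf.comp hg (a' := 0) (b' := b - a) (c' := c - a) (by simp) (by simp) (by simp)
      exact ⟨_, b - a, c - a, ⟨hl, by simp; linarith, by simp; linarith⟩,
        (hg.image_openTriangle (f := f) hl.pos (by simp) (by simp) (by simp)).symm⟩
    · have hg := IsHalfTranslation.neg_add a
      have hl := hf.comp hg (a' := 0) (b' := a - b) (c' := a - c) (by simp) (by simp) (by simp)
      exact ⟨_, a - b, a - c, ⟨hl, by simp; linarith, by simp; linarith⟩,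
        (hg.image_openTriangle (f := f) hl.pos (by simp) (by simp) (by simp)).symm⟩
  have n1 := (τ.re_im_ne hf.2.2.1 hf.saddle.hasHolonomy).1
  have n2 := (τ.re_im_ne hf.2.2.2.1 hf.cyc.saddle.hasHolonomy).1
  have n3 := (τ.re_im_ne hf.2.2.2.2 hf.cyc.cyc.saddle.hasHolonomy).1
  simp only [Complex.sub_re] at n1 n2 n3
  by_cases h1 : 0 < (b.re - a.re) * (a.re - c.re)
  · exact key a b c hf h1
  by_cases h2 : 0 < (c.re - b.re) * (b.re - a.re)
  · obtain ⟨f', b', c', h, e⟩ := key b c a hf.cyc h2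
    exact ⟨f', b', c', h, by rw [← e, openTriangle_cyc a b c]⟩
  obtain ⟨f', b', c', h, e⟩ := key c a b hf.cyc.cyc (by
    have h1 := lt_of_le_of_ne (not_lt.1 h1) (mul_ne_zero n1 n3)
    have h2 := lt_of_le_of_ne (not_lt.1 h2) (mul_ne_zero n2 n1)
    rcases mul_neg_iff.1 h1 with ⟨p1, p2⟩ | ⟨p1, p2⟩ <;>
      rcases mul_neg_iff.1 h2 with ⟨p3, p4⟩ | ⟨p3, p4⟩ <;> nlinarith)
  exact ⟨f', b', c', h, by rw [← e, openTriangle_cyc b c a, openTriangle_cyc a b c]⟩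

namespace VeeringTriangulation.IsUpright

variable {τ : VeeringTriangulation q} {f : ℂ → S} {b c : ℂ}

theorem holonomy_right (h : τ.IsUpright f b c) : HasHolonomy q (f '' segment ℝ 0 b) b := by
  simpa using h.laysOut.saddle.hasHolonomy

theorem holonomy_left (h : τ.IsUpright f b c) : HasHolonomy q (f '' segment ℝ c 0) c := by
  simpa using h.laysOut.cyc.cyc.saddle.hasHolonomy.neg

theorem holonomy_top (h : τ.IsUpright f b c) : HasHolonomy q (f '' segment ℝ b c) (c - b) :=
  h.laysOut.cyc.saddle.hasHolonomy

/-- If `b` were below the real axis, orientation would force `c` above it, and all three sides would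
be blue; if `c` were below, all would be red. -/
theorem im_pos (h : τ.IsUpright f b c) : 0 < b.im ∧ 0 < c.im := by
  have hp := h.pos
  have h1 := h.re_neg
  have h2 := h.re_pos
  have nb := (τ.re_im_ne h.laysOut.2.2.1 h.holonomy_right).2
  have nc := (τ.re_im_ne h.laysOut.2.2.2.2 h.holonomy_left).2
  obtain ⟨hr, hbl⟩ := τ.triangle_colours f 0 b c h.laysOut
  rw [h.holonomy_right.isRed_iff, h.holonomy_top.isRed_iff, h.holonomy_left.isRed_iff] at hr
  rw [h.holonomy_right.isBlue_iff, h.holonomy_top.isBlue_iff, h.holonomy_left.isBlue_iff] at hbl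
  simp only [cr, Complex.sub_re, Complex.sub_im] at hp hr hbl
  constructor
  · by_contra! hb
    have hb := lt_of_le_of_ne hb nb
    have hc : 0 < c.im := by
      by_contra! hc
      nlinarith [mul_nonneg h2.le (neg_nonneg.2 hc), mul_pos (neg_pos.2 hb) (neg_pos.2 h1)]
    exact hbl ⟨mul_neg_of_pos_of_neg h2 hb, mul_neg_of_neg_of_pos (by linarith) (by linarith),
      mul_neg_of_neg_of_pos h1 hc⟩
  · by_contra! hc
    have hc := lt_of_le_of_ne hc nc
    have hb : 0 < b.im := by
      by_contra! hb
      nlinarith [mul_nonneg (neg_nonneg.2 hb) (neg_pos.2 h1).le, mul_pos h2 (neg_pos.2 hc)]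
    exact hr ⟨mul_pos h2 hb, mul_pos_of_neg_of_neg (by linarith) (by linarith),
      mul_pos_of_neg_of_neg h1 hc⟩

theorem top_im_ne (h : τ.IsUpright f b c) : b.im ≠ c.im := by
  have := (τ.re_im_ne h.laysOut.2.2.2.1 h.holonomy_top).2
  intro he; simp [he] at this

theorem triangle_subset_box (h : τ.IsUpright f b c) : closedTriangle 0 b c ⊆ box b c :=
  VeeringLattice.triangle_subset_box h.re_neg.le h.re_pos.le h.im_pos.1.le h.im_pos.2.le

/-- The bounding box of a face of a veering triangulation develops on the surface, and contains no
marked points but the vertices of the face. -/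
theorem exists_box (h : τ.IsUpright f b c) :
    ∃ F, EqOn F f (closedTriangle 0 b c) ∧ IsDevelopment q F (box b c) {0, b, c} := by
  have h1 := h.re_neg
  have h2 := h.re_pos
  obtain ⟨h3, h4⟩ := h.im_pos
  have hp := h.laysOut.pos
  have hT {w : ℂ} := mem_closedTriangle (w := w) hp
  have hD := h.laysOut.tri.isDevelopment
  -- The box is the union of the face and of the half rectangles over its sides. The sides are
  -- reversed so that the half rectangles are on the outside; the pieces are glued one by one, each
  -- along the segment in which it meets the union of the previous ones.
  obtain ⟨F₁, e1, d1⟩ := exists_halfRect τ h.laysOut.saddle.symm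
    (by rw [segment_symm]; exact h.laysOut.2.2.1)
  obtain ⟨F₂, e2, d2⟩ := exists_halfRect τ h.laysOut.cyc.cyc.saddle.symm
    (by rw [segment_symm]; exact h.laysOut.2.2.2.2)
  obtain ⟨F₃, e3, d3⟩ := exists_halfRect τ h.laysOut.cyc.saddle.symm
    (by rw [segment_symm]; exact h.laysOut.2.2.2.1)
  have m1 : ∀ w ∈ halfRect b 0, (0 ≤ w.re ∧ w.re ≤ b.re) ∧ (0 ≤ w.im ∧ w.im ≤ b.im) ∧
      cr (b - 0) (w - 0) ≤ 0 := by
    intro w hw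
    obtain ⟨⟨p1, p2⟩, p3⟩ := mem_halfRect.1 hw
    simp only [Complex.zero_re, Complex.zero_im, min_eq_right h2.le, max_eq_left h2.le,
      min_eq_right h3.le, max_eq_left h3.le] at p1 p2
    refine ⟨p1, p2, ?_⟩
    simp only [cr, Complex.sub_re, Complex.sub_im, Complex.zero_re, Complex.zero_im] at p3 ⊢
    linarith
  have m2 : ∀ w ∈ halfRect 0 c, (c.re ≤ w.re ∧ w.re ≤ 0) ∧ (0 ≤ w.im ∧ w.im ≤ c.im) ∧
      cr (0 - c) (w - c) ≤ 0 := by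
    intro w hw
    obtain ⟨⟨p1, p2⟩, p3⟩ := mem_halfRect.1 hw
    simp only [Complex.zero_re, Complex.zero_im, min_eq_right h1.le, max_eq_left h1.le,
      min_eq_left h4.le, max_eq_right h4.le] at p1 p2
    refine ⟨p1, p2, ?_⟩
    simp only [cr, Complex.sub_re, Complex.sub_im, Complex.zero_re, Complex.zero_im] at p3 ⊢
    linarith
  have m3 : ∀ w ∈ halfRect c b, (c.re ≤ w.re ∧ w.re ≤ b.re) ∧ (min c.im b.im ≤ w.im) ∧
      cr (c - b) (w - b) ≤ 0 := by
    intro w hw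
    obtain ⟨⟨p1, p2⟩, p3⟩ := mem_halfRect.1 hw
    simp only [min_eq_left (h1.trans h2).le, max_eq_right (h1.trans h2).le] at p1
    refine ⟨p1, p2.1, ?_⟩
    simp only [cr, Complex.sub_re, Complex.sub_im] at p3 ⊢
    linarith
  have hn0 : b ≠ 0 := fun h => by simp [h] at h2
  have hn1 : c ≠ 0 := fun h => by simp [h] at h1
  have hn2 : b ≠ c := fun h => by rw [h] at h2; linarith
  have i1 : closedTriangle 0 b c ∩ halfRect b 0 = segment ℝ 0 b := by
    refine Subset.antisymm ?_ fun w hw => ⟨segment_subset_closedTriangle _ _ _ hw,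
      segment_subset_halfRect _ _ (segment_symm ℝ 0 b ▸ hw)⟩
    rintro w ⟨hw, hw'⟩
    exact mem_segment_of_cr hp hw (le_antisymm (m1 w hw').2.2 (hT.1 hw).1)
  obtain ⟨G₁, g1, g1', dg1⟩ := hD.glue d1 (isClosed_closedTriangle _ _ _) (isClosed_halfRect _ _)
    (toFinite _) (toFinite _)
    (vertices_subset _ _ _)
    (pair_subset_halfRect _ _)
    (by rw [i1, segment_symm]; exact e1.symm) (by rw [i1]; exact convex_segment _ _)
    (by rw [i1]; exact ⟨0, left_mem_segment _ _ _, b, right_mem_segment _ _ _, hn0.symm⟩)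
  have i2 : (closedTriangle 0 b c ∪ halfRect b 0) ∩ halfRect 0 c = segment ℝ c 0 := by
    refine Subset.antisymm ?_ fun w hw => ⟨Or.inl ?_,
      segment_subset_halfRect _ _ (segment_symm ℝ c 0 ▸ hw)⟩
    · rintro w ⟨hw | hw, hw'⟩
      · have := mem_segment_of_cr (cr_cyc c 0 b ▸ hp) (by rwa [closedTriangle_cyc] at hw)
          (le_antisymm (m2 w hw').2.2 (hT.1 hw).2.2)
        exact this
      · have p := m1 w hw
        have p' := m2 w hw'
        have hre : w.re = 0 := le_antisymm p'.1.2 p.1.1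
        have him : w.im = 0 := by
          have := p.2.2
          simp only [cr, sub_zero, hre, mul_zero] at this
          nlinarith [p.2.1.1]
        have : w = 0 := Complex.ext hre him
        rw [this]; exact right_mem_segment _ _ _
    · rw [closedTriangle_cyc]
      exact segment_subset_closedTriangle _ _ _ hw
  obtain ⟨G₂, g2, g2', dg2⟩ := dg1.glue d2
    ((isClosed_closedTriangle _ _ _).union (isClosed_halfRect _ _)) (isClosed_halfRect _ _)
    (toFinite _) (toFinite _)
    (union_subset_union (vertices_subset _ _ _)
     (pair_subset_halfRect _ _))
    (pair_subset_halfRect _ _)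
    (by
      rw [i2]
      intro w hw
      have hw' : w ∈ closedTriangle 0 b c := by
        rw [closedTriangle_cyc]; exact segment_subset_closedTriangle _ _ _ hw
      rw [g1 hw']
      exact (e2 (segment_symm ℝ c 0 ▸ hw)).symm)
    (by rw [i2]; exact convex_segment _ _)
    (by rw [i2]; exact ⟨c, left_mem_segment _ _ _, 0, right_mem_segment _ _ _, hn1⟩)
  have i3 : ((closedTriangle 0 b c ∪ halfRect b 0) ∪ halfRect 0 c) ∩ halfRect c b =
      segment ℝ b c := by
    refine Subset.antisymm ?_ fun w hw => ⟨Or.inl (Or.inl ?_),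
      segment_subset_halfRect _ _ (segment_symm ℝ b c ▸ hw)⟩
    · rintro w ⟨(hw | hw) | hw, hw'⟩
      · exact mem_segment_of_cr (cr_cyc 0 b c ▸ hp) (by rwa [closedTriangle_cyc])
          (le_antisymm (m3 w hw').2.2 (hT.1 hw).2.1)
      · have : w = b := eq_of_opposite_wedge hp (m1 w hw).2.2 (m3 w hw').2.2 (ε := 1)
          (by simpa using h2) (by simp; linarith) (by simp; linarith [(m1 w hw).1.2])
        rw [this]; exact left_mem_segment _ _ _
      · have : w = c := eq_of_opposite_wedge (cr_cyc 0 b c ▸ hp) (m3 w hw').2.2 (m2 w hw).2.2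
          (ε := -1) (by simp; linarith) (by simpa using h1) (by simp; linarith [(m2 w hw).1.1])
        rw [this]; exact right_mem_segment _ _ _
    · rw [← closedTriangle_cyc]
      exact segment_subset_closedTriangle _ _ _ hw
  obtain ⟨G₃, g3, g3', dg3⟩ := dg2.glue d3
    (((isClosed_closedTriangle _ _ _).union (isClosed_halfRect _ _)).union (isClosed_halfRect _ _))
    (isClosed_halfRect _ _) (toFinite _) (toFinite _)
    (union_subset_union (union_subset_union (vertices_subset _ _ _)
     (pair_subset_halfRect _ _))
     (pair_subset_halfRect _ _))
    (pair_subset_halfRect _ _)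
    (by
      rw [i3]
      intro w hw
      have hw' : w ∈ closedTriangle 0 b c := by
        rw [← closedTriangle_cyc]; exact segment_subset_closedTriangle _ _ _ hw
      rw [g2 (Or.inl hw'), g1 hw']
      exact (e3 (segment_symm ℝ b c ▸ hw)).symm)
    (by rw [i3]; exact convex_segment _ _)
    (by rw [i3]; exact ⟨b, left_mem_segment _ _ _, c, right_mem_segment _ _ _, hn2⟩)
  refine ⟨G₃, fun w hw => by rw [g3 (Or.inl (Or.inl hw)), g2 (Or.inl hw), g1 hw], ?_⟩
  have hV : (({0, b, c} ∪ {b, 0} ∪ {0, c}) ∪ {c, b} : Set ℂ) = {0, b, c} := by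
    ext w; simp
  rw [hV] at dg3
  refine dg3.mono fun w hw => ?_
  obtain ⟨⟨w1, w2⟩, w3, w4⟩ := mem_box.1 hw
  have hp' := hp
  simp only [cr, sub_zero] at hp'
  -- A point of the box on the wrong side of one of the sides belongs to the half rectangle over
  -- that side.
  by_cases c1 : 0 ≤ cr (b - 0) (w - 0)
  swap
  · refine Or.inl (Or.inl (Or.inr (mem_halfRect.2 ?_)))
    simp only [cr, Complex.sub_re, Complex.sub_im, Complex.zero_re, Complex.zero_im, sub_zero,
      min_eq_right h2.le, max_eq_left h2.le, min_eq_right h3.le, max_eq_left h3.le, not_le] at c1 ⊢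
    refine ⟨⟨⟨?_, w2⟩, w3, ?_⟩, by linarith⟩
    · by_contra! hh; nlinarith
    · by_contra! hh; nlinarith
  by_cases c2 : 0 ≤ cr (0 - c) (w - c)
  swap
  · refine Or.inl (Or.inr (mem_halfRect.2 ?_))
    simp only [cr, Complex.sub_re, Complex.sub_im, Complex.zero_re, Complex.zero_im, sub_zero,
      min_eq_right h1.le, max_eq_left h1.le, min_eq_left h4.le, max_eq_right h4.le, not_le] at c2 ⊢
    refine ⟨⟨⟨w1, ?_⟩, w3, ?_⟩, by linarith⟩
    · by_contra! hh; nlinarith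
    · by_contra! hh; nlinarith
  by_cases c3 : 0 ≤ cr (c - b) (w - b)
  swap
  · refine Or.inr (mem_halfRect.2 ?_)
    simp only [cr, Complex.sub_re, Complex.sub_im, min_eq_left (h1.trans h2).le,
      max_eq_right (h1.trans h2).le, not_le] at c3 ⊢
    refine ⟨⟨⟨w1, w2⟩, ?_, by rwa [max_comm]⟩, by linarith⟩
    rcases le_total c.im b.im with hh | hh
    · rw [min_eq_left hh]; by_contra! hk; nlinarith
    · rw [min_eq_right hh]; by_contra! hk; nlinarith
  exact Or.inl (Or.inl (Or.inl (hT.2 ⟨c1, c3, c2⟩)))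

end VeeringTriangulation.IsUpright

end VeeringLattice

/-! ### Two triangulations at a common separatrix; antisymmetry -/

namespace VeeringLattice

open Set Filter

theorem eventually_mem_openTriangle {b c : ℂ} (hp : 0 < cr b c) (h1 : c.re < 0) (h2 : 0 < b.re) :
    ∀ᶠ t : ℝ in 𝓝[>] 0, (t : ℂ) * Complex.I ∈ openTriangle 0 b c := by
  have hlt : 0 < cr b c / (b.re - c.re) := div_pos hp (by linarith)
  filter_upwards [Ioo_mem_nhdsGT hlt] with t ht
  have h3 : t * (b.re - c.re) < cr b c := (lt_div_iff₀ (by linarith)).1 ht.2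
  rw [mem_openTriangle (by simpa using hp)]
  simp only [cr] at h3
  refine ⟨?_, ?_, ?_⟩
  · simp [cr]; exact mul_pos h2 ht.1
  · simp [cr]; nlinarith
  · simp [cr]; nlinarith [mul_pos (neg_pos.2 h1) ht.1]

variable {S : Type*} [TopologicalSpace S] {q : HalfTranslationSurface S}
theorem LaysOutAt.isUpright {τ : VeeringTriangulation q} {β : VerticalSeparatrix q} {f : ℂ → S}
    {b c : ℂ} (h : LaysOutAt τ.toStraightTriangulation β f b c) : τ.IsUpright f b c :=
  ⟨h.laysOut, h.re_pos.2, h.re_pos.1⟩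

theorem Precedes.refl (τ : VeeringTriangulation q) : Precedes τ τ := fun _ => subset_rfl

theorem Precedes.trans {τ σ ρ : VeeringTriangulation q} (h : Precedes τ σ) (h' : Precedes σ ρ) :
    Precedes τ ρ := fun β => (h' β).trans (h β)

theorem VeeringTriangulation.IsUpright.laysOutAt {τ : VeeringTriangulation q} {f : ℂ → S}
    {b c : ℂ} (h : τ.IsUpright f b c) {β : VerticalSeparatrix q}
    (hβ : ∀ᶠ t : ℝ in 𝓝[>] 0, f ((t : ℂ) * Complex.I) = β.map (t * Complex.I)) :
    LaysOutAt τ.toStraightTriangulation β f b c :=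
  .of_eventually h.laysOut ((eventually_mem_openTriangle h.pos h.re_neg h.re_pos).and hβ)

variable [T2Space S]

theorem VeeringTriangulation.exists_laysOutAt (τ : VeeringTriangulation q)
    (β : VerticalSeparatrix q) : ∃ f b c, LaysOutAt τ.toStraightTriangulation β f b c :=
  VeeringLattice.exists_laysOutAt _ β fun _ he _ hv => (τ.re_im_ne he hv).1

namespace VeeringTriangulation.IsUpright

variable {τ : VeeringTriangulation q} {f : ℂ → S} {b c : ℂ}

-- The layout itself, on a short vertical segment from `0`, is a separatrix. So every face is of the
-- form `T(β, τ)`.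
omit [T2Space S] in
theorem exists_separatrix (h : τ.IsUpright f b c) :
    ∃ β : VerticalSeparatrix q, β.map = f ∧ LaysOutAt τ.toStraightTriangulation β f b c := by
  obtain ⟨δ, hδ, hm⟩ := mem_nhdsGT_iff_exists_Ioo_subset.1
    (eventually_mem_openTriangle h.pos h.re_neg h.re_pos)
  have hδ : 0 < δ := hδ
  have hopen : openSegment ℝ 0 (((δ / 2 : ℝ) : ℂ) * Complex.I) ⊆ openTriangle 0 b c := by
    intro w hw
    obtain ⟨t, t0, t1, rfl⟩ := mem_openSegment_iff'.1 hw
    have : (t * (δ / 2)) ∈ Ioo 0 δ := ⟨by positivity, by nlinarith⟩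
    have := hm this
    simp only [mem_ofPred_eq] at this
    convert this using 1
    push_cast; ring
  have hclosed : segment ℝ 0 (((δ / 2 : ℝ) : ℂ) * Complex.I) ⊆ closedTriangle 0 b c := by
    refine (convex_closedTriangle _ _ _).segment_subset (left_mem_closedTriangle _ _ _) ?_
    refine openTriangle_subset _ _ _ ?_
    exact hm (show δ / 2 ∈ Ioo 0 δ from ⟨by linarith, by linarith⟩)
  refine ⟨⟨f, δ / 2, by linarith, h.laysOut.tri.2.2.1, h.laysOut.tri.2.1.mono hclosed,
    h.laysOut.tri.flat.mono (hopen.trans h.laysOut.tri.open_subset)⟩, rfl, h.laysOutAt ?_⟩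
  exact Eventually.of_forall fun _ => rfl

end VeeringTriangulation.IsUpright

namespace LaysOutAt

variable {τ σ : VeeringTriangulation q} {β : VerticalSeparatrix q} {f f' F F' : ℂ → S}
  {b c b' c' : ℂ}

/-- The developments of the bounding boxes of two faces at the same vertical separatrix agree. -/
theorem eqOn_box (h : LaysOutAt τ.toStraightTriangulation β f b c)
    (h' : LaysOutAt σ.toStraightTriangulation β f' b' c') (hF : EqOn F f (closedTriangle 0 b c))
    (hF' : EqOn F' f' (closedTriangle 0 b' c')) (hD : IsDevelopment q F (box b c) {0, b, c})
    (hD' : IsDevelopment q F' (box b' c') {0, b', c'}) : EqOn F F' (box b c ∩ box b' c') := by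
  have hu := h.isUpright
  have hu' := h'.isUpright
  obtain ⟨δ, hδ, hm⟩ := mem_nhdsGT_iff_exists_Ioo_subset.1 (h.eventually.and h'.eventually)
  have hδ : 0 < δ := hδ
  have hC : ∀ w ∈ openSegment ℝ 0 ((δ : ℂ) * Complex.I), ∃ t : ℝ, w = t * Complex.I ∧ t ∈ Ioo 0 δ := by
    intro w hw
    obtain ⟨t, t0, t1, rfl⟩ := mem_openSegment_iff'.1 hw
    exact ⟨t * δ, by push_cast; ring, by positivity, by nlinarith⟩
  -- Both developments follow `β` on a short vertical segment, and the identity principle extends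
  -- this to the whole intersection of the boxes.
  refine hD.eqOn hD' (convex_rect _ _ _ _) (convex_rect _ _ _ _) ?_ (toFinite _) (toFinite _)
    (disjoint_interior_box _ _) (disjoint_interior_box _ _) (convex_openSegment (𝕜 := ℝ) 0 (δ * Complex.I))
    (openSegment_nontrivial ?_) ?_ ?_
  · rw [box, box, rect_inter]
    refine interior_rect_nonempty ?_ ?_
    · exact (max_lt hu.re_neg hu'.re_neg).trans (lt_min hu.re_pos hu'.re_pos)
    · rw [max_self]
      exact lt_min (lt_max_of_lt_left hu.im_pos.1) (lt_max_of_lt_left hu'.im_pos.1)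
  · exact (mul_ne_zero (Complex.ofReal_ne_zero.2 hδ.ne') Complex.I_ne_zero).symm
  · intro w hw
    obtain ⟨t, rfl, ht⟩ := hC w hw
    obtain ⟨h1, h2⟩ := hm ht
    exact ⟨hu.triangle_subset_box (openTriangle_subset _ _ _ h1.1),
      hu'.triangle_subset_box (openTriangle_subset _ _ _ h2.1)⟩
  · intro w hw
    obtain ⟨t, rfl, ht⟩ := hC w hw
    obtain ⟨h1, h2⟩ := hm ht
    rw [hF (openTriangle_subset _ _ _ h1.1), hF' (openTriangle_subset _ _ _ h2.1), h1.2, h2.2]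

/-- The developments of the two boxes agree, so `v` is marked for both, and a box has no marked
points but the vertices of its own face. The vertex `0` is excluded since `b'` and `c'` are off the
imaginary axis. -/
theorem mark_mem (h : LaysOutAt τ.toStraightTriangulation β f b c)
    (h' : LaysOutAt σ.toStraightTriangulation β f' b' c') {v : ℂ} (hv : v = b' ∨ v = c')
    (hvb : v ∈ box b c) : v = b ∨ v = c := by
  obtain ⟨F, f1, f2⟩ := h.isUpright.exists_box
  obtain ⟨F', f1', f2'⟩ := h'.isUpright.exists_box
  have hv' : v ∈ ({0, b', c'} : Set ℂ) := by rcases hv with rfl | rfl <;> simp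
  have hvb' := h'.isUpright.triangle_subset_box (vertices_subset _ _ _ hv')
  have hZ : F v ∈ q.Z := by
    rw [h.eqOn_box h' f1 f1' f2 f2' ⟨hvb, hvb'⟩]
    exact f2'.marked v hv'
  rcases f2.mem_of_marked hvb hZ with rfl | hmem
  · exfalso
    rcases hv with hv | hv
    · have := h'.re_pos.1; simp [← hv] at this
    · have := h'.re_pos.2; simp [← hv] at this
  · exact hmem

theorem eqOn_of_eq (h : LaysOutAt τ.toStraightTriangulation β f b c)
    (h' : LaysOutAt σ.toStraightTriangulation β f' b c) : EqOn f f' (closedTriangle 0 b c) := by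
  obtain ⟨F, f1, f2⟩ := h.isUpright.exists_box
  obtain ⟨F', f1', f2'⟩ := h'.isUpright.exists_box
  intro w hw
  have hwb := h.isUpright.triangle_subset_box hw
  rw [← f1 hw, ← f1' hw]
  exact h.eqOn_box h' f1 f1' f2 f2' ⟨hwb, hwb⟩

theorem right_mem_wedge (h : LaysOutAt τ.toStraightTriangulation β f b c) :
    b ∈ wedge β τ.toStraightTriangulation :=
  h.mem_wedge.2 ⟨by simp [cr, mul_comm], h.pos.le⟩

theorem left_mem_wedge (h : LaysOutAt τ.toStraightTriangulation β f b c) :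
    c ∈ wedge β τ.toStraightTriangulation :=
  h.mem_wedge.2 ⟨h.pos.le, by simp [cr, mul_comm]⟩

/-- Of two edges in the same direction the shorter one ends in the box of the other face, hence at a
vertex of that face. -/
theorem right_eq_of_cr (h : LaysOutAt τ.toStraightTriangulation β f b c)
    (h' : LaysOutAt σ.toStraightTriangulation β f' b' c') (h0 : cr b b' = 0) : b' = b := by
  have key : ∀ {τ σ : VeeringTriangulation q} {f f' : ℂ → S} {b c b' c' : ℂ},
      LaysOutAt τ.toStraightTriangulation β f b c → LaysOutAt σ.toStraightTriangulation β f' b' c' →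
      cr b b' = 0 → b'.re ≤ b.re → b' = b := by
    intro τ σ f f' b c b' c' h h' h0 hle
    have := h.re_pos
    have h2' := h'.re_pos
    have h3' := h'.isUpright.im_pos
    have h3 := h.isUpright.im_pos
    simp only [cr] at h0
    refine (h.mark_mem h' (Or.inl rfl) (mem_box.2 ⟨⟨by linarith, hle⟩, h3'.1.le,
      le_max_of_le_left ?_⟩)).resolve_right fun hc => ?_
    · by_contra! hlt
      nlinarith [mul_pos this.1 (sub_pos.2 hlt), mul_nonneg h3.1.le (sub_nonneg.2 hle)]
    · rw [hc] at h2'; linarith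
  rcases le_total b'.re b.re with hle | hle
  · exact key h h' h0 hle
  · exact (key h' h (by simp only [cr] at *; linarith) hle).symm

theorem left_eq_of_cr (h : LaysOutAt τ.toStraightTriangulation β f b c)
    (h' : LaysOutAt σ.toStraightTriangulation β f' b' c') (h0 : cr c c' = 0) : c' = c := by
  have key : ∀ {τ σ : VeeringTriangulation q} {f f' : ℂ → S} {b c b' c' : ℂ},
      LaysOutAt τ.toStraightTriangulation β f b c → LaysOutAt σ.toStraightTriangulation β f' b' c' →
      cr c c' = 0 → c.re ≤ c'.re → c' = c := by
    intro τ σ f f' b c b' c' h h' h0 hle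
    have := h.re_pos
    have h2' := h'.re_pos
    have h3' := h'.isUpright.im_pos
    have h3 := h.isUpright.im_pos
    simp only [cr] at h0
    refine (h.mark_mem h' (Or.inr rfl) (mem_box.2 ⟨⟨hle, by linarith⟩, h3'.2.le,
      le_max_of_le_right ?_⟩)).resolve_left fun hc => ?_
    · by_contra! hlt
      nlinarith [mul_pos (neg_pos.2 this.2) (sub_pos.2 hlt), mul_nonneg h3.2.le (sub_nonneg.2 hle)]
    · rw [hc] at h2'; linarith
  rcases le_total c.re c'.re with hle | hle
  · exact key h h' h0 hle
  · exact (key h' h (by simp only [cr] at *; linarith) hle).symm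

theorem eq_of_wedge_eq (h : LaysOutAt τ.toStraightTriangulation β f b c)
    (h' : LaysOutAt σ.toStraightTriangulation β f' b' c')
    (hw : wedge β τ.toStraightTriangulation = wedge β σ.toStraightTriangulation) :
    b' = b ∧ c' = c := by
  have hb := h'.mem_wedge.1 (hw ▸ h.right_mem_wedge)
  have hb' := h.mem_wedge.1 (hw ▸ h'.right_mem_wedge)
  have hc := h'.mem_wedge.1 (hw ▸ h.left_mem_wedge)
  have hc' := h.mem_wedge.1 (hw ▸ h'.left_mem_wedge)
  constructor
  · refine h.right_eq_of_cr h' (le_antisymm ?_ hb'.1)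
    have := hb.1
    simp only [cr] at *; linarith
  · refine h.left_eq_of_cr h' (le_antisymm ?_ ?_)
    · have := hc'.2; simp only [cr] at *; linarith
    · exact hc.2

end LaysOutAt

namespace VeeringTriangulation

/-- By `exists_adjacent` every edge is a side of some face, so the faces determine the edges. -/
theorem edge_mem_of_faces_subset {τ σ : StraightTriangulation q} (h : τ.faces ⊆ σ.faces)
    {e : Set S} (he : e ∈ τ.edges) : e ∈ σ.edges := by
  obtain ⟨v, f, a, b, hf, rfl, -⟩ := τ.edge_saddle e he
  obtain ⟨g, s, hg, hgf⟩ := τ.exists_adjacent hf he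
  have := (StraightTriangulation.LaysOut.of_face hg.1 (h hg.2.1)).2.2.1
  rwa [hgf.image_eq] at this

theorem ext_of_faces {τ σ : VeeringTriangulation q} (h : τ.faces = σ.faces) : τ = σ := by
  ext x
  · exact ⟨edge_mem_of_faces_subset h.subset, edge_mem_of_faces_subset h.superset⟩
  · rw [h]

/-- A veering triangulation is determined by its wedges. -/
theorem eq_of_wedge_eq {τ σ : VeeringTriangulation q}
    (h : ∀ β, wedge β τ.toStraightTriangulation = wedge β σ.toStraightTriangulation) : τ = σ := by
  have key : ∀ {τ σ : VeeringTriangulation q},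
      (∀ β, wedge β τ.toStraightTriangulation = wedge β σ.toStraightTriangulation) →
      τ.faces ⊆ σ.faces := by
    intro τ σ h T hT
    obtain ⟨f, b, c, hf, rfl⟩ := τ.exists_isUpright hT
    obtain ⟨β, -, hβ⟩ := hf.exists_separatrix
    obtain ⟨f', b', c', hβ'⟩ := σ.exists_laysOutAt β
    obtain ⟨rfl, rfl⟩ := hβ.eq_of_wedge_eq hβ' (h β)
    rw [((hβ.eqOn_of_eq hβ').mono (openTriangle_subset _ _ _)).image_eq]
    exact hβ'.laysOut.2.1
  exact ext_of_faces (Subset.antisymm (key h) (key fun β => (h β).symm))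

end VeeringTriangulation

theorem Precedes.antisymm {τ σ : VeeringTriangulation q} (h : Precedes τ σ) (h' : Precedes σ τ) :
    τ = σ :=
  VeeringTriangulation.eq_of_wedge_eq fun β => Subset.antisymm (h' β) (h β)

end VeeringLattice

/-! ### Exchanging the diagonals of a strictly convex quadrilateral -/

namespace VeeringLattice

open Set Filter

theorem eventually_mem_openTriangle_add {l u s m v : ℂ} (h : 0 < cr (u - l) (s - l))
    (hm : m ∈ openSegment ℝ l u) (hv : 0 < cr (u - l) v) :
    ∀ᶠ t : ℝ in 𝓝[>] 0, m + (t : ℂ) * v ∈ openTriangle l u s := by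
  obtain ⟨t₀, h0, h1, rfl⟩ := mem_openSegment_iff'.1 hm
  have key : ∀ x y : ℂ, 0 < cr x (l + t₀ * (u - l) - y) →
      ∀ᶠ t : ℝ in 𝓝[>] 0, 0 < cr x (l + t₀ * (u - l) + t * v - y) := by
    intro x y hpos
    have hc : Continuous fun t : ℝ => cr x (l + t₀ * (u - l) + t * v - y) :=
      (continuous_cr_right x).comp (by fun_prop)
    have := hc.tendsto 0
    simp only [Complex.ofReal_zero, zero_mul, add_zero] at this
    exact (this.eventually (lt_mem_nhds hpos)).filter_mono nhdsWithin_le_nhds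
  have e1 : cr (s - u) (l + t₀ * (u - l) - u) = (1 - t₀) * cr (u - l) (s - l) := by
    simp [cr]; ring
  have e2 : cr (l - s) (l + t₀ * (u - l) - s) = t₀ * cr (u - l) (s - l) := by
    simp [cr]; ring
  filter_upwards [key (s - u) u (e1 ▸ mul_pos (by linarith) h),
    key (l - s) s (e2 ▸ mul_pos h0 h), self_mem_nhdsWithin] with t h2 h3 ht
  refine (mem_openTriangle h).2 ⟨?_, h2, h3⟩
  have : cr (u - l) (l + t₀ * (u - l) + t * v - l) = t * cr (u - l) v := by simp [cr]; ring
  rw [this]; exact mul_pos ht hv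

/-- The interior of the convex quadrilateral with anti-clockwise vertices `p`, `u`, `r`, `s`. -/
def openQuad (p u r s : ℂ) : Set ℂ :=
  {w | 0 < cr (u - p) (w - p) ∧ 0 < cr (r - u) (w - u) ∧ 0 < cr (s - r) (w - r) ∧
    0 < cr (p - s) (w - s)}

/-- The quadrilateral `p`, `u`, `r`, `s` is strictly convex, with its vertices anti-clockwise. -/
structure IsConvexQuad (p u r s : ℂ) : Prop where
  pur : 0 < cr (u - p) (r - p)
  urs : 0 < cr (r - u) (s - u)
  rsp : 0 < cr (s - r) (p - r)
  spu : 0 < cr (p - s) (u - s)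

theorem openQuad_cyc (p u r s : ℂ) : openQuad u r s p = openQuad p u r s := by
  ext w; simp only [openQuad, mem_ofPred_eq]; tauto

theorem IsConvexQuad.cyc {p u r s : ℂ} (h : IsConvexQuad p u r s) : IsConvexQuad u r s p :=
  ⟨h.urs, h.rsp, h.spu, h.pur⟩

theorem cr_barycentric (a b c w v x : ℂ) : cr (b - a) (c - a) * cr v (w - x) =
    cr (c - b) (w - b) * cr v (a - x) + cr (a - c) (w - c) * cr v (b - x) +
      cr (b - a) (w - a) * cr v (c - x) := by
  simp only [cr, Complex.sub_re, Complex.sub_im]; ring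

/-- An affine function that is non-negative at the vertices and positive at one of them is positive
inside. -/
theorem cr_pos_of_mem_openTriangle {a b c w v x : ℂ} (h : 0 < cr (b - a) (c - a))
    (hw : w ∈ openTriangle a b c) (ha : 0 ≤ cr v (a - x)) (hb : 0 ≤ cr v (b - x))
    (hc : 0 ≤ cr v (c - x)) (hs : 0 < cr v (a - x) ∨ 0 < cr v (b - x) ∨ 0 < cr v (c - x)) :
    0 < cr v (w - x) := by
  obtain ⟨h1, h2, h3⟩ := (mem_openTriangle h).1 hw
  have hid := cr_barycentric a b c w v x
  have p1 := mul_nonneg h2.le ha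
  have p2 := mul_nonneg h3.le hb
  have p3 := mul_nonneg h1.le hc
  refine pos_of_mul_pos_right (a := cr (b - a) (c - a)) ?_ h.le
  rw [hid]
  rcases hs with hs | hs | hs
  · linarith [mul_pos h2 hs]
  · linarith [mul_pos h3 hs]
  · linarith [mul_pos h1 hs]

namespace IsConvexQuad

variable {p u r s : ℂ}

theorem prs (h : IsConvexQuad p u r s) : 0 < cr (r - p) (s - p) := cr_cyc p r s ▸ h.rsp

theorem cr_openSegment (h : IsConvexQuad p u r s) {w : ℂ} (hw : w ∈ openSegment ℝ p r) :
    w ∈ openQuad p u r s := by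
  obtain ⟨t, t0, t1, rfl⟩ := mem_openSegment_iff'.1 hw
  have e1 := h.pur
  have e2 := h.rsp
  refine ⟨?_, ?_, ?_, ?_⟩
  · have : cr (u - p) (p + t * (r - p) - p) = t * cr (u - p) (r - p) := by simp [cr]; ring
    rw [this]; positivity
  · have : cr (r - u) (p + t * (r - p) - u) = (1 - t) * cr (u - p) (r - p) := by
      simp [cr]; ring
    rw [this]; exact mul_pos (by linarith) e1
  · have : cr (s - r) (p + t * (r - p) - r) = (1 - t) * cr (s - r) (p - r) := by simp [cr]; ring
    rw [this]; exact mul_pos (by linarith) e2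
  · have : cr (p - s) (p + t * (r - p) - s) = t * cr (s - r) (p - r) := by simp [cr]; ring
    rw [this]; positivity

theorem pur_subset (h : IsConvexQuad p u r s) : openTriangle p u r ⊆ openQuad p u r s := by
  intro w hw
  obtain ⟨h1, h2, -⟩ := (mem_openTriangle h.pur).1 hw
  refine ⟨h1, h2, ?_, ?_⟩
  · refine cr_pos_of_mem_openTriangle h.pur hw h.rsp.le ?_ (by simp [cr]) (Or.inl h.rsp)
    have := h.urs; rw [← cr_cyc, ← cr_cyc] at this; exact (cr_cyc u r s ▸ h.urs).le
  · refine cr_pos_of_mem_openTriangle h.pur hw (by simp only [cr]; linarith) h.spu.le ?_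
      (Or.inr (Or.inl h.spu))
    exact (cr_cyc r s p ▸ h.rsp).le

theorem prs_subset (h : IsConvexQuad p u r s) : openTriangle p r s ⊆ openQuad p u r s := by
  intro w hw
  obtain ⟨-, h2, h3⟩ := (mem_openTriangle h.prs).1 hw
  refine ⟨?_, ?_, h2, h3⟩
  · refine cr_pos_of_mem_openTriangle h.prs hw (by simp [cr]) h.pur.le ?_ (Or.inr (Or.inl h.pur))
    exact (cr_cyc s p u ▸ h.spu).le
  · refine cr_pos_of_mem_openTriangle h.prs hw (cr_cyc p u r ▸ h.pur).le
      (by simp only [cr]; linarith) h.urs.le (Or.inr (Or.inr h.urs))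

theorem openQuad_eq (h : IsConvexQuad p u r s) :
    openQuad p u r s = openTriangle p u r ∪ openTriangle p r s ∪ openSegment ℝ p r := by
  refine Subset.antisymm ?_ (union_subset (union_subset h.pur_subset h.prs_subset)
    fun w hw => h.cr_openSegment hw)
  rintro w ⟨h1, h2, h3, h4⟩
  rcases lt_trichotomy (cr (r - p) (w - p)) 0 with hlt | heq | hgt
  · refine Or.inl (Or.inl ((mem_openTriangle h.pur).2 ⟨h1, h2, ?_⟩))
    have : cr (p - r) (w - r) = - cr (r - p) (w - p) := by simp [cr]; ring
    linarith
  · have hn : r - p ≠ 0 := fun h0 => by have := h.pur; simp [h0, cr] at this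
    have hw := eq_of_cr_eq_zero hn heq
    set t := dt (r - p) (w - p) / dt (r - p) (r - p)
    have hw' : w = p + t * (r - p) := by rw [← hw]; ring
    have e1 : cr (u - p) (w - p) = t * cr (u - p) (r - p) := by rw [hw']; simp [cr]; ring
    have e2 : cr (r - u) (w - u) = (1 - t) * cr (u - p) (r - p) := by rw [hw']; simp [cr]; ring
    refine Or.inr (mem_openSegment_iff'.2 ⟨t, ?_, ?_, hw'⟩)
    · exact pos_of_mul_pos_left (e1 ▸ h1) h.pur.le
    · have := pos_of_mul_pos_left (e2 ▸ h2) h.pur.le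
      linarith
  · exact Or.inl (Or.inr ((mem_openTriangle h.prs).2 ⟨hgt, h3, h4⟩))

theorem openQuad_eq' (h : IsConvexQuad p u r s) :
    openQuad p u r s = openTriangle p u s ∪ openTriangle u r s ∪ openSegment ℝ u s := by
  rw [← openQuad_cyc, h.cyc.openQuad_eq, union_comm (openTriangle u r s), ← openTriangle_cyc u s p,
    ← openTriangle_cyc s p u]

end IsConvexQuad

variable {S : Type*} [TopologicalSpace S] {q : HalfTranslationSurface S}

theorem IsFlatTriangle.marked_notMem {f : ℂ → S} {a b c : ℂ} (h : IsFlatTriangle q f a b c) {w : ℂ}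
    (hw : w ∈ openTriangle a b c) : f w ∉ q.Z := h.flat.notMem (h.open_subset hw)

namespace StraightTriangulation

variable {τ : StraightTriangulation q} {f : ℂ → S} {p u r s : ℂ}

theorem face_marked {T : Set S} (hT : T ∈ τ.faces) {x : S} (hx : x ∈ T) : x ∉ q.Z := by
  obtain ⟨g, a, b, c, hg, rfl⟩ := τ.exists_laysOut hT
  obtain ⟨w, hw, rfl⟩ := hx
  exact hg.tri.marked_notMem hw

/-- Two faces of a straight triangulation with a common side `p`, `r`, laid out in the plane so that
they make up a strictly convex quadrilateral. -/
structure IsQuad (τ : StraightTriangulation q) (f : ℂ → S) (p u r s : ℂ) : Prop where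
  pur : τ.LaysOut f p u r
  prs : τ.LaysOut f p r s
  ne : f '' openTriangle p r s ≠ f '' openTriangle p u r
  convex : IsConvexQuad p u r s

namespace IsQuad

theorem closed_subset {a b c : ℂ} (h : τ.IsQuad f p u r s) (ha : a ∈ ({p, u, r, s} : Set ℂ))
    (hb : b ∈ ({p, u, r, s} : Set ℂ)) (hc : c ∈ ({p, u, r, s} : Set ℂ)) :
    closedTriangle a b c ⊆ closedTriangle p u r ∪ closedTriangle p r s := by
  have hpur {w : ℂ} := mem_closedTriangle (w := w) h.pur.pos
  have hprs {w : ℂ} := mem_closedTriangle (w := w) h.prs.pos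
  have hcv : Convex ℝ {w : ℂ | (0 ≤ cr (u - p) (w - p) ∧ 0 ≤ cr (r - u) (w - u)) ∧
      0 ≤ cr (s - r) (w - r) ∧ 0 ≤ cr (p - s) (w - s)} :=
    ((convex_cr_nonneg _ _).inter (convex_cr_nonneg _ _)).inter
      ((convex_cr_nonneg _ _).inter (convex_cr_nonneg _ _))
  have hv : ({p, u, r, s} : Set ℂ) ⊆ {w : ℂ | (0 ≤ cr (u - p) (w - p) ∧ 0 ≤ cr (r - u) (w - u)) ∧
      0 ≤ cr (s - r) (w - r) ∧ 0 ≤ cr (p - s) (w - s)} := by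
    have := h.convex.pur
    have := h.convex.urs
    have := h.convex.rsp
    have := h.convex.spu
    simp only [cr, Complex.sub_re, Complex.sub_im] at *
    rintro w (rfl | rfl | rfl | rfl) <;> simp only [mem_ofPred_eq] <;>
      refine ⟨⟨?_, ?_⟩, ?_, ?_⟩ <;> linarith
  intro w hw
  have hm := convexHull_min (by
    rintro x (rfl | rfl | rfl)
    exacts [hv ha, hv hb, hv hc]) hcv hw
  simp only [mem_ofPred_eq] at hm
  rcases le_total 0 (cr (r - p) (w - p)) with h0 | h0
  · exact Or.inr (hprs.2 ⟨h0, hm.2.1, hm.2.2⟩)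
  · refine Or.inl (hpur.2 ⟨hm.1.1, hm.1.2, ?_⟩)
    simp only [cr, Complex.sub_re, Complex.sub_im] at h0 ⊢; linarith

/-- An edge has no point in a face, so inside the quadrilateral the new diagonal could only run
along the old one; but the two are not parallel. -/
theorem new_notMem (h : τ.IsQuad f p u r s) : f '' segment ℝ u s ∉ τ.edges := by
  intro hmem
  have hsub : openSegment ℝ u s ⊆ openQuad p u r s := by
    rw [h.convex.openQuad_eq']; exact subset_union_right
  have hseg : ∀ w ∈ openSegment ℝ u s, cr (r - p) (w - p) = 0 := by
    intro w hw
    have hw' := hsub hw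
    rw [h.convex.openQuad_eq] at hw'
    have hwe := mem_image_of_mem f (openSegment_subset_segment ℝ u s hw)
    rcases hw' with (hw' | hw') | hw'
    · exact absurd (mem_image_of_mem f hw') (disjoint_left.1 (τ.edge_face _ hmem _ h.pur.2.1) hwe)
    · exact absurd (mem_image_of_mem f hw') (disjoint_left.1 (τ.edge_face _ hmem _ h.prs.2.1) hwe)
    · exact cr_of_mem_segment (openSegment_subset_segment ℝ p r hw')
  have h1 := hseg (u + ((1 / 2 : ℝ) : ℂ) * (s - u))
    (mem_openSegment_iff'.2 ⟨1 / 2, by norm_num, by norm_num, rfl⟩)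
  have h2 := hseg (u + ((1 / 4 : ℝ) : ℂ) * (s - u))
    (mem_openSegment_iff'.2 ⟨1 / 4, by norm_num, by norm_num, rfl⟩)
  have h3 := h.convex.pur
  simp only [cr, Complex.sub_re, Complex.sub_im, Complex.add_re, Complex.add_im,
    Complex.re_ofReal_mul, Complex.im_ofReal_mul] at h1 h2 h3
  linarith

theorem image_openQuad (h : τ.IsQuad f p u r s) : f '' openQuad p u r s =
    f '' openTriangle p u r ∪ f '' openTriangle p r s ∪ f '' openSegment ℝ p r := by
  rw [h.convex.openQuad_eq, image_union, image_union]

theorem image_openQuad' (h : τ.IsQuad f p u r s) : f '' openQuad p u r s =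
    f '' openTriangle p u s ∪ f '' openTriangle u r s ∪ f '' openSegment ℝ u s := by
  rw [h.convex.openQuad_eq', image_union, image_union]

end IsQuad

variable [T2Space S]

/-- The layouts agree along the side, hence on the overlap of the triangles, which contains points
just to the left of the midpoint. Faces with a common point coincide. -/
theorem LaysOut.face_eq_of_side {g : ℂ → S} {l u s s' : ℂ} (hf : τ.LaysOut f l u s)
    (hg : τ.LaysOut g l u s') (h : EqOn f g (segment ℝ l u)) :
    f '' openTriangle l u s = g '' openTriangle l u s' := by
  have hm := midpoint_mem_openSegment l u
  have hv : 0 < cr (u - l) (Complex.I * (u - l)) := by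
    have := dt_self_pos (sub_ne_zero.2 hf.tri.ne.symm)
    simp only [cr, dt, Complex.mul_re, Complex.mul_im, Complex.I_re, Complex.I_im] at *
    linarith
  obtain ⟨t, ht, ht'⟩ := ((eventually_mem_openTriangle_add hf.pos hm hv).and
    (eventually_mem_openTriangle_add hg.pos hm hv)).exists
  have he := hf.tri.isDevelopment.eqOn hg.tri.isDevelopment (convex_closedTriangle _ _ _)
    (convex_closedTriangle _ _ _) ⟨_, by rw [interior_inter]; exact ⟨ht, ht'⟩⟩ (toFinite _)
    (toFinite _) (disjoint_vertices hf.pos) (disjoint_vertices hg.pos) (convex_segment l u)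
    ⟨l, left_mem_segment _ _ _, u, right_mem_segment _ _ _, hf.tri.ne⟩
    (fun w hw => ⟨segment_subset_closedTriangle _ _ _ hw, segment_subset_closedTriangle _ _ _ hw⟩) h
    ⟨openTriangle_subset _ _ _ ht, openTriangle_subset _ _ _ ht'⟩
  by_contra hne
  exact disjoint_left.1 (τ.face_face _ hf.2.1 _ hg.2.1 hne) (mem_image_of_mem f ht)
    (he ▸ mem_image_of_mem g ht')

/-- The faces with a given side are those to the left and to the right of it. -/
theorem LaysOut.face_of_side {g : ℂ → S} {a b c l u s s' : ℂ} (hf : τ.LaysOut f l u s)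
    (hf' : τ.LaysOut f u l s') (hg : τ.LaysOut g a b c)
    (h : g '' segment ℝ a b = f '' segment ℝ l u) :
    g '' openTriangle a b c = f '' openTriangle l u s ∨
      g '' openTriangle a b c = f '' openTriangle u l s' := by
  obtain ⟨k, hk, hab, hfk⟩ := hf.saddle.unique' hg.saddle h
  obtain ⟨j, hj, hjk, hkj⟩ := hk.exists_inv
  have hl : τ.LaysOut (fun w => g (j w)) (k a) (k b) (k c) :=
    hg.comp hj (hjk a) (hjk b) (hjk c)
  have he : EqOn f (fun w => g (j w)) (segment ℝ (k a) (k b)) := by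
    intro w hw
    rw [← hk.image_segment] at hw
    obtain ⟨x, hx, rfl⟩ := hw
    simp only [hjk]
    exact hfk x hx
  have him := hj.image_openTriangle (f := g) hl.pos (hjk a) (hjk b) (hjk c)
  rcases hab with ⟨ha, hb⟩ | ⟨ha, hb⟩ <;> rw [ha, hb] at hl he him
  · exact Or.inl (by rw [← him, hf.face_eq_of_side hl he])
  · exact Or.inr (by rw [← him, hf'.face_eq_of_side hl he])

namespace IsQuad

theorem face_of_side (h : τ.IsQuad f p u r s) {g : ℂ → S} {a b c : ℂ} (hg : τ.LaysOut g a b c)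
    (he : g '' segment ℝ a b = f '' segment ℝ p r) :
    g '' openTriangle a b c = f '' openTriangle p u r ∨
      g '' openTriangle a b c = f '' openTriangle p r s := by
  have := h.prs.face_of_side h.pur.cyc.cyc hg he
  rw [openTriangle_cyc u r p, openTriangle_cyc p u r] at this
  exact this.symm

theorem saddle (h : τ.IsQuad f p u r s) : IsSaddleParam q f p r := h.prs.saddle

/-- The quadrilateral consists of two faces and an open edge, which are disjoint on the surface;
this is where the two faces have to be distinct. -/
theorem injOn (h : τ.IsQuad f p u r s) : InjOn f (openQuad p u r s) := by
  have d1 : ∀ w ∈ openTriangle p u r, ∀ w' ∈ openTriangle p r s, f w ≠ f w' := by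
    intro w hw w' hw' he
    exact disjoint_left.1 (τ.face_face _ h.prs.2.1 _ h.pur.2.1 h.ne) (mem_image_of_mem f hw')
      (he ▸ mem_image_of_mem f hw)
  have d2 : ∀ w ∈ openTriangle p u r, ∀ w' ∈ openSegment ℝ p r, f w ≠ f w' := by
    intro w hw w' hw' he
    exact disjoint_left.1 (τ.edge_face _ h.prs.2.2.1 _ h.pur.2.1)
      (mem_image_of_mem f (openSegment_subset_segment _ _ _ hw')) (he ▸ mem_image_of_mem f hw)
  have d3 : ∀ w ∈ openTriangle p r s, ∀ w' ∈ openSegment ℝ p r, f w ≠ f w' := by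
    intro w hw w' hw' he
    exact disjoint_left.1 (τ.edge_face _ h.prs.2.2.1 _ h.prs.2.1)
      (mem_image_of_mem f (openSegment_subset_segment _ _ _ hw')) (he ▸ mem_image_of_mem f hw)
  rw [h.convex.openQuad_eq]
  rintro x ((hx | hx) | hx) y ((hy | hy) | hy) hxy
  · exact h.pur.tri.2.2.2.2.2.2 hx hy hxy
  · exact absurd hxy (d1 x hx y hy)
  · exact absurd hxy (d2 x hx y hy)
  · exact absurd hxy.symm (d1 y hy x hx)
  · exact h.prs.tri.2.2.2.2.2.2 hx hy hxy
  · exact absurd hxy (d3 x hx y hy)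
  · exact absurd hxy.symm (d2 y hy x hx)
  · exact absurd hxy.symm (d3 y hy x hx)
  · exact h.saddle.2.2.2.2.2 hx hy hxy

/-- Each face is flat up to the common side from its own side only; flatness across it comes from
gluing. -/
theorem isDevelopment (h : τ.IsQuad f p u r s) :
    IsDevelopment q f (closedTriangle p u r ∪ closedTriangle p r s) {p, u, r, s} := by
  have hint : closedTriangle p u r ∩ closedTriangle p r s = segment ℝ p r := by
    refine Subset.antisymm ?_ fun w hw => ⟨?_, segment_subset_closedTriangle _ _ _ hw⟩
    · rintro w ⟨hw, hw'⟩
      have h1 := ((mem_closedTriangle h.pur.pos).1 hw).2.2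
      have h2 := ((mem_closedTriangle h.prs.pos).1 hw').1
      refine mem_segment_of_cr h.prs.pos hw' (le_antisymm ?_ h2)
      simp only [cr, Complex.sub_re, Complex.sub_im] at *; linarith
    · rw [closedTriangle_cyc]
      exact segment_subset_closedTriangle _ _ _ (segment_symm ℝ p r ▸ hw)
  obtain ⟨G, g1, g2, g3⟩ := h.pur.tri.isDevelopment.glue h.prs.tri.isDevelopment
    (isClosed_closedTriangle _ _ _) (isClosed_closedTriangle _ _ _) (toFinite _) (toFinite _)
    (vertices_subset _ _ _) (vertices_subset _ _ _) (fun _ _ => rfl)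
    (by rw [hint]; exact convex_segment _ _)
    (by rw [hint]; exact ⟨p, left_mem_segment _ _ _, r, right_mem_segment _ _ _, h.saddle.1⟩)
  have hG : EqOn f G (closedTriangle p u r ∪ closedTriangle p r s) := by
    rintro w (hw | hw)
    · exact (g1 hw).symm
    · exact (g2 hw).symm
  have hV : ({p, u, r} ∪ {p, r, s} : Set ℂ) = {p, u, r, s} := by ext w; simp; tauto
  rw [hV] at g3
  have hsub : ({p, u, r, s} : Set ℂ) ⊆ closedTriangle p u r ∪ closedTriangle p r s := by
    rw [← hV]; exact union_subset_union (vertices_subset _ _ _) (vertices_subset _ _ _)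
  exact ⟨g3.continuousOn.congr hG, g3.flat.congr fun w hw => hG hw.1,
    fun v hv => by rw [hG (hsub hv)]; exact g3.marked v hv⟩

theorem flat_openQuad (h : τ.IsQuad f p u r s) : IsFlatOn q f (openQuad p u r s) := by
  refine h.isDevelopment.flat.mono fun w hw => ⟨?_, ?_⟩
  · rw [h.convex.openQuad_eq] at hw
    rcases hw with (hw | hw) | hw
    · exact Or.inl (openTriangle_subset _ _ _ hw)
    · exact Or.inr (openTriangle_subset _ _ _ hw)
    · exact Or.inr (segment_subset_closedTriangle _ _ _ (openSegment_subset_segment _ _ _ hw))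
  · have hself : ∀ x : ℂ, cr x 0 = 0 := fun x => by simp [cr]
    obtain ⟨h1, h2, h3, h4⟩ := hw
    rintro (rfl | rfl | rfl | rfl)
    · simp [hself] at h1
    · simp [hself] at h2
    · simp [hself] at h3
    · simp [hself] at h4

theorem saddle' (h : τ.IsQuad f p u r s) : IsSaddleParam q f u s := by
  have hsub : openSegment ℝ u s ⊆ openQuad p u r s := by
    rw [h.convex.openQuad_eq']; exact subset_union_right
  have hD := h.isDevelopment
  refine ⟨?_, hD.continuousOn.mono fun w hw => ?_, hD.marked u (by simp), hD.marked s (by simp),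
    h.flat_openQuad.mono hsub, h.injOn.mono hsub⟩
  · rintro rfl
    have := h.convex.urs
    simp [cr] at this
  · exact h.closed_subset (a := u) (b := s) (c := u) (by simp) (by simp) (by simp)
      (segment_subset_closedTriangle _ _ _ hw)

theorem flat_left (h : τ.IsQuad f p u r s) : IsFlatTriangle q f p u s := by
  have hD := h.isDevelopment
  have hsub : openTriangle p u s ⊆ openQuad p u r s := by
    rw [h.convex.openQuad_eq']; exact fun w hw => Or.inl (Or.inl hw)
  have hcs : closedTriangle p u s ⊆ _ := h.closed_subset (by simp) (by simp) (by simp)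
  have hpos : 0 < cr (u - p) (s - p) := cr_cyc s p u ▸ h.convex.spu
  refine ⟨by rw [conj_mul_im]; exact hpos, hD.continuousOn.mono hcs, hD.marked p (by simp),
    hD.marked u (by simp), hD.marked s (by simp), hD.flat.mono fun w hw => ⟨hcs hw.1, ?_⟩,
    h.injOn.mono hsub⟩
  rintro (rfl | rfl | rfl | rfl)
  · exact hw.2 (by simp)
  · exact hw.2 (by simp)
  · have h1 := ((mem_closedTriangle hpos).1 hw.1).2.1
    have := h.convex.urs
    simp only [cr, Complex.sub_re, Complex.sub_im] at *; linarith
  · exact hw.2 (by simp)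

theorem flat_right (h : τ.IsQuad f p u r s) : IsFlatTriangle q f u r s := by
  have hD := h.isDevelopment
  have hsub : openTriangle u r s ⊆ openQuad p u r s := by
    rw [h.convex.openQuad_eq']; exact fun w hw => Or.inl (Or.inr hw)
  have hcs : closedTriangle u r s ⊆ _ := h.closed_subset (by simp) (by simp) (by simp)
  have hpos : 0 < cr (r - u) (s - u) := h.convex.urs
  refine ⟨by rw [conj_mul_im]; exact hpos, hD.continuousOn.mono hcs, hD.marked u (by simp),
    hD.marked r (by simp), hD.marked s (by simp), hD.flat.mono fun w hw => ⟨hcs hw.1, ?_⟩,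
    h.injOn.mono hsub⟩
  rintro (rfl | rfl | rfl | rfl)
  · have h1 := ((mem_closedTriangle hpos).1 hw.1).2.2
    have := h.convex.spu
    simp only [cr, Complex.sub_re, Complex.sub_im] at *; linarith
  · exact hw.2 (by simp)
  · exact hw.2 (by simp)
  · exact hw.2 (by simp)

/-- The holonomy of an edge is unique up to sign, so saddle connections that are not parallel
differ. -/
theorem side_ne {a b c d : ℂ} (h1 : IsSaddleParam q f a b) (h2 : IsSaddleParam q f c d)
    (h : cr (b - a) (d - c) ≠ 0) : f '' segment ℝ a b ≠ f '' segment ℝ c d := by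
  intro he
  have h3 := h2.hasHolonomy
  rw [← he] at h3
  rcases h1.hasHolonomy.unique h3 with h4 | h4 <;> rw [h4] at h <;>
    exact h (by simp [cr]; try ring)

theorem sides_ne (h : τ.IsQuad f p u r s) :
    f '' segment ℝ p u ≠ f '' segment ℝ p r ∧ f '' segment ℝ u r ≠ f '' segment ℝ p r ∧
    f '' segment ℝ r s ≠ f '' segment ℝ p r ∧ f '' segment ℝ s p ≠ f '' segment ℝ p r := by
  have h1 := h.convex.pur
  have h2 := h.convex.rsp
  refine ⟨side_ne h.pur.saddle h.saddle h1.ne', side_ne h.pur.cyc.saddle h.saddle ?_,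
    side_ne h.prs.cyc.saddle h.saddle ?_, side_ne h.prs.cyc.cyc.saddle h.saddle ?_⟩ <;>
  · simp only [cr, Complex.sub_re, Complex.sub_im] at *
    first
    | (apply ne_of_gt; linarith)
    | (apply ne_of_lt; linarith)

theorem edge_disjoint (h : τ.IsQuad f p u r s) {x : Set S} (hx : x ∈ τ.edges)
    (hne : x ≠ f '' segment ℝ p r) : Disjoint x (f '' openQuad p u r s) := by
  rw [h.image_openQuad, disjoint_left]
  rintro y hy ((hy' | hy') | ⟨w, hw, rfl⟩)
  · exact disjoint_left.1 (τ.edge_face _ hx _ h.pur.2.1) hy hy'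
  · exact disjoint_left.1 (τ.edge_face _ hx _ h.prs.2.1) hy hy'
  · exact h.saddle.flat.notMem hw (τ.edge_edge _ hx _ h.prs.2.2.1 hne
      ⟨hy, mem_image_of_mem f (openSegment_subset_segment _ _ _ hw)⟩)

omit [T2Space S] in
theorem face_disjoint (h : τ.IsQuad f p u r s) {T : Set S} (hT : T ∈ τ.faces)
    (h1 : T ≠ f '' openTriangle p u r) (h2 : T ≠ f '' openTriangle p r s) :
    Disjoint T (f '' openQuad p u r s) := by
  rw [h.image_openQuad, disjoint_left]
  rintro y hy ((hy' | hy') | ⟨w, hw, rfl⟩)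
  · exact disjoint_left.1 (τ.face_face _ hT _ h.pur.2.1 h1) hy hy'
  · exact disjoint_left.1 (τ.face_face _ hT _ h.prs.2.1 h2) hy hy'
  · exact disjoint_left.1 (τ.edge_face _ h.prs.2.2.1 _ hT)
      (mem_image_of_mem f (openSegment_subset_segment _ _ _ hw)) hy

/-- The other diagonal of a strictly convex quadrilateral can replace the given one. -/
theorem exists_isFlipAt (h : τ.IsQuad f p u r s) :
    ∃ τ', IsFlipAt τ τ' (f '' segment ℝ p r) (f '' segment ℝ u s) f p u r s := by
  have hU := h.image_openQuad
  have hU' := h.image_openQuad'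
  obtain ⟨n1, n2, n3, n4⟩ := h.sides_ne
  have hleft : f '' openTriangle p u s ⊆ f '' openQuad p u r s := by
    rw [hU']; exact fun w hw => Or.inl (Or.inl hw)
  have hright : f '' openTriangle u r s ⊆ f '' openQuad p u r s := by
    rw [hU']; exact fun w hw => Or.inl (Or.inr hw)
  have hdiag : f '' openSegment ℝ u s ⊆ f '' openQuad p u r s := by
    rw [hU']; exact subset_union_right
  have hedge : ∀ x ∈ f '' segment ℝ u s, x ∈ q.Z ∨ x ∈ f '' openSegment ℝ u s := by
    rintro x ⟨w, hw, rfl⟩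
    rw [segment_eq_union] at hw
    rcases hw with hw | rfl | rfl
    · exact Or.inr (mem_image_of_mem f hw)
    · exact Or.inl h.saddle'.2.2.1
    · exact Or.inl h.saddle'.2.2.2.1
  have hZ : ∀ x ∈ f '' openQuad p u r s, x ∉ q.Z := by
    rintro x ⟨w, hw, rfl⟩
    exact h.flat_openQuad.notMem hw
  have hposl : 0 < cr (u - p) (s - p) := h.flat_left.pos
  have hposr : 0 < cr (r - u) (s - u) := h.convex.urs
  -- Disjointness on the surface is checked in the plane, as the layout is injective on the open
  -- quadrilateral.
  have dis : ∀ A B : Set ℂ, A ⊆ openQuad p u r s → B ⊆ openQuad p u r s → Disjoint A B →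
      Disjoint (f '' A) (f '' B) := fun A B hA hB hd => by
    rw [disjoint_iff_inter_eq_empty, ← h.injOn.image_inter hA hB, hd.inter_eq, image_empty]
  have sl : openTriangle p u s ⊆ openQuad p u r s := by
    rw [h.convex.openQuad_eq']; exact fun w hw => Or.inl (Or.inl hw)
  have sr : openTriangle u r s ⊆ openQuad p u r s := by
    rw [h.convex.openQuad_eq']; exact fun w hw => Or.inl (Or.inr hw)
  have sd : openSegment ℝ u s ⊆ openQuad p u r s := by
    rw [h.convex.openQuad_eq']; exact subset_union_right
  have d1 : Disjoint (f '' openTriangle p u s) (f '' openTriangle u r s) := by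
    refine dis _ _ sl sr (disjoint_left.2 fun w hw hw' => ?_)
    have := ((mem_openTriangle hposl).1 hw).2.1
    have := ((mem_openTriangle hposr).1 hw').2.2
    simp only [cr, Complex.sub_re, Complex.sub_im] at *; linarith
  have d2 : Disjoint (f '' openSegment ℝ u s) (f '' openTriangle p u s) := by
    refine dis _ _ sd sl (disjoint_left.2 fun w hw hw' => ?_)
    have := ((mem_openTriangle hposl).1 hw').2.1
    rw [cr_of_mem_segment (openSegment_subset_segment _ _ _ hw)] at this
    exact lt_irrefl _ this
  have d3 : Disjoint (f '' openSegment ℝ u s) (f '' openTriangle u r s) := by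
    refine dis _ _ sd sr (disjoint_left.2 fun w hw hw' => ?_)
    have := ((mem_openTriangle hposr).1 hw').2.2
    have := cr_of_mem_segment (openSegment_subset_segment _ _ _ hw)
    simp only [cr, Complex.sub_re, Complex.sub_im] at *; linarith
  have hnew : ∀ T, T = f '' openTriangle p u s ∨ T = f '' openTriangle u r s →
      T ⊆ f '' openQuad p u r s ∧ Disjoint (f '' openSegment ℝ u s) T := by
    rintro T (rfl | rfl)
    exacts [⟨hleft, d2⟩, ⟨hright, d3⟩]
  have hold : ∀ {x}, x ∈ τ.edges → x ≠ f '' segment ℝ p r →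
      x ∈ insert (f '' segment ℝ u s) (τ.edges \ {f '' segment ℝ p r}) :=
    fun hx hne => Or.inr ⟨hx, hne⟩
  -- The four sides are not parallel to the removed diagonal, so they remain edges.
  have s1 := hold h.pur.2.2.1 n1
  have s2 := hold h.pur.2.2.2.1 n2
  have s3 := hold h.prs.2.2.2.1 n3
  have s4 := hold h.prs.2.2.2.2 n4
  let τ' : StraightTriangulation q :=
    { edges := insert (f '' segment ℝ u s) (τ.edges \ {f '' segment ℝ p r})
      faces := {f '' openTriangle p u s, f '' openTriangle u r s} ∪
        (τ.faces \ {f '' openTriangle p r s, f '' openTriangle p u r})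
      edges_finite := (τ.edges_finite.subset sdiff_subset).insert _
      faces_finite := (toFinite _).union (τ.faces_finite.subset sdiff_subset)
      edge_saddle := by
        rintro x (rfl | hx)
        · exact ⟨_, h.saddle'.hasHolonomy⟩
        · exact τ.edge_saddle x hx.1
      face_triangle := by
        rintro T ((rfl | rfl) | ⟨hT, hT'⟩)
        · exact ⟨f, p, u, s, h.flat_left, rfl, s1, mem_insert _ _, s4⟩
        · exact ⟨f, u, r, s, h.flat_right, rfl, s2, s3, segment_symm ℝ u s ▸ mem_insert _ _⟩
        · obtain ⟨g, a, b, c, hg, rfl⟩ := τ.exists_laysOut hT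
          -- Only the two halves of the quadrilateral have the removed diagonal as a side, so all
          -- sides of the other faces remain.
          have hside : ∀ a b c, τ.LaysOut g a b c → g '' openTriangle a b c ∉
              ({f '' openTriangle p r s, f '' openTriangle p u r} : Set (Set S)) →
              g '' segment ℝ a b ∈
                insert (f '' segment ℝ u s) (τ.edges \ {f '' segment ℝ p r}) := by
            intro a b c hg hT'
            exact hold hg.2.2.1 fun he => (h.face_of_side hg he).elim (fun h1 => hT' (Or.inr h1))
              fun h2 => hT' (Or.inl h2)
          refine ⟨g, a, b, c, hg.tri, rfl, hside _ _ _ hg hT', hside _ _ _ hg.cyc ?_,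
            hside _ _ _ hg.cyc.cyc ?_⟩
          · rwa [openTriangle_cyc a b c]
          · rwa [openTriangle_cyc b c a, openTriangle_cyc a b c]
      edge_edge := by
        have key : ∀ x ∈ τ.edges, x ≠ f '' segment ℝ p r → ∀ y ∈ x, y ∈ f '' segment ℝ u s →
            y ∈ q.Z := fun x hx hne y hy hy' => (hedge y hy').resolve_right fun hy'' =>
          disjoint_left.1 (h.edge_disjoint hx hne) hy (hdiag hy'')
        rintro x (rfl | ⟨hx, hx'⟩) x' (rfl | ⟨hx1, hx1'⟩) hne y ⟨hy, hy'⟩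
        · exact absurd rfl hne
        · exact key x' hx1 hx1' y hy' hy
        · exact key x hx hx' y hy hy'
        · exact τ.edge_edge x hx x' hx1 hne ⟨hy, hy'⟩
      edge_face := by
        rintro x (rfl | ⟨hx, hx'⟩) T (hT | ⟨hT, hT'⟩)
        · refine disjoint_left.2 fun y hy hy' => ?_
          obtain ⟨h1, h2⟩ := hnew T hT
          rcases hedge y hy with hy | hy
          · exact hZ y (h1 hy') hy
          · exact disjoint_left.1 h2 hy hy'
        · refine disjoint_left.2 fun y hy hy' => ?_
          rcases hedge y hy with hy | hy
          · exact face_marked hT hy' hy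
          · exact disjoint_left.1 (h.face_disjoint hT (fun h => hT' (Or.inr h))
              fun h => hT' (Or.inl h)) hy' (hdiag hy)
        · exact (h.edge_disjoint hx hx').mono_right (hnew T hT).1
        · exact τ.edge_face x hx T hT
      face_face := by
        have key : ∀ T T', T = f '' openTriangle p u s ∨ T = f '' openTriangle u r s →
            T' ∈ τ.faces \ {f '' openTriangle p r s, f '' openTriangle p u r} → Disjoint T' T :=
          fun T T' hT hT' => (h.face_disjoint hT'.1 (fun h => hT'.2 (Or.inr h))
            fun h => hT'.2 (Or.inl h)).mono_right (hnew T hT).1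
        rintro T (hT | hT) T' (hT' | hT') hne
        · rcases hT with rfl | rfl <;> rcases hT' with rfl | rfl
          exacts [absurd rfl hne, d1, d1.symm, absurd rfl hne]
        · exact (key T T' hT hT').symm
        · exact key T' T hT' hT
        · exact τ.face_face T hT.1 T' hT'.1 hne
      cover := by
        have key : ∀ x ∈ f '' openQuad p u r s,
            (∃ e ∈ insert (f '' segment ℝ u s) (τ.edges \ {f '' segment ℝ p r}), x ∈ e) ∨
            ∃ T ∈ ({f '' openTriangle p u s, f '' openTriangle u r s} : Set (Set S)) ∪
              (τ.faces \ {f '' openTriangle p r s, f '' openTriangle p u r}), x ∈ T := by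
          intro x hx
          rw [hU'] at hx
          rcases hx with (hx | hx) | hx
          · exact Or.inr ⟨_, Or.inl (Or.inl rfl), hx⟩
          · exact Or.inr ⟨_, Or.inl (Or.inr rfl), hx⟩
          · exact Or.inl ⟨_, mem_insert _ _, image_mono (openSegment_subset_segment _ _ _) hx⟩
        intro x
        rcases τ.cover x with hx | ⟨e, he, hx⟩ | ⟨T, hT, hx⟩
        · exact Or.inl hx
        · by_cases hne : e = f '' segment ℝ p r
          · rw [hne] at hx
            obtain ⟨w, hw, rfl⟩ := hx
            by_cases hwZ : f w ∈ q.Z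
            · exact Or.inl hwZ
            · refine Or.inr (key _ ?_)
              rw [hU]
              exact Or.inr (mem_image_of_mem f (h.saddle.mem_openSegment hw hwZ))
          · exact Or.inr (Or.inl ⟨e, hold he hne, hx⟩)
        · by_cases hT1 : T = f '' openTriangle p u r
          · exact Or.inr (key _ (by rw [hU]; exact Or.inl (Or.inl (hT1 ▸ hx))))
          · by_cases hT2 : T = f '' openTriangle p r s
            · exact Or.inr (key _ (by rw [hU]; exact Or.inl (Or.inr (hT2 ▸ hx))))
            · refine Or.inr (Or.inr ⟨T, Or.inr ⟨hT, ?_⟩, hx⟩)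
              rintro (h' | h')
              exacts [hT2 h', hT1 h'] }
  exact ⟨τ', h.prs, h.pur, h.ne, ⟨h.flat_left, Or.inl (Or.inl rfl), s1, mem_insert _ _, s4⟩,
    ⟨h.flat_right, Or.inl (Or.inr rfl), s2, s3, segment_symm ℝ u s ▸ mem_insert _ _⟩, rfl, rfl,
    h.new_notMem, rfl, rfl⟩

end IsQuad

end StraightTriangulation

end VeeringLattice

/-! ### Flips of veering triangulations, and their standard position -/

namespace VeeringLattice

open Set Filter

variable {S : Type*} [TopologicalSpace S] {q : HalfTranslationSurface S}

namespace IsFlipAt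

variable {τ τ' : StraightTriangulation q} {f : ℂ → S} {p u r s : ℂ} {e e' : Set S}

/-- Strict convexity amounts to the positive orientation of four triangles, the halves of the
quadrilateral before and after the flip. -/
theorem isQuad (h : IsFlipAt τ τ' e e' f p u r s) : τ.IsQuad f p u r s :=
  ⟨h.2.1, h.1, h.2.2.1, h.2.1.pos, h.2.2.2.2.1.pos, h.1.cyc.pos, h.2.2.2.1.cyc.cyc.pos⟩

theorem old_mem (h : IsFlipAt τ τ' e e' f p u r s) : e ∈ τ.edges := by
  rw [h.2.2.2.2.2.1]; exact h.1.2.2.1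

theorem new_notMem (h : IsFlipAt τ τ' e e' f p u r s) : e' ∉ τ.edges := h.2.2.2.2.2.2.2.1

theorem edges_eq (h : IsFlipAt τ τ' e e' f p u r s) : τ'.edges = insert e' (τ.edges \ {e}) :=
  h.2.2.2.2.2.2.2.2.1

theorem faces_eq (h : IsFlipAt τ τ' e e' f p u r s) :
    τ'.faces = {f '' openTriangle p u s, f '' openTriangle u r s} ∪
    (τ.faces \ {f '' openTriangle p r s, f '' openTriangle p u r}) := h.2.2.2.2.2.2.2.2.2

end IsFlipAt

namespace StraightTriangulation

variable {τ τ' : StraightTriangulation q} {f g : ℂ → S} {p u r s a b c a' b' c' : ℂ} {e e' : Set S}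

/-- A quadrilateral, turned by a half-turn. -/
theorem IsQuad.rotate (h : τ.IsQuad f p u r s) {k : ℂ → ℂ} (hk : IsHalfTranslation k)
    (hp : k p' = r) (hu : k u' = s) (hr : k r' = p) (hs : k s' = u) :
    τ.IsQuad (fun w => f (k w)) p' u' r' s' := by
  have h1 := h.prs.cyc.comp hk hp hu hr
  have h2 := h.pur.cyc.cyc.comp hk hp hr hs
  refine ⟨h1, h2, ?_, ?_⟩
  · rw [hk.image_openTriangle h1.pos hp hu hr, hk.image_openTriangle h2.pos hp hr hs,
      openTriangle_cyc p r s, openTriangle_cyc u r p, openTriangle_cyc p u r]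
    exact h.ne.symm
  · obtain ⟨c1, c2, c3, c4⟩ := h.convex
    subst hp hu hr hs
    simp only [hk.cr_sub] at c1 c2 c3 c4
    exact ⟨c3, c4, c1, c2⟩

variable [T2Space S]

theorem LaysOut.sides_eq (hg : τ.LaysOut g a b c) (hf : τ.LaysOut f a' b' c')
    (him : f '' openTriangle a' b' c' = g '' openTriangle a b c) :
    (f '' segment ℝ a' b' = g '' segment ℝ a b ∧ f '' segment ℝ b' c' = g '' segment ℝ b c ∧
      f '' segment ℝ c' a' = g '' segment ℝ c a) ∨
    (f '' segment ℝ a' b' = g '' segment ℝ b c ∧ f '' segment ℝ b' c' = g '' segment ℝ c a ∧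
      f '' segment ℝ c' a' = g '' segment ℝ a b) ∨
    (f '' segment ℝ a' b' = g '' segment ℝ c a ∧ f '' segment ℝ b' c' = g '' segment ℝ a b ∧
      f '' segment ℝ c' a' = g '' segment ℝ b c) := by
  obtain ⟨h, hh, hfg, -, hcases⟩ := hg.unique hf.tri him
  have key : ∀ x y, segment ℝ x y ⊆ closedTriangle a' b' c' →
      f '' segment ℝ x y = g '' segment ℝ (h x) (h y) := by
    intro x y hs
    rw [← hh.image_segment, image_image]
    exact image_congr fun w hw => (hfg w (hs hw)).symm
  rw [key a' b' (segment_subset_closedTriangle _ _ _),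
    key b' c' (closedTriangle_cyc a' b' c' ▸ segment_subset_closedTriangle _ _ _),
    key c' a' (by
      rw [← closedTriangle_cyc, ← closedTriangle_cyc]; exact segment_subset_closedTriangle _ _ _)]
  rcases hcases with ⟨h1, h2, h3⟩ | ⟨h1, h2, h3⟩ | ⟨h1, h2, h3⟩ <;> rw [h1, h2, h3]
  · exact Or.inl ⟨rfl, rfl, rfl⟩
  · exact Or.inr (Or.inl ⟨rfl, rfl, rfl⟩)
  · exact Or.inr (Or.inr ⟨rfl, rfl, rfl⟩)

theorem IsQuad.disjoint_new (h : τ.IsQuad f p u r s) :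
    Disjoint (f '' openTriangle p u s) (f '' openTriangle u r s) := by
  have sl : openTriangle p u s ⊆ openQuad p u r s := by
    rw [h.convex.openQuad_eq']; exact fun w hw => Or.inl (Or.inl hw)
  have sr : openTriangle u r s ⊆ openQuad p u r s := by
    rw [h.convex.openQuad_eq']; exact fun w hw => Or.inl (Or.inr hw)
  rw [disjoint_iff_inter_eq_empty, ← h.injOn.image_inter sl sr, image_eq_empty,
    ← disjoint_iff_inter_eq_empty, disjoint_left]
  intro w hw hw'
  have := ((mem_openTriangle h.flat_left.pos).1 hw).2.1
  have := ((mem_openTriangle h.convex.urs).1 hw').2.2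
  simp only [cr, Complex.sub_re, Complex.sub_im] at *; linarith

theorem IsQuad.left_notMem (h : τ.IsQuad f p u r s) : f '' openTriangle p u s ∉ τ.faces :=
  fun hm => h.new_notMem (LaysOut.of_face h.flat_left hm).2.2.2.1

theorem IsQuad.right_notMem (h : τ.IsQuad f p u r s) : f '' openTriangle u r s ∉ τ.faces :=
  fun hm => h.new_notMem (segment_symm ℝ u s ▸ (LaysOut.of_face h.flat_right hm).2.2.2.2)

end StraightTriangulation

variable [T2Space S]

theorem IsRed.not_isBlue {e : Set S} (h : IsRed q e) : ¬ IsBlue q e := by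
  intro h'
  obtain ⟨v, hv, -⟩ := id h
  have := hv.isRed_iff.1 h
  have := hv.isBlue_iff.1 h'
  linarith

namespace IsFlipAt

variable {τ τ' : StraightTriangulation q} {f : ℂ → S} {p u r s : ℂ} {e e' : Set S}

/-- The inverse flip takes place in the same quadrilateral, with the vertices renamed by one step,
which exchanges the diagonals. -/
theorem symm (h : IsFlipAt τ τ' e e' f p u r s) : IsFlipAt τ' τ e' e f u r s p := by
  have hq := h.isQuad
  have hne : e ≠ e' := fun he => h.new_notMem (he ▸ h.old_mem)
  have hl := hq.left_notMem
  have hr := hq.right_notMem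
  refine ⟨h.2.2.2.1.cyc, h.2.2.2.2.1, ?_, h.2.1.cyc, h.1.cyc, h.2.2.2.2.2.2.1,
    by rw [h.2.2.2.2.2.1, segment_symm], ?_, ?_, ?_⟩
  · rw [openTriangle_cyc p u s]
    intro he
    have := hq.disjoint_new
    rw [he, disjoint_self, bot_eq_empty, image_eq_empty] at this
    exact (openTriangle_nonempty h.2.2.2.2.1.pos).ne_empty this
  · rw [h.edges_eq]
    rintro (he | he)
    exacts [hne he, he.2 rfl]
  · rw [h.edges_eq]
    ext x
    simp only [mem_insert_iff, Set.mem_sdiff, mem_singleton_iff]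
    constructor
    · intro hx
      by_cases hxe : x = e
      · exact Or.inl hxe
      · exact Or.inr ⟨Or.inr ⟨hx, hxe⟩, fun hx' => h.new_notMem (hx' ▸ hx)⟩
    · rintro (rfl | ⟨rfl | hx, hx'⟩)
      exacts [h.old_mem, absurd rfl hx', hx.1]
  · rw [h.faces_eq, openTriangle_cyc p u r, openTriangle_cyc p r s, openTriangle_cyc p u s]
    ext x
    simp only [mem_union, mem_insert_iff, Set.mem_sdiff, mem_singleton_iff]
    constructor
    · intro hx
      by_cases h1 : x = f '' openTriangle p u r
      · exact Or.inl (Or.inl h1)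
      by_cases h2 : x = f '' openTriangle p r s
      · exact Or.inl (Or.inr h2)
      refine Or.inr ⟨Or.inr ⟨hx, fun h => h.elim h2 h1⟩, ?_⟩
      rintro (rfl | rfl)
      exacts [hl hx, hr hx]
    · rintro ((rfl | rfl) | ⟨h3 | hx, hx'⟩)
      exacts [h.2.1.2.1, h.1.2.1, absurd h3 hx', hx.1]

omit [T2Space S] in
theorem rotate (h : IsFlipAt τ τ' e e' f p u r s) {k : ℂ → ℂ} (hk : IsHalfTranslation k)
    {p' u' r' s' : ℂ} (hp : k p' = r) (hu : k u' = s) (hr : k r' = p) (hs : k s' = u) :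
    IsFlipAt τ τ' e e' (fun w => f (k w)) p' u' r' s' := by
  have hq := h.isQuad.rotate hk hp hu hr hs
  have h1 := h.2.2.2.2.1.cyc.comp hk hp hu hs
  have h2 := h.2.2.2.1.cyc.cyc.comp hk hu hr hs
  have seg : ∀ x y, (fun w => f (k w)) '' segment ℝ x y = f '' segment ℝ (k x) (k y) := by
    intro x y; rw [← hk.image_segment, image_image]
  refine ⟨hq.prs, hq.pur, hq.ne, h1, h2, ?_, ?_, h.new_notMem, h.edges_eq, ?_⟩
  · rw [seg, hp, hr, segment_symm]; exact h.2.2.2.2.2.1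
  · rw [seg, hu, hs, segment_symm]; exact h.2.2.2.2.2.2.1
  · rw [h.faces_eq, hk.image_openTriangle h1.pos hp hu hs, hk.image_openTriangle h2.pos hu hr hs,
      hk.image_openTriangle hq.prs.pos hp hr hs, hk.image_openTriangle hq.pur.pos hp hu hr,
      openTriangle_cyc u r s, openTriangle_cyc u s p, openTriangle_cyc p u s,
      openTriangle_cyc u r p, openTriangle_cyc p u r, openTriangle_cyc p r s]
    congr 1
    · exact pair_comm _ _
    · rw [pair_comm]

end IsFlipAt

/-- Renaming the vertices by one step exchanges the diagonals and also the two colour patterns. So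
only forward flips need to be studied. -/
theorem isBackwardFlip_iff {τ τ' : VeeringTriangulation q} {e e' : Set S} :
    IsBackwardFlip τ τ' e e' ↔ IsForwardFlip τ' τ e' e := by
  have seg : ∀ (f : ℂ → S) x y, f '' segment ℝ x y = f '' segment ℝ y x := fun f x y => by
    rw [segment_symm]
  constructor
  · rintro ⟨f, p, u, r, s, h, h1, h2, h3, h4⟩
    exact ⟨f, u, r, s, p, h.symm, h2, h3, h4, h1⟩
  · rintro ⟨f, p, u, r, s, h, h1, h2, h3, h4⟩
    exact ⟨f, u, r, s, p, h.symm, h2, h3, h4, h1⟩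

namespace VeeringTriangulation

variable {τ τ' : VeeringTriangulation q} {f g : ℂ → S} {p u r s a b c a' b' c' : ℂ} {e e' : Set S}

/-- A quadrilateral with sides alternating in colour and with an oblique second diagonal can be
flipped. -/
theorem exists_isForwardFlip (h : τ.toStraightTriangulation.IsQuad f p u r s)
    (h1 : IsBlue q (f '' segment ℝ r s)) (h2 : IsRed q (f '' segment ℝ s p))
    (h3 : IsBlue q (f '' segment ℝ p u)) (h4 : IsRed q (f '' segment ℝ u r))
    (hre : (s - u).re ≠ 0) (him : (s - u).im ≠ 0) : ∃ τ' : VeeringTriangulation q,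
      IsFlipAt τ.toStraightTriangulation τ'.toStraightTriangulation (f '' segment ℝ p r)
        (f '' segment ℝ u s) f p u r s := by
  obtain ⟨σ, hσ⟩ := h.exists_isFlipAt
  obtain ⟨n1, n2, n3, n4⟩ := h.sides_ne
  have hold : ∀ {x}, x ∈ τ.edges → x ≠ f '' segment ℝ p r → x ∈ σ.edges := fun hx hne => by
    rw [hσ.edges_eq]; exact Or.inr ⟨hx, hne⟩
  refine ⟨⟨σ, ?_, ?_, ?_⟩, hσ⟩
  · intro x hx
    rw [hσ.edges_eq] at hx
    rcases hx with rfl | hx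
    · rw [h.saddle'.hasHolonomy.isRed_iff, h.saddle'.hasHolonomy.isBlue_iff]
      exact (mul_ne_zero hre him).lt_or_gt.symm
    · exact τ.coloured x hx.1
  · intro g a b c hg
    have hT := hg.2.1
    rw [hσ.faces_eq] at hT
    have r1 := h2.not_isBlue
    have r2 := h4.not_isBlue
    have r3 : ¬ IsRed q (f '' segment ℝ r s) := fun h => h.not_isBlue h1
    have r4 : ¬ IsRed q (f '' segment ℝ p u) := fun h => h.not_isBlue h3
    -- Each of the new faces has one red and one blue side of the quadrilateral; the other faces are
    -- old.
    rcases hT with (hT | hT) | hT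
    · rcases hσ.2.2.2.1.sides_eq hg hT with ⟨e1, e2, e3⟩ | ⟨e1, e2, e3⟩ | ⟨e1, e2, e3⟩ <;>
        rw [e1, e2, e3] <;> tauto
    · rcases hσ.2.2.2.2.1.sides_eq hg hT with ⟨e1, e2, e3⟩ | ⟨e1, e2, e3⟩ | ⟨e1, e2, e3⟩ <;>
        rw [e1, e2, e3] <;> tauto
    · exact τ.triangle_colours g a b c (StraightTriangulation.LaysOut.of_face hg.tri hT.1)
  -- If the edge that provided a colour at `z` is the removed one, `z` is an end of it, where a red
  -- and a blue side of the quadrilateral meet.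
  · intro z hz
    have hend : z ∈ f '' segment ℝ p r → z = f p ∨ z = f r := by
      rintro ⟨w, hw, rfl⟩
      rw [segment_eq_union] at hw
      rcases hw with hw | rfl | rfl
      · exact absurd hz (h.saddle.flat.notMem hw)
      · exact Or.inl rfl
      · exact Or.inr rfl
    obtain ⟨⟨x, hx, hzx, hxr⟩, y, hy, hzy, hyb⟩ := τ.vertex_colours z hz
    constructor
    · by_cases hne : x = f '' segment ℝ p r
      · rcases hend (hne ▸ hzx) with rfl | rfl
        · exact ⟨_, hold h.prs.2.2.2.2 n4, mem_image_of_mem f (right_mem_segment _ _ _), h2⟩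
        · exact ⟨_, hold h.pur.2.2.2.1 n2, mem_image_of_mem f (right_mem_segment _ _ _), h4⟩
      · exact ⟨x, hold hx hne, hzx, hxr⟩
    · by_cases hne : y = f '' segment ℝ p r
      · rcases hend (hne ▸ hzy) with rfl | rfl
        · exact ⟨_, hold h.pur.2.2.1 n1, mem_image_of_mem f (left_mem_segment _ _ _), h3⟩
        · exact ⟨_, hold h.prs.2.2.2.1 n3, mem_image_of_mem f (left_mem_segment _ _ _), h1⟩
      · exact ⟨y, hold hy hne, hzy, hyb⟩

/-- A quadrilateral in standard position: the lowest vertex is `0`, the highest one is `s`, and they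
lie between the vertices `c` and `b` in the horizontal direction. -/
structure IsStdQuad (τ : VeeringTriangulation q) (f : ℂ → S) (c b s : ℂ) : Prop where
  quad : τ.toStraightTriangulation.IsQuad f c 0 b s
  re_neg : c.re < 0
  re_pos : 0 < b.re
  lt_re : c.re < s.re
  re_lt : s.re < b.re
  im_lt_right : b.im < s.im
  im_lt_left : c.im < s.im

namespace IsStdQuad

omit [T2Space S] in
theorem isUpright (h : τ.IsStdQuad f c b s) : τ.IsUpright f b c :=
  ⟨h.quad.pur.cyc, h.re_neg, h.re_pos⟩

/-- The half-turn about `s / 2` exchanges the lowest and the highest vertex. Statements about the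
bottom thereby apply to the top. -/
theorem rotate (h : τ.IsStdQuad f c b s) :
    τ.IsStdQuad (fun w => f (-w + s)) (s - b) (s - c) s := by
  have := h.isUpright.im_pos
  refine ⟨h.quad.rotate (IsHalfTranslation.neg_add s) ?_ ?_ ?_ ?_, ?_, ?_, ?_, ?_, ?_, ?_⟩
  any_goals simp
  all_goals linarith [h.re_neg, h.re_pos, h.lt_re, h.re_lt]

theorem im_pos (h : τ.IsStdQuad f c b s) : 0 < s.im :=
  h.isUpright.im_pos.1.trans h.im_lt_right

theorem colours (h : τ.IsStdQuad f c b s) : IsBlue q (f '' segment ℝ b s) ∧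
    IsRed q (f '' segment ℝ s c) ∧ IsBlue q (f '' segment ℝ c 0) ∧ IsRed q (f '' segment ℝ 0 b) := by
  have := h.isUpright.im_pos
  have h1 := h.re_neg
  have h2 := h.re_pos
  have h3 := h.lt_re
  have h4 := h.re_lt
  have h5 := h.im_lt_right
  have h6 := h.im_lt_left
  rw [h.quad.prs.cyc.saddle.hasHolonomy.isBlue_iff, h.quad.prs.cyc.cyc.saddle.hasHolonomy.isRed_iff,
    h.quad.pur.saddle.hasHolonomy.isBlue_iff, h.quad.pur.cyc.saddle.hasHolonomy.isRed_iff]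
  simp only [Complex.sub_re, Complex.sub_im, Complex.zero_re, Complex.zero_im]
  refine ⟨mul_neg_of_neg_of_pos ?_ ?_, mul_pos_of_neg_of_neg ?_ ?_, mul_neg_of_pos_of_neg ?_ ?_,
    mul_pos ?_ ?_⟩ <;> linarith

theorem exists_isFlipAt (h : τ.IsStdQuad f c b s) (hs : s.re ≠ 0) : ∃ τ' : VeeringTriangulation q,
    IsFlipAt τ.toStraightTriangulation τ'.toStraightTriangulation (f '' segment ℝ c b)
      (f '' segment ℝ 0 s) f c 0 b s := by
  obtain ⟨h1, h2, h3, h4⟩ := h.colours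
  exact exists_isForwardFlip h.quad h1 h2 h3 h4 (by simpa using hs) (by simpa using h.im_pos.ne')

theorem isForwardFlip (h : τ.IsStdQuad f c b s)
    (hf : IsFlipAt τ.toStraightTriangulation τ'.toStraightTriangulation e e' f c 0 b s) :
    IsForwardFlip τ τ' e e' := by
  obtain ⟨h1, h2, h3, h4⟩ := h.colours
  exact ⟨f, c, 0, b, s, hf, h1, h2, h3, h4⟩

theorem re_ne (hf : IsFlipAt τ.toStraightTriangulation τ'.toStraightTriangulation e e' f c 0 b s) :
    s.re ≠ 0 := by
  have he : f '' segment ℝ 0 s ∈ τ'.edges := by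
    have := hf.edges_eq
    rw [this, hf.2.2.2.2.2.2.1]; exact mem_insert _ _
  have := (τ'.re_im_ne he hf.isQuad.saddle'.hasHolonomy).1
  simpa using this

end IsStdQuad

/-- Every forward flip can be laid out in standard position. -/
theorem _root_.VeeringLattice.IsForwardFlip.exists_isStdQuad (h : IsForwardFlip τ τ' e e') :
    ∃ f c b s, τ.IsStdQuad f c b s ∧
      IsFlipAt τ.toStraightTriangulation τ'.toStraightTriangulation e e' f c 0 b s := by
  obtain ⟨f, p, u, r, s, hf, h1, h2, h3, h4⟩ := h
  -- The case where the flipped edge runs from left to right; the other one is reduced to it by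
  -- naming the vertices from the opposite end.
  have key : ∀ (f : ℂ → S) (p u r s : ℂ),
      IsFlipAt τ.toStraightTriangulation τ'.toStraightTriangulation e e' f p u r s →
      (r - s).re * (r - s).im < 0 → 0 < (s - p).re * (s - p).im → (u - p).re * (u - p).im < 0 →
      0 < (r - u).re * (r - u).im → 0 < (r - p).re →
      ∃ f c b s, τ.IsStdQuad f c b s ∧
        IsFlipAt τ.toStraightTriangulation τ'.toStraightTriangulation e e' f c 0 b s := by
    intro f p u r s hf h1 h2 h3 h4 h5
    have hpos1 := hf.isQuad.convex.prs
    have hpos2 := hf.isQuad.convex.pur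
    -- The colours fix the direction of each side up to sign, and the orientation of the two
    -- triangles fixes the signs.
    have l1 : 0 < (s - p).re ∧ 0 < (s - p).im ∧ 0 < (r - s).re ∧ (r - s).im < 0 := by
      have e1 : cr (r - p) (s - p) = (r - s).re * (s - p).im - (r - s).im * (s - p).re := by
        simp only [cr, Complex.sub_re, Complex.sub_im]; ring
      have e2 : (r - p).re = (r - s).re + (s - p).re := by simp
      rw [e1] at hpos1
      rw [e2] at h5
      rcases mul_pos_iff.1 h2 with ⟨a1, a2⟩ | ⟨a1, a2⟩ <;>
        rcases mul_neg_iff.1 h1 with ⟨a3, a4⟩ | ⟨a3, a4⟩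
      · exact ⟨a1, a2, a3, a4⟩
      · exfalso; nlinarith [mul_pos a2 (neg_pos.2 a3), mul_pos a1 a4]
      · exfalso; nlinarith [mul_pos (neg_pos.2 a2) a3, mul_pos (neg_pos.2 a1) (neg_pos.2 a4)]
      · linarith
    have l2 : 0 < (u - p).re ∧ (u - p).im < 0 ∧ 0 < (r - u).re ∧ 0 < (r - u).im := by
      have e1 : cr (u - p) (r - p) = (u - p).re * (r - u).im - (u - p).im * (r - u).re := by
        simp only [cr, Complex.sub_re, Complex.sub_im]; ring
      have e2 : (r - p).re = (r - u).re + (u - p).re := by simp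
      rw [e1] at hpos2
      rw [e2] at h5
      rcases mul_neg_iff.1 h3 with ⟨a1, a2⟩ | ⟨a1, a2⟩ <;>
        rcases mul_pos_iff.1 h4 with ⟨a3, a4⟩ | ⟨a3, a4⟩
      · exact ⟨a1, a2, a3, a4⟩
      · exfalso; nlinarith [mul_pos a1 (neg_pos.2 a4), mul_pos (neg_pos.2 a2) (neg_pos.2 a3)]
      · exfalso; nlinarith [mul_pos (neg_pos.2 a1) a4, mul_pos a2 a3]
      · linarith
    simp only [Complex.sub_re, Complex.sub_im] at l1 l2
    obtain ⟨j1, j2, j3, j4⟩ := l1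
    obtain ⟨k1, k2, k3, k4⟩ := l2
    -- turn twice, the second time with a translation built in
    have hf1 := hf.rotate (IsHalfTranslation.neg_add 0) (p' := -r) (u' := -s) (r' := -p) (s' := -u)
      (by simp) (by simp) (by simp) (by simp)
    have hf2 := hf1.rotate (IsHalfTranslation.neg_add (-u)) (p' := p - u) (u' := 0) (r' := r - u)
      (s' := s - u) (by ring) (by ring) (by ring) (by ring)
    exact ⟨_, _, _, _, ⟨hf2.isQuad, by simp; linarith, by simp; linarith, by simp; linarith,
      by simp; linarith, by simp; linarith, by simp; linarith⟩, hf2⟩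
  have hq := hf.isQuad
  rw [hq.prs.cyc.saddle.hasHolonomy.isBlue_iff] at h1
  rw [hq.prs.cyc.cyc.saddle.hasHolonomy.isRed_iff] at h2
  rw [hq.pur.saddle.hasHolonomy.isBlue_iff] at h3
  rw [hq.pur.cyc.saddle.hasHolonomy.isRed_iff] at h4
  have hne := (τ.re_im_ne hq.prs.2.2.1 hq.saddle.hasHolonomy).1
  simp only [Complex.sub_re, Complex.sub_im] at h1 h2 h3 h4 hne
  rcases hne.lt_or_gt with h5 | h5
  · refine key _ _ _ _ _ (hf.rotate IsHalfTranslation.id (p' := r) (u' := s) (r' := p) (s' := u)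
      rfl rfl rfl rfl) ?_ ?_ ?_ ?_ ?_ <;> simp <;> linarith
  · refine key f p u r s hf ?_ ?_ ?_ ?_ ?_ <;> simp <;> linarith

end VeeringTriangulation

end VeeringLattice

/-! ### Boxes of quadrilaterals; a forward flip makes the wedges smaller -/

namespace VeeringLattice

open Set Filter

variable {S : Type*} [TopologicalSpace S] {q : HalfTranslationSurface S} [T2Space S]

namespace VeeringTriangulation

variable {τ τ' : VeeringTriangulation q} {f g : ℂ → S} {s b c b' c' : ℂ} {e e' : Set S}

/-- The upright layout of a face is unique. -/
theorem IsUpright.unique (h : τ.IsUpright f b c) (h' : τ.IsUpright g b' c')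
    (him : g '' openTriangle 0 b' c' = f '' openTriangle 0 b c) :
    b' = b ∧ c' = c ∧ EqOn g f (closedTriangle 0 b c) := by
  obtain ⟨k, hk, hkf, -, hcases⟩ := h.laysOut.unique h'.laysOut.tri him
  have i1 := h.im_pos
  have i2 := h'.im_pos
  have r1 := h.re_neg
  have r2 := h.re_pos
  have r3 := h'.re_neg
  have r4 := h'.re_pos
  rcases hk.sub_eq with hs | hs <;> have e1 := hs b' 0 <;> have e2 := hs c' 0 <;>
    rcases hcases with ⟨k1, k2, k3⟩ | ⟨k1, k2, k3⟩ | ⟨k1, k2, k3⟩ <;>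
    rw [k1, k2] at e1 <;> rw [k1, k3] at e2
  · have hid : ∀ w, k w = w := fun w => by have := hs w 0; rw [k1] at this; simpa using this
    have hb : b' = b := by rw [← k2, hid]
    have hc : c' = c := by rw [← k3, hid]
    subst hb hc
    exact ⟨rfl, rfl, fun w hw => by rw [← hkf w hw, hid]⟩
  -- With a half-turn or a nontrivial cyclic shift, some vertex would be on the wrong side of `0`.
  all_goals
    exfalso
    have a1 := congrArg Complex.re e1
    have a2 := congrArg Complex.re e2
    have a3 := congrArg Complex.im e1
    have a4 := congrArg Complex.im e2
    simp at a1 a2 a3 a4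
    linarith

omit [T2Space S] in
theorem isUpright_opposite (h2 : τ.LaysOut f c b s) (h3 : c.re < s.re) (h4 : s.re < b.re) :
    τ.IsUpright (fun w => f (-w + s)) (s - c) (s - b) :=
  ⟨h2.cyc.cyc.comp (IsHalfTranslation.neg_add s) (by simp) (by simp) (by simp),
    by simp; linarith, by simp; linarith⟩

/-- Two faces on both sides of the widest edge of both form a quadrilateral in standard position. -/
theorem IsUpright.isStdQuad (h : τ.IsUpright f b c) (h2 : τ.LaysOut f c b s)
    (h3 : c.re < s.re) (h4 : s.re < b.re) : τ.IsStdQuad f c b s := by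
  have h' := isUpright_opposite h2 h3 h4
  have i1 := h.im_pos
  have i2 := h'.im_pos
  have r1 := h.re_neg
  have r2 := h.re_pos
  have hp := h.pos
  have hp2 := h2.pos
  simp only [Complex.sub_im, sub_pos] at i2
  refine ⟨⟨h.laysOut.cyc.cyc, h2, fun him => ?_, ?_, ?_, ?_, ?_⟩, r1, r2, h3, h4, i2.2, i2.1⟩
  -- If both halves were the same face, the uniqueness of upright layouts would make the layout
  -- invariant under the half-turn about the midpoint of the top side, which would fold that side.
  -- The points at one and at three quarters of it contradict injectivity.
  · have him' : (fun w => f (-w + s)) '' openTriangle 0 (s - c) (s - b) =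
        f '' openTriangle 0 b c := by
      rw [(IsHalfTranslation.neg_add s).image_openTriangle (f := f) (a := s) (b := c) (c := b)
        h'.laysOut.pos (by simp) (by simp) (by simp), openTriangle_cyc b s c, openTriangle_cyc c b s,
        him, openTriangle_cyc b c 0, openTriangle_cyc 0 b c]
    obtain ⟨e1, e2, he⟩ := h.unique h' him'
    have hs : s = b + c := by rw [← e1]; ring
    have hsd := h.laysOut.cyc.saddle
    have m1 : b + ((1 / 4 : ℝ) : ℂ) * (c - b) ∈ openSegment ℝ b c :=
      mem_openSegment_iff'.2 ⟨_, by norm_num, by norm_num, rfl⟩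
    have m2 : -(b + ((1 / 4 : ℝ) : ℂ) * (c - b)) + s ∈ openSegment ℝ b c :=
      mem_openSegment_iff'.2 ⟨3 / 4, by norm_num, by norm_num, by rw [hs]; push_cast; ring⟩
    have hcl : b + ((1 / 4 : ℝ) : ℂ) * (c - b) ∈ closedTriangle 0 b c := by
      rw [← closedTriangle_cyc]
      exact segment_subset_closedTriangle _ _ _ (openSegment_subset_segment _ _ _ m1)
    have := hsd.2.2.2.2.2 m2 m1 (he hcl)
    have hre := congrArg Complex.re this
    simp [hs] at hre
    linarith
  · exact cr_cyc c 0 b ▸ (cr_cyc 0 b c ▸ h.laysOut.pos)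
  · simp only [cr, sub_zero]
    rcases le_total s.re 0 with hs | hs
    · nlinarith [mul_pos r2 (i1.1.trans i2.2), mul_nonneg i1.1.le (neg_nonneg.2 hs)]
    · nlinarith [mul_pos r2 (sub_pos.2 i2.2), mul_pos i1.1 (sub_pos.2 h4)]
  · exact cr_cyc c b s ▸ hp2
  · simp only [cr, Complex.sub_re, Complex.sub_im, Complex.zero_re, Complex.zero_im]
    rcases le_total s.re 0 with hs | hs
    · nlinarith [mul_pos (neg_pos.2 r1) (sub_pos.2 i2.1), mul_pos i1.2 (sub_pos.2 h3)]
    · nlinarith [mul_pos (neg_pos.2 r1) (i1.1.trans i2.2), mul_nonneg i1.2.le hs]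

namespace IsStdQuad

theorem isUpright_opposite (h : τ.IsStdQuad f c b s) :
    τ.IsUpright (fun w => f (-w + s)) (s - c) (s - b) := h.rotate.isUpright

/-- The bounding box of a quadrilateral in standard position develops on the surface, and contains
no marked points but the vertices. -/
theorem exists_box (h : τ.IsStdQuad f c b s) :
    ∃ F, EqOn F f (closedTriangle 0 b c ∪ closedTriangle c b s) ∧
      IsDevelopment q F (rect c.re b.re 0 s.im) {0, b, c, s} := by
  have i1 := h.isUpright.im_pos
  have r1 := h.re_neg
  have r2 := h.re_pos
  have r3 := h.im_lt_left
  have r4 := h.im_lt_right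
  -- The rectangle is the union of the boxes of the two halves, the upper one turned by a half-turn.
  -- They overlap in the horizontal strip between the heights of `b` and `c`.
  obtain ⟨F, f1, f2⟩ := h.isUpright.exists_box
  obtain ⟨F', f1', f2'⟩ := h.isUpright_opposite.exists_box
  have hk := IsHalfTranslation.neg_add s
  have f3 := f2'.comp hk
  have hD' : (fun w => -w + s) ⁻¹' box (s - c) (s - b) = rect c.re b.re (min b.im c.im) s.im := by
    ext w
    simp only [mem_preimage, mem_box, mem_rect, Complex.sub_re, Complex.sub_im, Complex.add_re,
      Complex.add_im, Complex.neg_re, Complex.neg_im, le_max_iff, min_le_iff]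
    constructor
    · rintro ⟨⟨w1, w2⟩, w3, w4⟩
      refine ⟨⟨by linarith, by linarith⟩, ?_, by linarith⟩
      rcases w4 with w4 | w4
      · right; linarith
      · left; linarith
    · rintro ⟨⟨w1, w2⟩, w3, w4⟩
      refine ⟨⟨by linarith, by linarith⟩, by linarith, ?_⟩
      rcases w3 with w3 | w3
      · right; linarith
      · left; linarith
  have hV' : (fun w => -w + s) ⁻¹' {0, s - c, s - b} = {s, c, b} := by
    ext w
    simp only [mem_preimage, mem_insert_iff, mem_singleton_iff]
    have e1 : -w + s = 0 ↔ w = s := by rw [neg_add_eq_zero]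
    have e2 : -w + s = s - c ↔ w = c := ⟨fun h => by linear_combination -h, fun h => by rw [h]; ring⟩
    have e3 : -w + s = s - b ↔ w = b := ⟨fun h => by linear_combination -h, fun h => by rw [h]; ring⟩
    rw [e1, e2, e3]
  rw [hD', hV'] at f3
  have htri : ∀ w ∈ closedTriangle c b s, F' (-w + s) = f w := by
    intro w hw
    have : -w + s ∈ closedTriangle 0 (s - c) (s - b) := by
      have := (hk.mem_closedTriangle s c b w).2 (by
        rw [← closedTriangle_cyc, ← closedTriangle_cyc] at hw; exact hw)
      convert this using 2 <;> ring
    rw [f1' this]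
    simp
  have hsub1 : closedTriangle 0 b c ⊆ box b c := h.isUpright.triangle_subset_box
  have hmem : ∀ w ∈ ({c, b, s} : Set ℂ), w ∈ rect c.re b.re (min b.im c.im) s.im := by
    rintro w (rfl | rfl | rfl) <;> rw [mem_rect]
    · exact ⟨⟨le_rfl, by linarith⟩, min_le_right _ _, r3.le⟩
    · exact ⟨⟨by linarith, le_rfl⟩, min_le_left _ _, r4.le⟩
    · exact ⟨⟨h.lt_re.le, h.re_lt.le⟩, min_le_of_left_le r4.le, le_rfl⟩
  have hsub2 : closedTriangle c b s ⊆ rect c.re b.re (min b.im c.im) s.im :=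
    convexHull_min hmem (convex_rect _ _ _ _)
  have hseg1 : segment ℝ b c ⊆ closedTriangle 0 b c := by
    rw [← closedTriangle_cyc]; exact segment_subset_closedTriangle _ _ _
  have hseg2 : segment ℝ b c ⊆ closedTriangle c b s := by
    rw [segment_symm]; exact segment_subset_closedTriangle _ _ _
  have hint : box b c ∩ rect c.re b.re (min b.im c.im) s.im =
      rect c.re b.re (min b.im c.im) (max b.im c.im) := by
    rw [box, rect_inter, max_self, min_self, max_eq_right (le_min i1.1.le i1.2.le),
      min_eq_left (max_le r4.le r3.le)]
  -- The strip has an interior because the common side is not horizontal; the identity principle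
  -- needs this.
  have hlt : min b.im c.im < max b.im c.im := by
    rcases h.isUpright.top_im_ne.lt_or_gt with hh | hh
    · rw [min_eq_left hh.le, max_eq_right hh.le]; exact hh
    · rw [min_eq_right hh.le, max_eq_left hh.le]; exact hh
  have hni := interior_rect_nonempty (x₁ := c.re) (x₂ := b.re) (by linarith) hlt
  have heq : EqOn F (fun w => F' (-w + s)) (box b c ∩ rect c.re b.re (min b.im c.im) s.im) := by
    refine f2.eqOn f3 (convex_rect _ _ _ _) (convex_rect _ _ _ _) (hint ▸ hni) (toFinite _)
      (toFinite _) (disjoint_interior_box _ _) ?_ (convex_segment b c)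
      ⟨b, left_mem_segment _ _ _, c, right_mem_segment _ _ _, h.isUpright.laysOut.cyc.tri.ne⟩
      (fun w hw => ⟨hsub1 (hseg1 hw), hsub2 (hseg2 hw)⟩)
      fun w hw => by rw [f1 (hseg1 hw), htri w (hseg2 hw)]
    rw [disjoint_left]
    rintro w (rfl | rfl | rfl) hw <;> rw [mem_interior_rect] at hw
    · exact lt_irrefl _ hw.2.2
    · exact lt_irrefl _ hw.1.1
    · exact lt_irrefl _ hw.1.2
  obtain ⟨G, g1, g2, g3⟩ := f2.glue f3 (isClosed_rect _ _ _ _) (isClosed_rect _ _ _ _) (toFinite _)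
    (toFinite _) ((vertices_subset _ _ _).trans hsub1) (by
      rintro w (rfl | rfl | rfl) <;> exact hmem _ (by simp))
    heq (hint ▸ convex_rect _ _ _ _) (hint ▸ by
      obtain ⟨x, hx⟩ := hni
      exact ⟨b, mem_rect.2 ⟨⟨by linarith, le_rfl⟩, min_le_left _ _, le_max_left _ _⟩, c,
        mem_rect.2 ⟨⟨le_rfl, by linarith⟩, min_le_right _ _, le_max_right _ _⟩,
        h.isUpright.laysOut.cyc.tri.ne⟩)
  refine ⟨G, ?_, ?_⟩
  · rintro w (hw | hw)
    · rw [g1 (hsub1 hw), f1 hw]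
    · rw [g2 (hsub2 hw)]; exact htri w hw
  · have hV : ({0, b, c} ∪ {s, c, b} : Set ℂ) = {0, b, c, s} := by ext w; simp; tauto
    rw [hV] at g3
    refine g3.mono fun w hw => ?_
    obtain ⟨hw1, hw2, hw3⟩ := mem_rect.1 hw
    rcases le_total w.im (max b.im c.im) with hw4 | hw4
    · exact Or.inl (mem_box.2 ⟨hw1, hw2, hw4⟩)
    · exact Or.inr (mem_rect.2 ⟨hw1, hlt.le.trans hw4, hw3⟩)

omit [T2Space S] in
theorem cr_pos (h : τ.IsStdQuad f c b s) : 0 < cr b s ∧ 0 < cr s c := by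
  have h1 := h.quad.convex.urs
  have h2 := h.quad.convex.spu
  simp only [cr, Complex.sub_re, Complex.sub_im, Complex.zero_re, Complex.zero_im] at *
  constructor <;> linarith

omit [T2Space S] in
/-- The effect of a flip on the face at the lowest vertex. -/
theorem laysOutAt_new (h : τ.IsStdQuad f c b s)
    (hf : IsFlipAt τ.toStraightTriangulation τ'.toStraightTriangulation e e' f c 0 b s)
    {β : VerticalSeparatrix q} (hβ : LaysOutAt τ.toStraightTriangulation β f b c) :
    (0 < s.re → LaysOutAt τ'.toStraightTriangulation β f s c) ∧
    (s.re < 0 → LaysOutAt τ'.toStraightTriangulation β f b s) := by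
  have hev := hβ.eventually.mono fun _ ht => ht.2
  refine ⟨fun hs => IsUpright.laysOutAt ⟨hf.2.2.2.1.cyc, h.re_neg, hs⟩ hev,
    fun hs => IsUpright.laysOutAt ⟨hf.2.2.2.2.1, hs, h.re_pos⟩ hev⟩

end IsStdQuad

/-- A flip leaves the face at a vertical separatrix as it is, unless the face is one of the halves of
the flipped quadrilateral. -/
theorem IsStdQuad.laysOutAt_or (hs : τ.IsStdQuad f c b s)
    (hf : IsFlipAt τ.toStraightTriangulation τ'.toStraightTriangulation e e' f c 0 b s)
    {β : VerticalSeparatrix q} (hβ : LaysOutAt τ.toStraightTriangulation β g b' c') :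
    LaysOutAt τ'.toStraightTriangulation β g b' c' ∨ LaysOutAt τ.toStraightTriangulation β f b c ∨
      LaysOutAt τ.toStraightTriangulation β (fun w => f (-w + s)) (s - c) (s - b) := by
  have hev := hβ.eventually.mono fun _ ht => ht.2
  have key : ∀ f b c, τ.IsUpright f b c → g '' openTriangle 0 b' c' = f '' openTriangle 0 b c →
      LaysOutAt τ.toStraightTriangulation β f b c := by
    intro f b c hu him
    obtain ⟨rfl, rfl, he⟩ := hu.unique hβ.isUpright him
    refine hu.laysOutAt (hβ.eventually.mono fun t ht => ?_)
    rw [← he (openTriangle_subset _ _ _ ht.1), ht.2]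
  by_cases h1 : g '' openTriangle 0 b' c' = f '' openTriangle 0 b c
  · exact Or.inr (Or.inl (key f b c hs.isUpright h1))
  have hro := hs.isUpright_opposite
  by_cases h2 : g '' openTriangle 0 b' c' =
      (fun w => f (-w + s)) '' openTriangle 0 (s - c) (s - b)
  · exact Or.inr (Or.inr (key _ _ _ hro h2))
  left
  have hT : g '' openTriangle 0 b' c' ∈ τ'.faces := by
    rw [hf.faces_eq]
    refine Or.inr ⟨hβ.laysOut.2.1, ?_⟩
    rintro (h3 | h3)
    · apply h2
      rw [h3, (IsHalfTranslation.neg_add s).image_openTriangle (f := f) (a := s) (b := c) (c := b)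
        hro.laysOut.pos (by simp) (by simp) (by simp), openTriangle_cyc b s c, openTriangle_cyc c b s]
    · exact h1 (by rw [h3, openTriangle_cyc b c 0, openTriangle_cyc 0 b c])
  exact IsUpright.laysOutAt ⟨StraightTriangulation.LaysOut.of_face hβ.laysOut.tri hT,
    hβ.re_pos.2, hβ.re_pos.1⟩ hev

omit [T2Space S] in
theorem IsStdQuad.rotate_isFlipAt
    (hf : IsFlipAt τ.toStraightTriangulation τ'.toStraightTriangulation e e' f c 0 b s) :
    IsFlipAt τ.toStraightTriangulation τ'.toStraightTriangulation e e' (fun w => f (-w + s))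
      (s - b) 0 (s - c) s :=
  hf.rotate (IsHalfTranslation.neg_add s) (by simp) (by simp) (by simp) (by simp)

/-- If the face at `β` is the upper half, turning the quadrilateral makes it the lower one, so one
case is enough. -/
theorem _root_.VeeringLattice.IsForwardFlip.laysOutAt_or (h : IsForwardFlip τ τ' e e')
    {β : VerticalSeparatrix q} (hβ : LaysOutAt τ.toStraightTriangulation β g b' c') :
    LaysOutAt τ'.toStraightTriangulation β g b' c' ∨ ∃ f c b s, τ.IsStdQuad f c b s ∧
      IsFlipAt τ.toStraightTriangulation τ'.toStraightTriangulation e e' f c 0 b s ∧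
      LaysOutAt τ.toStraightTriangulation β f b c := by
  obtain ⟨f, c, b, s, hs, hf⟩ := h.exists_isStdQuad
  rcases hs.laysOutAt_or hf hβ with h1 | h1 | h1
  · exact Or.inl h1
  · exact Or.inr ⟨f, c, b, s, hs, hf, h1⟩
  · exact Or.inr ⟨_, _, _, s, hs.rotate, IsStdQuad.rotate_isFlipAt hf, h1⟩

/-- At the lowest vertex the new diagonal cuts the wedge, and the part around the vertical direction
is the new wedge. The highest vertex is the same after a half-turn, and elsewhere nothing changes.
-/
theorem _root_.VeeringLattice.IsForwardFlip.precedes (h : IsForwardFlip τ τ' e e') :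
    Precedes τ τ' := by
  intro β
  obtain ⟨g, b', c', hβ⟩ := τ.exists_laysOutAt β
  rcases h.laysOutAt_or hβ with hβ' | ⟨f, c, b, s, hs, hf, hβ⟩
  · intro w hw
    exact hβ.mem_wedge.2 (hβ'.mem_wedge.1 hw)
  · obtain ⟨n1, n2⟩ := hs.laysOutAt_new hf hβ
    obtain ⟨p1, p2⟩ := hs.cr_pos
    have p3 := hβ.pos
    intro w hw
    rw [hβ.mem_wedge]
    rcases (IsStdQuad.re_ne hf).lt_or_gt with h0 | h0
    · obtain ⟨w1, w2⟩ := (n2 h0).mem_wedge.1 hw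
      refine ⟨w1, ?_⟩
      have hid : cr w c * cr b s = cr b w * cr s c + cr b c * cr w s := by simp only [cr]; ring
      exact nonneg_of_mul_nonneg_left (hid ▸ by positivity) p1
    · obtain ⟨w1, w2⟩ := (n1 h0).mem_wedge.1 hw
      refine ⟨?_, w2⟩
      have hid : cr b w * cr s c = cr b s * cr w c + cr b c * cr s w := by simp only [cr]; ring
      exact nonneg_of_mul_nonneg_left (hid ▸ by positivity) p2

end VeeringTriangulation

end VeeringLattice

/-! ### Neighbouring faces, and edges that leave a box through the top -/

namespace VeeringLattice

open Set Filter

variable {S : Type*} [TopologicalSpace S] {q : HalfTranslationSurface S}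

theorem IsFlatTriangle.congr {f g : ℂ → S} {a b c : ℂ} (h : IsFlatTriangle q f a b c)
    (he : EqOn g f (closedTriangle a b c)) : IsFlatTriangle q g a b c := by
  have hm : ∀ w ∈ ({a, b, c} : Set ℂ), g w = f w := fun w hw => he (vertices_subset _ _ _ hw)
  exact ⟨h.1, h.2.1.congr he, hm a (by simp) ▸ h.2.2.1, hm b (by simp) ▸ h.2.2.2.1,
    hm c (by simp) ▸ h.2.2.2.2.1, h.flat.congr fun w hw => he hw.1,
    h.2.2.2.2.2.2.congr fun w hw => (he (openTriangle_subset _ _ _ hw)).symm⟩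

theorem StraightTriangulation.LaysOut.congr {τ : StraightTriangulation q} {f g : ℂ → S} {a b c : ℂ}
    (h : τ.LaysOut f a b c) (he : EqOn g f (closedTriangle a b c)) : τ.LaysOut g a b c := by
  refine ⟨h.tri.congr he, ?_, ?_, ?_, ?_⟩
  · rw [(he.mono (openTriangle_subset _ _ _)).image_eq]; exact h.2.1
  · rw [(he.mono (segment_subset_closedTriangle _ _ _)).image_eq]; exact h.2.2.1
  · rw [← closedTriangle_cyc] at he
    rw [(he.mono (segment_subset_closedTriangle _ _ _)).image_eq]; exact h.2.2.2.1
  · rw [closedTriangle_cyc c a b] at he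
    rw [(he.mono (segment_subset_closedTriangle _ _ _)).image_eq]; exact h.2.2.2.2

theorem eventually_smul_mem_openTriangle {b c v : ℂ} (hp : 0 < cr b c) (h1 : 0 < cr b v)
    (h2 : 0 < cr v c) : ∀ᶠ t : ℝ in 𝓝[>] 0, (t : ℂ) * v ∈ openTriangle 0 b c := by
  have hlt : 0 < cr b c / (cr b v + cr v c) := by positivity
  filter_upwards [Ioo_mem_nhdsGT hlt] with t ht
  have h3 : t * (cr b v + cr v c) < cr b c := (lt_div_iff₀ (by positivity)).1 ht.2
  have p1 := mul_pos ht.1 h1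
  have p2 := mul_pos ht.1 h2
  rw [mem_openTriangle (by simpa using hp)]
  simp only [cr] at h3 p1 p2
  refine ⟨?_, ?_, ?_⟩ <;> simp [cr] <;> linarith

variable [T2Space S]

/-- A face and its neighbour across a side can be laid out in the plane by the same map. -/
theorem StraightTriangulation.LaysOut.exists_opposite {τ : StraightTriangulation q} {f : ℂ → S}
    {a b c : ℂ} (h : τ.LaysOut f a b c) :
    ∃ g s, EqOn g f (closedTriangle a b c) ∧ τ.LaysOut g c b s := by
  obtain ⟨f', s, h', he⟩ := τ.exists_adjacent h.cyc.saddle.symm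
    (segment_symm ℝ b c ▸ h.2.2.2.1)
  have hint : closedTriangle a b c ∩ closedTriangle c b s = segment ℝ c b := by
    refine Subset.antisymm ?_ fun w hw => ⟨?_, segment_subset_closedTriangle _ _ _ hw⟩
    · rintro w ⟨hw, hw'⟩
      have h1 := ((mem_closedTriangle h.pos).1 hw).2.1
      have h2 := ((mem_closedTriangle h'.pos).1 hw').1
      refine mem_segment_of_cr h'.pos hw' (le_antisymm ?_ h2)
      simp only [cr, Complex.sub_re, Complex.sub_im] at *; linarith
    · rw [← closedTriangle_cyc]
      exact segment_subset_closedTriangle _ _ _ (segment_symm ℝ c b ▸ hw)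
  obtain ⟨G, g1, g2, -⟩ := h.tri.isDevelopment.glue h'.tri.isDevelopment
    (isClosed_closedTriangle _ _ _) (isClosed_closedTriangle _ _ _) (toFinite _) (toFinite _)
    (vertices_subset _ _ _) (vertices_subset _ _ _) (by rw [hint]; exact he.symm)
    (by rw [hint]; exact convex_segment _ _)
    (by rw [hint]; exact ⟨c, left_mem_segment _ _ _, b, right_mem_segment _ _ _, h'.tri.ne⟩)
  exact ⟨G, s, g1, h'.congr g2⟩

namespace LaysOutAt

variable {τ σ : VeeringTriangulation q} {β : VerticalSeparatrix q} {f f' F : ℂ → S}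
  {b c b' c' v w : ℂ}

omit [T2Space S] in
theorem congr (h : LaysOutAt τ.toStraightTriangulation β f b c)
    (he : EqOn f' f (closedTriangle 0 b c)) : LaysOutAt τ.toStraightTriangulation β f' b c :=
  .of_eventually (h.laysOut.congr he) (h.eventually.mono fun _ ht =>
    ⟨ht.1, (he (openTriangle_subset _ _ _ ht.1)).trans ht.2⟩)

/-- The development of a rectangle at a vertical separatrix agrees with that of the bounding box of
the face there. -/
theorem exists_eqOn_rect {x₁ x₂ y : ℝ} {V : Set ℂ} (h : LaysOutAt σ.toStraightTriangulation β f' b' c')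
    (hD : IsDevelopment q F (rect x₁ x₂ 0 y) V) (hV : V.Finite)
    (hVd : Disjoint V (interior (rect x₁ x₂ 0 y))) (hx₁ : x₁ < 0) (hx₂ : 0 < x₂) (hy : 0 < y)
    (hF : ∀ᶠ t : ℝ in 𝓝[>] 0, F (t * Complex.I) = β.map (t * Complex.I)) :
    ∃ F', EqOn F' f' (closedTriangle 0 b' c') ∧ IsDevelopment q F' (box b' c') {0, b', c'} ∧
      EqOn F F' (rect x₁ x₂ 0 y ∩ box b' c') := by
  have hu := h.isUpright
  obtain ⟨F', f1, f2⟩ := hu.exists_box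
  obtain ⟨δ, hδ, hm⟩ := mem_nhdsGT_iff_exists_Ioo_subset.1
    (h.eventually.and (hF.and (Ioo_mem_nhdsGT hy)))
  have hδ : 0 < δ := hδ
  have hC : ∀ w ∈ openSegment ℝ 0 ((δ : ℂ) * Complex.I), ∃ t : ℝ, w = t * Complex.I ∧ t ∈ Ioo 0 δ := by
    intro w hw
    obtain ⟨t, t0, t1, rfl⟩ := mem_openSegment_iff'.1 hw
    exact ⟨t * δ, by push_cast; ring, by positivity, by nlinarith⟩
  refine ⟨F', f1, f2, hD.eqOn f2 (convex_rect _ _ _ _) (convex_rect _ _ _ _) ?_ hV (toFinite _)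
    hVd (disjoint_interior_box _ _) (convex_openSegment (𝕜 := ℝ) 0 (δ * Complex.I))
    (openSegment_nontrivial ?_) ?_ ?_⟩
  · rw [box, rect_inter]
    refine interior_rect_nonempty ((max_lt hx₁ hu.re_neg).trans (lt_min hx₂ hu.re_pos)) ?_
    rw [max_self]
    exact lt_min hy (lt_max_of_lt_left hu.im_pos.1)
  · exact (mul_ne_zero (Complex.ofReal_ne_zero.2 hδ.ne') Complex.I_ne_zero).symm
  · intro w hw
    obtain ⟨t, rfl, ht⟩ := hC w hw
    obtain ⟨h1, h2, h3⟩ := hm ht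
    refine ⟨mem_rect.2 ?_, hu.triangle_subset_box (openTriangle_subset _ _ _ h1.1)⟩
    simp [h3.1.le, h3.2.le, hx₁.le, hx₂.le]
  · intro w hw
    obtain ⟨t, rfl, ht⟩ := hC w hw
    obtain ⟨h1, h2, h3⟩ := hm ht
    rw [h2, f1 (openTriangle_subset _ _ _ h1.1), h1.2]

omit [T2Space S] in
theorem eventually_eq_map (h : LaysOutAt τ.toStraightTriangulation β f b c)
    (hF : EqOn F f (closedTriangle 0 b c)) :
    ∀ᶠ t : ℝ in 𝓝[>] 0, F (t * Complex.I) = β.map (t * Complex.I) :=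
  h.eventually.mono fun _ ht => by rw [hF (openTriangle_subset _ _ _ ht.1), ht.2]

theorem saddle_of_mem (h : LaysOutAt τ.toStraightTriangulation β f b c) (hv : v = b ∨ v = c) :
    IsSaddleParam q f 0 v ∧ f '' segment ℝ 0 v ∈ τ.edges ∧ segment ℝ 0 v ⊆ closedTriangle 0 b c := by
  rcases hv with rfl | rfl
  · exact ⟨h.laysOut.saddle, h.laysOut.2.2.1, segment_subset_closedTriangle _ _ _⟩
  · refine ⟨h.laysOut.cyc.cyc.saddle.symm, segment_symm ℝ v 0 ▸ h.laysOut.2.2.2.2, ?_⟩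
    rw [segment_symm, closedTriangle_cyc]
    exact segment_subset_closedTriangle _ _ _

theorem im_pos_of_mem (h : LaysOutAt τ.toStraightTriangulation β f b c) (hv : v = b ∨ v = c) :
    0 < v.im := by
  rcases hv with rfl | rfl
  exacts [h.isUpright.im_pos.1, h.isUpright.im_pos.2]

/-- If the wedge of `τ` is not contained in that of `σ`, then one of the edges of the latter runs
out of the bounding box of the face of `τ` at the top. -/
theorem exists_tall (h : LaysOutAt τ.toStraightTriangulation β f b c)
    (h' : LaysOutAt σ.toStraightTriangulation β f' b' c')
    (hw : ¬ wedge β τ.toStraightTriangulation ⊆ wedge β σ.toStraightTriangulation) :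
    ∃ v, (v = b' ∨ v = c') ∧ (c.re < v.re ∧ v.re < b.re) ∧ max b.im c.im < v.im := by
  obtain ⟨r1, r2⟩ := h.re_pos
  obtain ⟨r1', r2'⟩ := h'.re_pos
  obtain ⟨i1, i2⟩ := h.isUpright.im_pos
  obtain ⟨i1', i2'⟩ := h'.isUpright.im_pos
  have hp := h.pos
  have hp' := h'.pos
  -- The right edge of `σ` is steeper than that of `τ`. If it also reached as far to the right, `b`
  -- would be in the box of `σ`; if it ended within the height of the box of `τ`, then `b'` would be
  -- in that box. Both contradict `mark_mem`.
  by_cases hb : 0 < cr b b'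
  · simp only [cr] at hb
    have hlt : b'.re < b.re := by
      by_contra! hle
      have him : b.im ≤ b'.im := by
        by_contra! hlt
        nlinarith [mul_pos r1 (sub_pos.2 hlt), mul_nonneg i1.le (sub_nonneg.2 hle)]
      rcases h'.mark_mem h (Or.inl rfl) (mem_box.2 ⟨⟨by linarith, hle⟩, i1.le, le_max_of_le_left him⟩)
        with he | he
      · rw [he] at hb; linarith
      · rw [he] at r1; linarith
    refine ⟨b', Or.inl rfl, ⟨by linarith, hlt⟩, ?_⟩
    by_contra! hle
    rcases h.mark_mem h' (Or.inl rfl) (mem_box.2 ⟨⟨by linarith, hlt.le⟩, i1'.le, hle⟩) with he | he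
    · rw [he] at hlt; exact lt_irrefl _ hlt
    · rw [he] at r1'; linarith
  by_cases hc : 0 < cr c' c
  · simp only [cr] at hc
    have hlt : c.re < c'.re := by
      by_contra! hle
      have him : c.im ≤ c'.im := by
        by_contra! hlt
        nlinarith [mul_pos (neg_pos.2 r2) (sub_pos.2 hlt), mul_nonneg i2.le (sub_nonneg.2 hle)]
      rcases h'.mark_mem h (Or.inr rfl)
        (mem_box.2 ⟨⟨hle, by linarith⟩, i2.le, le_max_of_le_right him⟩) with he | he
      · rw [he] at r2; linarith
      · rw [he] at hc; linarith
    refine ⟨c', Or.inr rfl, ⟨hlt, by linarith⟩, ?_⟩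
    by_contra! hle
    rcases h.mark_mem h' (Or.inr rfl) (mem_box.2 ⟨⟨hlt.le, by linarith⟩, i2'.le, hle⟩) with he | he
    · rw [he] at r2'; linarith
    · rw [he] at hlt; exact lt_irrefl _ hlt
  -- If neither edge of `σ` is steeper than its counterpart, the wedge of `σ` contains that of `τ`.
  exfalso
  apply hw
  intro w hw
  obtain ⟨w1, w2⟩ := h.mem_wedge.1 hw
  have hid1 : cr b' w * cr b c = cr b' b * cr w c + cr b w * cr b' c := by simp only [cr]; ring
  have hid2 : cr w c' * cr b c = cr b w * cr c c' + cr w c * cr b c' := by simp only [cr]; ring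
  have e1 : 0 < cr b' c := by
    simp only [cr]; nlinarith [mul_pos r1' i2, mul_pos i1' (neg_pos.2 r2)]
  have e2 : 0 < cr b c' := by
    simp only [cr]; nlinarith [mul_pos r1 i2', mul_pos i1 (neg_pos.2 r2')]
  have e3 : 0 ≤ cr b' b := by simp only [cr] at *; linarith
  have e4 : 0 ≤ cr c c' := by simp only [cr] at *; linarith
  exact h'.mem_wedge.2 ⟨nonneg_of_mul_nonneg_left (hid1 ▸ by positivity) hp,
    nonneg_of_mul_nonneg_left (hid2 ▸ by positivity) hp⟩

end LaysOutAt

end VeeringLattice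

/-! ### Crossing edges, and the passage to a wider top side -/

namespace VeeringLattice

open Set Filter

variable {S : Type*} [TopologicalSpace S] {q : HalfTranslationSurface S} [T2Space S]

namespace LaysOutAt

variable {τ σ : VeeringTriangulation q} {β β₂ : VerticalSeparatrix q} {f f' f₂ h F : ℂ → S}
  {b c b' c' b₂ c₂ g₁ g₂ v w m n g s : ℂ}

set_option maxHeartbeats 1000000 in
/-- Two edges of a triangulation `σ`, one from a corner `0` of a face of `τ` to some point above this
face, and one from the lower end `m` of the top side to some point beyond it, do not exist both. -/
theorem false_of_cross (hβ : LaysOutAt τ.toStraightTriangulation β f b c)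
    (hβ' : LaysOutAt σ.toStraightTriangulation β f' b' c') (hv : v = b' ∨ v = c')
    (hv1 : c.re < v.re ∧ v.re < b.re) (hv2 : max b.im c.im < v.im)
    (hβ₂ : LaysOutAt τ.toStraightTriangulation β₂ f₂ b₂ c₂)
    (hβ₂' : LaysOutAt σ.toStraightTriangulation β₂ h g₁ g₂) (hg : g = g₁ ∨ g = g₂)
    (hf₂ : ∀ w ∈ segment ℝ m n, f₂ (w + -m) = f w) {ε : ℝ}
    (hmn : (ε = 1 ∧ m = c ∧ n = b ∧ b₂ = n - m) ∨ (ε = -1 ∧ m = b ∧ n = c ∧ c₂ = n - m))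
    (him : m.im < n.im) (hlong : ε * (n - m).re ≤ ε * g.re)
    (hflat : ε * cr (n - m) g ≤ 0) : False := by
  obtain ⟨r1, r2⟩ := hβ.re_pos
  obtain ⟨i1, i2⟩ := hβ.isUpright.im_pos
  obtain ⟨r1', r2'⟩ := hβ₂.re_pos
  have hv0 := hβ'.im_pos_of_mem hv
  have hg0 := hβ₂'.im_pos_of_mem hg
  -- The sign `ε` tells whether the lower end `m` of the top side is on the left (`1`) or on the
  -- right (`-1`); all horizontal distances are multiplied by it.
  have hε : ε * ε = 1 := by rcases hmn with ⟨rfl, -⟩ | ⟨rfl, -⟩ <;> norm_num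
  have hm0 : 0 < m.im := by rcases hmn with ⟨-, rfl, -⟩ | ⟨-, rfl, -⟩ <;> assumption
  have hn0 : n.im ≤ max b.im c.im := by
    rcases hmn with ⟨-, -, rfl, -⟩ | ⟨-, -, rfl, -⟩ <;> simp
  have hεm : ε * m.re < 0 := by
    rcases hmn with ⟨rfl, rfl, -⟩ | ⟨rfl, rfl, -⟩ <;> linarith
  have hεv : 0 < ε * (v.re - m.re) ∧ ε * (v.re - m.re) < ε * (n - m).re := by
    rcases hmn with ⟨rfl, rfl, rfl, -⟩ | ⟨rfl, rfl, rfl, -⟩ <;> simp <;> constructor <;> linarith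
  have hd0 : 0 < ε * (n - m).re := hεv.1.trans hεv.2
  have hd2 : 0 < (n - m).im := by simpa using him
  obtain ⟨X, hX⟩ : ∃ X, X = ε * g.re := ⟨_, rfl⟩
  have hX0 : 0 < X := by rw [hX]; linarith
  have hfl : g.im * (ε * (n - m).re) ≤ (n - m).im * X := by
    rw [hX]; simp only [cr] at hflat; linarith
  -- the parameter of the crossing point on the first edge
  obtain ⟨A, hA⟩ : ∃ A, A = X * m.im - g.im * (ε * m.re) := ⟨_, rfl⟩
  obtain ⟨B, hB⟩ : ∃ B, B = X * (v.im - m.im) - g.im * (ε * (v.re - m.re)) := ⟨_, rfl⟩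
  -- `-A` and `B` are the values at `0` and at `v` of an equation of the line through `m` in
  -- direction `g`. So the line separates these points.
  have hA0 : 0 < A := by
    rw [hA]; nlinarith [mul_pos hX0 hm0, mul_pos hg0 (neg_pos.2 hεm)]
  have hB0 : 0 < B := by
    have h1 : g.im * (ε * (v.re - m.re)) ≤ g.im * (ε * (n - m).re) :=
      mul_le_mul_of_nonneg_left hεv.2.le hg0.le
    have h2 : 0 < X * (v.im - n.im) := mul_pos hX0 (by linarith)
    simp only [Complex.sub_im] at hfl
    rw [hB]; linarith
  obtain ⟨t, ht⟩ : ∃ t, t = A / (A + B) := ⟨_, rfl⟩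
  have ht0 : 0 < t := by rw [ht]; positivity
  have ht1 : t < 1 := by rw [ht, div_lt_one (by positivity)]; linarith
  have hte : t * (A + B) = A := by rw [ht]; field_simp
  have hφ : X * (t * v.im - m.im) = g.im * (ε * (t * v.re - m.re)) := by
    have : A + B = X * v.im - g.im * (ε * v.re) := by rw [hA, hB]; ring
    rw [this] at hte
    linear_combination hte + hA
  have hy : 0 < ε * (t * v.re - m.re) ∧ ε * (t * v.re - m.re) < ε * (n - m).re := by
    constructor
    · nlinarith [mul_pos ht0 hεv.1, mul_pos (sub_pos.2 ht1) (neg_pos.2 hεm)]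
    · have hεn : 0 < ε * n.re := by
        rcases hmn with ⟨rfl, -, rfl, -⟩ | ⟨rfl, -, rfl, -⟩ <;> linarith
      have h1 := hεv.2
      simp only [Complex.sub_re] at h1 ⊢
      nlinarith [mul_pos ht0 (sub_pos.2 h1), mul_pos (sub_pos.2 ht1) hεn]
  -- The parameter of the crossing point on the second edge.
  obtain ⟨r, hr⟩ : ∃ r, r = ε * (t * v.re - m.re) / X := ⟨_, rfl⟩
  have hrX : r * X = ε * (t * v.re - m.re) := by rw [hr]; field_simp
  have hr0 : 0 < r := by rw [hr]; exact div_pos hy.1 hX0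
  have hr1 : r < 1 := by rw [hr, div_lt_one hX0, hX]; linarith [hy.2]
  have hre : t * v.re = m.re + r * g.re := by
    rw [hX] at hrX
    linear_combination -ε * hrX + (r * g.re - t * v.re + m.re) * hε
  have him2 : t * v.im = m.im + r * g.im := by
    have : X * (t * v.im) = X * (m.im + r * g.im) := by
      linear_combination hφ - g.im * hrX
    exact mul_left_cancel₀ hX0.ne' this
  -- The crossing point is not higher than the upper end `n` of the top side, and so lies in the
  -- boxes of both faces of `τ`. There the layouts of the faces of `σ` can be compared.
  have hrg : r * g.im ≤ (n - m).im := by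
    have h1 : X * (r * g.im) ≤ X * (n - m).im := by
      have h2 : X * (r * g.im) = g.im * (ε * (t * v.re - m.re)) := by rw [← hrX]; ring
      have h3 := mul_le_mul_of_nonneg_left hy.2.le hg0.le
      linarith
    exact le_of_mul_le_mul_left h1 hX0
  have hw0 : (t : ℂ) * v + -m = r * g := by
    apply Complex.ext <;> simp <;> linarith
  have hw1 : (t : ℂ) * v ∈ openSegment ℝ 0 v := mem_openSegment_iff'.2 ⟨t, ht0, ht1, by ring⟩
  have hw2 : (r : ℂ) * g ∈ openSegment ℝ 0 g := mem_openSegment_iff'.2 ⟨r, hr0, hr1, by ring⟩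
  obtain ⟨s1, s2, s3⟩ := hβ'.saddle_of_mem hv
  obtain ⟨s1', s2', s3'⟩ := hβ₂'.saddle_of_mem hg
  -- the two bounding boxes
  obtain ⟨F, f1, d1⟩ := hβ.isUpright.exists_box
  obtain ⟨F', f1', d1'⟩ := hβ'.isUpright.exists_box
  obtain ⟨F₂, f2, d2⟩ := hβ₂.isUpright.exists_box
  obtain ⟨F₂', f2', d2'⟩ := hβ₂'.isUpright.exists_box
  have hb1 : (t : ℂ) * v ∈ box b c := by
    rw [mem_box]
    simp only [Complex.re_ofReal_mul, Complex.im_ofReal_mul]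
    refine ⟨?_, by positivity, ?_⟩
    · rcases hmn with ⟨rfl, rfl, rfl, -⟩ | ⟨rfl, rfl, rfl, -⟩ <;> simp at hy <;>
        constructor <;> linarith
    · simp only [Complex.sub_im] at hrg; linarith
  have hb2 : (r : ℂ) * g ∈ box b₂ c₂ := by
    rw [← hw0, mem_box]
    simp only [Complex.add_re, Complex.add_im, Complex.re_ofReal_mul, Complex.im_ofReal_mul,
      Complex.neg_re, Complex.neg_im]
    refine ⟨?_, ?_, ?_⟩
    · rcases hmn with ⟨rfl, -, -, e⟩ | ⟨rfl, -, -, e⟩ <;> rw [← e] at hy <;> constructor <;> linarith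
    · rw [him2]; nlinarith
    · have : (n - m).im ≤ max b₂.im c₂.im := by
        rcases hmn with ⟨-, -, -, e⟩ | ⟨-, -, -, e⟩ <;> rw [← e] <;> simp
      linarith
  have hk := IsHalfTranslation.add (-m)
  have d3 := d2.comp hk
  have hpre : (fun w => w + -m) ⁻¹' box b₂ c₂ =
      rect (c₂.re + m.re) (b₂.re + m.re) m.im (max b₂.im c₂.im + m.im) := by
    ext w
    simp only [mem_preimage, mem_box, mem_rect, Complex.add_re, Complex.add_im, Complex.neg_re,
      Complex.neg_im]
    constructor <;> rintro ⟨⟨h1, h2⟩, h3, h4⟩ <;> refine ⟨⟨?_, ?_⟩, ?_, ?_⟩ <;> linarith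
  have hmid : (m + n) / 2 ∈ interior (box b c ∩ (fun w => w + -m) ⁻¹' box b₂ c₂) := by
    have hM : (n - m).im ≤ max b₂.im c₂.im := by
      rcases hmn with ⟨-, -, -, e⟩ | ⟨-, -, -, e⟩ <;> rw [← e] <;> simp
    simp only [Complex.sub_im] at hM
    rw [interior_inter, hpre]
    refine ⟨mem_interior_rect.2 ?_, mem_interior_rect.2 ?_⟩
    · simp only [Complex.div_ofNat_re, Complex.div_ofNat_im, Complex.add_re, Complex.add_im]
      refine ⟨?_, by linarith, by linarith⟩
      rcases hmn with ⟨rfl, rfl, rfl, -⟩ | ⟨rfl, rfl, rfl, -⟩ <;> constructor <;> linarith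
    · simp only [Complex.div_ofNat_re, Complex.div_ofNat_im, Complex.add_re, Complex.add_im]
      refine ⟨?_, by linarith, by linarith⟩
      rcases hmn with ⟨rfl, rfl, rfl, e⟩ | ⟨rfl, rfl, rfl, e⟩ <;> have e := congrArg Complex.re e <;>
        simp at e <;> constructor <;> linarith
  have hseg1 : segment ℝ m n ⊆ closedTriangle 0 b c := by
    rcases hmn with ⟨-, rfl, rfl, -⟩ | ⟨-, rfl, rfl, -⟩
    · rw [segment_symm, ← closedTriangle_cyc]; exact segment_subset_closedTriangle _ _ _
    · rw [← closedTriangle_cyc]; exact segment_subset_closedTriangle _ _ _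
  have hseg2 : ∀ w ∈ segment ℝ m n, w + -m ∈ closedTriangle 0 b₂ c₂ := by
    intro w hw
    have : w + -m ∈ segment ℝ 0 (n - m) := by
      obtain ⟨x, x0, x1, rfl⟩ := mem_segment_iff'.1 hw
      exact mem_segment_iff'.2 ⟨x, x0, x1, by ring⟩
    exact (hβ₂.saddle_of_mem (v := n - m) (by
      rcases hmn with ⟨-, -, -, e⟩ | ⟨-, -, -, e⟩ <;> simp [e])).2.2 this
  have hagree := d1.eqOn d3 (convex_rect _ _ _ _) (hpre ▸ convex_rect _ _ _ _) ⟨_, hmid⟩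
    (toFinite _) ((toFinite _).preimage hk.injective.injOn) (disjoint_interior_box _ _) (by
      rw [hpre, disjoint_left]
      rintro w hw hw'
      rw [mem_interior_rect] at hw'
      have hwV : w + -m ∈ ({0, b₂, c₂} : Set ℂ) := hw
      have e : w = (w + -m) + m := by ring
      rw [e] at hw'
      simp only [Complex.add_re, Complex.add_im (_ + _)] at hw'
      rcases hwV with h0 | h0 | h0 <;> have hr := congrArg Complex.re h0 <;>
        have hi := congrArg Complex.im h0 <;> simp only [Complex.add_re, Complex.add_im,
          Complex.zero_re, Complex.zero_im] at hr hi hw' <;> linarith)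
    (convex_segment m n) ⟨m, left_mem_segment _ _ _, n, right_mem_segment _ _ _, fun h => by
      rw [h] at him; exact lt_irrefl _ him⟩
    (fun w hw => ⟨hβ.isUpright.triangle_subset_box (hseg1 hw),
      hβ₂.isUpright.triangle_subset_box (hseg2 w hw)⟩)
    fun w hw => by rw [f1 (hseg1 hw), f2 (hseg2 w hw), hf₂ w hw]
  have hwm1 := s3 (openSegment_subset_segment _ _ _ hw1)
  have hwm2 := s3' (openSegment_subset_segment _ _ _ hw2)
  have e1 : F (t * v) = f' (t * v) := by
    rw [hβ.eqOn_box hβ' f1 f1' d1 d1' ⟨hb1, hβ'.isUpright.triangle_subset_box hwm1⟩, f1' hwm1]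
  have e2 : F₂ (r * g) = h (r * g) := by
    rw [hβ₂.eqOn_box hβ₂' f2 f2' d2 d2' ⟨hb2, hβ₂'.isUpright.triangle_subset_box hwm2⟩, f2' hwm2]
  have e3 : F (t * v) = F₂ (r * g) := by
    rw [← hw0]
    exact hagree ⟨hb1, by rw [mem_preimage, hw0]; exact hb2⟩
  have hs := s1'.comp hk (a' := m) (b' := g + m) (by ring) (by ring)
  have hseg : (fun w => w + -m) '' segment ℝ m (g + m) = segment ℝ 0 g := by
    rw [hk.image_segment]; simp
  -- Edges of `σ` that cross are equal, so `g = v` or `g = -v`. The first is excluded because `g` is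
  -- too long horizontally, the second because both point upwards.
  have := σ.parallel_of_cross s1 hs s2 (by
    rw [show (fun w => h (w + -m)) = h ∘ (fun w => w + -m) from rfl, image_comp, hseg]; exact s2')
    hw1 (by
      rw [← hk.mem_openSegment, hw0]
      simpa using hw2) (by rw [← e1, e3, e2, hw0])
  simp only [add_sub_cancel_right, sub_zero] at this
  rcases this with he | he
  · rw [he] at hlong
    have := hεv.2
    nlinarith
  · rw [he] at hg0; simp at hg0; linarith

/-- If the wedge of `τ` at `β` is not contained in that of `σ`, then the face across the top side is
above it, or there is such a separatrix with a wider top side. -/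
theorem exists_wider (hβ : LaysOutAt τ.toStraightTriangulation β f b c)
    (hw : ¬ wedge β τ.toStraightTriangulation ⊆ wedge β σ.toStraightTriangulation)
    (hs : τ.LaysOut f c b s) (hn : ¬ (c.re < s.re ∧ s.re < b.re)) :
    ∃ β₂ f₂ b₂ c₂, LaysOutAt τ.toStraightTriangulation β₂ f₂ b₂ c₂ ∧
      ¬ wedge β₂ τ.toStraightTriangulation ⊆ wedge β₂ σ.toStraightTriangulation ∧
      b.re - c.re < b₂.re - c₂.re := by
  obtain ⟨f', b', c', hβ'⟩ := σ.exists_laysOutAt β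
  obtain ⟨v, hv, hv1, hv2⟩ := hβ.exists_tall hβ' hw
  obtain ⟨r1, r2⟩ := hβ.re_pos
  have n1 := (τ.re_im_ne hs.2.2.2.1 hs.cyc.saddle.hasHolonomy).1
  have n2 := (τ.re_im_ne hs.2.2.2.2 hs.cyc.cyc.saddle.hasHolonomy).1
  simp only [Complex.sub_re] at n1 n2
  -- Then `c` is the middle vertex of the face across, and the old top side is its right edge, seen
  -- from `c`; its own top side, from `s` to `b`, is wider. Were its wedge contained in that of `σ`,
  -- the right edge of `σ` at `c` would not be steeper than the old top side and would cross the
  -- edge to `v`.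
  by_cases hsc : s.re < c.re
  · have hl := hs.comp (IsHalfTranslation.add c) (a' := 0) (b' := b - c) (c' := s - c)
      (by simp) (by simp) (by simp)
    have hu : τ.IsUpright (fun w => f (w + c)) (b - c) (s - c) :=
      ⟨hl, by simp; linarith, by simp; linarith⟩
    obtain ⟨β₂, -, hβ₂⟩ := hu.exists_separatrix
    refine ⟨β₂, _, _, _, hβ₂, fun hsub => ?_, by simp; linarith⟩
    obtain ⟨h, g₁, g₂, hβ₂'⟩ := σ.exists_laysOutAt β₂
    have hfl := (hβ₂'.mem_wedge.1 (hsub hβ₂.right_mem_wedge)).1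
    have him := hu.im_pos
    obtain ⟨j1, j2⟩ := hβ₂'.re_pos
    obtain ⟨j3, j4⟩ := hβ₂'.isUpright.im_pos
    refine hβ.false_of_cross hβ' hv hv1 hv2 hβ₂ hβ₂' (Or.inl rfl) (m := c) (n := b)
      (fun w _ => by simp) (Or.inl ⟨rfl, rfl, rfl, rfl⟩) (by simpa using him.1) ?_
      (by simp only [cr] at *; linarith)
    -- If this edge of `σ` were too short for a crossing, it would end inside the box of the new
    -- face.
    by_contra! hlt
    rw [one_mul, one_mul] at hlt
    have hle : g₁.im ≤ (b - c).im := by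
      by_contra! hlt2
      simp only [cr] at hfl
      nlinarith [mul_pos (sub_pos.2 hlt) him.1, mul_pos (sub_pos.2 hlt2) j1]
    rcases hβ₂.mark_mem hβ₂' (Or.inl rfl)
      (mem_box.2 ⟨⟨by linarith [hu.re_neg], hlt.le⟩, j3.le, le_max_of_le_left hle⟩) with he | he
    · rw [he] at hlt; exact lt_irrefl _ hlt
    · rw [he] at j1; linarith [hu.re_neg]
  · have hsb : b.re < s.re := by
      by_contra! hle
      exact hn ⟨lt_of_le_of_ne (not_lt.1 hsc) fun h => n2 (by linarith),
        lt_of_le_of_ne hle fun h => n1 (by linarith)⟩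
    have hl := hs.cyc.comp (IsHalfTranslation.add b) (a' := 0) (b' := s - b) (c' := c - b)
      (by simp) (by simp) (by simp)
    have hu : τ.IsUpright (fun w => f (w + b)) (s - b) (c - b) :=
      ⟨hl, by simp; linarith, by simp; linarith⟩
    obtain ⟨β₂, -, hβ₂⟩ := hu.exists_separatrix
    refine ⟨β₂, _, _, _, hβ₂, fun hsub => ?_, by simp; linarith⟩
    obtain ⟨h, g₁, g₂, hβ₂'⟩ := σ.exists_laysOutAt β₂
    have hfl := (hβ₂'.mem_wedge.1 (hsub hβ₂.left_mem_wedge)).2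
    have him := hu.im_pos
    obtain ⟨j1, j2⟩ := hβ₂'.re_pos
    obtain ⟨j3, j4⟩ := hβ₂'.isUpright.im_pos
    refine hβ.false_of_cross hβ' hv hv1 hv2 hβ₂ hβ₂' (Or.inr rfl) (m := b) (n := c)
      (fun w _ => by simp) (Or.inr ⟨rfl, rfl, rfl, rfl⟩) (by simpa using him.2) ?_
      (by linarith)
    by_contra! hlt
    have hlt : (c - b).re < g₂.re := by linarith
    have hle : g₂.im ≤ (c - b).im := by
      by_contra! hlt2
      simp only [cr] at hfl
      nlinarith [mul_pos (sub_pos.2 hlt) him.2, mul_pos (sub_pos.2 hlt2) (neg_pos.2 j2)]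
    rcases hβ₂.mark_mem hβ₂' (Or.inr rfl)
      (mem_box.2 ⟨⟨hlt.le, by linarith [hu.re_pos]⟩, j4.le, le_max_of_le_right hle⟩) with he | he
    · rw [he] at j2; linarith [hu.re_pos]
    · rw [he] at hlt; exact lt_irrefl _ hlt

end LaysOutAt

end VeeringLattice

/-! ### Edges of the other triangulation at both ends of the new diagonal -/

namespace VeeringLattice

open Set Filter

variable {S : Type*} [TopologicalSpace S] {q : HalfTranslationSurface S} [T2Space S]

namespace VeeringTriangulation.IsStdQuad

variable {τ σ : VeeringTriangulation q} {β β₂ : VerticalSeparatrix q} {f f' f₂ F : ℂ → S}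
  {b c b' c' b₂ c₂ v p p₂ s : ℂ}

omit [T2Space S] in
theorem disjoint_interior (h : τ.IsStdQuad f c b s) :
    Disjoint ({0, b, c, s} : Set ℂ) (interior (rect c.re b.re 0 s.im)) := by
  rw [disjoint_left]
  rintro w (rfl | rfl | rfl | rfl) hw <;> obtain ⟨⟨h1, h2⟩, h3, h4⟩ := mem_interior_rect.1 hw
  · exact lt_irrefl _ h3
  · exact lt_irrefl _ h2
  · exact lt_irrefl _ h1
  · exact lt_irrefl _ h4

/-- If `σ` has an edge from the lowest vertex that runs out of the lower face at the top, then the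
edges of `σ` there are at least as steep as the second diagonal. -/
theorem steep_at_bottom (h : τ.IsStdQuad f c b s) (hβ : LaysOutAt τ.toStraightTriangulation β f b c)
    (hβ' : LaysOutAt σ.toStraightTriangulation β f' b' c') (hv : v = b' ∨ v = c')
    (hv1 : c.re < v.re ∧ v.re < b.re) :
    s.im ≤ v.im ∧ s.re ≠ 0 ∧ ∀ ε : ℝ, (ε = 1 ∨ ε = -1) → 0 < ε * s.re → (p = b' ∨ p = c') →
      0 < ε * p.re → p = s ∨ (ε * p.re < ε * s.re ∧ s.im < p.im) := by
  obtain ⟨r1, r2⟩ := hβ.re_pos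
  obtain ⟨r1', r2'⟩ := hβ'.re_pos
  obtain ⟨i1, i2⟩ := hβ.isUpright.im_pos
  have hi := hβ'.isUpright.im_pos
  have q1 := h.lt_re
  have q2 := h.re_lt
  have q3 := h.im_pos
  obtain ⟨F, f1, d1⟩ := h.exists_box
  obtain ⟨F', f1', d1', heq⟩ := hβ'.exists_eqOn_rect d1 (toFinite _) h.disjoint_interior r2 r1 q3
    (hβ.eventually_eq_map fun w hw => f1 (Or.inl hw))
  -- Points of one box that are marked for the other: once for vertices of `σ` in the box of the
  -- quadrilateral, and then for `s` in the box of `σ`.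
  have mark : ∀ x, (x = b' ∨ x = c') → x ∈ rect c.re b.re 0 s.im → x ∈ ({0, b, c, s} : Set ℂ) := by
    intro x hx hxr
    have hx' : x ∈ ({0, b', c'} : Set ℂ) := Or.inr hx
    refine d1.mem_of_marked hxr ?_
    rw [heq ⟨hxr, hβ'.isUpright.triangle_subset_box (vertices_subset _ _ _ hx')⟩]
    exact d1'.marked x hx'
  have hsr : s ∈ rect c.re b.re 0 s.im := mem_rect.2 ⟨⟨q1.le, q2.le⟩, q3.le, le_rfl⟩
  have mark' : s ∈ box b' c' → s = b' ∨ s = c' := by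
    intro hsb
    rcases d1'.mem_of_marked hsb (heq ⟨hsr, hsb⟩ ▸ d1.marked s (by simp)) with h0 | h0
    · rw [h0] at q3; simp at q3
    · exact h0
  have hv0 := hβ'.im_pos_of_mem hv
  have hsv : s.im ≤ v.im := by
    by_contra! hlt
    rcases mark v hv (mem_rect.2 ⟨⟨hv1.1.le, hv1.2.le⟩, hv0.le, hlt.le⟩) with h0 | h0 | h0 | h0
    · rw [h0] at hv0; simp at hv0
    · rw [h0] at hv1; exact lt_irrefl _ hv1.2
    · rw [h0] at hv1; exact lt_irrefl _ hv1.1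
    · rw [h0] at hlt; exact lt_irrefl _ hlt
  have hsmax : s.im ≤ max b'.im c'.im := by
    rcases hv with rfl | rfl
    exacts [le_max_of_le_left hsv, le_max_of_le_right hsv]
  -- A vertical diagonal would put `s` into the box of `σ`, making it one of the vertices `b'` and
  -- `c'`, whose real parts are not `0`.
  refine ⟨hsv, fun h0 => ?_, ?_⟩
  · rcases mark' (mem_box.2 ⟨⟨by linarith, by linarith⟩, q3.le, hsmax⟩) with h1 | h1
    · rw [h1] at h0; linarith
    · rw [h1] at h0; linarith
  · rintro ε (rfl | rfl) hεs hp hεp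
    · have hpb : p = b' := hp.resolve_right fun h0 => by rw [h0] at hεp; linarith
      subst hpb
      rw [one_mul] at *
      rcases le_or_gt s.re p.re with hle | hlt
      · left
        rcases mark' (mem_box.2 ⟨⟨by linarith, hle⟩, q3.le, hsmax⟩) with h1 | h1
        · exact h1.symm
        · rw [h1] at hεs; linarith
      · refine Or.inr ⟨by rwa [one_mul], ?_⟩
        by_contra! hle
        rcases mark p hp (mem_rect.2 ⟨⟨by linarith, by linarith⟩, hi.1.le, hle⟩) with h0 | h0 | h0 | h0
        · rw [h0] at hεp; simp at hεp
        · rw [h0] at hlt; linarith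
        · rw [h0] at hεp; linarith
        · rw [h0] at hlt; exact lt_irrefl _ hlt
    · have hpc : p = c' := hp.resolve_left fun h0 => by rw [h0] at hεp; linarith
      subst hpc
      rcases le_or_gt p.re s.re with hle | hlt
      · left
        rcases mark' (mem_box.2 ⟨⟨hle, by linarith⟩, q3.le, hsmax⟩) with h1 | h1
        · rw [h1] at hεs; linarith
        · exact h1.symm
      · refine Or.inr ⟨by linarith, ?_⟩
        by_contra! hle
        rcases mark p hp (mem_rect.2 ⟨⟨by linarith, by linarith⟩, hi.2.le, hle⟩) with h0 | h0 | h0 | h0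
        · rw [h0] at hεp; simp at hεp
        · rw [h0] at hεp; linarith
        · rw [h0] at hlt; linarith
        · rw [h0] at hlt; exact lt_irrefl _ hlt

/-- In the situation of `steep_at_bottom`, the edges of `σ` at the highest vertex are at least as
steep as the second diagonal, too. -/
theorem steep_at_top (h : τ.IsStdQuad f c b s) (hβ : LaysOutAt τ.toStraightTriangulation β f b c)
    (hβ' : LaysOutAt σ.toStraightTriangulation β f' b' c')
    (hβ₂ : LaysOutAt τ.toStraightTriangulation β₂ (fun w => f (-w + s)) (s - c) (s - b))
    (hβ₂' : LaysOutAt σ.toStraightTriangulation β₂ f₂ b₂ c₂) {ε : ℝ} (hε : ε = 1 ∨ ε = -1)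
    (hs : 0 < ε * s.re) (hp : p = b' ∨ p = c')
    (hps : p = s ∨ (ε * p.re < ε * s.re ∧ s.im < p.im)) (hεp : 0 < ε * p.re)
    (hp₂ : p₂ = b₂ ∨ p₂ = c₂) (hεp₂ : 0 < ε * p₂.re) : 0 ≤ ε * cr s p₂ := by
  -- Suppose that the edge to `p₂`, seen from the top, is less steep than the diagonal. It will
  -- cross the edge of `σ` to `p` that starts at the bottom or, if `p = s`, that edge will run
  -- through a face of `σ`.
  by_contra! hneg
  obtain ⟨r1, r2⟩ := hβ.re_pos
  obtain ⟨r1', r2'⟩ := hβ₂'.re_pos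
  have hi₂ := hβ₂'.isUpright.im_pos
  have hp0 := hβ'.im_pos_of_mem hp
  have hp₂0 := hβ₂'.im_pos_of_mem hp₂
  have q1 := h.lt_re
  have q2 := h.re_lt
  have q3 := h.im_pos
  obtain ⟨F, f1, d1⟩ := h.exists_box
  obtain ⟨F', f1', d1', heq⟩ := hβ'.exists_eqOn_rect d1 (toFinite _) h.disjoint_interior r2 r1 q3
    (hβ.eventually_eq_map fun w hw => f1 (Or.inl hw))
  have hk := IsHalfTranslation.neg_add s
  have d2 := d1.comp hk
  have hD : (fun w => -w + s) ⁻¹' rect c.re b.re 0 s.im = rect (s.re - b.re) (s.re - c.re) 0 s.im := by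
    ext w
    simp only [mem_preimage, mem_rect, Complex.add_re, Complex.add_im, Complex.neg_re,
      Complex.neg_im]
    constructor <;> rintro ⟨⟨h1, h2⟩, h3, h4⟩ <;> refine ⟨⟨?_, ?_⟩, ?_, ?_⟩ <;> linarith
  rw [hD] at d2
  have hVd : Disjoint ((fun w => -w + s) ⁻¹' {0, b, c, s})
      (interior (rect (s.re - b.re) (s.re - c.re) 0 s.im)) := by
    rw [disjoint_left]
    intro w hw hw'
    refine disjoint_left.1 h.disjoint_interior hw ?_
    rw [mem_interior_rect] at hw' ⊢
    simp only [Complex.add_re, Complex.add_im, Complex.neg_re, Complex.neg_im]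
    refine ⟨⟨?_, ?_⟩, ?_, ?_⟩ <;> linarith
  obtain ⟨F₂, f2, d2', heq₂⟩ := hβ₂'.exists_eqOn_rect d2 ((toFinite _).preimage hk.injective.injOn)
    hVd (by linarith) (by linarith) q3 (hβ₂.eventually.mono fun t ht => by
      rw [← ht.2]
      refine f1 (Or.inr ?_)
      have h1 := openTriangle_subset _ _ _ ht.1
      rw [← (hk.mem_closedTriangle 0 (s - c) (s - b) _)] at h1
      simp only [neg_zero, zero_add, neg_sub, sub_add_cancel] at h1
      rwa [closedTriangle_cyc s c b])
  obtain ⟨s1, s2, s3⟩ := hβ'.saddle_of_mem hp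
  obtain ⟨s1', s2', s3'⟩ := hβ₂'.saddle_of_mem hp₂
  have agree1 : ∀ w ∈ segment ℝ 0 p, w ∈ rect c.re b.re 0 s.im → F w = f' w := fun w hw hwr => by
    rw [heq ⟨hwr, hβ'.isUpright.triangle_subset_box (s3 hw)⟩, f1' (s3 hw)]
  have agree2 : ∀ w ∈ closedTriangle 0 b₂ c₂, -w + s ∈ rect c.re b.re 0 s.im →
      F (-w + s) = f₂ w := fun w hw hwr => by
    have : F (-w + s) = F₂ w := heq₂
      ⟨show w ∈ rect (s.re - b.re) (s.re - c.re) 0 s.im by rw [← hD]; exact hwr,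
        hβ₂'.isUpright.triangle_subset_box hw⟩
    rw [this, f2 hw]
  rcases hps with rfl | ⟨hlt, him⟩
  · -- the second diagonal is an edge of `σ` that starts inside a face
    have hcone : 0 < cr b₂ p ∧ 0 < cr p c₂ := by
      rcases hε with rfl | rfl
      · have hpb : p₂ = b₂ := hp₂.resolve_right fun h0 => by rw [h0] at hεp₂; linarith
        subst hpb
        simp only [cr] at *
        constructor
        · linarith
        · nlinarith [mul_pos (show 0 < p.re by linarith) hi₂.2, mul_pos q3 (neg_pos.2 r2')]
      · have hpc : p₂ = c₂ := hp₂.resolve_left fun h0 => by rw [h0] at hεp₂; linarith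
        subst hpc
        simp only [cr] at *
        constructor
        · nlinarith [mul_pos (show 0 < -p.re by linarith) hi₂.1, mul_pos q3 r1']
        · linarith
    obtain ⟨t, ht, ht0, ht1⟩ := ((eventually_smul_mem_openTriangle hβ₂'.pos hcone.1 hcone.2).and
      (Ioo_mem_nhdsGT one_pos)).exists
    have hmem : -((t : ℂ) * p) + p ∈ rect c.re b.re 0 p.im := by
      rw [mem_rect]
      simp only [Complex.add_re, Complex.add_im, Complex.neg_re, Complex.neg_im,
        Complex.re_ofReal_mul, Complex.im_ofReal_mul]
      refine ⟨⟨?_, ?_⟩, ?_, ?_⟩ <;> nlinarith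
    have hseg : -((t : ℂ) * p) + p ∈ segment ℝ 0 p :=
      mem_segment_iff'.2 ⟨1 - t, by linarith, by linarith, by push_cast; ring⟩
    have e1 := agree1 _ hseg hmem
    have e2 := agree2 _ (openTriangle_subset _ _ _ ht) hmem
    refine disjoint_left.1 (σ.edge_face _ s2 _ hβ₂'.laysOut.2.1) (mem_image_of_mem f' hseg) ?_
    rw [← e1, e2]
    exact mem_image_of_mem f₂ ht
  -- A shorter edge would end inside the turned box of the quadrilateral, at a point that is none of
  -- its vertices.
  · have hp₂long : ε * s.re < ε * p₂.re := by
      by_contra! hle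
      have hp2s : p₂.im < s.im := by
        by_contra! hlt2
        simp only [cr] at hneg
        nlinarith [mul_nonneg (sub_nonneg.2 hle) q3.le, mul_nonneg hs.le (sub_nonneg.2 hlt2)]
      have hr : p₂ ∈ rect (s.re - b.re) (s.re - c.re) 0 s.im := by
        rw [mem_rect]
        rcases hε with rfl | rfl <;> refine ⟨⟨?_, ?_⟩, hp₂0.le, hp2s.le⟩ <;> linarith
      have hpV : p₂ ∈ ({0, b₂, c₂} : Set ℂ) := Or.inr hp₂
      have := d2.mem_of_marked hr (by
        have h5 : F (-p₂ + s) = F₂ p₂ :=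
          heq₂ ⟨hr, hβ₂'.isUpright.triangle_subset_box (vertices_subset _ _ _ hpV)⟩
        rw [h5]
        exact d2'.marked _ hpV)
      simp only [mem_preimage, mem_insert_iff, mem_singleton_iff] at this
      rcases this with h0 | h0 | h0 | h0 <;> have h3 := congrArg Complex.re h0 <;>
        have h4 := congrArg Complex.im h0 <;>
        simp only [Complex.add_re, Complex.add_im, Complex.neg_re, Complex.neg_im,
          Complex.zero_re, Complex.zero_im] at h3 h4
      · linarith
      · rcases hε with rfl | rfl <;> linarith
      · rcases hε with rfl | rfl <;> linarith
      · linarith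
    -- Cramer's rule
    have a1 : ε * cr p s < 0 := by
      simp only [cr]
      nlinarith [mul_pos (sub_pos.2 hlt) q3, mul_pos hs (sub_pos.2 him)]
    have a3 : ε * cr (p - s) p₂ < 0 := by
      simp only [cr, Complex.sub_re, Complex.sub_im]
      nlinarith [mul_pos (sub_pos.2 hlt) hp₂0, mul_pos (sub_pos.2 him) hεp₂]
    have a4 : ε * cr p (p₂ - s) < 0 := by
      simp only [cr, Complex.sub_re, Complex.sub_im]
      simp only [cr] at hneg
      rcases le_total p₂.im s.im with hle | hle
      · nlinarith [mul_nonneg hεp.le (sub_nonneg.2 hle), mul_pos hp0 (sub_pos.2 hp₂long)]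
      · nlinarith [mul_nonneg (sub_pos.2 hlt).le (sub_nonneg.2 hle),
          mul_pos (sub_pos.2 him) (sub_pos.2 hp₂long)]
    have a2 : ε * cr p p₂ < 0 := by
      have : ε * cr p p₂ = ε * cr (p - s) p₂ + ε * cr s p₂ := by
        simp only [cr, Complex.sub_re, Complex.sub_im]; ring
      linarith
    have hne : ε * cr p p₂ ≠ 0 := a2.ne
    -- With these `t` and `r`, `t * p + r * p₂ = s`; the signs above give `0 < t, r < 1`, so the
    -- open edges cross.
    obtain ⟨t, ht⟩ : ∃ t, t = (ε * cr s p₂) / (ε * cr p p₂) := ⟨_, rfl⟩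
    obtain ⟨r, hr⟩ : ∃ r, r = (ε * cr p s) / (ε * cr p p₂) := ⟨_, rfl⟩
    have ht0 : 0 < t := ht ▸ div_pos_of_neg_of_neg hneg a2
    have hr0 : 0 < r := hr ▸ div_pos_of_neg_of_neg a1 a2
    have ht1 : t < 1 := by
      rw [ht, div_lt_one_of_neg a2]
      have : ε * cr p p₂ = ε * cr (p - s) p₂ + ε * cr s p₂ := by
        simp only [cr, Complex.sub_re, Complex.sub_im]; ring
      linarith
    have hr1 : r < 1 := by
      rw [hr, div_lt_one_of_neg a2]
      have : ε * cr p p₂ = ε * cr p (p₂ - s) + ε * cr p s := by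
        simp only [cr, Complex.sub_re, Complex.sub_im]; ring
      linarith
    have hte : t * (ε * cr p p₂) = ε * cr s p₂ := by rw [ht, div_mul_cancel₀ _ hne]
    have hre : r * (ε * cr p p₂) = ε * cr p s := by rw [hr, div_mul_cancel₀ _ hne]
    have hsum : (t : ℂ) * p + r * p₂ = s := by
      apply Complex.ext
      · simp only [Complex.add_re, Complex.re_ofReal_mul]
        refine mul_left_cancel₀ hne ?_
        simp only [cr] at hte hre ⊢
        linear_combination p.re * hte + p₂.re * hre
      · simp only [Complex.add_im, Complex.im_ofReal_mul]
        refine mul_left_cancel₀ hne ?_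
        simp only [cr] at hte hre ⊢
        linear_combination p.im * hte + p₂.im * hre
    have hk2 : -((r : ℂ) * p₂) + s = t * p := by linear_combination -hsum
    have hmem : (t : ℂ) * p ∈ rect c.re b.re 0 s.im := by
      have h2 := congrArg Complex.im hsum
      simp only [Complex.add_im, Complex.im_ofReal_mul] at h2
      rw [mem_rect]
      simp only [Complex.re_ofReal_mul, Complex.im_ofReal_mul]
      have hp3 : t * (ε * p.re) < ε * p.re := by nlinarith
      have hp4 : 0 < t * (ε * p.re) := by positivity
      refine ⟨?_, by positivity, by nlinarith⟩
      rcases hε with rfl | rfl <;> constructor <;> linarith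
    have hw1 : (t : ℂ) * p ∈ openSegment ℝ 0 p := mem_openSegment_iff'.2 ⟨t, ht0, ht1, by ring⟩
    have hw2 : (r : ℂ) * p₂ ∈ openSegment ℝ 0 p₂ := mem_openSegment_iff'.2 ⟨r, hr0, hr1, by ring⟩
    have e1 := agree1 _ (openSegment_subset_segment _ _ _ hw1) hmem
    have e2 := agree2 _ (s3' (openSegment_subset_segment _ _ _ hw2)) (by rw [hk2]; exact hmem)
    have hsd := s1'.comp hk (a' := s) (b' := s - p₂) (by ring) (by ring)
    have hseg : (fun w => -w + s) '' segment ℝ s (s - p₂) = segment ℝ 0 p₂ := by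
      rw [hk.image_segment]; simp
    have := σ.parallel_of_cross s1 hsd s2 (by
      rw [show (fun w => f₂ (-w + s)) = f₂ ∘ (fun w => -w + s) from rfl, image_comp, hseg]
      exact s2') hw1 (by
        rw [← hk.mem_openSegment]
        have : -((t : ℂ) * p) + s = r * p₂ := by linear_combination -hsum
        rw [this]; simpa using hw2) (by
        rw [← e1, ← hk2, e2]
        congr 1; ring)
    rcases this with he | he
    · have he : p = -p₂ := by linear_combination -he
      rw [he] at hp0; simp at hp0; linarith
    · have he : p₂ = p := by linear_combination -he
      rw [he] at a2; simp [cr, mul_comm] at a2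

end VeeringTriangulation.IsStdQuad

end VeeringLattice

/-! ### Heights of edges, and flipping towards an upper bound -/

namespace VeeringLattice

open Set Filter

variable {S : Type*} [TopologicalSpace S] {q : HalfTranslationSurface S}

variable (q) in
/-- The vertical extent of a saddle connection. -/
noncomputable def height (e : Set S) : ℝ := sSup {r | ∃ v, HasHolonomy q e v ∧ r = |v.im|}

variable [T2Space S]

/-- The set in the definition is a singleton, as the holonomy is unique up to sign. -/
theorem HasHolonomy.height_eq {e : Set S} {v : ℂ} (h : HasHolonomy q e v) : height q e = |v.im| := by
  have : {r | ∃ v, HasHolonomy q e v ∧ r = |v.im|} = {|v.im|} := by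
    ext r
    constructor
    · rintro ⟨v', h', rfl⟩
      rcases h.unique h' with rfl | rfl <;> simp
    · rintro rfl
      exact ⟨v, h, rfl⟩
  rw [height, this, csSup_singleton]

namespace VeeringTriangulation

variable {τ τ' σ : VeeringTriangulation q} {β : VerticalSeparatrix q} {f f' g : ℂ → S}
  {b c b' c' p s : ℂ} {e e' : Set S}

theorem finite_widths (τ : VeeringTriangulation q) :
    {r | ∃ e ∈ τ.edges, ∃ v, HasHolonomy q e v ∧ r = |v.re|}.Finite := by
  have : {r | ∃ e ∈ τ.edges, ∃ v, HasHolonomy q e v ∧ r = |v.re|} =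
      ⋃ e ∈ τ.edges, {r | ∃ v, HasHolonomy q e v ∧ r = |v.re|} := by ext; simp
  rw [this]
  refine τ.edges_finite.biUnion fun e _ => Set.Subsingleton.finite ?_
  rintro r ⟨v, hv, rfl⟩ r' ⟨v', hv', rfl⟩
  rcases hv.unique hv' with rfl | rfl <;> simp

/-- The flip cuts the wedge of `τ` along the diagonal to `s`. The edge of `σ` on the same side of
the vertical is at least as steep, so the wedge of `σ` already avoids the part that is cut off. -/
theorem IsStdQuad.wedge_inter_subset (hs : τ.IsStdQuad f c b s)
    (hf : IsFlipAt τ.toStraightTriangulation τ'.toStraightTriangulation e e' f c 0 b s)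
    (hβ : LaysOutAt τ.toStraightTriangulation β f b c)
    (hβ' : LaysOutAt σ.toStraightTriangulation β f' b' c') {ε : ℝ} (hε : ε = 1 ∨ ε = -1)
    (hεs : 0 < ε * s.re) (hp : p = b' ∨ p = c') (hεp : 0 < ε * p.re) (hcr : 0 ≤ ε * cr s p) :
    wedge β τ.toStraightTriangulation ∩ wedge β σ.toStraightTriangulation ⊆
      wedge β τ'.toStraightTriangulation := by
  rintro w ⟨h1, h2⟩
  obtain ⟨a1, a2⟩ := hβ.mem_wedge.1 h1
  obtain ⟨a3, a4⟩ := hβ'.mem_wedge.1 h2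
  obtain ⟨i1, i2⟩ := hβ.isUpright.im_pos
  have i3 := hs.im_pos
  have ip := hβ'.im_pos_of_mem hp
  have hbc := hβ.pos
  obtain ⟨r1, r2⟩ := hβ'.re_pos
  have iw : 0 ≤ w.im := by
    have : w.im * cr b c = b.im * cr w c + c.im * cr b w := by simp only [cr]; ring
    exact nonneg_of_mul_nonneg_left (this ▸ by positivity) hbc
  have key : p.im * cr s w = s.im * cr p w + w.im * cr s p := by simp only [cr]; ring
  rcases hε with rfl | rfl
  · rw [one_mul] at *
    have hpb : p = b' := hp.resolve_right fun h0 => by rw [h0] at hεp; linarith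
    subst hpb
    refine ((hs.laysOutAt_new hf hβ).1 hεs).mem_wedge.2 ⟨?_, a2⟩
    exact nonneg_of_mul_nonneg_right (key ▸ by positivity) ip
  · have hpc : p = c' := hp.resolve_left fun h0 => by rw [h0] at hεp; linarith
    subst hpc
    refine ((hs.laysOutAt_new hf hβ).2 (by linarith)).mem_wedge.2 ⟨a1, ?_⟩
    have e1 : cr w s = -cr s w := by simp only [cr]; ring
    have e2 : cr p w = -cr w p := by simp only [cr]; ring
    rw [e2] at key
    have : 0 ≤ -(p.im * cr s w) := by
      rw [key]; nlinarith [mul_nonneg i3.le a4]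
    rw [e1]
    refine nonneg_of_mul_nonneg_right (this.trans_eq ?_) ip
    ring

/-- A triangulation that does not bound `σ` can be flipped forward in such a way that the new
triangulation stays below every common upper bound. -/
theorem exists_flip_of_not_precedes (h : ¬ Precedes σ τ) :
    ∃ τ' e e', IsForwardFlip τ τ' e e' ∧
      (∀ β, wedge β τ.toStraightTriangulation ∩ wedge β σ.toStraightTriangulation ⊆
        wedge β τ'.toStraightTriangulation) ∧ ∃ d ∈ σ.edges, height q e' ≤ height q d := by
  -- The widths of the top sides of those faces of `τ` whose wedge is not contained in the wedge of
  -- `σ`.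
  obtain ⟨X, hX⟩ : ∃ X : Set ℝ, X = {r | ∃ β f b c, LaysOutAt τ.toStraightTriangulation β f b c ∧
    ¬ wedge β τ.toStraightTriangulation ⊆ wedge β σ.toStraightTriangulation ∧ r = b.re - c.re} :=
    ⟨_, rfl⟩
  have hfin : X.Finite := by
    refine τ.finite_widths.subset ?_
    rw [hX]
    rintro r ⟨β, f, b, c, hβ, -, rfl⟩
    refine ⟨_, hβ.laysOut.2.2.2.1, _, hβ.isUpright.holonomy_top, ?_⟩
    have := hβ.re_pos
    rw [Complex.sub_re, abs_sub_comm, abs_of_pos (by linarith)]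
  have hne : X.Nonempty := by
    rw [Precedes, not_forall] at h
    obtain ⟨β, hβw⟩ := h
    obtain ⟨f, b, c, hβ⟩ := τ.exists_laysOutAt β
    exact ⟨b.re - c.re, hX ▸ ⟨β, f, b, c, hβ, hβw, rfl⟩⟩
  obtain ⟨r, hr, hmax⟩ := X.exists_max_image id hfin hne
  rw [hX] at hr
  obtain ⟨β, f₀, b, c, hβ₀, hw, rfl⟩ := hr
  obtain ⟨f, s, hff, hs⟩ := hβ₀.laysOut.exists_opposite
  have hβ := hβ₀.congr hff
  -- If the apex of the face across were not between the ends of the top side, `exists_wider` would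
  -- contradict the maximality of the width.
  have hmid : c.re < s.re ∧ s.re < b.re := by
    by_contra hn
    obtain ⟨β₂, f₂, b₂, c₂, h1, h2, h3⟩ := hβ.exists_wider hw hs hn
    exact (hmax (b₂.re - c₂.re) (hX ▸ ⟨β₂, f₂, b₂, c₂, h1, h2, rfl⟩)).not_gt h3
  have hq := hβ.isUpright.isStdQuad hs hmid.1 hmid.2
  obtain ⟨f', b', c', hβ'⟩ := σ.exists_laysOutAt β
  obtain ⟨v, hv, hv1, -⟩ := hβ.exists_tall hβ' hw
  have hsteep := fun p => hq.steep_at_bottom (p := p) hβ hβ' hv hv1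
  obtain ⟨hsv, hs0, -⟩ := hsteep 0
  obtain ⟨τ', hf⟩ := hq.exists_isFlipAt hs0
  refine ⟨τ', _, _, hq.isForwardFlip hf, ?_, ?_⟩
  · obtain ⟨ε, hε, hεs⟩ : ∃ ε : ℝ, (ε = 1 ∨ ε = -1) ∧ 0 < ε * s.re := by
      rcases hs0.lt_or_gt with h0 | h0
      exacts [⟨-1, Or.inr rfl, by linarith⟩, ⟨1, Or.inl rfl, by linarith⟩]
    have side : ∀ {γ f b c}, LaysOutAt σ.toStraightTriangulation γ f b c →
        ∃ p, (p = b ∨ p = c) ∧ 0 < ε * p.re := fun {γ f b c} hγ => by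
      have := hγ.re_pos
      rcases hε with rfl | rfl
      exacts [⟨b, Or.inl rfl, by linarith⟩, ⟨c, Or.inr rfl, by linarith⟩]
    obtain ⟨p, hp, hεp⟩ := side hβ'
    have hps := (hsteep p).2.2 ε hε hεs hp hεp
    have hcr : 0 ≤ ε * cr s p := by
      rcases hps with rfl | ⟨h1, h2⟩
      · simp [cr, mul_comm]
      · simp only [cr]
        nlinarith [mul_pos hεs (sub_pos.2 h2), mul_pos (sub_pos.2 h1) hq.im_pos]
    intro γ
    obtain ⟨g, b₁, c₁, hγ⟩ := τ.exists_laysOutAt γ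
    -- Unchanged faces are trivial; at the lower half the bound is `steep_at_bottom`, at the upper
    -- half `steep_at_top`, with the same sign `ε`.
    rcases hq.laysOutAt_or hf hγ with h1 | h1 | h1
    · exact fun w hw => h1.mem_wedge.2 (hγ.mem_wedge.1 hw.1)
    · refine hq.wedge_inter_subset hf h1 (hβ'.isUpright.laysOutAt ?_) hε hεs hp hεp hcr
      filter_upwards [hβ.eventually, hβ'.eventually, h1.eventually] with t t1 t2 t3
      rw [t2.2, ← t1.2, t3.2]
    · obtain ⟨f₂, b₂, c₂, hγ'⟩ := σ.exists_laysOutAt γ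
      obtain ⟨p₂, hp₂, hεp₂⟩ := side hγ'
      exact hq.rotate.wedge_inter_subset (IsStdQuad.rotate_isFlipAt hf) h1 hγ' hε hεs hp₂ hεp₂
        (hq.steep_at_top hβ hβ' h1 hγ' hε hεs hp hps hεp hp₂ hεp₂)
  · obtain ⟨s1, s2, -⟩ := hβ'.saddle_of_mem hv
    refine ⟨_, s2, ?_⟩
    rw [s1.hasHolonomy.height_eq, hf.isQuad.saddle'.hasHolonomy.height_eq]
    simpa using abs_le_abs_of_nonneg hq.im_pos.le hsv

end VeeringTriangulation

end VeeringLattice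

/-! ### A flip is determined by either of its diagonals -/

namespace VeeringLattice

open Set Filter

variable {S : Type*} [TopologicalSpace S] {q : HalfTranslationSurface S} [T2Space S]

theorem LaysOutAt.eqOn {τ σ : VeeringTriangulation q} {β : VerticalSeparatrix q} {f f' : ℂ → S}
    {b c b' c' : ℂ} (h : LaysOutAt τ.toStraightTriangulation β f b c)
    (h' : LaysOutAt σ.toStraightTriangulation β f' b' c') :
    EqOn f f' (closedTriangle 0 b c ∩ closedTriangle 0 b' c') := by
  obtain ⟨F, f1, f2⟩ := h.isUpright.exists_box
  obtain ⟨F', f1', f2'⟩ := h'.isUpright.exists_box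
  intro w hw
  rw [← f1 hw.1, ← f1' hw.2]
  exact h.eqOn_box h' f1 f1' f2 f2'
    ⟨h.isUpright.triangle_subset_box hw.1, h'.isUpright.triangle_subset_box hw.2⟩

namespace VeeringTriangulation.IsStdQuad

variable {τ σ : VeeringTriangulation q} {f g : ℂ → S} {b c b' c' s s' t : ℂ}

omit [T2Space S] in
theorem diagonal_subset (h : τ.IsStdQuad f c b s) :
    segment ℝ 0 s ⊆ closedTriangle 0 b c ∪ closedTriangle c b s := by
  intro w hw
  obtain ⟨r, h0, h1, rfl⟩ := mem_segment_iff'.1 hw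
  obtain ⟨p1, p2⟩ := h.cr_pos
  have p3 := h.isUpright.pos
  have p4 := h.quad.prs.pos
  have q1 := mul_nonneg h0 p1.le
  have q2 := mul_nonneg h0 p2.le
  have q3 := mul_nonneg (sub_nonneg.2 h1) p1.le
  have q4 := mul_nonneg (sub_nonneg.2 h1) p2.le
  rcases le_total 0 (cr (c - b) (0 + r * (s - 0) - b)) with h2 | h2
  · refine Or.inl ((mem_closedTriangle (by simpa using p3)).2 ⟨?_, h2, ?_⟩) <;>
      simp only [cr, Complex.sub_re, Complex.sub_im, Complex.add_re, Complex.add_im,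
        Complex.zero_re, Complex.zero_im, Complex.re_ofReal_mul, Complex.im_ofReal_mul] at * <;>
      linarith
  · refine Or.inr ((mem_closedTriangle p4).2 ⟨?_, ?_, ?_⟩) <;>
      simp only [cr, Complex.sub_re, Complex.sub_im, Complex.add_re, Complex.add_im,
        Complex.zero_re, Complex.zero_im, Complex.re_ofReal_mul, Complex.im_ofReal_mul] at * <;>
      linarith

theorem triangles_subset (h : τ.IsStdQuad f c b s) :
    closedTriangle 0 b c ∪ closedTriangle c b s ⊆ rect c.re b.re 0 s.im := by
  have r1 := h.re_neg
  have r2 := h.re_pos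
  have r3 := h.im_lt_left
  have r4 := h.im_lt_right
  have r5 := h.lt_re
  have r6 := h.re_lt
  obtain ⟨i1, i2⟩ := h.isUpright.im_pos
  refine Set.union_subset ?_ ?_ <;> refine convexHull_min ?_ (convex_rect _ _ _ _) <;>
    rintro w (rfl | rfl | rfl) <;> refine mem_rect.2 ⟨⟨?_, ?_⟩, ?_, ?_⟩ <;>
    linarith [Complex.zero_re, Complex.zero_im]

/-- Two quadrilaterals in standard position with the same vertical diagonal coincide. -/
theorem eq_of_eqOn_diagonal (h : τ.IsStdQuad f c b s) (h' : σ.IsStdQuad g c' b' s)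
    (he : EqOn g f (segment ℝ 0 s)) :
    c' = c ∧ b' = b ∧ EqOn f g (closedTriangle 0 b c ∪ closedTriangle c b s) := by
  -- On each side, the corner of the narrower quadrilateral lies in the box of the other one, hence
  -- is its corner. As either may be the narrower one, this is applied in both directions.
  have key : ∀ {τ σ : VeeringTriangulation q} {f g : ℂ → S} {b c b' c' s : ℂ},
      τ.IsStdQuad f c b s → σ.IsStdQuad g c' b' s → EqOn g f (segment ℝ 0 s) →
      ∃ F F', EqOn F f (closedTriangle 0 b c ∪ closedTriangle c b s) ∧
        EqOn F' g (closedTriangle 0 b' c' ∪ closedTriangle c' b' s) ∧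
        EqOn F F' (rect c.re b.re 0 s.im ∩ rect c'.re b'.re 0 s.im) ∧
        (c.re ≤ c'.re → c' = c) ∧ (b'.re ≤ b.re → b' = b) := by
    intro τ σ f g b c b' c' s h h' he
    obtain ⟨F, f1, f2⟩ := h.exists_box
    obtain ⟨F', f1', f2'⟩ := h'.exists_box
    have r1 := h.re_neg
    have r2 := h.re_pos
    have r1' := h'.re_neg
    have r2' := h'.re_pos
    have q3 := h.im_pos
    have i1 := h.isUpright.im_pos
    have i1' := h'.isUpright.im_pos
    have l1 := h'.im_lt_left
    have l2 := h'.im_lt_right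
    have heq := f2.eqOn f2' (convex_rect _ _ _ _) (convex_rect _ _ _ _) (by
        rw [rect_inter]
        exact interior_rect_nonempty (max_lt (lt_min (by linarith) (by linarith))
          (lt_min (by linarith) (by linarith))) (by simpa using q3))
      (toFinite _) (toFinite _) h.disjoint_interior h'.disjoint_interior (convex_segment 0 s)
      ⟨0, left_mem_segment _ _ _, s, right_mem_segment _ _ _, fun h0 => by
        rw [← h0] at q3; simp at q3⟩
      (fun w hw => ⟨h.triangles_subset (h.diagonal_subset hw), h'.triangles_subset (h'.diagonal_subset hw)⟩)
      (fun w hw => by rw [f1 (h.diagonal_subset hw), f1' (h'.diagonal_subset hw), he hw])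
    refine ⟨F, F', f1, f1', heq, fun hle => ?_, fun hle => ?_⟩
    · have m1 : c' ∈ rect c.re b.re 0 s.im :=
        mem_rect.2 ⟨⟨hle, by linarith⟩, i1'.2.le, l1.le⟩
      have m2 : c' ∈ rect c'.re b'.re 0 s.im :=
        mem_rect.2 ⟨⟨le_rfl, by linarith⟩, i1'.2.le, l1.le⟩
      rcases f2.mem_of_marked m1 (heq ⟨m1, m2⟩ ▸ f2'.marked c' (by simp)) with h0 | h0 | h0 | h0
      · rw [h0] at r1'; simp at r1'
      · rw [h0] at r1'; linarith
      · exact h0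
      · rw [h0] at l1; exact absurd l1 (lt_irrefl _)
    · have m1 : b' ∈ rect c.re b.re 0 s.im :=
        mem_rect.2 ⟨⟨by linarith, hle⟩, i1'.1.le, l2.le⟩
      have m2 : b' ∈ rect c'.re b'.re 0 s.im :=
        mem_rect.2 ⟨⟨by linarith, le_rfl⟩, i1'.1.le, l2.le⟩
      rcases f2.mem_of_marked m1 (heq ⟨m1, m2⟩ ▸ f2'.marked b' (by simp)) with h0 | h0 | h0 | h0
      · rw [h0] at r2'; simp at r2'
      · exact h0
      · rw [h0] at r2'; linarith
      · rw [h0] at l2; exact absurd l2 (lt_irrefl _)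
  obtain ⟨F, F', f1, f1', heq, k1, k2⟩ := key h h' he
  obtain ⟨-, -, -, -, -, k3, k4⟩ := key h' h he.symm
  obtain rfl : c' = c := (le_total c.re c'.re).elim k1 fun hle => (k3 hle).symm
  obtain rfl : b' = b := (le_total b'.re b.re).elim k2 fun hle => (k4 hle).symm
  refine ⟨rfl, rfl, fun w hw => ?_⟩
  rw [← f1 hw, ← f1' hw]
  exact heq ⟨h.triangles_subset hw, h.triangles_subset hw⟩

/-- Two quadrilaterals in standard position with the same horizontal diagonal coincide. -/
theorem eq_of_eqOn_translate (h : τ.IsStdQuad f c b s) (h' : σ.IsStdQuad g (c + t) (b + t) s')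
    (he : ∀ w ∈ segment ℝ c b, g (w + t) = f w) :
    t = 0 ∧ s' = s ∧ EqOn f g (closedTriangle 0 b c ∪ closedTriangle c b s) := by
  obtain ⟨F, f1, f2⟩ := h.exists_box
  obtain ⟨F', f1', f2'⟩ := h'.exists_box
  have hk : IsHalfTranslation fun w => w + t := ⟨t, Or.inl fun _ => rfl⟩
  have r1 := h.re_neg
  have r2 := h.re_pos
  have r1' := h'.re_neg
  have r2' := h'.re_pos
  have q3 := h.im_pos
  have q3' := h'.im_pos
  have i1 := h.isUpright.im_pos
  have i1' := h'.isUpright.im_pos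
  have l1 := h.im_lt_left
  have l2 := h.im_lt_right
  have l1' := h'.im_lt_left
  have l2' := h'.im_lt_right
  have a1 := h.lt_re
  have a2 := h.re_lt
  have a1' := h'.lt_re
  have a2' := h'.re_lt
  simp only [Complex.add_re, Complex.add_im] at r1' r2' i1' l1' l2' a1' a2'
  have hD : (fun w => w + t) ⁻¹' rect (c + t).re (b + t).re 0 s'.im =
      rect c.re b.re (-t.im) (s'.im - t.im) := by
    ext w
    simp only [mem_preimage, mem_rect, Complex.add_re, Complex.add_im]
    constructor <;> rintro ⟨⟨h1, h2⟩, h3, h4⟩ <;> refine ⟨⟨?_, ?_⟩, ?_, ?_⟩ <;> linarith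
  have d2 := f2'.comp hk
  rw [hD] at d2
  have hVd : Disjoint ((fun w => w + t) ⁻¹' {0, b + t, c + t, s'})
      (interior (rect c.re b.re (-t.im) (s'.im - t.im))) := by
    rw [disjoint_left]
    intro w hw hw'
    refine disjoint_left.1 h'.disjoint_interior hw ?_
    rw [mem_interior_rect] at hw' ⊢
    simp only [Complex.add_re, Complex.add_im]
    refine ⟨⟨?_, ?_⟩, ?_, ?_⟩ <;> linarith
  have hcb : c ≠ b := fun h0 => by rw [h0] at r1; linarith
  have hseg : segment ℝ c b ⊆ closedTriangle 0 b c :=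
    fun w hw => by
      rw [segment_symm] at hw
      rw [← closedTriangle_cyc]
      exact segment_subset_closedTriangle _ _ _ hw
  have hseg' : ∀ w ∈ segment ℝ c b, w + t ∈ closedTriangle 0 (b + t) (c + t) := fun w hw => by
    rw [← closedTriangle_cyc]
    refine segment_subset_closedTriangle _ _ _ ?_
    have := mem_image_of_mem (fun w => w + t) hw
    rwa [hk.image_segment, segment_symm] at this
  have heq := f2.eqOn d2 (convex_rect _ _ _ _) (convex_rect _ _ _ _) (by
      rw [rect_inter]
      exact interior_rect_nonempty (by simp; linarith)
        (max_lt (lt_min (by linarith) (by linarith)) (lt_min (by linarith) (by linarith))))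
    (toFinite _) ((toFinite _).preimage hk.injective.injOn) h.disjoint_interior hVd
    (convex_segment c b) ⟨c, left_mem_segment _ _ _, b, right_mem_segment _ _ _, hcb⟩
    (fun w hw => ⟨h.triangles_subset (Or.inl (hseg hw)), by
      rw [← hD]; exact h'.triangles_subset (Or.inl (hseg' w hw))⟩)
    (fun w hw => by
      rw [f1 (Or.inl (hseg hw)), f1' (Or.inl (hseg' w hw)), he w hw])
  have mark : ∀ w ∈ rect c.re b.re 0 s.im, w ∈ rect c.re b.re (-t.im) (s'.im - t.im) →
      (w ∈ ({0, b, c, s} : Set ℂ) ↔ w + t ∈ ({0, b + t, c + t, s'} : Set ℂ)) := fun w h1 h2 =>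
    have h3 : F w = F' (w + t) := heq ⟨h1, h2⟩
    ⟨fun hw => d2.mem_of_marked h2 (show F' (w + t) ∈ q.Z from h3 ▸ f2.marked w hw),
      fun hw => f2.mem_of_marked h1 (h3 ▸ d2.marked w hw)⟩
  -- In common coordinates the lowest vertices are `0` and `-t`. The higher one is in the box of the
  -- other quadrilateral, so it is one of its four vertices, and only the lowest is possible.
  have ht : t = 0 := by
    rcases lt_or_ge 0 (-t.im) with hlt | hge
    · rcases (mark (-t) (mem_rect.2 (by simp; refine ⟨⟨?_, ?_⟩, ?_, ?_⟩ <;> linarith))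
        (mem_rect.2 (by simp; refine ⟨⟨?_, ?_⟩, ?_⟩ <;> linarith))).2 (by simp) with h0 | h0 | h0 | h0
      · simpa using h0
      all_goals
        have h1 := congrArg Complex.re h0
        have h2 := congrArg Complex.im h0
        simp at h1 h2
        linarith
    · rcases (mark 0 (mem_rect.2 (by simp; refine ⟨⟨?_, ?_⟩, ?_⟩ <;> linarith))
        (mem_rect.2 (by simp; refine ⟨⟨?_, ?_⟩, ?_, ?_⟩ <;> linarith))).1 (by simp) with
        h0 | h0 | h0 | h0
      · simpa using h0
      all_goals
        have h1 := congrArg Complex.re h0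
        have h2 := congrArg Complex.im h0
        simp at h1 h2
        linarith
  subst ht
  simp only [add_zero, Complex.zero_re, Complex.zero_im, neg_zero, sub_zero]
    at h' heq mark f1' r1' r2' i1' l1' l2' a1' a2'
  -- Likewise the lower one of the two highest vertices is in the box of the other quadrilateral.
  have hs : s' = s := by
    rcases le_total s.im s'.im with hle | hle
    · rcases (mark s (mem_rect.2 ⟨⟨by linarith, by linarith⟩, by linarith, by linarith⟩)
        (mem_rect.2 ⟨⟨by linarith, by linarith⟩, by linarith, by linarith⟩)).1 (by simp) with
        h0 | h0 | h0 | h0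
      · rw [h0] at q3; simp at q3
      · rw [h0] at l2; exact absurd l2 (lt_irrefl _)
      · rw [h0] at l1; exact absurd l1 (lt_irrefl _)
      · exact h0.symm
    · rcases (mark s' (mem_rect.2 ⟨⟨by linarith, by linarith⟩, by linarith, by linarith⟩)
        (mem_rect.2 ⟨⟨by linarith, by linarith⟩, by linarith, by linarith⟩)).2 (by simp) with
        h0 | h0 | h0 | h0
      · rw [h0] at q3'; simp at q3'
      · rw [h0] at l2'; exact absurd l2' (lt_irrefl _)
      · rw [h0] at l1'; exact absurd l1' (lt_irrefl _)
      · exact h0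
  subst hs
  refine ⟨rfl, rfl, fun w hw => ?_⟩
  rw [← f1 hw, ← f1' hw]
  exact heq ⟨h.triangles_subset hw, h.triangles_subset hw⟩

end VeeringTriangulation.IsStdQuad

namespace IsForwardFlip

variable {τ τ' σ σ' ν : VeeringTriangulation q} {e e' d d' : Set S}

/-- Two forward flips that remove the same edge, or that create the same edge, take place in the same
quadrilateral. -/
theorem exists_common (h : IsForwardFlip τ τ' e e') (h' : IsForwardFlip σ σ' d d')
    (hed : e = d ∨ e' = d') : ∃ f g c b s, τ.IsStdQuad f c b s ∧
      IsFlipAt τ.toStraightTriangulation τ'.toStraightTriangulation e e' f c 0 b s ∧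
      σ.IsStdQuad g c b s ∧
      IsFlipAt σ.toStraightTriangulation σ'.toStraightTriangulation d d' g c 0 b s ∧
      EqOn f g (closedTriangle 0 b c ∪ closedTriangle c b s) := by
  obtain ⟨f, c, b, s, hq, hf⟩ := h.exists_isStdQuad
  obtain ⟨g, c', b', s', hq', hf'⟩ := h'.exists_isStdQuad
  have a1 := hq.re_neg
  have a2 := hq.re_pos
  have a3 := hq'.re_neg
  have a4 := hq'.re_pos
  have a5 := hq.im_pos
  have a6 := hq'.im_pos
  rcases hed with hed | hed
  · rw [hf.2.2.2.2.2.1, hf'.2.2.2.2.2.1] at hed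
    obtain ⟨k, ⟨t, hk⟩, hkv, hkf⟩ := hq'.quad.saddle.unique' hq.quad.saddle hed
    have key : ∀ g c' b' s' t, σ.IsStdQuad g c' b' s' →
        IsFlipAt σ.toStraightTriangulation σ'.toStraightTriangulation d d' g c' 0 b' s' →
        c' = c + t → b' = b + t → (∀ w ∈ segment ℝ c b, g (w + t) = f w) →
        ∃ f g c b s, τ.IsStdQuad f c b s ∧
          IsFlipAt τ.toStraightTriangulation τ'.toStraightTriangulation e e' f c 0 b s ∧
          σ.IsStdQuad g c b s ∧
          IsFlipAt σ.toStraightTriangulation σ'.toStraightTriangulation d d' g c 0 b s ∧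
          EqOn f g (closedTriangle 0 b c ∪ closedTriangle c b s) := by
      rintro g _ _ s' t h1 h2 rfl rfl h3
      obtain ⟨rfl, rfl, h4⟩ := hq.eq_of_eqOn_translate h1 h3
      simp only [add_zero] at h1 h2
      exact ⟨f, g, c, b, s', hq, hf, h1, h2, h4⟩
    -- Translations that exchange the ends, and half-turns that keep them, would turn left into
    -- right. The remaining half-turn is absorbed by rotating the second quadrilateral.
    rcases hk with hk | hk <;> simp only [hk] at hkv hkf <;>
      rcases hkv with ⟨h1, h2⟩ | ⟨h1, h2⟩
    · exact key g c' b' s' t hq' hf' h1.symm h2.symm hkf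
    · have h3 := congrArg Complex.re h1
      have h4 := congrArg Complex.re h2
      simp at h3 h4
      linarith
    · have h3 := congrArg Complex.re h1
      have h4 := congrArg Complex.re h2
      simp at h3 h4
      linarith
    · refine key _ _ _ _ (s' - t) hq'.rotate
        (VeeringTriangulation.IsStdQuad.rotate_isFlipAt hf') ?_ ?_ fun w hw => ?_
      · linear_combination h1
      · linear_combination h2
      · rw [← hkf w hw]; congr 1; ring
  · rw [hf.2.2.2.2.2.2.1, hf'.2.2.2.2.2.2.1] at hed
    obtain ⟨k, ⟨t, hk⟩, hkv, hkf⟩ := hq'.quad.saddle'.unique' hq.quad.saddle' hed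
    have key : ∀ g c' b', σ.IsStdQuad g c' b' s →
        IsFlipAt σ.toStraightTriangulation σ'.toStraightTriangulation d d' g c' 0 b' s →
        (∀ w ∈ segment ℝ 0 s, g w = f w) →
        ∃ f g c b s, τ.IsStdQuad f c b s ∧
          IsFlipAt τ.toStraightTriangulation τ'.toStraightTriangulation e e' f c 0 b s ∧
          σ.IsStdQuad g c b s ∧
          IsFlipAt σ.toStraightTriangulation σ'.toStraightTriangulation d d' g c 0 b s ∧
          EqOn f g (closedTriangle 0 b c ∪ closedTriangle c b s) := by
      intro g c' b' h1 h2 h3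
      obtain ⟨rfl, rfl, h4⟩ := hq.eq_of_eqOn_diagonal h1 h3
      exact ⟨f, g, c', b', s, hq, hf, h1, h2, h4⟩
    rcases hk with hk | hk <;> simp only [hk] at hkv hkf <;>
      rcases hkv with ⟨h1, h2⟩ | ⟨h1, h2⟩
    · obtain rfl : t = 0 := by simpa using h1
      obtain rfl : s = s' := by simpa using h2
      exact key g c' b' hq' hf' (by simpa using hkf)
    · have h3 := congrArg Complex.im h1
      have h4 := congrArg Complex.im h2
      simp at h3 h4
      linarith
    · have h3 := congrArg Complex.im h1
      have h4 := congrArg Complex.im h2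
      simp at h3 h4
      linarith
    · obtain rfl : t = s' := by simpa using h1
      obtain rfl : s = t := by linear_combination -h2
      exact key _ _ _ hq'.rotate (VeeringTriangulation.IsStdQuad.rotate_isFlipAt hf') hkf

/-- The relation "some flip replaces `e` by `e'`" is a partial injection on edges, independently of
the triangulations. This is what makes chains of edges. -/
theorem eq_iff (h : IsForwardFlip τ τ' e e') (h' : IsForwardFlip σ σ' d d') : e = d ↔ e' = d' := by
  have key : e = d ∨ e' = d' → e = d ∧ e' = d' := by
    intro hed
    obtain ⟨f, g, c, b, s, h1, h2, h3, h4, h5⟩ := h.exists_common h' hed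
    rw [h2.2.2.2.2.2.1, h4.2.2.2.2.2.1, h2.2.2.2.2.2.2.1, h4.2.2.2.2.2.2.1]
    refine ⟨image_congr fun w hw => h5 (Or.inl ?_), image_congr fun w hw => h5 (h1.diagonal_subset hw)⟩
    rw [segment_symm] at hw
    rw [← closedTriangle_cyc]
    exact segment_subset_closedTriangle _ _ _ hw
  exact ⟨fun h0 => (key (Or.inl h0)).2, fun h0 => (key (Or.inr h0)).1⟩

/-- If an edge is created by flips of `τ` and of `σ`, then it is not an edge of any triangulation
below the join of `τ` and `σ`. -/
theorem notMem_of_wedge_inter_subset (h : IsForwardFlip τ τ' e e') (h' : IsForwardFlip σ σ' d e')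
    (hν : ∀ β, wedge β τ.toStraightTriangulation ∩ wedge β σ.toStraightTriangulation ⊆
      wedge β ν.toStraightTriangulation) : e' ∉ ν.edges := by
  intro hmem
  obtain ⟨f, g, c, b, s, h1, h2, h3, h4, h5⟩ := h.exists_common h' (Or.inr rfl)
  obtain ⟨β, -, hβ⟩ := h1.isUpright.exists_separatrix
  have hβ' : LaysOutAt σ.toStraightTriangulation β g b c := h3.isUpright.laysOutAt <| by
    filter_upwards [hβ.eventually] with t ht
    rw [← ht.2, h5 (Or.inl (openTriangle_subset _ _ _ ht.1))]
  obtain ⟨f₂, b₂, c₂, hβ₂⟩ := ν.exists_laysOutAt β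
  -- The wedge of `ν` contains the wedge that `τ` and `σ` share at the lowest vertex, and the
  -- diagonal is strictly inside the latter.
  have m1 := (hβ₂.mem_wedge.1 (hν β ⟨hβ.right_mem_wedge, hβ'.right_mem_wedge⟩)).1
  have m2 := (hβ₂.mem_wedge.1 (hν β ⟨hβ.left_mem_wedge, hβ'.left_mem_wedge⟩)).2
  obtain ⟨p1, p2⟩ := h1.cr_pos
  obtain ⟨i1, i2⟩ := hβ.isUpright.im_pos
  obtain ⟨j1, j2⟩ := hβ₂.isUpright.im_pos
  have q3 := h1.im_pos
  have n1 : 0 < cr b₂ s := by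
    have : b.im * cr b₂ s = b₂.im * cr b s + s.im * cr b₂ b := by simp only [cr]; ring
    exact pos_of_mul_pos_right (this ▸ by positivity) i1.le
  have n2 : 0 < cr s c₂ := by
    have : c.im * cr s c₂ = c₂.im * cr s c + s.im * cr c c₂ := by simp only [cr]; ring
    exact pos_of_mul_pos_right (this ▸ by positivity) i2.le
  -- A point of the diagonal close to the vertex is in the interior of a face of `ν`, so the
  -- diagonal is not an edge of `ν`.
  obtain ⟨t, ⟨t1, t2⟩, t3, t4⟩ := ((eventually_smul_mem_openTriangle hβ.pos p1 p2).and
    (eventually_smul_mem_openTriangle hβ₂.pos n1 n2)).and (Ioo_mem_nhdsGT one_pos) |>.exists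
  refine disjoint_left.1 (ν.edge_face _ hmem _ hβ₂.laysOut.2.1) ?_ (mem_image_of_mem f₂ t2)
  rw [h2.2.2.2.2.2.2.1, ← hβ.eqOn hβ₂ ⟨openTriangle_subset _ _ _ t1, openTriangle_subset _ _ _ t2⟩]
  exact mem_image_of_mem f (mem_segment_iff'.2 ⟨t, t3.le, t4.le, by ring⟩)

omit [T2Space S] in
theorem old_mem (h : IsForwardFlip τ τ' e e') : e ∈ τ.edges := by
  obtain ⟨f, p, u, r, s, hf, -⟩ := h
  exact hf.old_mem

omit [T2Space S] in
theorem new_notMem (h : IsForwardFlip τ τ' e e') : e' ∉ τ.edges := by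
  obtain ⟨f, p, u, r, s, hf, -⟩ := h
  exact hf.new_notMem

omit [T2Space S] in
theorem edges_eq (h : IsForwardFlip τ τ' e e') : τ'.edges = insert e' (τ.edges \ {e}) := by
  obtain ⟨f, p, u, r, s, hf, -⟩ := h
  exact hf.edges_eq

/-- The new diagonal is higher than both lower sides, and the height of the old one is the
difference of their heights, each of which is at least `h₀`. -/
theorem height_add_le (h : IsForwardFlip τ τ' e e') {h₀ : ℝ} (hh : ∀ e ∈ τ.edges, h₀ ≤ height q e) :
    height q e + h₀ ≤ height q e' := by
  obtain ⟨f, c, b, s, hq, hf⟩ := h.exists_isStdQuad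
  obtain ⟨i1, i2⟩ := hq.isUpright.im_pos
  have hb := hh _ hq.isUpright.laysOut.2.2.1
  have hc := hh _ hq.isUpright.laysOut.2.2.2.2
  have l1 := hq.im_lt_left
  have l2 := hq.im_lt_right
  rw [hq.isUpright.holonomy_right.height_eq, abs_of_pos i1] at hb
  rw [hq.isUpright.holonomy_left.height_eq, abs_of_pos i2] at hc
  rw [hf.2.2.2.2.2.1, hf.2.2.2.2.2.2.1, hq.quad.saddle.hasHolonomy.height_eq,
    hq.quad.saddle'.hasHolonomy.height_eq, sub_zero, abs_of_pos hq.im_pos, Complex.sub_im]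
  rcases abs_cases (b.im - c.im) with ⟨h1, -⟩ | ⟨h1, -⟩ <;> linarith

end IsForwardFlip

end VeeringLattice

/-! ### Chains of a partial injection and positions in them -/

namespace VeeringLattice

open Set Filter Relation

section Chain

/-- `Steps N n x y`: there is a chain of length `n` from `x` to `y`. -/
def Steps {E : Type*} (N : E → E → Prop) : ℕ → E → E → Prop
  | 0, x, y => x = y
  | n + 1, x, y => ∃ z, Steps N n x z ∧ N z y

/-- The signed distance along the chains of `N`. -/
def ChainDist {E : Type*} (N : E → E → Prop) (x y : E) (k : ℤ) : Prop :=
  (∃ n : ℕ, k = n ∧ Steps N n x y) ∨ (∃ n : ℕ, k = -n ∧ Steps N n y x)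

variable {E : Type*} {N : E → E → Prop} {x y z : E} {m n : ℕ} {k l : ℤ}

theorem Steps.head (h : N x y) : ∀ {n z}, Steps N n y z → Steps N (n + 1) x z
  | 0, _, rfl => ⟨_, rfl, h⟩
  | _ + 1, _, ⟨w, hw, hN⟩ => ⟨w, Steps.head h hw, hN⟩

theorem Steps.exists_head : ∀ {n z}, Steps N (n + 1) x z → ∃ y, N x y ∧ Steps N n y z
  | 0, _, ⟨_, rfl, h⟩ => ⟨_, h, rfl⟩
  | _ + 1, _, ⟨_, hw, hN⟩ => by
    obtain ⟨y, h1, h2⟩ := Steps.exists_head hw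
    exact ⟨y, h1, _, h2, hN⟩

theorem Steps.potential_le {ht : E → ℝ} (hN : ∀ x y, N x y → ht x < ht y) :
    ∀ {n z}, Steps N n x z → ht x ≤ ht z ∧ (n ≠ 0 → ht x < ht z)
  | 0, _, rfl => ⟨le_rfl, fun h => absurd rfl h⟩
  | _ + 1, _, ⟨_, hw, h⟩ =>
    have := (Steps.potential_le hN hw).1.trans_lt (hN _ _ h)
    ⟨this.le, fun _ => this⟩

namespace ChainDist

theorem refl (x : E) : ChainDist N x x 0 := Or.inl ⟨0, rfl, rfl⟩

theorem symm (h : ChainDist N x y k) : ChainDist N y x (-k) := by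
  rcases h with ⟨n, rfl, h⟩ | ⟨n, rfl, h⟩
  exacts [Or.inr ⟨n, rfl, h⟩, Or.inl ⟨n, neg_neg _, h⟩]

theorem eq_of_zero (h : ChainDist N x y 0) : x = y := by
  rcases h with ⟨n, h0, h⟩ | ⟨n, h0, h⟩ <;> obtain rfl : n = 0 := by omega
  exacts [h, Eq.symm h]

/-- For a partial injection, a further step either lengthens a chain that runs forwards or undoes
the adjacent step of one that runs backwards. -/
theorem succ (hN : ∀ x y x' y', N x y → N x' y' → (x = x' ↔ y = y')) (h : ChainDist N x y k)
    (hyz : N y z) : ChainDist N x z (k + 1) := by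
  rcases h with ⟨n, rfl, h⟩ | ⟨n, rfl, h⟩
  · exact Or.inl ⟨n + 1, by simp, y, h, hyz⟩
  · cases n with
    | zero => obtain rfl : y = x := h; exact Or.inl ⟨1, by simp, y, rfl, hyz⟩
    | succ n =>
      obtain ⟨w, h1, h2⟩ := h.exists_head
      obtain rfl : w = z := (hN _ _ _ _ h1 hyz).1 rfl
      exact Or.inr ⟨n, by push_cast; ring, h2⟩

theorem pred (hN : ∀ x y x' y', N x y → N x' y' → (x = x' ↔ y = y')) (h : ChainDist N x y k)
    (hzy : N z y) : ChainDist N x z (k - 1) := by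
  rcases h with ⟨n, rfl, h⟩ | ⟨n, rfl, h⟩
  · cases n with
    | zero => obtain rfl : x = y := h; exact Or.inr ⟨1, by simp, z, rfl, hzy⟩
    | succ n =>
      obtain ⟨w, h1, h2⟩ := h
      obtain rfl : w = z := (hN _ _ _ _ h2 hzy).2 rfl
      exact Or.inl ⟨n, by push_cast; ring, h1⟩
  · exact Or.inr ⟨n + 1, by push_cast; ring, h.head hzy⟩

theorem trans (hN : ∀ x y x' y', N x y → N x' y' → (x = x' ↔ y = y')) (h : ChainDist N x y k)
    (h' : ChainDist N y z l) : ChainDist N x z (k + l) := by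
  rcases h' with ⟨n, rfl, h'⟩ | ⟨n, rfl, h'⟩
  · induction n generalizing z with
    | zero => obtain rfl : y = z := h'; simpa using h
    | succ n ih =>
      obtain ⟨w, h1, h2⟩ := h'
      have := (ih h1).succ hN h2
      rwa [add_assoc] at this
  · induction n generalizing z with
    | zero => obtain rfl : z = y := h'; simpa using h
    | succ n ih =>
      obtain ⟨w, h1, h2⟩ := h'.exists_head
      have := (ih h2).pred hN h1
      rwa [show k + -((n + 1 : ℕ) : ℤ) = k + -(n : ℤ) - 1 by push_cast; ring]

/-- Two different distances would combine to a closed chain of positive length, along which `ht`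
increases strictly. -/
theorem unique {ht : E → ℝ} (hN : ∀ x y x' y', N x y → N x' y' → (x = x' ↔ y = y'))
    (hlt : ∀ x y, N x y → ht x < ht y) (h : ChainDist N x y k) (h' : ChainDist N x y l) :
    k = l := by
  have key : ∀ n : ℕ, Steps N n x x → n = 0 := fun n hn => by
    by_contra h0
    exact lt_irrefl _ ((hn.potential_le hlt).2 h0)
  rcases h.trans hN h'.symm with ⟨n, h1, h2⟩ | ⟨n, h1, h2⟩ <;> have := key n h2 <;> omega

end ChainDist

/-- The chains of a relation that is a strictly increasing partial injection can be coordinatised: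
`κ` names the chain, and `ψ` is the position in the chain. -/
theorem exists_chain_coordinates {ht : E → ℝ}
    (hN : ∀ x y x' y', N x y → N x' y' → (x = x' ↔ y = y')) (hlt : ∀ x y, N x y → ht x < ht y) :
    ∃ (κ : E → E) (ψ : E → ℤ), (∀ x y, N x y → κ y = κ x ∧ ψ y = ψ x + 1) ∧
      ∀ x y, κ x = κ y → ψ x = ψ y → x = y := by
  let r : Setoid E := ⟨fun x y => ∃ k, ChainDist N x y k, fun x => ⟨0, .refl x⟩,
    fun ⟨_, h⟩ => ⟨_, h.symm⟩, fun ⟨_, h⟩ ⟨_, h'⟩ => ⟨_, h.trans hN h'⟩⟩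
  have hκ : ∀ x, ∃ k, ChainDist N (Quotient.mk r x).out x k := fun x => Quotient.mk_out (s := r) x
  choose ψ hψ using hκ
  -- `κ` picks a representative of each chain, and `ψ` is the signed distance from it.
  refine ⟨fun x => (Quotient.mk r x).out, ψ, fun x y h => ?_, fun x y h1 h2 => ?_⟩
  · have he : (Quotient.mk r y).out = (Quotient.mk r x).out := by
      congr 1
      exact Quotient.sound (s := r) ⟨_, ((ChainDist.refl x).succ hN h).symm⟩
    have h1 := hψ y
    rw [he] at h1
    exact ⟨he, h1.unique hN hlt ((hψ x).succ hN h)⟩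
  · have h3 := hψ y
    rw [← show (Quotient.mk r x).out = (Quotient.mk r y).out from h1, ← h2] at h3
    have := (hψ x).symm.trans hN h3
    rw [neg_add_cancel] at this
    exact this.eq_of_zero

end Chain

/-! ### Abstract flip systems: labels and coordinates carried along flips -/

/-- An abstract system of flips: the objects `V` have finite sets of edges, and a flip replaces an
edge by a higher one, in such a way that each edge determines its successor and predecessor. -/
structure FlipSystem (V E : Type*) where
  /-- the edges of an object -/
  edges : V → Set E
  /-- `flip τ τ' e e'`: the object `τ'` is obtained from `τ` by flipping `e` to `e'` -/
  flip : V → V → E → E → Prop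
  /-- the height of an edge -/
  height : E → ℝ
  edges_finite : ∀ τ, (edges τ).Finite
  old_mem : ∀ {τ τ' e e'}, flip τ τ' e e' → e ∈ edges τ
  new_notMem : ∀ {τ τ' e e'}, flip τ τ' e e' → e' ∉ edges τ
  edges_eq : ∀ {τ τ' e e'}, flip τ τ' e e' → edges τ' = insert e' (edges τ \ {e})
  eq_iff : ∀ {τ τ' e e' σ σ' d d'}, flip τ τ' e e' → flip σ σ' d d' → (e = d ↔ e' = d')
  height_lt : ∀ {τ τ' e e'}, flip τ τ' e e' → height e < height e'

namespace FlipSystem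

variable {V E A : Type*} [DecidableEq A] (M : FlipSystem V E)

/-- There is a flip from `τ` to `τ'`. -/
def Adj (τ τ' : V) : Prop := ∃ e e', M.flip τ τ' e e'

variable {M} {τ₀ τ τ' σ ν : V} {e e' : E} {p₀ p p' : A → E} {φ φ' : A → ℤ}

theorem old_notMem (h : M.flip τ τ' e e') : e ∉ M.edges τ' := by
  rw [M.edges_eq h]
  rintro (h0 | h0)
  · exact M.new_notMem h (h0 ▸ M.old_mem h)
  · exact h0.2 rfl

theorem new_mem (h : M.flip τ τ' e e') : e' ∈ M.edges τ' := by
  rw [M.edges_eq h]; exact mem_insert _ _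

theorem edges_eq' (h : M.flip τ τ' e e') : M.edges τ = insert e (M.edges τ' \ {e'}) := by
  have hn := M.new_notMem h
  rw [M.edges_eq h, insert_sdiff_of_mem _ (mem_singleton _), sdiff_singleton_eq_self
    (fun h0 => hn h0.1), insert_sdiff_singleton, insert_eq_of_mem (M.old_mem h)]

variable (M τ₀ p₀) in
/-- The labellings and coordinates that arise along sequences of flips. -/
inductive Reach : V → (A → E) → (A → ℤ) → Prop
  | base : Reach τ₀ p₀ 0
  | forward {τ τ' p φ a e'} : Reach τ p φ → M.flip τ τ' (p a) e' →
      Reach τ' (Function.update p a e') (φ + Pi.single a 1)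
  | backward {τ τ' p φ a e} : Reach τ' p φ → M.flip τ τ' e (p a) →
      Reach τ (Function.update p a e) (φ - Pi.single a 1)

theorem range_update_of_injective (hp : Function.Injective p) (a : A) (e : E) :
    range (Function.update p a e) = insert e (range p \ {p a}) := by
  ext x
  simp only [mem_range, mem_insert_iff, Set.mem_sdiff, mem_singleton_iff]
  constructor
  · rintro ⟨b, rfl⟩
    rcases eq_or_ne b a with rfl | h
    · left; simp
    · right; rw [Function.update_of_ne h]; exact ⟨⟨b, rfl⟩, fun h0 => h (hp h0)⟩
  · rintro (rfl | ⟨⟨b, rfl⟩, h⟩)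
    · exact ⟨a, by simp⟩
    · exact ⟨b, Function.update_of_ne (fun h0 => h (by rw [h0])) _ _⟩

theorem injective_update_of_notMem (hp : Function.Injective p) (a : A) (he : e ∉ range p) :
    Function.Injective (Function.update p a e) := by
  intro x y hxy
  rcases eq_or_ne x a with rfl | hx <;> rcases eq_or_ne y x with rfl | hy
  · rfl
  · rw [Function.update_self, Function.update_of_ne hy] at hxy
    exact absurd ⟨y, hxy.symm⟩ he
  · rfl
  · rw [Function.update_of_ne hx] at hxy
    rcases eq_or_ne y a with rfl | hy'
    · rw [Function.update_self] at hxy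
      exact absurd ⟨x, hxy⟩ he
    · rw [Function.update_of_ne hy'] at hxy
      exact hp hxy

theorem Reach.labelling (h : M.Reach τ₀ p₀ τ p φ) (hp : Function.Injective p₀)
    (hr : range p₀ = M.edges τ₀) : Function.Injective p ∧ range p = M.edges τ := by
  induction h with
  | base => exact ⟨hp, hr⟩
  | forward _ hf ih =>
    exact ⟨injective_update_of_notMem ih.1 _ (ih.2 ▸ M.new_notMem hf),
      by rw [range_update_of_injective ih.1, ih.2, M.edges_eq hf]⟩
  | backward _ hf ih =>
    exact ⟨injective_update_of_notMem ih.1 _ (ih.2 ▸ old_notMem hf),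
      by rw [range_update_of_injective ih.1, ih.2, edges_eq' hf]⟩

section Coordinates

variable {κ : E → E} {ψ : E → ℤ}

/-- The labels keep their chains, and their order in each chain. -/
structure Coherent (κ : E → E) (ψ : E → ℤ) (p₀ p : A → E) (φ : A → ℤ) : Prop where
  chain : ∀ a, κ (p a) = κ (p₀ a)
  position : ∀ a, ψ (p a) = ψ (p₀ a) + φ a
  order : ∀ a b, κ (p₀ a) = κ (p₀ b) → (ψ (p₀ a) < ψ (p₀ b) ↔ ψ (p a) < ψ (p b))

/-- The moved label changes its integer position by one. Labels in one chain occupy distinct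
positions before and after, so it cannot pass its neighbour. -/
theorem Coherent.update (h : Coherent κ ψ p₀ p φ) (hinj : ∀ x y, κ x = κ y → ψ x = ψ y → x = y)
    (hp : Function.Injective p) {a : A} (he : e ∉ range p) {δ : ℤ} (hδ : δ = 1 ∨ δ = -1)
    (hκ : κ e = κ (p a)) (hψ : ψ e = ψ (p a) + δ) :
    Coherent κ ψ p₀ (Function.update p a e) (φ + Pi.single a δ) := by
  refine ⟨fun x => ?_, fun x => ?_, fun x y hxy => ?_⟩
  · rcases eq_or_ne x a with rfl | hx
    · rw [Function.update_self, hκ, h.chain]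
    · rw [Function.update_of_ne hx, h.chain]
  · rcases eq_or_ne x a with rfl | hx
    · rw [Function.update_self, hψ, h.position]; simp [add_assoc]
    · rw [Function.update_of_ne hx, h.position]; simp [hx]
  · rcases eq_or_ne x y with rfl | hne
    · simp
    rw [h.order x y hxy]
    have hne' : ψ (p x) ≠ ψ (p y) := fun h0 =>
      hne (hp (hinj _ _ (by rw [h.chain, h.chain, hxy]) h0))
    rcases eq_or_ne x a with rfl | hx
    · have : ψ e ≠ ψ (p y) := fun h0 =>
        he ⟨y, (hinj _ _ (by rw [hκ, h.chain, h.chain, hxy]) h0).symm⟩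
      rw [Function.update_self, Function.update_of_ne hne.symm]
      omega
    · rcases eq_or_ne y a with rfl | hy
      · have : ψ e ≠ ψ (p x) := fun h0 =>
          he ⟨x, (hinj _ _ (by rw [hκ, h.chain, h.chain, hxy]) h0).symm⟩
        rw [Function.update_self, Function.update_of_ne hne]
        omega
      · rw [Function.update_of_ne hx, Function.update_of_ne hy]

theorem Reach.coherent (h : M.Reach τ₀ p₀ τ p φ) (hp : Function.Injective p₀)
    (hr : range p₀ = M.edges τ₀)
    (hN : ∀ τ τ' x y, M.flip τ τ' x y → κ y = κ x ∧ ψ y = ψ x + 1)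
    (hinj : ∀ x y, κ x = κ y → ψ x = ψ y → x = y) : Coherent κ ψ p₀ p φ := by
  induction h with
  | base => exact ⟨fun _ => rfl, fun _ => by simp, fun _ _ _ => Iff.rfl⟩
  | forward h1 hf ih =>
    have hl := h1.labelling hp hr
    exact ih.update hinj hl.1 (hl.2 ▸ M.new_notMem hf) (Or.inl rfl) (hN _ _ _ _ hf).1
      (hN _ _ _ _ hf).2
  | @backward τ τ' p φ a e h1 hf ih =>
    have hl := h1.labelling hp hr
    have := ih.update hinj hl.1 (hl.2 ▸ old_notMem hf) (Or.inr rfl) (hN _ _ _ _ hf).1.symm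
      (by rw [(hN _ _ _ _ hf).2]; ring)
    rwa [Pi.single_neg, ← sub_eq_add_neg] at this

-- On each chain, both labellings order the labels as `p₀` does; order-preserving labellings with
-- the same finite range coincide.
omit [DecidableEq A] in
theorem Coherent.eq_of_range [Finite A] (h : Coherent κ ψ p₀ p φ) (h' : Coherent κ ψ p₀ p' φ')
    (hinj : ∀ x y, κ x = κ y → ψ x = ψ y → x = y) (hp₀ : Function.Injective p₀)
    (hp : Function.Injective p) (hp' : Function.Injective p') (hr : range p = range p') :
    p = p' ∧ φ = φ' := by
  have hpp : p = p' := by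
    have hg : ∀ a, ∃ b, p' b = p a := fun a => by
      have := mem_range_self (f := p) a
      rwa [hr] at this
    choose g hg using hg
    have hgκ : ∀ a, κ (p₀ (g a)) = κ (p₀ a) := fun a => by
      rw [← h'.chain, hg, h.chain]
    have hgo : ∀ a b, κ (p₀ a) = κ (p₀ b) → ψ (p₀ a) < ψ (p₀ b) → ψ (p₀ (g a)) < ψ (p₀ (g b)) :=
      fun a b h1 h2 => by
        rw [h'.order _ _ (by rw [hgκ, hgκ, h1]), hg, hg]
        exact (h.order _ _ h1).1 h2
    suffices ∀ a, g a = a by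
      funext a
      rw [← hg, this]
    by_contra! hne
    -- Let `p' ∘ g = p`, and let `a` be the highest label moved by `g`. The label `b` with `g b = a`
    -- is moved too, so it is below `a`; then `a = g b` is below `g a`, which is moved as well,
    -- against the choice of `a`.
    obtain ⟨a, ha, hmax⟩ := Set.exists_max_image {a | g a ≠ a} (fun a => ψ (p₀ a)) (toFinite _) hne
    obtain ⟨b, hb⟩ : ∃ b, p b = p' a := by
      have := mem_range_self (f := p') a
      rwa [← hr] at this
    have hgb : g b = a := hp' (by rw [hg, hb])
    have hba : b ≠ a := by
      rintro rfl
      exact ha hgb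
    have hbm : g b ≠ b := by rw [hgb]; exact hba.symm
    have hgm : g (g a) ≠ g a := fun h0 => ha (hp (by rw [← hg (g a), h0, hg]))
    have hκ : κ (p₀ b) = κ (p₀ a) := by rw [← hgκ, hgb]
    have hlt : ψ (p₀ b) < ψ (p₀ a) :=
      lt_of_le_of_ne (hmax b hbm) fun h0 => hba (hp₀ (hinj _ _ hκ h0))
    have h1 := hgo b a hκ hlt
    rw [hgb] at h1
    exact (hmax (g a) hgm).not_gt h1
  refine ⟨hpp, funext fun a => ?_⟩
  have h1 := h.position a
  have h2 := h'.position a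
  rw [hpp] at h1
  omega

end Coordinates

/-- Labels and coordinates do not depend on the sequence of flips. -/
theorem Reach.unique (h : M.Reach τ₀ p₀ τ p φ) (h' : M.Reach τ₀ p₀ τ p' φ')
    (hp : Function.Injective p₀) (hr : range p₀ = M.edges τ₀) : p = p' ∧ φ = φ' := by
  obtain ⟨κ, ψ, hN, hinj⟩ := exists_chain_coordinates (ht := M.height)
    (N := fun x y => ∃ τ τ', M.flip τ τ' x y)
    (fun _ _ _ _ ⟨_, _, h1⟩ ⟨_, _, h2⟩ => M.eq_iff h1 h2) fun _ _ ⟨_, _, h1⟩ => M.height_lt h1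
  have hN' : ∀ τ τ' x y, M.flip τ τ' x y → κ y = κ x ∧ ψ y = ψ x + 1 :=
    fun τ τ' x y hf => hN x y ⟨τ, τ', hf⟩
  have : Finite A := by
    have := (M.edges_finite τ₀).to_subtype
    rw [← hr] at this
    exact Finite.of_injective (rangeFactorization p₀) fun x y hxy => hp (congrArg Subtype.val hxy)
  have hl := h.labelling hp hr
  have hl' := h'.labelling hp hr
  exact (h.coherent hp hr hN' hinj).eq_of_range (h'.coherent hp hr hN' hinj) hinj hp hl.1 hl'.1
    (hl.2.trans hl'.2.symm)

/-- Along forward flips coordinates only grow. If the coordinate of `a` has changed, the last flip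
with this label has created the edge that `a` finally carries, and it took place above `τ`. -/
theorem Reach.exists_of_path (h : M.Reach τ₀ p₀ τ p φ) (hp : Function.Injective p₀)
    (hr : range p₀ = M.edges τ₀) (hpath : ReflTransGen M.Adj τ ν) :
    ∃ p' φ', M.Reach τ₀ p₀ ν p' φ' ∧ φ ≤ φ' ∧ (φ = φ' → τ = ν) ∧
      ∀ a, φ' a = φ a ∨ ∃ μ μ' e, ReflTransGen M.Adj τ μ ∧ M.flip μ μ' e (p' a) := by
  induction hpath with
  | refl => exact ⟨p, φ, h, le_rfl, fun _ => rfl, fun a => Or.inl rfl⟩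
  | @tail μ μ' hpath hf ih =>
    obtain ⟨p', φ', h1, h2, h3, h4⟩ := ih
    obtain ⟨e, e', hf⟩ := hf
    obtain ⟨a, rfl⟩ : e ∈ range p' := (h1.labelling hp hr).2 ▸ M.old_mem hf
    have hlt : φ' < φ' + Pi.single a 1 := lt_add_of_pos_right _ (by simp)
    refine ⟨_, _, h1.forward hf, h2.trans hlt.le, fun h0 => absurd (h2.trans_lt hlt) (by simp [h0]),
      fun b => ?_⟩
    rcases eq_or_ne b a with rfl | hb
    · exact Or.inr ⟨μ, μ', p' b, hpath, by simpa using hf⟩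
    · rw [Function.update_of_ne hb]
      simpa [hb] using h4 b

/-- Read backwards: a coordinate that has changed belongs to an edge that is removed by some forward
flip below `τ`. -/
theorem Reach.exists_of_path_symm (h : M.Reach τ₀ p₀ τ p φ) (hp : Function.Injective p₀)
    (hr : range p₀ = M.edges τ₀) (hpath : ReflTransGen M.Adj ν τ) :
    ∃ p' φ', M.Reach τ₀ p₀ ν p' φ' ∧ φ' ≤ φ ∧
      ∀ a, φ' a = φ a ∨ ∃ μ μ' e', ReflTransGen M.Adj μ' τ ∧ M.flip μ μ' (p' a) e' := by
  induction hpath using ReflTransGen.head_induction_on with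
  | refl => exact ⟨p, φ, h, le_rfl, fun a => Or.inl rfl⟩
  | @head μ μ' hf hpath ih =>
    obtain ⟨p', φ', h1, h2, h4⟩ := ih
    obtain ⟨e, e', hf⟩ := hf
    obtain ⟨a, rfl⟩ : e' ∈ range p' := (h1.labelling hp hr).2 ▸ new_mem hf
    have hlt : φ' - Pi.single a 1 ≤ φ' := sub_le_self _ (by simp)
    refine ⟨_, _, h1.backward hf, hlt.trans h2, fun b => ?_⟩
    rcases eq_or_ne b a with rfl | hb
    · exact Or.inr ⟨μ, μ', p' b, hpath, by simpa using hf⟩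
    · rw [Function.update_of_ne hb]
      simpa [hb] using h4 b

/-- The coordinates embed the lattice. -/
theorem exists_coordinates [Lattice V] (hle : ∀ τ τ' e e', M.flip τ τ' e e' → τ ≤ τ')
    (hpath : ∀ τ σ, τ ≤ σ → ReflTransGen M.Adj τ σ)
    (hsup : ∀ τ τ' σ σ' ν e d x, M.flip τ τ' e x → M.flip σ σ' d x → ν ≤ τ ⊔ σ → x ∉ M.edges ν)
    (hinf : ∀ τ τ' σ σ' ν e d x, M.flip τ' τ x e → M.flip σ' σ x d → τ ⊓ σ ≤ ν → x ∉ M.edges ν)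
    (hp : Function.Injective p₀) (hr : range p₀ = M.edges τ₀) :
    ∃ (p : V → A → E) (Φ : V → A → ℤ), (∀ τ, M.Reach τ₀ p₀ τ (p τ) (Φ τ)) ∧
      Function.Injective Φ ∧ (∀ τ σ, Φ (τ ⊔ σ) = Φ τ ⊔ Φ σ) ∧ ∀ τ σ, Φ (τ ⊓ σ) = Φ τ ⊓ Φ σ := by
  have hle' : ∀ {τ σ}, ReflTransGen M.Adj τ σ → τ ≤ σ := fun {τ σ} h => by
    induction h with
    | refl => exact le_rfl
    | tail _ h ih => obtain ⟨e, e', h⟩ := h; exact ih.trans (hle _ _ _ _ h)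
  have hreach : ∀ τ, ∃ p φ, M.Reach τ₀ p₀ τ p φ := fun τ => by
    -- Any two objects are connected through their join: up from `τ₀`, then down to `τ`.
    obtain ⟨p, φ, h, -⟩ := Reach.base.exists_of_path hp hr (hpath τ₀ (τ₀ ⊔ τ) le_sup_left)
    obtain ⟨p', φ', h', -⟩ := h.exists_of_path_symm hp hr (hpath τ (τ₀ ⊔ τ) le_sup_right)
    exact ⟨p', φ', h'⟩
  choose p Φ hΦ using hreach
  have up : ∀ {τ ν}, τ ≤ ν → Φ τ ≤ Φ ν ∧ (Φ τ = Φ ν → τ = ν) ∧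
      ∀ a, Φ ν a = Φ τ a ∨ ∃ μ μ' e, τ ≤ μ ∧ M.flip μ μ' e (p ν a) := fun {τ ν} h => by
    obtain ⟨p', φ', h1, h2, h3, h4⟩ := (hΦ τ).exists_of_path hp hr (hpath τ ν h)
    obtain ⟨rfl, rfl⟩ := h1.unique (hΦ ν) hp hr
    refine ⟨h2, h3, fun a => (h4 a).imp_right ?_⟩
    rintro ⟨μ, μ', e, h5, h6⟩
    exact ⟨μ, μ', e, hle' h5, h6⟩
  have down : ∀ {τ ν}, ν ≤ τ → ∀ a, Φ ν a = Φ τ a ∨ ∃ μ μ' e', μ' ≤ τ ∧ M.flip μ μ' (p ν a) e' :=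
    fun {τ ν} h => by
    obtain ⟨p', φ', h1, h2, h4⟩ := (hΦ τ).exists_of_path_symm hp hr (hpath ν τ h)
    obtain ⟨rfl, rfl⟩ := h1.unique (hΦ ν) hp hr
    refine fun a => (h4 a).imp_right ?_
    rintro ⟨μ, μ', e, h5, h6⟩
    exact ⟨μ, μ', e, hle' h5, h6⟩
  have mem : ∀ ν a, p ν a ∈ M.edges ν := fun ν a => ((hΦ ν).labelling hp hr).2 ▸ mem_range_self a
  -- If a coordinate of the join differs from those of both terms, its edge was created by a flip
  -- above `τ` and by one above `σ`; then `hsup` says that it is not an edge of the join.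
  have hmax : ∀ τ σ, Φ (τ ⊔ σ) = Φ τ ⊔ Φ σ := fun τ σ => by
    have u1 := up (τ := τ) (ν := τ ⊔ σ) le_sup_left
    have u2 := up (τ := σ) (ν := τ ⊔ σ) le_sup_right
    refine le_antisymm (fun a => ?_) (sup_le u1.1 u2.1)
    rw [Pi.sup_apply]
    rcases u1.2.2 a with h1 | ⟨μ, μ', e, h1, h2⟩
    · exact h1.le.trans le_sup_left
    rcases u2.2.2 a with h3 | ⟨μ₂, μ₂', d, h3, h4⟩
    · exact h3.le.trans le_sup_right
    exact absurd (mem _ _) (hsup _ _ _ _ _ _ _ _ h2 h4 (sup_le_sup h1 h3))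
  refine ⟨p, Φ, hΦ, fun τ σ h => ?_, hmax, fun τ σ => ?_⟩
  -- With equal coordinates, the join has the same ones too; but every forward flip on the way to it
  -- would have changed them.
  · have h1 := hmax τ σ
    rw [← h, sup_idem] at h1
    rw [(up (le_sup_left : τ ≤ τ ⊔ σ)).2.1 h1.symm, 
      ← (up (le_sup_right : σ ≤ τ ⊔ σ)).2.1 (h.symm.trans h1.symm)]
  · have d1 := down (τ := τ) (ν := τ ⊓ σ) inf_le_left
    have d2 := down (τ := σ) (ν := τ ⊓ σ) inf_le_right
    refine le_antisymm (le_inf (up inf_le_left).1 (up inf_le_right).1) fun a => ?_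
    rw [Pi.inf_apply]
    rcases d1 a with h1 | ⟨μ, μ', e, h1, h2⟩
    · exact inf_le_left.trans h1.ge
    rcases d2 a with h3 | ⟨μ₂, μ₂', d, h3, h4⟩
    · exact inf_le_right.trans h3.ge
    exact absurd (mem _ _) (hinf _ _ _ _ _ _ _ _ h2 h4 (inf_le_inf h1 h3))

end FlipSystem

end VeeringLattice

/-! ### Joins and meets of veering triangulations -/

namespace VeeringLattice

open Set Filter Relation

variable {S : Type*} [TopologicalSpace S] {q : HalfTranslationSurface S} [T2Space S]

namespace VeeringTriangulation

variable {τ σ ν : VeeringTriangulation q}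

theorem exists_le_height (τ : VeeringTriangulation q) : ∃ h₀ > 0, ∀ e ∈ τ.edges, h₀ ≤ height q e := by
  obtain ⟨_, -, h₀, hh, h⟩ := τ.exists_lower_bounds
  refine ⟨h₀, hh, fun e he => ?_⟩
  obtain ⟨v, hv⟩ := τ.edge_saddle e he
  exact hv.height_eq ▸ (h e he v hv).2

variable (q) in
/-- The system of forward flips of veering triangulations. -/
noncomputable def flipSystem : FlipSystem (VeeringTriangulation q) (Set S) where
  edges τ := τ.edges
  flip := IsForwardFlip
  height := height q
  edges_finite τ := τ.edges_finite
  old_mem h := h.old_mem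
  new_notMem h := h.new_notMem
  edges_eq h := h.edges_eq
  eq_iff h h' := h.eq_iff h'
  height_lt {τ _ _ _} h := by
    obtain ⟨h₀, hh, hb⟩ := τ.exists_le_height
    linarith [h.height_add_le hb]

theorem precedes_of_path (h : ReflTransGen (flipSystem q).Adj τ σ) : Precedes τ σ := by
  induction h with
  | refl => exact Precedes.refl τ
  | tail _ h ih => obtain ⟨e, e', h⟩ := h; exact ih.trans (IsForwardFlip.precedes h)

/-- The sum of the heights of all edges. -/
noncomputable def totalHeight (τ : VeeringTriangulation q) : ℝ := ∑ᶠ e ∈ τ.edges, height q e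

omit [T2Space S] in
theorem totalHeight_le {M : ℝ} (hM : ∀ e ∈ τ.edges, height q e ≤ M) :
    τ.totalHeight ≤ τ.edges.ncard * M := by
  rw [totalHeight, finsum_mem_eq_finite_toFinset_sum _ τ.edges_finite,
    ncard_eq_toFinset_card _ τ.edges_finite, ← nsmul_eq_mul]
  exact Finset.sum_le_card_nsmul _ _ _ fun e he => hM e (by simpa using he)

omit [T2Space S] in
theorem _root_.VeeringLattice.IsForwardFlip.totalHeight_eq {e e' : Set S}
    (h : IsForwardFlip τ σ e e') :
    σ.totalHeight + height q e = τ.totalHeight + height q e' := by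
  have hfin : (τ.edges \ {e}).Finite := τ.edges_finite.subset Set.sdiff_subset
  have h1 : τ.totalHeight = height q e + ∑ᶠ x ∈ τ.edges \ {e}, height q x := by
    rw [totalHeight, ← finsum_mem_insert _ (fun h0 => h0.2 rfl) hfin, insert_sdiff_singleton,
      insert_eq_of_mem h.old_mem]
  have h2 : σ.totalHeight = height q e' + ∑ᶠ x ∈ τ.edges \ {e}, height q x := by
    rw [totalHeight, h.edges_eq, finsum_mem_insert _ (fun h0 => h.new_notMem h0.1) hfin]
  rw [h1, h2]; ring

omit [T2Space S] in
theorem _root_.VeeringLattice.IsForwardFlip.ncard_eq {e e' : Set S}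
    (h : IsForwardFlip τ σ e e') : σ.edges.ncard = τ.edges.ncard := by
  have hfin : (τ.edges \ {e}).Finite := τ.edges_finite.subset Set.sdiff_subset
  rw [h.edges_eq, ncard_insert_of_notMem (fun h0 => h.new_notMem h0.1) hfin,
    ncard_sdiff_singleton_add_one h.old_mem τ.edges_finite]

/-- Forward flips of `τ` lead to an upper bound of `τ` and `σ` with the largest possible wedges. -/
theorem exists_path_precedes (τ σ : VeeringTriangulation q) :
    ∃ ν, ReflTransGen (flipSystem q).Adj τ ν ∧ Precedes σ ν ∧
      ∀ β, wedge β τ.toStraightTriangulation ∩ wedge β σ.toStraightTriangulation ⊆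
        wedge β ν.toStraightTriangulation := by
  obtain ⟨h₀, hh, hlow⟩ := τ.exists_le_height
  obtain ⟨M, hM⟩ : ∃ M, ∀ e ∈ τ.edges ∪ σ.edges, height q e ≤ M := by
    obtain ⟨M, hM⟩ := ((τ.edges_finite.union σ.edges_finite).image (height q)).bddAbove
    exact ⟨M, fun e he => hM (mem_image_of_mem _ he)⟩
  -- `n` bounds the number of flips that remain: the total height is at most the number of edges
  -- times `M`, and each flip adds at least `h₀`. All edges keep heights between `h₀` and `M`.
  have key : ∀ (n : ℕ) (μ : VeeringTriangulation q), (∀ e ∈ μ.edges, h₀ ≤ height q e ∧ height q e ≤ M) →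
      μ.edges.ncard = τ.edges.ncard → τ.edges.ncard * M < μ.totalHeight + n * h₀ →
      ∃ ν, ReflTransGen (flipSystem q).Adj μ ν ∧ Precedes σ ν ∧
        ∀ β, wedge β μ.toStraightTriangulation ∩ wedge β σ.toStraightTriangulation ⊆
          wedge β ν.toStraightTriangulation := by
    intro n
    induction n with
    | zero =>
      intro μ h1 h2 h3
      have := totalHeight_le fun e he => (h1 e he).2
      rw [h2] at this
      simp at h3
      linarith
    | succ n ih =>
      intro μ h1 h2 h3
      by_cases hp : Precedes σ μ
      · exact ⟨μ, .refl, hp, fun β => inter_subset_left⟩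
      obtain ⟨μ', e, e', hf, hw, d, hd, hed⟩ := exists_flip_of_not_precedes hp
      have hadd := hf.height_add_le fun e he => (h1 e he).1
      obtain ⟨ν, n1, n2, n3⟩ := ih μ' (fun x hx => by
          rw [hf.edges_eq] at hx
          rcases hx with rfl | hx
          · exact ⟨by linarith [(h1 e hf.old_mem).1], hed.trans (hM d (Or.inr hd))⟩
          · exact h1 x hx.1) (hf.ncard_eq.trans h2) (by
          have := hf.totalHeight_eq
          push_cast at h3
          linarith)
      exact ⟨ν, .head ⟨e, e', hf⟩ n1, n2, fun β w hw' => n3 β ⟨hw β hw', hw'.2⟩⟩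
  obtain ⟨n, hn⟩ := exists_nat_gt ((τ.edges.ncard * M - τ.totalHeight) / h₀)
  rw [div_lt_iff₀ hh] at hn
  exact key n τ (fun e he => ⟨hlow e he, hM e (Or.inl he)⟩) rfl (by linarith)

/-- The join of two veering triangulations. -/
noncomputable def join (τ σ : VeeringTriangulation q) : VeeringTriangulation q :=
  (τ.exists_path_precedes σ).choose

theorem precedes_join_left (τ σ : VeeringTriangulation q) : Precedes τ (τ.join σ) :=
  precedes_of_path (τ.exists_path_precedes σ).choose_spec.1

theorem precedes_join_right (τ σ : VeeringTriangulation q) : Precedes σ (τ.join σ) :=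
  (τ.exists_path_precedes σ).choose_spec.2.1

theorem wedge_inter_subset_join (τ σ : VeeringTriangulation q) (β : VerticalSeparatrix q) :
    wedge β τ.toStraightTriangulation ∩ wedge β σ.toStraightTriangulation ⊆
      wedge β (τ.join σ).toStraightTriangulation :=
  (τ.exists_path_precedes σ).choose_spec.2.2 β

/-- The wedges of an upper bound lie in the intersections of the wedges of `τ` and `σ`, and these
lie in the wedges of the join. -/
theorem join_precedes (h : Precedes τ ν) (h' : Precedes σ ν) : Precedes (τ.join σ) ν :=
  fun β _ hw => τ.wedge_inter_subset_join σ β ⟨h β hw, h' β hw⟩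

/-- If `σ` is above `τ`, antisymmetry identifies it with the join, which was constructed by forward
flips of `τ`. -/
theorem precedes_iff_path : Precedes τ σ ↔ ReflTransGen (flipSystem q).Adj τ σ := by
  refine ⟨fun h => ?_, precedes_of_path⟩
  have he : τ.join σ = σ :=
    (join_precedes h (Precedes.refl σ)).antisymm (τ.precedes_join_right σ)
  exact he ▸ (τ.exists_path_precedes σ).choose_spec.1

theorem isForwardFlip_rot_iff {e e' : Set S} :
    IsForwardFlip τ.rot σ.rot e e' ↔ IsForwardFlip σ τ e' e :=
  isForwardFlip_rot.trans isBackwardFlip_iff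

/-- The wedges belong to vertical separatrices, so their behaviour under the quarter turn is not
visible. It is visible for paths of flips, which are reversed. -/
theorem precedes_rot_iff : Precedes τ.rot σ.rot ↔ Precedes σ τ := by
  rw [precedes_iff_path, precedes_iff_path]
  constructor
  · intro h
    -- The intermediate triangulations live on the rotated surface; `unrot` brings them back, and
    -- `unrot` followed by `rot` changes nothing by definition.
    have : ReflTransGen (Function.swap (flipSystem q).Adj) τ.rot.unrot σ.rot.unrot :=
      h.lift unrot fun μ μ' ⟨e, e', hf⟩ =>
        ⟨e', e, isForwardFlip_rot_iff.1 (show IsForwardFlip μ.unrot.rot μ'.unrot.rot e e' from hf)⟩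
    exact reflTransGen_swap.1 this
  · intro h
    have := reflTransGen_swap.2 h
    exact this.lift rot fun μ μ' ⟨e, e', hf⟩ => ⟨e', e, isForwardFlip_rot_iff.2 hf⟩

/-- The meet of two veering triangulations. -/
noncomputable def meet (τ σ : VeeringTriangulation q) : VeeringTriangulation q :=
  (τ.rot.join σ.rot).unrot

theorem meet_precedes_left (τ σ : VeeringTriangulation q) : Precedes (τ.meet σ) τ :=
  precedes_rot_iff.1 (τ.rot.precedes_join_left σ.rot)

theorem meet_precedes_right (τ σ : VeeringTriangulation q) : Precedes (τ.meet σ) σ :=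
  precedes_rot_iff.1 (τ.rot.precedes_join_right σ.rot)

theorem precedes_meet (h : Precedes ν τ) (h' : Precedes ν σ) : Precedes ν (τ.meet σ) :=
  precedes_rot_iff.1 (join_precedes (precedes_rot_iff.2 h) (precedes_rot_iff.2 h'))

/-- The lattice of veering triangulations. -/
@[reducible] noncomputable def lattice (q : HalfTranslationSurface S) :
    Lattice (VeeringTriangulation q) where
  le := Precedes
  le_refl := Precedes.refl
  le_trans _ _ _ := Precedes.trans
  le_antisymm _ _ := Precedes.antisymm
  sup := join
  le_sup_left := precedes_join_left
  le_sup_right := precedes_join_right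
  sup_le _ _ _ := join_precedes
  inf := meet
  inf_le_left := meet_precedes_left
  inf_le_right := meet_precedes_right
  le_inf _ _ _ := precedes_meet

theorem notMem_of_precedes_join {τ' σ' : VeeringTriangulation q} {e d x : Set S}
    (h : IsForwardFlip τ τ' e x) (h' : IsForwardFlip σ σ' d x) (hν : Precedes ν (τ.join σ)) :
    x ∉ ν.edges :=
  h.notMem_of_wedge_inter_subset h' fun β => (τ.wedge_inter_subset_join σ β).trans (hν β)

/-- On the rotated surface, flips that remove `x` become flips that create `x`, and the meet becomes
the join. -/
theorem notMem_of_meet_precedes {τ' σ' : VeeringTriangulation q} {e d x : Set S}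
    (h : IsForwardFlip τ' τ x e) (h' : IsForwardFlip σ' σ x d) (hν : Precedes (τ.meet σ) ν) :
    x ∉ ν.edges :=
  notMem_of_precedes_join (ν := ν.rot) (isForwardFlip_rot_iff.2 h) (isForwardFlip_rot_iff.2 h')
    (precedes_rot_iff.2 hν)

end VeeringTriangulation

/-! ### Labellings, coordinates and distributivity -/

section Labelling

open VeeringTriangulation FlipSystem

variable {A : Type*} [DecidableEq A] {τ₀ : VeeringTriangulation q} {π₀ : A ≃ τ₀.edges}

omit [T2Space S] [DecidableEq A] in
theorem range_coe_labelling (π : A ≃ τ₀.edges) : range (fun a => (π a : Set S)) = τ₀.edges := by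
  rw [show (fun a => (π a : Set S)) = Subtype.val ∘ π from rfl, π.surjective.range_comp,
    Subtype.range_coe]

omit [T2Space S] [DecidableEq A] in
theorem injective_coe_labelling (π : A ≃ τ₀.edges) : Function.Injective fun a => (π a : Set S) :=
  Subtype.val_injective.comp π.injective

/-- This gives uniqueness: the rules prescribe label and coordinate changes at every flip, so they
hold along each sequence of flips from `τ₀`. -/
theorem IsFlipCoordinates.eq_of_reach {π : ∀ τ : VeeringTriangulation q, A ≃ τ.edges}
    {Φ : VeeringTriangulation q → A → ℤ} (h : IsFlipCoordinates τ₀ π₀ π Φ)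
    {τ : VeeringTriangulation q} {p : A → Set S} {φ : A → ℤ}
    (hr : (flipSystem q).Reach τ₀ (fun a => (π₀ a : Set S)) τ p φ) :
    p = (fun a => (π τ a : Set S)) ∧ φ = Φ τ := by
  have update : ∀ {τ τ' : VeeringTriangulation q} {a e'},
      IsInducedLabelling (π τ) (π τ') (π τ a) e' →
      Function.update (fun a => (π τ a : Set S)) a e' = fun a => (π τ' a : Set S) := by
    intro τ τ' a e' hi
    funext b
    rcases eq_or_ne b a with rfl | hb
    · rw [Function.update_self, (hi b).1 rfl]
    · rw [Function.update_of_ne hb, (hi b).2 fun h0 => hb (injective_coe_labelling _ h0)]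
  induction hr with
  | base => exact ⟨by rw [h.base_label], h.base_coord.symm⟩
  | @forward τ τ' p φ a e' _ hf ih =>
    obtain ⟨rfl, rfl⟩ := ih
    exact ⟨update (h.forward_label _ _ _ _ hf), (h.forward_coord _ _ _ _ hf a rfl).symm⟩
  | @backward τ τ' p φ a e _ hf ih =>
    obtain ⟨rfl, rfl⟩ := ih
    have hf' := isBackwardFlip_iff.2 hf
    exact ⟨update (h.backward_label _ _ _ _ hf'), (h.backward_coord _ _ _ _ hf' a rfl).symm⟩

/-- This gives existence: continuing a path to `τ` by one more flip is a path to `τ'`, and by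
`Reach.unique` it leads to the chosen labelling and coordinates of `τ'`. -/
theorem IsFlipCoordinates.of_reach {π : ∀ τ : VeeringTriangulation q, A ≃ τ.edges}
    {Φ : VeeringTriangulation q → A → ℤ}
    (h : ∀ τ, (flipSystem q).Reach τ₀ (fun a => (π₀ a : Set S)) τ (fun a => (π τ a : Set S)) (Φ τ)) :
    IsFlipCoordinates τ₀ π₀ π Φ := by
  have uniq : ∀ {τ p φ}, (flipSystem q).Reach τ₀ (fun a => (π₀ a : Set S)) τ p φ →
      (fun a => (π τ a : Set S)) = p ∧ Φ τ = φ := fun {τ p φ} hr =>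
    (h τ).unique hr (injective_coe_labelling π₀) (range_coe_labelling π₀)
  have fwd : ∀ τ τ' a e', IsForwardFlip τ τ' (π τ a) e' →
      (fun b => (π τ' b : Set S)) = Function.update (fun b => (π τ b : Set S)) a e' ∧
        Φ τ' = Φ τ + Pi.single a 1 := fun τ τ' a e' hf => uniq ((h τ).forward hf)
  have bwd : ∀ τ τ' a e', IsBackwardFlip τ τ' (π τ a) e' →
      (fun b => (π τ' b : Set S)) = Function.update (fun b => (π τ b : Set S)) a e' ∧
        Φ τ' = Φ τ - Pi.single a 1 := fun τ τ' a e' hf =>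
    uniq ((h τ).backward (isBackwardFlip_iff.1 hf))
  have induced : ∀ {τ τ' : VeeringTriangulation q} {a e'},
      (fun b => (π τ' b : Set S)) = Function.update (fun b => (π τ b : Set S)) a e' →
      IsInducedLabelling (π τ) (π τ') (π τ a) e' := fun {τ τ' a e'} hu b => by
    have hb : (π τ' b : Set S) = Function.update (fun b => (π τ b : Set S)) a e' b :=
      congrFun hu b
    refine ⟨fun h0 => ?_, fun h0 => ?_⟩
    · rw [hb, injective_coe_labelling _ h0, Function.update_self]
    · rw [hb, Function.update_of_ne fun h1 => h0 (by rw [h1])]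
  have label : ∀ {τ : VeeringTriangulation q} {e}, e ∈ τ.edges → ∃ a, (π τ a : Set S) = e :=
    fun {τ e} he => by rwa [← range_coe_labelling (π τ)] at he
  obtain ⟨b1, b2⟩ := uniq Reach.base
  refine ⟨Equiv.ext fun a => Subtype.ext (congrFun b1 a), b2, fun τ τ' e e' hf => ?_,
    fun τ τ' e e' hf a ha => ?_, fun τ τ' e e' hf => ?_, fun τ τ' e e' hf a ha => ?_⟩
  · obtain ⟨a, rfl⟩ := label hf.old_mem
    exact induced (fwd _ _ _ _ hf).1
  · subst ha
    exact (fwd _ _ _ _ hf).2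
  · obtain ⟨a, rfl⟩ := label (new_mem (M := flipSystem q) (isBackwardFlip_iff.1 hf))
    exact induced (bwd _ _ _ _ hf).1
  · subst ha
    exact (bwd _ _ _ _ hf).2

/-- Labellings and coordinates exist, and the coordinates embed the lattice. -/
theorem VeeringTriangulation.exists_isFlipCoordinates (τ₀ : VeeringTriangulation q)
    (π₀ : A ≃ τ₀.edges) :
    ∃ (π : ∀ τ : VeeringTriangulation q, A ≃ τ.edges) (Φ : VeeringTriangulation q → A → ℤ),
      IsFlipCoordinates τ₀ π₀ π Φ ∧ Function.Injective Φ ∧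
      (∀ τ σ, Φ (τ.join σ) = Φ τ ⊔ Φ σ) ∧ (∀ τ σ, Φ (τ.meet σ) = Φ τ ⊓ Φ σ) ∧
      ∀ π' Φ', IsFlipCoordinates τ₀ π₀ π' Φ' → π' = π ∧ Φ' = Φ := by
  let _ := lattice q
  have hp := injective_coe_labelling π₀
  have hr := range_coe_labelling π₀
  obtain ⟨p, Φ, h1, h2, h3, h4⟩ := exists_coordinates (M := flipSystem q)
    (fun _ _ _ _ hf => hf.precedes) (fun _ _ => precedes_iff_path.1)
    (fun _ _ _ _ _ _ _ _ => notMem_of_precedes_join)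
    (fun _ _ _ _ _ _ _ _ => notMem_of_meet_precedes) hp hr
  have hl : ∀ τ : VeeringTriangulation q, Function.Injective (p τ) ∧ range (p τ) = τ.edges :=
    fun τ => (h1 τ).labelling hp hr
  have hbij : ∀ τ : VeeringTriangulation q, Function.Bijective
      fun a => (⟨p τ a, (hl τ).2 ▸ mem_range_self a⟩ : τ.edges) := fun τ =>
    ⟨fun a b hab => (hl τ).1 (congrArg Subtype.val hab), fun ⟨e, he⟩ => by
      obtain ⟨a, rfl⟩ : e ∈ range (p τ) := (hl τ).2 ▸ he
      exact ⟨a, rfl⟩⟩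
  refine ⟨fun τ => Equiv.ofBijective _ (hbij τ), Φ, .of_reach h1, h2, h3, h4, fun π' Φ' h => ?_⟩
  refine ⟨funext fun τ => Equiv.ext fun a => Subtype.ext ?_, funext fun τ => ?_⟩
  · exact (congrFun (h.eq_of_reach (h1 τ)).1 a).symm
  · exact (h.eq_of_reach (h1 τ)).2.symm

end Labelling

/-- The distributive lattice of veering triangulations. -/
@[reducible] noncomputable def VeeringTriangulation.distribLattice (q : HalfTranslationSurface S) :
    DistribLattice (VeeringTriangulation q) where
  toLattice := lattice q
  le_sup_inf τ σ ν := by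
    classical
    let _ := lattice q
    -- Any base point and any labels will do; here `τ` is labelled by its own edges. The
    -- distributive law holds in `ℤ^A` and is pulled back along the injective `Φ`.
    obtain ⟨π, Φ, -, h1, h2, h3, -⟩ := τ.exists_isFlipCoordinates (Equiv.refl τ.edges)
    have e1 : ∀ τ σ, Φ (τ ⊔ σ) = Φ τ ⊔ Φ σ := h2
    have e2 : ∀ τ σ, Φ (τ ⊓ σ) = Φ τ ⊓ Φ σ := h3
    exact le_of_eq (h1 (by rw [e1, e2, e1, e1, e2, sup_inf_left]))

end VeeringLattice

theorem proposition2p13 {S : Type*} [TopologicalSpace S] [T2Space S] [CompactSpace S]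
    [ConnectedSpace S] (q : VeeringLattice.HalfTranslationSurface S) :
    ∃ _L : DistribLattice (VeeringLattice.VeeringTriangulation q),
      (∀ τ σ : VeeringLattice.VeeringTriangulation q, τ ≤ σ ↔ VeeringLattice.Precedes τ σ) ∧
      ∀ (A : Type*) [DecidableEq A] (τ₀ : VeeringLattice.VeeringTriangulation q)
        (π₀ : A ≃ τ₀.edges),
        ∃ (π : ∀ τ : VeeringLattice.VeeringTriangulation q, A ≃ τ.edges)
          (Φ : LatticeHom (VeeringLattice.VeeringTriangulation q) (A → ℤ)),
          Function.Injective Φ ∧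
          VeeringLattice.IsFlipCoordinates τ₀ π₀ π Φ ∧
          ∀ π' Φ', VeeringLattice.IsFlipCoordinates τ₀ π₀ π' Φ' →
            π' = π ∧ Φ' = Φ := by
  let L := VeeringLattice.VeeringTriangulation.distribLattice q
  refine ⟨L, fun _ _ => Iff.rfl, ?_⟩
  intro A _ τ₀ π₀
  obtain ⟨π, Φ, h1, h2, h3, h4, h5⟩ := τ₀.exists_isFlipCoordinates π₀
  exact ⟨π, ⟨⟨Φ, h3⟩, h4⟩, h2, h1, h5⟩
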